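/- Let $M$ be a smooth manifold without boundary and $H:T^*M\to\mathbb R$ a $C^3$ Hamiltonian, strictly convex and superlinear in the momentum $p$. Fix an energy $E$, and let $D_E=\{q\in M: W(q)<E\}$, $W(q)=\min_p H(q,p)$. An orbit of energy $E$ is a solution $(q(t),p(t))$ of Hamilton's equations with $H=E$ and $q(t)\in D_E$ on a compact time interval; for such orbits let $J_E(\gamma)=\int\|\dot\gamma\|_E\,dt$ be the Maupertuis action, where $\|v\|_E=\max\{\langle p,v\rangle: H(q,p)=E\}$. Let $N\subset M$ be a smooth submanifold of codimension greater than $1$ and $K\subset N$ a compact subset (e.g. $K=N$ if $N$ is compact). **Collision chains.** A finite collision chain joining $a,b\in M$ is a curve $\gamma:[t_0,t_{n+1}]\to M$, $t_0<t_1<\dots<t_{n+1}$, $n\ge 0$, with $\gamma(t_0)=a$, $\gamma(t_{n+1})=b$, such that each segment $\gamma_j=\gamma|_{[t_j,t_{j+1}]}$ is an orbit of energy $E$; the points $x_j=\gamma(t_j)$, $1\le j\le n$, are interior points of $K$ relative to $N$; $\gamma(t)\notin K$ for all other $t$ (in particular $a,b\notin K$); and at each collision the momentum $p_+$ before and $p_-$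 after it satisfy $p_--p_+\perp T_{x_j}N$ and $p_-\neq p_+$, and the one-sided velocities are not tangent to $N$. The chain is nondegenerate if the end points of each $\gamma_j$ are non-conjugate along $\gamma_j$ (as an extremal of $J_E$), and $(x_1,\dots,x_n)$ is a nondegenerate critical point of the restriction to $N^n$ of the discrete action $$A(y_1,\dots,y_n)=\sum_{j=0}^n L_j(y_j,y_{j+1}),\qquad y_0=a,\ y_{n+1}=b.$$ Here $L_j(q_-,q_+)=J_E(\gamma_j(q_-,q_+))$ is the action of the orbit of energy $E$ close to $\gamma_j$ which joins points $q_-,q_+$ close to the end points of $\gamma_j$. **Thin scatterers.** Fix a smooth Riemannian metric on $M$, with exponential map $\exp$ and distance $d$. For $x\in N$ let $B_x$ be a compact convex neighborhood of $0$ in the normal space $T_x^\perp N$, whose boundary $S_x$ is a smooth hypersurface in $T_x^\perp N$ with positive definite second fundamental form, depending smoothly on $x$. For $\varepsilon>0$ let $$N_\varepsilon=\{\exp_x(\varepsilon u):x\in K,\ u\in B_x\},\quad \Sigma_\varepsilon=\{\exp_x(\varepsilon s):x\in K,\ s\in S_x\},\quad \Omega_\varepsilon=M\setminus N_\varepsilon.$$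 An orbit of energy $E$ of the billiard in $\Omega_\varepsilon$ with $n$ collisions is a curve $\gamma':[t'_0,t'_{n+1}]\to M$ consisting of $n+1$ orbits of energy $E$ on $[t_j',t_{j+1}']$, $t'_0<\dots<t'_{n+1}$, which lies in $\Omega_\varepsilon$ except at the times $t'_1,\dots,t'_n$, when it is on $\Sigma_\varepsilon$ and is elastically reflected: the jump of the momentum is nonzero and annihilates the tangent space of $\Sigma_\varepsilon$. **Theorem.** Let $\gamma$ be a nondegenerate finite collision chain joining $a$ and $b$. There exist $C>0$ and $\varepsilon_0>0$ such that for every $\varepsilon\in(0,\varepsilon_0)$, $\gamma$ is $O(\varepsilon)$-shadowed by an orbit $\gamma'$ of energy $E$ of the billiard in $\Omega_\varepsilon$ joining $a$ and $b$: $\gamma'$ has $n$ collisions, $\gamma'(t'_0)=a$, $\gamma'(t'_{n+1})=b$, $|t'_i-t_i|\le C\varepsilon$ for $0\le i\le n+1$, and $$d\bigl(\gamma'(t'_j+s(t'_{j+1}-t'_j)),\ \gamma(t_j+s(t_{j+1}-t_j))\bigr)\le C\varepsilon\qquad(0\le j\le n,\ 0\le s\le 1).$$ -/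

import Mathlib

open Set Filter Topology Manifold ContDiff
open scoped Bundle

namespace ThinBilliard

/-!
Throughout, `M` is a manifold without boundary modelled on the finite dimensional space `E`.
In Mathlib the tangent space `TangentSpace 𝓘(ℝ, E) q` is by definition the vector space `E` (the
identification being the one given by the preferred chart `chartAt E q` at `q`). So a tangent
vector at `q : M` is written as an element of `E`, a covector at `q` as an element of `E →L[ℝ] ℝ`,
and a function on `T*M` as a function of `q : M` and `p : E →L[ℝ] ℝ`.
-/

variable {E : Type*} [NormedAddCommGroup E] [NormedSpace ℝ E]
  {M : Type*} [TopologicalSpace M] [ChartedSpace E M]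

noncomputable section

/-! ### Hamiltonian systems -/

/-- The derivative `T_q M → E` of the chart `chartAt E q₀` at the point `q`. -/
def chartDeriv (q₀ q : M) : E →L[ℝ] E :=
  fderiv ℝ (chartAt E q₀ ∘ (chartAt E q).symm) (chartAt E q q)

/-- The derivative `E → T_q M` of the inverse of the chart `chartAt E q₀` at the image of `q`. -/
def chartSymmDeriv (q₀ q : M) : E →L[ℝ] E :=
  fderiv ℝ (chartAt E q ∘ (chartAt E q₀).symm) (chartAt E q₀ q)

/-- The components, in the chart `φ = chartAt E q₀`, of the covector `p` at the point `q`: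
`p ∘ (dφ(q))⁻¹`. -/
def cotCoord (q₀ q : M) (p : E →L[ℝ] ℝ) : E →L[ℝ] ℝ :=
  p ∘L chartSymmDeriv q₀ q

/-- The Hamiltonian in the canonical coordinates `(x, y)` on `T*M` given by the chart
`chartAt E q₀`. -/
def coordHam (H : M → (E →L[ℝ] ℝ) → ℝ) (q₀ : M) (z : E × (E →L[ℝ] ℝ)) : ℝ :=
  H ((chartAt E q₀).symm z.1) (z.2 ∘L chartDeriv q₀ ((chartAt E q₀).symm z.1))

/-- A `C³` Hamiltonian on `T*M`, strictly convex and superlinear in the momentum. -/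
structure IsHamiltonian (H : M → (E →L[ℝ] ℝ) → ℝ) : Prop where
  contDiffOn (q₀ : M) : ContDiffOn ℝ 3 (coordHam H q₀) ((chartAt E q₀).target ×ˢ univ)
  strictConvex (q : M) : StrictConvexOn ℝ univ (H q)
  superlinear (q : M) : Tendsto (fun p => H q p / ‖p‖) (cocompact (E →L[ℝ] ℝ)) atTop

/-- `(q(t), p(t))`, `t ∈ [t₀, t₁]`, solves Hamilton's equations `ẋ = ∂H/∂y`, `ẏ = -∂H/∂x`
(written, at each time `t`, in the coordinates `(x, y)` given by the chart at `q(t)`, in the form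
`dH(δx, δy) = ⟨δy, ẋ⟩ - ⟨ẏ, δx⟩`). -/
def IsTrajectory (H : M → (E →L[ℝ] ℝ) → ℝ) (q : ℝ → M) (p : ℝ → E →L[ℝ] ℝ) (t₀ t₁ : ℝ) : Prop :=
  ContinuousOn q (Icc t₀ t₁) ∧
  ∀ t ∈ Icc t₀ t₁, ∃ (xd : E) (yd : E →L[ℝ] ℝ),
    HasDerivWithinAt (fun τ => chartAt E (q t) (q τ)) xd (Icc t₀ t₁) t ∧
    HasDerivWithinAt (fun τ => cotCoord (q t) (q τ) (p τ)) yd (Icc t₀ t₁) t ∧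
    ∀ (δx : E) (δy : E →L[ℝ] ℝ),
      fderiv ℝ (coordHam H (q t)) (chartAt E (q t) (q t), cotCoord (q t) (q t) (p t)) (δx, δy)
        = δy xd - yd δx

/-- `v = ∂H/∂p (q, p)` (as an element of `T_q M`). -/
def IsVelocity (H : M → (E →L[ℝ] ℝ) → ℝ) (q : M) (p : E →L[ℝ] ℝ) (v : E) : Prop :=
  ∀ ξ : E →L[ℝ] ℝ, fderiv ℝ (H q) p ξ = ξ v

/-- `W(q) = min_p H(q, p)`. -/
def minHam (H : M → (E →L[ℝ] ℝ) → ℝ) (q : M) : ℝ := ⨅ p, H q p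

/-- The domain of possible motion `D_E = {q | W(q) < E}`. -/
def possibleMotion (H : M → (E →L[ℝ] ℝ) → ℝ) (e : ℝ) : Set M := {q | minHam H q < e}

/-- A trajectory `[t₀, t₁] → D_E` of the system `(M, H = E)`. -/
structure IsOrbit (H : M → (E →L[ℝ] ℝ) → ℝ) (e : ℝ) (q : ℝ → M) (p : ℝ → E →L[ℝ] ℝ)
    (t₀ t₁ : ℝ) : Prop where
  trajectory : IsTrajectory H q p t₀ t₁
  energy : ∀ t ∈ Icc t₀ t₁, H (q t) (p t) = e
  motion : ∀ t ∈ Icc t₀ t₁, q t ∈ possibleMotion H e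

/-- The Jacobi metric `‖v‖_E = max {⟨p, v⟩ : H(q, p) = E}`. -/
def jacobiNorm (H : M → (E →L[ℝ] ℝ) → ℝ) (e : ℝ) (q : M) (v : E) : ℝ :=
  sSup {r | ∃ p : E →L[ℝ] ℝ, H q p = e ∧ r = p v}

/-- The velocity of the curve `γ` (continuous at `t`) at time `t`, as an element of
`T_{γ(t)} M`. -/
def velocity (γ : ℝ → M) (t : ℝ) : E := deriv (fun τ => chartAt E (γ t) (γ τ)) t

/-- The Maupertuis action `J_E(γ) = ∫ ‖γ'(t)‖_E dt` over `[t₀, t₁]`. -/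
def maupertuis (H : M → (E →L[ℝ] ℝ) → ℝ) (e : ℝ) (γ : ℝ → M) (t₀ t₁ : ℝ) : ℝ :=
  ∫ t in t₀..t₁, jacobiNorm H e (γ t) (velocity γ t)

/-- The curve `c` in `M` has the tangent vector `v` at time `t`. -/
def HasTangentAt (c : ℝ → M) (t : ℝ) (v : E) : Prop :=
  ContinuousAt c t ∧ HasDerivAt (fun τ => chartAt E (c t) (c τ)) v t

/-- The end points of the energy `E` orbit `(γ, p)` on `[t₀, t₁]` are non-conjugate along `γ`
(for the functional `J_E`): for a one-parameter family of energy `E` orbits with the same initial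
point, a variation of the end point at time `t₁` which vanishes modulo the velocity of `γ` forces
the variation `dp` of the initial momentum to vanish. -/
def NonConjugate (H : M → (E →L[ℝ] ℝ) → ℝ) (e : ℝ) (γ : ℝ → M) (p : ℝ → E →L[ℝ] ℝ)
    (t₀ t₁ : ℝ) : Prop :=
  ∀ (Γ : ℝ → ℝ → M) (P : ℝ → ℝ → E →L[ℝ] ℝ) (dp : E →L[ℝ] ℝ) (v : E) (c : ℝ),
    (∀ᶠ σ in 𝓝 0, IsOrbit H e (Γ σ) (P σ) t₀ t₁ ∧ Γ σ t₀ = γ t₀) →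
    (∀ t ∈ Icc t₀ t₁, Γ 0 t = γ t ∧ P 0 t = p t) →
    HasDerivAt (fun σ => P σ t₀) dp 0 →
    IsVelocity H (γ t₁) (p t₁) v →
    HasTangentAt (fun σ => Γ σ t₁) 0 (c • v) →
    dp = 0

/-- `S` is (near `(γ(t₀), γ(t₁))`) the action function `S(q₋, q₊) = J_E(γ(q₋, q₊))` of the orbit
`(γ, p)`: for `(q₋, q₊)` near `(γ(t₀), γ(t₁))`, `γ(q₋, q₊)` is an orbit of energy `E` joining `q₋`
and `q₊` which coincides with `γ` at the base point, and whose initial momentum and travel time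
depend continuously on `(q₋, q₊)` there. For non-conjugate end points there is exactly one such
family near the base point, and it is smooth. -/
def IsActionFunction (H : M → (E →L[ℝ] ℝ) → ℝ) (e : ℝ) (γ : ℝ → M) (p : ℝ → E →L[ℝ] ℝ)
    (t₀ t₁ : ℝ) (S : M × M → ℝ) : Prop :=
  ∃ (Γ : M × M → ℝ → M) (P : M × M → ℝ → E →L[ℝ] ℝ) (T : M × M → ℝ),
    (∀ᶠ z in 𝓝 (γ t₀, γ t₁), t₀ < T z ∧ IsOrbit H e (Γ z) (P z) t₀ (T z) ∧
      Γ z t₀ = z.1 ∧ Γ z (T z) = z.2 ∧ S z = maupertuis H e (Γ z) t₀ (T z)) ∧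
    P (γ t₀, γ t₁) t₀ = p t₀ ∧ T (γ t₀, γ t₁) = t₁ ∧
    ContinuousAt (fun z => cotCoord (γ t₀) z.1 (P z t₀)) (γ t₀, γ t₁) ∧
    ContinuousAt T (γ t₀, γ t₁)

/-! ### Submanifolds -/

/-- A smooth chart `φ` of `M` around `x` in which `N` is given by a linear subspace `F` of `E`. -/
structure SliceChart (N : Set M) (x : M) where
  φ : OpenPartialHomeomorph M E
  F : Submodule ℝ E
  mem_atlas : φ ∈ IsManifold.maximalAtlas 𝓘(ℝ, E) ∞ M
  mem_source : x ∈ φ.source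
  slice : ∀ y ∈ φ.source, y ∈ N ↔ φ y ∈ F

/-- `N` is a smooth (embedded) submanifold of `M`, of codimension greater than one (components of
different dimensions are allowed). -/
def IsScatterer (N : Set M) : Prop :=
  ∀ x ∈ N, ∃ s : SliceChart (E := E) N x, Module.finrank ℝ s.F + 1 < Module.finrank ℝ E

/-- The tangent vectors to a submanifold `A` of `M` at `x`: the velocities of the curves in `A`. -/
def tangentTo (A : Set M) (x : M) : Set E :=
  {v | ∃ c : ℝ → M, c 0 = x ∧ (∀ᶠ t in 𝓝 0, c t ∈ A) ∧ HasTangentAt c 0 v}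

/-! ### Billiard orbits -/

/-- An orbit of energy `E` on `[t 0, t (n + 1)]`, with the `n` collision times `t 1, …, t n`, which
is reflected elastically from `A` (with a nonzero jump of momentum) and does not meet the obstacle
`O` at any other time. `p j` is the momentum on the `j`-th segment `[t j, t (j + 1)]`. The law
`ΔH = 0` is contained in the requirement that all segments have the same energy. -/
structure IsBilliardOrbit (H : M → (E →L[ℝ] ℝ) → ℝ) (e : ℝ) (A O : Set M) (n : ℕ)
    (t : Fin (n + 2) → ℝ) (γ : ℝ → M) (p : Fin (n + 1) → ℝ → E →L[ℝ] ℝ) : Prop where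
  strictMono : StrictMono t
  orbit (j : Fin (n + 1)) : IsOrbit H e γ (p j) (t j.castSucc) (t j.succ)
  collision (i : Fin n) : γ (t i.succ.castSucc) ∈ A
  elastic (i : Fin n) : ∀ v ∈ tangentTo (E := E) A (γ (t i.succ.castSucc)),
    (p i.succ (t i.succ.castSucc) - p i.castSucc (t i.succ.castSucc)) v = 0
  jump (i : Fin n) : p i.succ (t i.succ.castSucc) ≠ p i.castSucc (t i.succ.castSucc)
  free : ∀ τ ∈ Icc (t 0) (t (Fin.last (n + 1))),
    (∀ i : Fin n, τ ≠ t i.succ.castSucc) → γ τ ∉ O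

/-- A finite collision chain of energy `E` of the degenerate billiard with scatterer `N`, or with
scatterer a compact subdomain `K` of `N`. Collisions occur at interior points of `K` relative to
`N` (this holds always if `K = N`), the orbit is not tangent to `N` there, and it does not meet `K`
at other times. -/
structure IsCollisionChain (H : M → (E →L[ℝ] ℝ) → ℝ) (e : ℝ) (N K : Set M) (n : ℕ)
    (t : Fin (n + 2) → ℝ) (γ : ℝ → M) (p : Fin (n + 1) → ℝ → E →L[ℝ] ℝ) : Prop where
  billiard : IsBilliardOrbit H e N K n t γ p
  interior (i : Fin n) : K ∈ 𝓝[N] (γ (t i.succ.castSucc))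
  transversal (i : Fin n) (v : E) :
    IsVelocity H (γ (t i.succ.castSucc)) (p i.castSucc (t i.succ.castSucc)) v ∨
      IsVelocity H (γ (t i.succ.castSucc)) (p i.succ (t i.succ.castSucc)) v →
    v ∉ tangentTo (E := E) N (γ (t i.succ.castSucc))

/-! ### The discrete action functional -/

/-- The finite discrete action `A(x₁, …, xₙ) = ∑_{j=0}^n L_j(x_j, x_{j+1})`, `x₀ = a`,
`x_{n+1} = b`. -/
def discreteAction {X : Type*} {n : ℕ} (L : Fin (n + 1) → X × X → ℝ) (a b : X)
    (x : Fin n → X) : ℝ :=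
  let y : Fin (n + 2) → X := Fin.cons (α := fun _ => X) a (Fin.snoc (α := fun _ => X) x b)
  ∑ j : Fin (n + 1), L j (y j.castSucc, y j.succ)

/-- The function `A`, restricted to `Nⁿ`, in the local coordinates near `x` given by slice
charts (which correspond to `u = 0` at `x`). -/
def inSlices {N : Set M} {n : ℕ} {x : Fin n → M} (s : ∀ i, SliceChart (E := E) N (x i))
    (A : (Fin n → M) → ℝ) (u : ∀ i, (s i).F) : ℝ :=
  A fun i => (s i).φ.symm ((s i).φ (x i) + (u i : E))

/-- `x` is a nondegenerate critical point of the restriction of `A` to `Nⁿ`. -/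
def IsNondegenerateCriticalPoint (E : Type*) [NormedAddCommGroup E] [NormedSpace ℝ E]
    {M : Type*} [TopologicalSpace M] [ChartedSpace E M] (N : Set M) {n : ℕ}
    (A : (Fin n → M) → ℝ) (x : Fin n → M) : Prop :=
  ∃ s : ∀ i, SliceChart (E := E) N (x i),
    fderiv ℝ (inSlices s A) 0 = 0 ∧
    ∀ u, (∀ w, fderiv ℝ (fderiv ℝ (inSlices s A)) 0 u w = 0) → u = 0

/-- A collision chain is nondegenerate if the end points of each of its segments are non-conjugate
and its sequence of collision points is a nondegenerate critical point of the discrete action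
functional formed by the action functions of its segments. -/
structure IsNondegenerateChain (H : M → (E →L[ℝ] ℝ) → ℝ) (e : ℝ) (N : Set M) (n : ℕ)
    (t : Fin (n + 2) → ℝ) (γ : ℝ → M) (p : Fin (n + 1) → ℝ → E →L[ℝ] ℝ) : Prop where
  nonConjugate (j : Fin (n + 1)) : NonConjugate H e γ (p j) (t j.castSucc) (t j.succ)
  critical : ∃ L : Fin (n + 1) → M × M → ℝ,
    (∀ j, IsActionFunction H e γ (p j) (t j.castSucc) (t j.succ) (L j)) ∧
    IsNondegenerateCriticalPoint E N
      (discreteAction L (γ (t 0)) (γ (t (Fin.last (n + 1)))))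
      (fun i => γ (t i.succ.castSucc))

/-! ### Thin scatterers -/

/-- A smooth Riemannian metric on `M`. -/
abbrev Metric (E : Type*) [NormedAddCommGroup E] [NormedSpace ℝ E]
    (M : Type*) [TopologicalSpace M] [ChartedSpace E M] [IsManifold 𝓘(ℝ, E) ∞ M] :=
  Bundle.ContMDiffRiemannianMetric 𝓘(ℝ, E) ∞ E (fun x : M => TangentSpace 𝓘(ℝ, E) x)

variable [IsManifold 𝓘(ℝ, E) ∞ M]

/-- The scalar product of the metric on `T_x M = E`. -/
def Metric.at (g : Metric E M) (x : M) : E →L[ℝ] E →L[ℝ] ℝ := g.inner x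

/-- The kinetic Hamiltonian `½ |p|²` of a Riemannian metric; the projections to `M` of its
trajectories are the geodesics. -/
def kinetic (g : Metric E M) (q : M) (p : E →L[ℝ] ℝ) : ℝ := p ((g.at q).inverse p) / 2

/-- `q = exp_x u`: there is a geodesic `c : [0, 1] → M` with `c(0) = x`, `c'(0) = u`, `c(1) = q`. -/
def IsExp (g : Metric E M) (x : M) (u : E) (q : M) : Prop :=
  ∃ (c : ℝ → M) (p : ℝ → E →L[ℝ] ℝ), IsTrajectory (kinetic g) c p 0 1 ∧
    c 0 = x ∧ p 0 = g.at x u ∧ c 1 = q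

/-- The Riemannian distance (the infimum of the lengths of `C¹` paths). -/
def riemDist (g : Metric E M) (x y : M) : ENNReal :=
  letI : Bundle.RiemannianBundle (fun x : M => TangentSpace 𝓘(ℝ, E) x) := ⟨g.toRiemannianMetric⟩
  riemannianEDist 𝓘(ℝ, E) x y

/-- The normal space `T_x^⊥ N`. -/
def normalTo (g : Metric E M) (N : Set M) (x : M) : Set E :=
  {u | ∀ v ∈ tangentTo (E := E) N x, g.at x u v = 0}

/-- The boundary `S_x` of `B_x` in `T_x^⊥ N`. -/
def sphereOf (g : Metric E M) (N : Set M) (B : M → Set E) (x : M) : Set E :=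
  {s | s ∈ B x ∧ B x ∉ 𝓝[normalTo g N x] s}

/-- `B_x`, `x ∈ N`, are compact convex neighborhoods of `0` in the normal spaces `T_x^⊥ N`, whose
boundaries `S_x` are smooth hypersurfaces in `T_x^⊥ N` with positive definite second fundamental
form, depending smoothly on `x`: locally `B_x = {u ∈ T_x^⊥ N | ρ(x, u) ≤ 0}` with a smooth function
`ρ` whose derivative with respect to `u ∈ T_x^⊥ N` does not vanish, and whose second derivative
is positive definite on the tangent spaces of `S_x`. -/
structure IsConvexFamily (g : Metric E M) (N : Set M) (B : M → Set E) : Prop where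
  subset : ∀ x ∈ N, B x ⊆ normalTo g N x
  convex : ∀ x ∈ N, Convex ℝ (B x)
  compact : ∀ x ∈ N, IsCompact (B x)
  nhds_zero : ∀ x ∈ N, B x ∈ 𝓝[normalTo g N x] 0
  boundary : ∀ x ∈ N, ∀ s ∈ sphereOf g N B x, ∃ ρ : TangentBundle 𝓘(ℝ, E) M → ℝ,
    ContMDiffAt 𝓘(ℝ, E).tangent 𝓘(ℝ, ℝ) ∞ ρ ⟨x, s⟩ ∧
    (∀ᶠ z : TangentBundle 𝓘(ℝ, E) M in 𝓝 ⟨x, s⟩,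
      z.1 ∈ N → z.2 ∈ normalTo g N z.1 → (z.2 ∈ B z.1 ↔ ρ z ≤ 0)) ∧
    (∃ w ∈ normalTo g N x, deriv (fun τ : ℝ => ρ ⟨x, s + τ • w⟩) 0 ≠ 0) ∧
    ∀ w ∈ normalTo g N x, w ≠ 0 → deriv (fun τ : ℝ => ρ ⟨x, s + τ • w⟩) 0 = 0 →
      0 < iteratedDeriv 2 (fun τ : ℝ => ρ ⟨x, s + τ • w⟩) 0

/-- The thin scatterer `N_ε = {exp_x (ε u) : x ∈ K, u ∈ B_x}`; the billiard domain is
`Ω_ε = M \ N_ε`. -/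
def tube (g : Metric E M) (B : M → Set E) (K : Set M) (ε : ℝ) : Set M :=
  {q | ∃ x ∈ K, ∃ u ∈ B x, IsExp g x (ε • u) q}

/-- The reflecting hypersurface `Σ_ε = {exp_x (ε s) : x ∈ K, s ∈ S_x}`. -/
def tubeBoundary (g : Metric E M) (N : Set M) (B : M → Set E) (K : Set M) (ε : ℝ) : Set M :=
  {q | ∃ x ∈ K, ∃ s ∈ sphereOf g N B x, IsExp g x (ε • s) q}

end

end ThinBilliard

/-!
The shadowing orbit is found as a critical point of a discrete action, by the implicit function
theorem at `ε = 0`.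

*Segments.* Since the end points of each segment of the chain are non-conjugate, the segment belongs
to a family of orbits of energy `E` depending smoothly on their end points
(`NonConjugate.exists_segmentFamily`; this needs the smoothness of the Hamiltonian flow,
`Traj.smoothFlow`, which comes from the differentiability of solutions of differential equations
with respect to the initial value, `exists_contDiffAt_localFlow`). The action `S` of these orbits
satisfies `dS = p₊ dq₊ - p₋ dq₋` (`SegmentFamily.fderiv_segAction`), so that a billiard orbit is a
critical point of the discrete action `A = ∑ S` on the product of the reflecting hypersurfaces.

*Scaling.* Near a collision point `x` of the chain the normal exponential map gives coordinates
`(ξ, η)` (`tubeMap`), where `ξ` is a point of `N` and `η` a conormal vector. A point of the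
hypersurface `Σ_ε` is `(ξ, ε η)` with `r(ξ, η) = 0`, where `r` is a function defining the boundary
of the body in the normal space at `ξ`. Critical points of `A` on the product of the hypersurfaces
solve equations with Lagrange multipliers, which after the scaling extend smoothly to `ε = 0`
(`exists_scaled_multipliers`). There they decouple. The equation for `ξ` is that of a critical point
of `A` on `Nⁿ`, which is nondegenerate by hypothesis. The equation for `η` says that `η` is the
boundary point of the convex body at which the outer normal is the jump of momentum `J`
(`exists_reflection`); it is nondegenerate by the positivity of the second fundamental form. So
there is a solution depending on `ε` in a `C¹` way (`exists_reflected_nodes`), and all the estimates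
`O(ε)` follow from differentiability.

*Absence of other collisions.* At positive distance from `K` the orbits do not meet the tubes, by
compactness (`eventually_not_mem_tube`). Near a collision this has to be shown uniformly in `ε`
(`Reflection.eventually_not_mem_tube`). As `H` is strictly convex and the energies before and after
the collision agree, `J` is positive on the velocity after the collision and negative on the one
before (`IsBilliardOrbit.jump_vel`). As `J` is an outer normal of the body, the orbit leaves the
supporting hyperplane with a speed bounded from below, whereas the bodies over neighbouring points
cross this hyperplane at most by `ε` times the displacement of the base point
(`exists_support_bound`, `eventually_not_mem_scaled`).
-/

namespace ThinBilliard

/-! ### Smooth dependence of solutions of differential equations on the initial value -/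

section Superposition

universe u
variable {X : Type*} [TopologicalSpace X] [CompactSpace X]
  {Z G : Type u} [NormedAddCommGroup Z] [NormedSpace ℝ Z] [NormedAddCommGroup G] [NormedSpace ℝ G]

set_option synthInstance.maxHeartbeats 200000

/-- The pointwise application `(A, h) ↦ (x ↦ B (A x) (h x))` of a continuous bilinear map `B` to
continuous functions. -/
noncomputable def pointwiseBilin (X : Type*) [TopologicalSpace X] [CompactSpace X]
    {A Z G : Type*} [NormedAddCommGroup A] [NormedSpace ℝ A]
    [NormedAddCommGroup Z] [NormedSpace ℝ Z] [NormedAddCommGroup G] [NormedSpace ℝ G]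
    (B : A →L[ℝ] Z →L[ℝ] G) : C(X, A) →L[ℝ] C(X, Z) →L[ℝ] C(X, G) :=
  LinearMap.mkContinuous₂
    (LinearMap.mk₂ ℝ (fun (a : C(X, A)) (h : C(X, Z)) =>
        (⟨fun x => B (a x) (h x), by fun_prop⟩ : C(X, G)))
      (fun a b h => by ext x; simp) (fun c a h => by ext x; simp)
      (fun a h k => by ext x; simp) (fun c a h => by ext x; simp)) ‖B‖
    (fun a h => by
      rw [ContinuousMap.norm_le _ (by positivity)]
      intro x
      refine (B.le_opNorm₂ (a x) (h x)).trans ?_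
      have h1 := a.norm_coe_le_norm x
      have h2 := h.norm_coe_le_norm x
      gcongr)

/-- The pointwise application `(A, h) ↦ (x ↦ A x (h x))` of operator valued continuous functions. -/
noncomputable def pointwiseApply (X : Type*) [TopologicalSpace X] [CompactSpace X] (Z G : Type u)
    [NormedAddCommGroup Z] [NormedSpace ℝ Z] [NormedAddCommGroup G] [NormedSpace ℝ G] :
    C(X, Z →L[ℝ] G) →L[ℝ] C(X, Z) →L[ℝ] C(X, G) :=
  pointwiseBilin X (ContinuousLinearMap.id ℝ (Z →L[ℝ] G))

theorem pointwiseApply_apply (A : C(X, Z →L[ℝ] G)) (h : C(X, Z)) (x : X) :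
    pointwiseApply X Z G A h x = A x (h x) := rfl

theorem hasFDerivAt_postcomp {f : Z → G} (hf : ContDiff ℝ 1 f) (α : C(X, Z)) :
    HasFDerivAt (fun β : C(X, Z) => (⟨f, hf.continuous⟩ : C(Z, G)).comp β)
      (pointwiseApply X Z G
        ((⟨fderiv ℝ f, hf.continuous_fderiv one_ne_zero⟩ : C(Z, Z →L[ℝ] G)).comp α)) α := by
  rw [hasFDerivAt_iff_isLittleO_nhds_zero, Asymptotics.isLittleO_iff]
  intro c hc
  have hK : IsCompact (range α) := isCompact_range α.continuous
  have hU := hK.uniformContinuousAt_of_continuousAt (fderiv ℝ f)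
    (fun a _ => (hf.continuous_fderiv one_ne_zero).continuousAt) (Metric.dist_mem_uniformity hc)
  obtain ⟨δ, hδ, hU⟩ := Metric.mem_uniformity_dist.1 hU
  filter_upwards [Metric.ball_mem_nhds (0 : C(X, Z)) hδ] with h hh
  rw [ContinuousMap.norm_le _ (by positivity)]
  intro x
  have hhx : ‖h x‖ < δ := (h.norm_coe_le_norm x).trans_lt (by simpa using hh)
  have key : ‖f (α x + h x) - f (α x) - fderiv ℝ f (α x) (α x + h x - α x)‖
      ≤ c * ‖α x + h x - α x‖ := by
    refine (convex_ball (α x) δ).norm_image_sub_le_of_norm_fderiv_le' (𝕜 := ℝ)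
      (fun y _ => (hf.differentiable one_ne_zero) y) ?_ (Metric.mem_ball_self hδ)
      (by simpa using hhx)
    intro y hy
    have := @hU (α x) y (by rw [dist_comm]; exact hy) (mem_range_self x)
    simp only [mem_ofPred_eq] at this
    rw [dist_comm, dist_eq_norm] at this
    exact this.le
  rw [add_sub_cancel_left] at key
  refine le_trans (le_of_eq ?_) (key.trans (mul_le_mul_of_nonneg_left (h.norm_coe_le_norm x) hc.le))
  simp [pointwiseApply_apply]

/-- The superposition operator `α ↦ f ∘ α` on continuous functions on a compact space is as smooth
as `f`. -/
theorem contDiff_postcomp (k : ℕ) {Z G : Type u} [NormedAddCommGroup Z] [NormedSpace ℝ Z]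
    [NormedAddCommGroup G] [NormedSpace ℝ G] {f : Z → G} (hf : ContDiff ℝ k f)
    (hc : Continuous f) : ContDiff ℝ k (fun α : C(X, Z) => (⟨f, hc⟩ : C(Z, G)).comp α) := by
  induction k generalizing G with
  | zero =>
    rw [Nat.cast_zero, contDiff_zero]
    exact ContinuousMap.continuous_postcomp _
  | succ k ih =>
    have hf1 : ContDiff ℝ 1 f := hf.of_le (by exact_mod_cast Nat.le_add_left 1 k)
    have hd : ContDiff ℝ k (fderiv ℝ f) := by
      have := hf
      push_cast at this
      exact (contDiff_succ_iff_fderiv.1 this).2.2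
    push_cast
    rw [contDiff_succ_iff_hasFDerivAt]
    have hP : ContDiff ℝ k (pointwiseApply X Z G) := ContinuousLinearMap.contDiff _
    exact ⟨fun α => pointwiseApply X Z G ((⟨fderiv ℝ f, _⟩ : C(Z, Z →L[ℝ] G)).comp α),
      hP.comp (ih hd (hf1.continuous_fderiv one_ne_zero)), fun α => hasFDerivAt_postcomp hf1 α⟩

end Superposition

section LocalFlow

universe u
variable {Z : Type u} [NormedAddCommGroup Z] [NormedSpace ℝ Z]

/-- The Volterra operator `β ↦ (t ↦ ∫₀ᵗ β)` on `C([0, 1], Z)`. -/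
noncomputable def volterra (Z : Type u) [NormedAddCommGroup Z] [NormedSpace ℝ Z] :
    C(Icc (0 : ℝ) 1, Z) →L[ℝ] C(Icc (0 : ℝ) 1, Z) :=
  LinearMap.mkContinuous
    { toFun := fun β => ⟨fun t => ∫ s in (0 : ℝ)..t, IccExtend zero_le_one β s, by
        have : Continuous fun t : ℝ => ∫ s in (0 : ℝ)..t, IccExtend zero_le_one β s :=
          intervalIntegral.continuous_primitive
            (fun a b => (β.continuous.Icc_extend').intervalIntegrable a b) 0
        exact this.comp continuous_subtype_val⟩
      map_add' := fun β β' => by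
        ext t
        simp only [ContinuousMap.coe_mk, ContinuousMap.add_apply]
        rw [← intervalIntegral.integral_add ((β.continuous.Icc_extend').intervalIntegrable _ _)
          ((β'.continuous.Icc_extend').intervalIntegrable _ _)]
        rfl
      map_smul' := fun c β => by
        ext t
        simp only [ContinuousMap.coe_mk, ContinuousMap.smul_apply, RingHom.id_apply]
        rw [← intervalIntegral.integral_smul]
        rfl } 1
    (fun β => by
      rw [ContinuousMap.norm_le _ (by positivity)]
      intro t
      simp only [LinearMap.coe_mk, AddHom.coe_mk, ContinuousMap.coe_mk]
      have := intervalIntegral.norm_integral_le_of_norm_le_const (a := (0 : ℝ)) (b := t)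
        (f := IccExtend zero_le_one β) (C := ‖β‖) (fun x _ => β.norm_coe_le_norm _)
      refine this.trans ?_
      rw [sub_zero, abs_of_nonneg t.2.1, one_mul]
      exact mul_le_of_le_one_right (norm_nonneg _) t.2.2)

theorem volterra_apply (β : C(Icc (0 : ℝ) 1, Z)) (t : Icc (0 : ℝ) 1) :
    volterra Z β t = ∫ s in (0 : ℝ)..t, IccExtend zero_le_one β s := rfl

/-- Local flow of a `Cᵏ` vector field, jointly `Cᵏ` in the initial value and time. The rescaled
solutions `t ↦ z(τ t)`, `t ∈ [0, 1]`, are the solutions `α` of `α = z + τ ∫ f ∘ α` near the constant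
`z₀`, so the smoothness follows from the implicit function theorem in `C([0, 1], Z)`. -/
theorem exists_contDiffAt_localFlow [FiniteDimensional ℝ Z] {k : ℕ} (hk : k ≠ 0) {f : Z → Z} {z₀ : Z}
    (hf : ContDiffAt ℝ k f z₀) :
    ∃ Φ : Z × ℝ → Z, ContDiffAt ℝ k Φ (z₀, 0) ∧
      ∃ V ∈ 𝓝 z₀, ∃ δ > 0, ∀ z ∈ V, Φ (z, 0) = z ∧
        ∀ t ∈ Ioo (-δ) δ, HasDerivAt (fun s => Φ (z, s)) (f (Φ (z, t))) t := by
  have : CompleteSpace Z := FiniteDimensional.complete ℝ Z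
  -- replace `f` near `z₀` by a globally smooth vector field
  obtain ⟨f', hf', hff'⟩ : ∃ f' : Z → Z, ContDiff ℝ k f' ∧ f' =ᶠ[𝓝 z₀] f := by
    obtain ⟨u, hu, hfu⟩ := hf.contDiffOn (m := k) le_rfl (by simp)
    obtain ⟨r, hr, hru⟩ := Metric.mem_nhds_iff.1 hu
    let χ : ContDiffBump z₀ := ⟨r / 4, r / 2, by positivity, by linarith⟩
    refine ⟨fun z => χ z • f z, ?_, ?_⟩
    · rw [contDiff_iff_contDiffAt]
      intro z
      by_cases hz : dist z z₀ < r
      · have : ContDiffAt ℝ k f z := by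
          refine (hfu.mono (Subset.rfl)).contDiffAt ?_
          exact mem_of_superset (Metric.isOpen_ball.mem_nhds (show z ∈ Metric.ball z₀ r from hz)) hru
        exact χ.contDiffAt.smul this
      · have : (fun z => χ z • f z) =ᶠ[𝓝 z] fun _ => 0 := by
          have : {w | r / 2 < dist w z₀} ∈ 𝓝 z :=
            (isOpen_lt continuous_const (continuous_id.dist continuous_const)).mem_nhds
              (by simp only [mem_ofPred_eq, id]; linarith)
          filter_upwards [this] with w hw
          rw [χ.zero_of_le_dist (le_of_lt hw), zero_smul]
        exact contDiffAt_const.congr_of_eventuallyEq this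
    · filter_upwards [χ.eventuallyEq_one] with z hz
      simp [hz]
  have hk1 : (1 : WithTop ℕ∞) ≤ k := by exact_mod_cast Nat.one_le_iff_ne_zero.2 hk
  have hk0 : (k : WithTop ℕ∞) ≠ 0 := by exact_mod_cast hk
  obtain ⟨ε, hε, a, r, L, K, hr, hpl⟩ :=
    IsPicardLindelof.of_contDiffAt_one ((hf'.of_le hk1).contDiffAt (x := z₀))
  obtain ⟨Φ, hΦ, hΦc⟩ := (hpl 0).exists_forall_mem_closedBall_eq_hasDerivWithinAt_continuousOn
  simp only [zero_sub, zero_add] at hΦ hΦc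
  have hΦz₀ : Φ (z₀, 0) = z₀ := (hΦ z₀ (Metric.mem_closedBall_self r.2)).1
  have hnhds : Metric.closedBall z₀ r ×ˢ Icc (-ε) ε ∈ 𝓝 (z₀, (0 : ℝ)) :=
    prod_mem_nhds (Metric.closedBall_mem_nhds _ hr) (Icc_mem_nhds (by linarith) hε)
  have hΦ0 : ContinuousAt Φ (z₀, 0) := hΦc.continuousAt hnhds
  let I := Icc (0 : ℝ) 1
  let F : C(I, Z) → C(I, Z) := fun α => (⟨f', hf'.continuous⟩ : C(Z, Z)).comp α
  have hF : ContDiff ℝ k F := contDiff_postcomp k hf' hf'.continuous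
  let cst : Z →L[ℝ] C(I, Z) := ContinuousLinearMap.const ℝ I
  let Q : (Z × ℝ) × C(I, Z) → C(I, Z) := fun w => w.2 - cst w.1.1 - w.1.2 • volterra Z (F w.2)
  have hQ : ContDiff ℝ k Q :=
    (contDiff_snd.sub (cst.contDiff.comp (contDiff_fst.comp contDiff_fst))).sub
      ((contDiff_snd.comp contDiff_fst).smul ((volterra Z).contDiff.comp (hF.comp contDiff_snd)))
  let w₀ : (Z × ℝ) × C(I, Z) := ((z₀, 0), cst z₀)
  have hinv : fderiv ℝ Q w₀ ∘L .inr ℝ (Z × ℝ) C(I, Z) = ContinuousLinearMap.id ℝ _ := by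
    have h1 : HasFDerivAt Q (fderiv ℝ Q w₀) w₀ := (hQ.differentiable hk0 w₀).hasFDerivAt
    have h2 : HasFDerivAt (fun α : C(I, Z) => (((z₀, 0), α) : (Z × ℝ) × C(I, Z)))
      (.inr ℝ (Z × ℝ) C(I, Z)) (cst z₀) := hasFDerivAt_prodMk_right _ _
    have h3 := HasFDerivAt.comp (cst z₀) h1 h2
    refine h3.unique ?_
    have : (Q ∘ fun α : C(I, Z) => (((z₀, 0), α) : (Z × ℝ) × C(I, Z))) = fun α => α - cst z₀ := by
      ext α t
      simp [Q]
    rw [this]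
    exact (hasFDerivAt_id _).sub_const _
  have hinv' : (fderiv ℝ Q w₀ ∘L .inr ℝ (Z × ℝ) C(I, Z)).IsInvertible := by
    rw [hinv]; exact ⟨ContinuousLinearEquiv.refl ℝ _, rfl⟩
  have hQc : ContDiffAt ℝ k Q w₀ := hQ.contDiffAt
  have hQ0 : Q w₀ = 0 := by
    ext t
    simp [Q, w₀]
  let ψ := hQc.implicitFunction hk0 hinv'
  have hψ : ContDiffAt ℝ k ψ (z₀, 0) := hQc.contDiffAt_implicitFunction hk0 hinv'
  have hψu := hQc.eventually_apply_eq_iff_implicitFunction hk0 hinv'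
  rw [hQ0, nhds_prod_eq, eventually_prod_iff] at hψu
  obtain ⟨A, hA, B, hB, hAB⟩ := hψu
  obtain ⟨η, hη, hηB⟩ := Metric.eventually_nhds_iff_ball.1 hB
  -- on a small product neighbourhood the Picard-Lindelöf solutions stay close to `z₀`
  have hnear : ∀ᶠ w in 𝓝 (z₀, (0 : ℝ)), dist (Φ w) z₀ < η / 2 ∧ f' (Φ w) = f (Φ w) := by
    have h1 : ∀ᶠ z in 𝓝 (Φ (z₀, 0)), dist z z₀ < η / 2 ∧ f' z = f z := by
      rw [hΦz₀]
      exact Filter.Eventually.and (Metric.ball_mem_nhds z₀ (half_pos hη)) hff'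
    exact hΦ0.eventually h1
  obtain ⟨ρ, hρ, hρs⟩ := Metric.eventually_nhds_iff_ball.1 (hnear.and (hA.and hnhds))
  have hρs' : ∀ z t, dist z z₀ < ρ → |t| < ρ → (z, t) ∈ Metric.ball (z₀, (0 : ℝ)) ρ := by
    intro z t hz ht
    rw [Metric.mem_ball, Prod.dist_eq, max_lt_iff]
    exact ⟨hz, by simpa using ht⟩
  have hderiv : ∀ z t, dist z z₀ < ρ → |t| < ρ →
      HasDerivAt (fun s => Φ (z, s)) (f' (Φ (z, t))) t := by
    intro z t hz ht
    have h1 := (hρs _ (hρs' z t hz ht)).2.2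
    have hε' : ρ ≤ ε := by
      by_contra! h
      have h2 := (hρs _ (hρs' z ((ε + ρ) / 2) hz (by rw [abs_of_pos] <;> linarith))).2.2.2.2
      simp only at h2; linarith
    have habs := abs_lt.1 ht
    exact ((hΦ z h1.1).2 t h1.2).hasDerivAt (Icc_mem_nhds (by linarith) (by linarith))
  have heq : Φ =ᶠ[𝓝 (z₀, 0)] fun w => ψ w ⟨1, right_mem_Icc.2 zero_le_one⟩ := by
    filter_upwards [Metric.ball_mem_nhds (z₀, (0 : ℝ)) hρ] with w hw
    obtain ⟨z, τ⟩ := w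
    rw [Metric.mem_ball, Prod.dist_eq, max_lt_iff] at hw
    obtain ⟨hz, hτ⟩ := hw
    replace hτ : |τ| < ρ := by simpa using hτ
    have hτt : ∀ t ∈ Icc (0 : ℝ) 1, |τ * t| < ρ := fun t ht => by
      rw [abs_mul, abs_of_nonneg ht.1]
      exact (mul_le_of_le_one_right (abs_nonneg _) ht.2).trans_lt hτ
    let α : C(I, Z) := ⟨fun t => Φ (z, τ * t), by
      rw [continuous_iff_continuousAt]
      intro t
      have := (hderiv z (τ * t) hz (hτt t t.2)).continuousAt
      exact ContinuousAt.comp (f := fun t : I => τ * (t : ℝ)) this (by fun_prop)⟩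
    have hαd : ∀ t : I, α t = Φ (z, τ * t) := fun t => rfl
    have hαB : B α := by
      refine hηB _ ?_
      rw [Metric.mem_ball]
      refine lt_of_le_of_lt ?_ (half_lt_self hη)
      rw [ContinuousMap.dist_le (by positivity)]
      intro t
      exact (hρs _ (hρs' z (τ * t) hz (hτt t t.2))).1.1.le
    have hAz : A (z, τ) := (hρs _ (hρs' z τ hz hτ)).2.1
    have hiff := hAB hAz hαB
    have hQα : Q ((z, τ), α) = 0 := by
      ext t
      have hint : ∫ s in (0 : ℝ)..t, τ • f' (Φ (z, τ * s)) = Φ (z, τ * t) - Φ (z, τ * 0) := by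
        refine intervalIntegral.integral_eq_sub_of_hasDerivAt (f := fun s => Φ (z, τ * s)) ?_ ?_
        · intro s hs
          rw [uIcc_of_le t.2.1] at hs
          have h1 := hderiv z (τ * s) hz (hτt s ⟨hs.1, hs.2.trans t.2.2⟩)
          have h2 : HasDerivAt (fun s : ℝ => τ * s) τ s := by
            simpa using (hasDerivAt_id s).const_mul τ
          exact h1.scomp s h2
        · refine ContinuousOn.intervalIntegrable ?_
          intro s hs
          rw [uIcc_of_le t.2.1] at hs
          have h1 := (hderiv z (τ * s) hz (hτt s ⟨hs.1, hs.2.trans t.2.2⟩)).continuousAt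
          have h2 : ContinuousAt (fun s : ℝ => τ * s) s := by fun_prop
          exact (continuousAt_const.smul (hf'.continuous.continuousAt.comp
            (ContinuousAt.comp (f := fun s : ℝ => τ * s) h1 h2))).continuousWithinAt
      rw [mul_zero, (hΦ z (hρs _ (hρs' z τ hz hτ)).2.2.1).1, intervalIntegral.integral_smul] at hint
      have hv : volterra Z (F α) t = ∫ s in (0 : ℝ)..t, f' (Φ (z, τ * s)) := by
        rw [volterra_apply]
        refine intervalIntegral.integral_congr fun s hs => ?_
        rw [uIcc_of_le t.2.1] at hs
        rw [IccExtend_of_mem _ _ ⟨hs.1, hs.2.trans t.2.2⟩]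
        rfl
      simp only [Q, ContinuousMap.sub_apply, ContinuousMap.smul_apply, hv, hint, hαd]
      simp [cst]
    have := hiff.1 hQα
    change Φ (z, τ) = ψ (z, τ) _
    rw [show ψ (z, τ) = α from this, hαd, mul_one]
  refine ⟨Φ, ?_, Metric.ball z₀ ρ, Metric.ball_mem_nhds _ hρ, ρ, hρ, fun z hz => ⟨?_, ?_⟩⟩
  · refine ContDiffAt.congr_of_eventuallyEq ?_ heq
    have hev : ContDiff ℝ k (ContinuousMap.evalCLM (M := Z) ℝ
      (⟨1, right_mem_Icc.2 zero_le_one⟩ : Icc (0 : ℝ) 1)) := ContinuousLinearMap.contDiff _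
    exact hev.contDiffAt.comp _ hψ
  · exact (hΦ z (hρs _ (hρs' z 0 hz (by simpa using hρ))).2.2.1).1
  · intro t ht
    have h := hderiv z t hz (abs_lt.2 ht)
    rwa [(hρs _ (hρs' z t hz (abs_lt.2 ht))).1.2] at h

end LocalFlow

end ThinBilliard

namespace ThinBilliard

/-! ### Hamiltonian flows in a vector space -/

set_option synthInstance.maxHeartbeats 400000
set_option maxHeartbeats 1000000

theorem eq_of_forall_dual {V : Type*} [NormedAddCommGroup V] [NormedSpace ℝ V] {x y : V}
    (h : ∀ f : V →L[ℝ] ℝ, f x = f y) : x = y :=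
  (SeparatingDual.eq_iff_forall_dual_eq (R := ℝ)).2 h

section HamiltonianField

variable {E : Type*} [NormedAddCommGroup E] [NormedSpace ℝ E] [FiniteDimensional ℝ E]

theorem finrank_dual (V : Type*) [NormedAddCommGroup V] [NormedSpace ℝ V] [FiniteDimensional ℝ V] :
    Module.finrank ℝ (V →L[ℝ] ℝ) = Module.finrank ℝ V := by
  rw [← (LinearMap.toContinuousLinearMap : (V →ₗ[ℝ] ℝ) ≃ₗ[ℝ] _).finrank_eq]
  exact Subspace.dual_finrank_eq

/-- A finite dimensional space is its own bidual. -/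
noncomputable def bidual (E : Type*) [NormedAddCommGroup E] [NormedSpace ℝ E]
    [FiniteDimensional ℝ E] : E ≃L[ℝ] ((E →L[ℝ] ℝ) →L[ℝ] ℝ) :=
  (LinearEquiv.ofInjectiveOfFinrankEq
    (ContinuousLinearMap.apply ℝ ℝ : E →L[ℝ] (E →L[ℝ] ℝ) →L[ℝ] ℝ).toLinearMap
    (fun x y hxy => eq_of_forall_dual fun f =>
      congrArg (fun l : (E →L[ℝ] ℝ) →L[ℝ] ℝ => l f) hxy)
    (by rw [finrank_dual, finrank_dual])).toContinuousLinearEquiv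

theorem bidual_apply (x : E) (y : E →L[ℝ] ℝ) : bidual E x y = y x := rfl

theorem bidual_symm_apply (l : (E →L[ℝ] ℝ) →L[ℝ] ℝ) (y : E →L[ℝ] ℝ) :
    y ((bidual E).symm l) = l y := by
  rw [← bidual_apply, ContinuousLinearEquiv.apply_symm_apply]

/-- The Hamiltonian vector field `(∂h/∂y, -∂h/∂x)` of a function `h(x, y)`. -/
noncomputable def hamField (h : E × (E →L[ℝ] ℝ) → ℝ) (z : E × (E →L[ℝ] ℝ)) :
    E × (E →L[ℝ] ℝ) :=
  ((bidual E).symm (fderiv ℝ h z ∘L .inr ℝ E (E →L[ℝ] ℝ)),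
    -(fderiv ℝ h z ∘L .inl ℝ E (E →L[ℝ] ℝ)))

theorem fderiv_eq_hamField (h : E × (E →L[ℝ] ℝ) → ℝ) (z δ : E × (E →L[ℝ] ℝ)) :
    fderiv ℝ h z δ = δ.2 (hamField h z).1 - (hamField h z).2 δ.1 := by
  obtain ⟨a, b⟩ := δ
  simp only [hamField, bidual_symm_apply, neg_apply, sub_neg_eq_add]
  simp [← map_add]

theorem eq_hamField {h : E × (E →L[ℝ] ℝ) → ℝ} {z : E × (E →L[ℝ] ℝ)} {xd : E} {yd : E →L[ℝ] ℝ}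
    (H : ∀ (a : E) (b : E →L[ℝ] ℝ), fderiv ℝ h z (a, b) = b xd - yd a) :
    hamField h z = (xd, yd) := by
  have H' : ∀ (a : E) (b : E →L[ℝ] ℝ),
      b (hamField h z).1 - (hamField h z).2 a = b xd - yd a := fun a b => by
    rw [← H a b, fderiv_eq_hamField]
  refine Prod.ext (eq_of_forall_dual fun f => ?_) (ContinuousLinearMap.ext fun a => ?_)
  · simpa using H' 0 f
  · simpa using H' a 0

theorem contDiffAt_hamField {h : E × (E →L[ℝ] ℝ) → ℝ} {z : E × (E →L[ℝ] ℝ)} {k : ℕ}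
    (hh : ContDiffAt ℝ (k + 1) h z) : ContDiffAt ℝ k (hamField h) z := by
  have h1 : ContDiffAt ℝ k (fderiv ℝ h) z := hh.fderiv_right le_rfl
  have h2 : ContDiffAt ℝ k (fun z => fderiv ℝ h z ∘L .inr ℝ E (E →L[ℝ] ℝ)) z :=
    h1.clm_comp contDiffAt_const
  have h3 : ContDiffAt ℝ k (fun z => fderiv ℝ h z ∘L .inl ℝ E (E →L[ℝ] ℝ)) z :=
    h1.clm_comp contDiffAt_const
  exact ((bidual E).symm.contDiff.contDiffAt.comp z h2).prodMk h3.neg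

/-- The derivative in time of the derivative in the initial value is the derivative in the initial
value of the derivative in time. -/
theorem hasDerivAt_fderiv_of_hasDerivAt {Z G : Type*} [NormedAddCommGroup Z] [NormedSpace ℝ Z]
    [NormedAddCommGroup G] [NormedSpace ℝ G] {F K : Z × ℝ → G} {z : Z} {t : ℝ}
    (hF : ContDiffAt ℝ 2 F (z, t))
    (hFK : ∀ᶠ w in 𝓝 (z, t), HasDerivAt (fun s => F (w.1, s)) (K w) w.2) (v : Z) :
    HasDerivAt (fun s => fderiv ℝ F (z, s) (v, 0)) (fderiv ℝ K (z, t) (v, 0)) t := by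
  have hd : DifferentiableAt ℝ (fderiv ℝ F) (z, t) :=
    (hF.fderiv_right (m := 1) (by norm_num)).differentiableAt one_ne_zero
  have hK : K =ᶠ[𝓝 (z, t)] fun w => fderiv ℝ F w (0, 1) := by
    have hF1 : ∀ᶠ w in 𝓝 (z, t), DifferentiableAt ℝ F w :=
      (hF.eventually (by simp)).mono fun w hw => hw.differentiableAt two_ne_zero
    filter_upwards [hFK, hF1] with w hw hw1
    have h1 : HasDerivAt (fun s : ℝ => (w.1, s)) ((0 : Z), (1 : ℝ)) w.2 :=
      (hasDerivAt_const _ _).prodMk (hasDerivAt_id _)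
    exact hw.unique (hw1.hasFDerivAt.comp_hasDerivAt w.2 h1)
  have hsymm : fderiv ℝ (fderiv ℝ F) (z, t) (v, 0) (0, 1)
      = fderiv ℝ (fderiv ℝ F) (z, t) (0, 1) (v, 0) :=
    hF.isSymmSndFDerivAt (by simp) _ _
  have h2 : fderiv ℝ K (z, t) (v, 0) = fderiv ℝ (fderiv ℝ F) (z, t) (v, 0) (0, 1) := by
    rw [hK.fderiv_eq]
    rw [fderiv_clm_apply hd (differentiableAt_const _)]
    simp
  rw [h2, hsymm]
  have h1 : HasDerivAt (fun s : ℝ => (z, s)) ((0 : Z), (1 : ℝ)) t :=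
    (hasDerivAt_const _ _).prodMk (hasDerivAt_id _)
  have h3 := hd.hasFDerivAt.comp_hasDerivAt t h1
  exact (ContinuousLinearMap.apply ℝ G ((v, 0) : Z × ℝ)).hasFDerivAt.comp_hasDerivAt t h3

/-- The local flow `Φ` of a Hamiltonian vector field and its action `S = ∫ y dx`. The last clause is
the first variation formula `dS = y' dx' - y dx + t dh`. -/
theorem exists_localHamFlow {h : E × (E →L[ℝ] ℝ) → ℝ} {z₀ : E × (E →L[ℝ] ℝ)}
    (hh : ContDiffAt ℝ 3 h z₀) {U : Set (E × (E →L[ℝ] ℝ))} (hU : U ∈ 𝓝 z₀) :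
    ∃ (Φ : (E × (E →L[ℝ] ℝ)) × ℝ → E × (E →L[ℝ] ℝ)) (S : (E × (E →L[ℝ] ℝ)) × ℝ → ℝ),
      ∃ V ∈ 𝓝 z₀, ∃ δ > 0, ∀ z ∈ V, Φ (z, 0) = z ∧ S (z, 0) = 0 ∧ ∀ t ∈ Ioo (-δ) δ,
        ContDiffAt ℝ 2 Φ (z, t) ∧ ContDiffAt ℝ 2 S (z, t) ∧ Φ (z, t) ∈ U ∧
        HasDerivAt (fun s => Φ (z, s)) (hamField h (Φ (z, t))) t ∧
        HasDerivAt (fun s => S (z, s)) ((Φ (z, t)).2 (hamField h (Φ (z, t))).1) t ∧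
        h (Φ (z, t)) = h z ∧
        ∀ δ, fderiv ℝ S (z, t) δ
          = (Φ (z, t)).2 (fderiv ℝ Φ (z, t) δ).1 - z.2 δ.1.1 + t * fderiv ℝ h z δ.1 := by
  have hX : ContDiffAt ℝ 2 (hamField h) z₀ := contDiffAt_hamField (k := 2) (by exact_mod_cast hh)
  -- the vector field on the space with the action as an additional coordinate
  let f : (E × (E →L[ℝ] ℝ)) × ℝ → (E × (E →L[ℝ] ℝ)) × ℝ :=
    fun w => (hamField h w.1, w.1.2 (hamField h w.1).1)
  have hf : ContDiffAt ℝ (2 : ℕ) f (z₀, 0) := by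
    have h1 : ContDiffAt ℝ 2 (fun w : (E × (E →L[ℝ] ℝ)) × ℝ => hamField h w.1) (z₀, 0) :=
      ContDiffAt.comp (z₀, (0 : ℝ)) hX contDiffAt_fst
    exact h1.prodMk ((contDiffAt_snd.comp _ contDiffAt_fst).clm_apply
      (contDiffAt_fst.comp _ h1))
  obtain ⟨Ψ, hΨ, V, hV, δ, hδ, hVδ⟩ := exists_contDiffAt_localFlow two_ne_zero hf
  let ι : (E × (E →L[ℝ] ℝ)) × ℝ → ((E × (E →L[ℝ] ℝ)) × ℝ) × ℝ := fun w => ((w.1, 0), w.2)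
  have hι : ContDiff ℝ 2 ι := by fun_prop
  let Φ : (E × (E →L[ℝ] ℝ)) × ℝ → E × (E →L[ℝ] ℝ) := fun w => (Ψ (ι w)).1
  let S : (E × (E →L[ℝ] ℝ)) × ℝ → ℝ := fun w => (Ψ (ι w)).2
  have hΦ : ContDiffAt ℝ 2 Φ (z₀, 0) :=
    contDiffAt_fst.comp _ (ContDiffAt.comp (z₀, (0 : ℝ)) hΨ hι.contDiffAt)
  have hS : ContDiffAt ℝ 2 S (z₀, 0) :=
    contDiffAt_snd.comp _ (ContDiffAt.comp (z₀, (0 : ℝ)) hΨ hι.contDiffAt)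
  have hΦ0 : Φ (z₀, 0) = z₀ := congrArg Prod.fst (hVδ _ (mem_of_mem_nhds hV)).1
  have hΦU : ∀ᶠ w in 𝓝 (z₀, (0 : ℝ)), Φ w ∈ U ∧ ContDiffAt ℝ 3 h (Φ w) := by
    have : ∀ᶠ z in 𝓝 (Φ (z₀, 0)), z ∈ U ∧ ContDiffAt ℝ 3 h z := by
      rw [hΦ0]; exact Filter.Eventually.and hU (hh.eventually (by simp))
    exact hΦ.continuousAt.eventually this
  have hVz : ∀ᶠ z in 𝓝 z₀, ((z, 0) : (E × (E →L[ℝ] ℝ)) × ℝ) ∈ V :=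
    (by fun_prop : Continuous fun z : E × (E →L[ℝ] ℝ) => (z, (0 : ℝ))).continuousAt.eventually hV
  have hall : ∀ᶠ w in 𝓝 (z₀, (0 : ℝ)), ContDiffAt ℝ 2 Φ w ∧ ContDiffAt ℝ 2 S w ∧
      (Φ w ∈ U ∧ ContDiffAt ℝ 3 h (Φ w)) :=
    (hΦ.eventually (by simp)).and ((hS.eventually (by simp)).and hΦU)
  rw [nhds_prod_eq, eventually_prod_iff] at hall
  obtain ⟨A, hA, B, hB, hAB⟩ := hall
  obtain ⟨δ', hδ', hB⟩ := Metric.eventually_nhds_iff_ball.1 hB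
  obtain ⟨ρ, hρ, hρV⟩ := Metric.eventually_nhds_iff_ball.1 (hVz.and hA)
  refine ⟨Φ, S, Metric.ball z₀ ρ, Metric.ball_mem_nhds _ hρ, min δ δ', lt_min hδ hδ', ?_⟩
  have hin : ∀ t ∈ Ioo (-min δ δ') (min δ δ'), t ∈ Ioo (-δ) δ ∧ B t := by
    intro t ht
    have h1 := min_le_left δ δ'
    have h2 := min_le_right δ δ'
    refine ⟨⟨by linarith [ht.1], by linarith [ht.2]⟩, hB t ?_⟩
    rw [Real.ball_eq_Ioo]
    exact ⟨by linarith [ht.1], by linarith [ht.2]⟩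
  have h0in : (0 : ℝ) ∈ Ioo (-min δ δ') (min δ δ') :=
    ⟨neg_neg_of_pos (lt_min hδ hδ'), lt_min hδ hδ'⟩
  have hinit : ∀ z ∈ Metric.ball z₀ ρ, Φ (z, 0) = z ∧ S (z, 0) = 0 := fun z hz =>
    ⟨congrArg Prod.fst (hVδ _ (hρV z hz).1).1, congrArg Prod.snd (hVδ _ (hρV z hz).1).1⟩
  have hprops : ∀ z ∈ Metric.ball z₀ ρ, ∀ t ∈ Ioo (-min δ δ') (min δ δ'),
      ContDiffAt ℝ 2 Φ (z, t) ∧ ContDiffAt ℝ 2 S (z, t) ∧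
      (Φ (z, t) ∈ U ∧ ContDiffAt ℝ 3 h (Φ (z, t))) := fun z hz t ht =>
    hAB (hρV z hz).2 (hin t ht).2
  have hΦd : ∀ z ∈ Metric.ball z₀ ρ, ∀ t ∈ Ioo (-min δ δ') (min δ δ'),
      HasDerivAt (fun s => Φ (z, s)) (hamField h (Φ (z, t))) t := fun z hz t ht =>
    HasFDerivAt.comp_hasDerivAt (f := fun s => Ψ ((z, 0), s)) t hasFDerivAt_fst ((hVδ _ (hρV z hz).1).2 t (hin t ht).1)
  have hSd : ∀ z ∈ Metric.ball z₀ ρ, ∀ t ∈ Ioo (-min δ δ') (min δ δ'),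
      HasDerivAt (fun s => S (z, s)) ((Φ (z, t)).2 (hamField h (Φ (z, t))).1) t := fun z hz t ht =>
    HasFDerivAt.comp_hasDerivAt (f := fun s => Ψ ((z, 0), s)) t hasFDerivAt_snd ((hVδ _ (hρV z hz).1).2 t (hin t ht).1)
  have hnh : ∀ z ∈ Metric.ball z₀ ρ, ∀ t ∈ Ioo (-min δ δ') (min δ δ'),
      ∀ᶠ w in 𝓝 (z, t), w.1 ∈ Metric.ball z₀ ρ ∧ w.2 ∈ Ioo (-min δ δ') (min δ δ') :=
    fun z hz t ht => prod_mem_nhds (Metric.isOpen_ball.mem_nhds hz) (isOpen_Ioo.mem_nhds ht)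
  -- conservation of energy
  have henergy : ∀ z ∈ Metric.ball z₀ ρ, ∀ t ∈ Ioo (-min δ δ') (min δ δ'), h (Φ (z, t)) = h z := by
    intro z hz t ht
    have hd : ∀ s ∈ Ioo (-min δ δ') (min δ δ'), HasDerivAt (fun s => h (Φ (z, s))) 0 s := by
      intro s hs
      have h1 := ((hprops z hz s hs).2.2.2.differentiableAt (by simp)).hasFDerivAt.comp_hasDerivAt s
        (hΦd z hz s hs)
      exact h1.congr_deriv (by rw [fderiv_eq_hamField, sub_self])
    have := (convex_Ioo (-min δ δ') (min δ δ')).is_const_of_fderivWithin_eq_zero (𝕜 := ℝ)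
      (f := fun s => h (Φ (z, s))) (fun s hs => (hd s hs).differentiableAt.differentiableWithinAt)
      (fun s hs => by
        rw [fderivWithin_of_isOpen isOpen_Ioo hs]
        ext; simp [(hd s hs).hasFDerivAt.fderiv]) ht h0in
    simpa [(hinit z hz).1] using this
  -- the variation of the initial value
  have hvar : ∀ z ∈ Metric.ball z₀ ρ, ∀ t ∈ Ioo (-min δ δ') (min δ δ'), ∀ v,
      fderiv ℝ S (z, t) (v, 0)
        = (Φ (z, t)).2 (fderiv ℝ Φ (z, t) (v, 0)).1 - z.2 v.1 + t * fderiv ℝ h z v := by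
    intro z hz t ht v
    let D : ℝ → ℝ := fun s => fderiv ℝ S (z, s) (v, 0)
      - ((Φ (z, s)).2 (fderiv ℝ Φ (z, s) (v, 0)).1 - z.2 v.1 + s * fderiv ℝ h z v)
    have hd : ∀ s ∈ Ioo (-min δ δ') (min δ δ'), HasDerivAt D 0 s := by
      intro s hs
      obtain ⟨hΦ2, hS2, -, hh3⟩ := hprops z hz s hs
      have hΦ1 := hΦ2.differentiableAt two_ne_zero
      have hX2 : ContDiffAt ℝ 2 (hamField h) (Φ (z, s)) :=
        contDiffAt_hamField (k := 2) (by exact_mod_cast hh3)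
      have hX1 := hX2.differentiableAt two_ne_zero
      have hXΦ : DifferentiableAt ℝ (fun w => hamField h (Φ w)) (z, s) :=
        hX1.comp (z, s) hΦ1
      have h1 := hasDerivAt_fderiv_of_hasDerivAt (K := fun w => hamField h (Φ w)) hΦ2
        ((hnh z hz s hs).mono fun w hw => hΦd w.1 hw.1 w.2 hw.2) v
      have h2 := hasDerivAt_fderiv_of_hasDerivAt (K := fun w => (Φ w).2 (hamField h (Φ w)).1) hS2
        ((hnh z hz s hs).mono fun w hw => hSd w.1 hw.1 w.2 hw.2) v
      have h3 := hΦd z hz s hs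
      set W := fderiv ℝ Φ (z, s) (v, 0) with hW
      have h4 : HasDerivAt (fun s => (Φ (z, s)).2 (fderiv ℝ Φ (z, s) (v, 0)).1)
          ((hamField h (Φ (z, s))).2 W.1
            + (Φ (z, s)).2 (fderiv ℝ (fun w => hamField h (Φ w)) (z, s) (v, 0)).1) s :=
        have e1 : HasDerivAt (fun s => (Φ (z, s)).2) (hamField h (Φ (z, s))).2 s :=
          HasFDerivAt.comp_hasDerivAt (f := fun s => Φ (z, s)) s hasFDerivAt_snd h3
        have e2 : HasDerivAt (fun s => (fderiv ℝ Φ (z, s) (v, 0)).1)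
            (fderiv ℝ (fun w => hamField h (Φ w)) (z, s) (v, 0)).1 s :=
          HasFDerivAt.comp_hasDerivAt (f := fun s => fderiv ℝ Φ (z, s) (v, 0)) s hasFDerivAt_fst h1
        e1.clm_apply e2
      have h5 : fderiv ℝ (fun w => (Φ w).2 (hamField h (Φ w)).1) (z, s) (v, 0)
          = W.2 (hamField h (Φ (z, s))).1
            + (Φ (z, s)).2 (fderiv ℝ (fun w => hamField h (Φ w)) (z, s) (v, 0)).1 := by
        have e1 : HasFDerivAt (fun w => (Φ w).2) (.snd ℝ _ _ ∘L fderiv ℝ Φ (z, s)) (z, s) :=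
          hasFDerivAt_snd.comp (z, s) hΦ1.hasFDerivAt
        have e2 : HasFDerivAt (fun w => (hamField h (Φ w)).1)
            (.fst ℝ _ _ ∘L fderiv ℝ (fun w => hamField h (Φ w)) (z, s)) (z, s) :=
          hasFDerivAt_fst.comp (z, s) hXΦ.hasFDerivAt
        rw [(e1.clm_apply e2).fderiv, add_comm]
        rfl
      have h6 : fderiv ℝ h (Φ (z, s)) W = fderiv ℝ h z v := by
        have e1 : HasFDerivAt (fun w => h (Φ w)) (fderiv ℝ h (Φ (z, s)) ∘L fderiv ℝ Φ (z, s)) (z, s) :=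
          (hh3.differentiableAt (by simp)).hasFDerivAt.comp (z, s) hΦ1.hasFDerivAt
        have hhz : ContDiffAt ℝ 3 h z := by
          have := (hprops z hz 0 h0in).2.2.2
          rwa [(hinit z hz).1] at this
        have e2 : HasFDerivAt (fun w : (E × (E →L[ℝ] ℝ)) × ℝ => h w.1)
            (fderiv ℝ h z ∘L .fst ℝ _ _) (z, s) :=
          HasFDerivAt.comp (z, s) (hhz.differentiableAt (by simp)).hasFDerivAt hasFDerivAt_fst
        have e3 : (fun w => h (Φ w)) =ᶠ[𝓝 (z, s)] fun w => h w.1 :=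
          (hnh z hz s hs).mono fun w hw => henergy w.1 hw.1 w.2 hw.2
        have := (e1.congr_of_eventuallyEq e3.symm).unique e2
        exact DFunLike.congr_fun this (v, 0)
      have h7 := h2.sub ((h4.sub_const (z.2 v.1)).add ((hasDerivAt_id s).mul_const (fderiv ℝ h z v)))
      refine h7.congr_deriv ?_
      rw [h5, ← h6, fderiv_eq_hamField]
      ring
    have hD0 : D 0 = 0 := by
      have e1 : fderiv ℝ S (z, 0) (v, 0) = 0 := by
        have h1 : HasFDerivAt (fun w : E × (E →L[ℝ] ℝ) => S (w, 0))
            (fderiv ℝ S (z, 0) ∘L .inl ℝ _ _) z :=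
          HasFDerivAt.comp (g := S) (f := fun w => (w, (0 : ℝ))) z ((hprops z hz 0 h0in).2.1.differentiableAt two_ne_zero).hasFDerivAt
            (hasFDerivAt_prodMk_left z (0 : ℝ))
        have h2 : HasFDerivAt (fun w : E × (E →L[ℝ] ℝ) => S (w, 0))
            (0 : (E × (E →L[ℝ] ℝ)) →L[ℝ] ℝ) z :=
          (hasFDerivAt_const (0 : ℝ) z).congr_of_eventuallyEq
            (Filter.mem_of_superset (Metric.isOpen_ball.mem_nhds hz) fun w hw => (hinit w hw).2)
        simpa using DFunLike.congr_fun (h1.unique h2) v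
      have e2 : fderiv ℝ Φ (z, 0) (v, 0) = v := by
        have h1 : HasFDerivAt (fun w : E × (E →L[ℝ] ℝ) => Φ (w, 0))
            (fderiv ℝ Φ (z, 0) ∘L .inl ℝ _ _) z :=
          HasFDerivAt.comp (g := Φ) (f := fun w => (w, (0 : ℝ))) z ((hprops z hz 0 h0in).1.differentiableAt two_ne_zero).hasFDerivAt
            (hasFDerivAt_prodMk_left z (0 : ℝ))
        have h2 : HasFDerivAt (fun w : E × (E →L[ℝ] ℝ) => Φ (w, 0)) (.id ℝ _) z :=
          (hasFDerivAt_id z).congr_of_eventuallyEq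
            (Filter.mem_of_superset (Metric.isOpen_ball.mem_nhds hz) fun w hw => (hinit w hw).1)
        simpa using DFunLike.congr_fun (h1.unique h2) v
      simp only [D, e1, e2, (hinit z hz).1]
      ring
    have hDt := (convex_Ioo (-min δ δ') (min δ δ')).is_const_of_fderivWithin_eq_zero (𝕜 := ℝ)
      (f := D) (fun s hs => (hd s hs).differentiableAt.differentiableWithinAt)
      (fun s hs => by
        rw [fderivWithin_of_isOpen isOpen_Ioo hs]
        ext; simp [(hd s hs).hasFDerivAt.fderiv]) ht h0in
    rw [hD0] at hDt
    exact sub_eq_zero.1 hDt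
  intro z hz
  refine ⟨(hinit z hz).1, (hinit z hz).2, fun t ht => ?_⟩
  obtain ⟨h1, h2, h3, h4⟩ := hprops z hz t ht
  refine ⟨h1, h2, h3, hΦd z hz t ht, hSd z hz t ht, henergy z hz t ht, ?_⟩
  rintro ⟨v, c⟩
  have hvc : ((v, c) : (E × (E →L[ℝ] ℝ)) × ℝ) = (v, 0) + c • (0, 1) := by simp
  have ht1 : HasDerivAt (fun s : ℝ => (z, s)) ((0 : E × (E →L[ℝ] ℝ)), (1 : ℝ)) t :=
    (hasDerivAt_const _ _).prodMk (hasDerivAt_id _)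
  have e1 : fderiv ℝ S (z, t) (0, 1) = (Φ (z, t)).2 (hamField h (Φ (z, t))).1 :=
    ((h2.differentiableAt two_ne_zero).hasFDerivAt.comp_hasDerivAt t ht1).unique (hSd z hz t ht)
  have e2 : fderiv ℝ Φ (z, t) (0, 1) = hamField h (Φ (z, t)) :=
    ((h1.differentiableAt two_ne_zero).hasFDerivAt.comp_hasDerivAt t ht1).unique (hΦd z hz t ht)
  rw [hvc, map_add, map_add, map_smul, map_smul, hvar z hz t ht v, e1, e2]
  simp only [Prod.fst_add, Prod.smul_fst, map_add, map_smul, smul_eq_mul, smul_zero, add_zero]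
  ring

end HamiltonianField

end ThinBilliard

namespace ThinBilliard

/-! ### Canonical coordinates on the cotangent bundle -/

set_option synthInstance.maxHeartbeats 400000
set_option maxHeartbeats 1000000
set_option linter.unusedSectionVars false

theorem two_le_infty : (2 : WithTop ℕ∞) ≤ ∞ :=
  WithTop.coe_le_coe.2 (le_top : (2 : ℕ∞) ≤ ⊤)

section Coordinates

variable {E : Type*} [NormedAddCommGroup E] [NormedSpace ℝ E]
  {M : Type*} [TopologicalSpace M]

/-- The derivative, at the point `q`, of the change of charts from `φ` to `ψ`. -/
noncomputable def tr (φ ψ : OpenPartialHomeomorph M E) (q : M) : E →L[ℝ] E :=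
  fderiv ℝ (ψ ∘ φ.symm) (φ q)

/-- The cotangent lift of the change of charts from `φ` to `ψ`. -/
noncomputable def cotLift (φ ψ : OpenPartialHomeomorph M E) (z : E × (E →L[ℝ] ℝ)) :
    E × (E →L[ℝ] ℝ) :=
  (ψ (φ.symm z.1), z.2 ∘L tr ψ φ (φ.symm z.1))

/-- The canonical coordinates of `(q, p)` in the chart at `q₀`. -/
noncomputable def phaseCoord [ChartedSpace E M] (q₀ : M) (m : M × (E →L[ℝ] ℝ)) :
    E × (E →L[ℝ] ℝ) :=
  (chartAt E q₀ m.1, cotCoord q₀ m.1 m.2)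

/-- The point of `T*M` with the given canonical coordinates in the chart at `q₀`. -/
noncomputable def phasePt [ChartedSpace E M] (q₀ : M) (z : E × (E →L[ℝ] ℝ)) :
    M × (E →L[ℝ] ℝ) :=
  ((chartAt E q₀).symm z.1, z.2 ∘L chartDeriv q₀ ((chartAt E q₀).symm z.1))

theorem chartDeriv_eq_tr [ChartedSpace E M] (q₀ q : M) :
    chartDeriv q₀ q = tr (chartAt E q) (chartAt E q₀) q := rfl

theorem chartSymmDeriv_eq_tr [ChartedSpace E M] (q₀ q : M) :
    chartSymmDeriv q₀ q = tr (chartAt E q₀) (chartAt E q) q := rfl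

theorem coordHam_eq [ChartedSpace E M] (H : M → (E →L[ℝ] ℝ) → ℝ) (q₀ : M)
    (z : E × (E →L[ℝ] ℝ)) : coordHam H q₀ z = H (phasePt q₀ z).1 (phasePt q₀ z).2 := rfl

variable [ChartedSpace E M] [IsManifold 𝓘(ℝ, E) ∞ M]
  {φ ψ χ : OpenPartialHomeomorph M E}

theorem chart_mem (q : M) : chartAt E q ∈ IsManifold.maximalAtlas 𝓘(ℝ, E) ∞ M :=
  IsManifold.chart_mem_maximalAtlas q

theorem contDiffAt_trans (hφ : φ ∈ IsManifold.maximalAtlas 𝓘(ℝ, E) ∞ M)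
    (hψ : ψ ∈ IsManifold.maximalAtlas 𝓘(ℝ, E) ∞ M) {x : E} (hx : x ∈ φ.target)
    (hxψ : φ.symm x ∈ ψ.source) : ContDiffAt ℝ ∞ (ψ ∘ φ.symm) x := by
  have h := IsManifold.compatible_of_mem_maximalAtlas hφ hψ
  rw [contDiffGroupoid, mem_groupoid_of_pregroupoid] at h
  have h1 : ContDiffOn ℝ ∞ (ψ ∘ φ.symm) (φ.symm.trans ψ).source := by
    simpa [contDiffPregroupoid] using h.1
  exact h1.contDiffAt ((φ.symm.trans ψ).open_source.mem_nhds (by simp [hx, hxψ]))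

theorem tr_comp (hφ : φ ∈ IsManifold.maximalAtlas 𝓘(ℝ, E) ∞ M)
    (hψ : ψ ∈ IsManifold.maximalAtlas 𝓘(ℝ, E) ∞ M) (hχ : χ ∈ IsManifold.maximalAtlas 𝓘(ℝ, E) ∞ M)
    {q : M} (h1 : q ∈ φ.source) (h2 : q ∈ ψ.source) (h3 : q ∈ χ.source) :
    tr ψ χ q ∘L tr φ ψ q = tr φ χ q := by
  have e1 : HasFDerivAt (ψ ∘ φ.symm) (tr φ ψ q) (φ q) :=
    ((contDiffAt_trans hφ hψ (φ.map_source h1) (by simpa [h1])).differentiableAt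
      (by simp)).hasFDerivAt
  have e2 : HasFDerivAt (χ ∘ ψ.symm) (tr ψ χ q) ((ψ ∘ φ.symm) (φ q)) := by
    simp only [Function.comp, φ.left_inv h1]
    exact ((contDiffAt_trans hψ hχ (ψ.map_source h2) (by simpa [h2])).differentiableAt
      (by simp)).hasFDerivAt
  have e3 := e2.comp (φ q) e1
  have e4 : (χ ∘ ψ.symm) ∘ ψ ∘ φ.symm =ᶠ[𝓝 (φ q)] χ ∘ φ.symm := by
    have : φ.symm ⁻¹' ψ.source ∈ 𝓝 (φ q) :=
      (φ.symm.continuousAt (φ.map_source h1)).preimage_mem_nhds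
        (ψ.open_source.mem_nhds (by simpa [h1]))
    filter_upwards [this] with y hy
    simp only [Function.comp, ψ.left_inv hy]
  exact (e3.congr_of_eventuallyEq e4.symm).fderiv.symm


theorem tr_self {q : M} (h : q ∈ φ.source) : tr φ φ q = ContinuousLinearMap.id ℝ E := by
  have : φ ∘ φ.symm =ᶠ[𝓝 (φ q)] id := by
    filter_upwards [φ.open_target.mem_nhds (φ.map_source h)] with y hy
    exact φ.right_inv hy
  rw [tr, this.fderiv_eq, fderiv_id]

theorem tr_comp_tr (hφ : φ ∈ IsManifold.maximalAtlas 𝓘(ℝ, E) ∞ M)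
    (hψ : ψ ∈ IsManifold.maximalAtlas 𝓘(ℝ, E) ∞ M) {q : M} (h1 : q ∈ φ.source)
    (h2 : q ∈ ψ.source) : tr ψ φ q ∘L tr φ ψ q = ContinuousLinearMap.id ℝ E := by
  rw [tr_comp hφ hψ hφ h1 h2 h1, tr_self h1]

theorem cotLift_cotLift (hφ : φ ∈ IsManifold.maximalAtlas 𝓘(ℝ, E) ∞ M)
    (hψ : ψ ∈ IsManifold.maximalAtlas 𝓘(ℝ, E) ∞ M) (hχ : χ ∈ IsManifold.maximalAtlas 𝓘(ℝ, E) ∞ M)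
    {z : E × (E →L[ℝ] ℝ)} (h1 : z.1 ∈ φ.target) (h2 : φ.symm z.1 ∈ ψ.source)
    (h3 : φ.symm z.1 ∈ χ.source) :
    cotLift ψ χ (cotLift φ ψ z) = cotLift φ χ z := by
  simp only [cotLift, ψ.left_inv h2, ContinuousLinearMap.comp_assoc]
  rw [tr_comp hχ hψ hφ h3 h2 (φ.map_target h1)]

theorem cotLift_self {z : E × (E →L[ℝ] ℝ)} (h1 : z.1 ∈ φ.target) : cotLift φ φ z = z := by
  simp [cotLift, tr_self (φ.map_target h1), φ.right_inv h1]

theorem phaseCoord_eq (q₀ : M) (m : M × (E →L[ℝ] ℝ)) :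
    phaseCoord q₀ m = cotLift (chartAt E m.1) (chartAt E q₀) (chartAt E m.1 m.1, m.2) := by
  simp [phaseCoord, cotLift, cotCoord, chartSymmDeriv_eq_tr]

theorem cotLift_phaseCoord {q₀ : M} {m : M × (E →L[ℝ] ℝ)}
    (hψ : ψ ∈ IsManifold.maximalAtlas 𝓘(ℝ, E) ∞ M)
    (h0 : m.1 ∈ (chartAt E q₀).source) (h1 : m.1 ∈ ψ.source) :
    cotLift (chartAt E q₀) ψ (phaseCoord q₀ m)
      = cotLift (chartAt E m.1) ψ (chartAt E m.1 m.1, m.2) := by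
  rw [phaseCoord_eq]
  exact cotLift_cotLift (chart_mem _) (chart_mem _) hψ (by simp) (by simpa) (by simpa)

theorem cotLift_phaseCoord_chart {q₀ q₁ : M} {m : M × (E →L[ℝ] ℝ)}
    (h0 : m.1 ∈ (chartAt E q₀).source) (h1 : m.1 ∈ (chartAt E q₁).source) :
    cotLift (chartAt E q₀) (chartAt E q₁) (phaseCoord q₀ m) = phaseCoord q₁ m := by
  rw [cotLift_phaseCoord (chart_mem _) h0 h1, phaseCoord_eq]

theorem phasePt_fst_mem {q₀ : M} {z : E × (E →L[ℝ] ℝ)} (h : z.1 ∈ (chartAt E q₀).target) :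
    (phasePt q₀ z).1 ∈ (chartAt E q₀).source := (chartAt E q₀).map_target h

theorem phaseCoord_phasePt {q₀ : M} {z : E × (E →L[ℝ] ℝ)} (h : z.1 ∈ (chartAt E q₀).target) :
    phaseCoord q₀ (phasePt q₀ z) = z := by
  simp only [phaseCoord, phasePt, cotCoord, chartSymmDeriv_eq_tr, chartDeriv_eq_tr,
    ContinuousLinearMap.comp_assoc]
  rw [tr_comp_tr (chart_mem _) (chart_mem _) ((chartAt E q₀).map_target h) (by simp)]
  simp [(chartAt E q₀).right_inv h]

theorem phasePt_phaseCoord {q₀ : M} {m : M × (E →L[ℝ] ℝ)} (h : m.1 ∈ (chartAt E q₀).source) :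
    phasePt q₀ (phaseCoord q₀ m) = m := by
  simp only [phaseCoord, phasePt, cotCoord, chartSymmDeriv_eq_tr, chartDeriv_eq_tr,
    ContinuousLinearMap.comp_assoc, (chartAt E q₀).left_inv h]
  rw [tr_comp_tr (chart_mem _) (chart_mem _) (by simp) h]
  simp

theorem phaseCoord_injOn {q₀ : M} {m m' : M × (E →L[ℝ] ℝ)} (h : m.1 ∈ (chartAt E q₀).source)
    (h' : m'.1 ∈ (chartAt E q₀).source) (he : phaseCoord q₀ m = phaseCoord q₀ m') : m = m' := by
  rw [← phasePt_phaseCoord h, he, phasePt_phaseCoord h']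

theorem phaseCoord_self (m : M × (E →L[ℝ] ℝ)) :
    phaseCoord m.1 m = (chartAt E m.1 m.1, m.2) := by
  rw [phaseCoord_eq, cotLift_self (by simp)]

theorem contDiffAt_tr (hφ : φ ∈ IsManifold.maximalAtlas 𝓘(ℝ, E) ∞ M)
    (hψ : ψ ∈ IsManifold.maximalAtlas 𝓘(ℝ, E) ∞ M) {x : E} (hx : x ∈ φ.target)
    (hxψ : φ.symm x ∈ ψ.source) : ContDiffAt ℝ ∞ (fun x => tr ψ φ (φ.symm x)) x := by
  have h1 : ContDiffAt ℝ ∞ (fderiv ℝ (φ ∘ ψ.symm)) ((ψ ∘ φ.symm) x) :=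
    (contDiffAt_trans hψ hφ (ψ.map_source hxψ)
      (by simpa [ψ.left_inv hxψ] using φ.map_target hx)).fderiv_right (by simp)
  exact ContDiffAt.comp x h1 (contDiffAt_trans hφ hψ hx hxψ)

theorem contDiffAt_cotLift (hφ : φ ∈ IsManifold.maximalAtlas 𝓘(ℝ, E) ∞ M)
    (hψ : ψ ∈ IsManifold.maximalAtlas 𝓘(ℝ, E) ∞ M) {z : E × (E →L[ℝ] ℝ)} (hz : z.1 ∈ φ.target)
    (hzψ : φ.symm z.1 ∈ ψ.source) : ContDiffAt ℝ ∞ (cotLift φ ψ) z := by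
  have h1 : ContDiffAt ℝ ∞ (fun z : E × (E →L[ℝ] ℝ) => tr ψ φ (φ.symm z.1)) z :=
    ContDiffAt.comp (g := fun x => tr ψ φ (φ.symm x)) z (contDiffAt_tr hφ hψ hz hzψ) contDiffAt_fst
  exact (ContDiffAt.comp z (contDiffAt_trans hφ hψ hz hzψ) contDiffAt_fst).prodMk
    (contDiffAt_snd.clm_comp h1)

theorem fderiv_cotLift_fst (hφ : φ ∈ IsManifold.maximalAtlas 𝓘(ℝ, E) ∞ M)
    (hψ : ψ ∈ IsManifold.maximalAtlas 𝓘(ℝ, E) ∞ M) {z : E × (E →L[ℝ] ℝ)} (hz : z.1 ∈ φ.target)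
    (hzψ : φ.symm z.1 ∈ ψ.source) (v : E × (E →L[ℝ] ℝ)) :
    (fderiv ℝ (cotLift φ ψ) z v).1 = tr φ ψ (φ.symm z.1) v.1 := by
  have h1 := ((contDiffAt_cotLift hφ hψ hz hzψ).differentiableAt (by simp)).hasFDerivAt.fst
  have h2 : HasFDerivAt (fun z : E × (E →L[ℝ] ℝ) => (cotLift φ ψ z).1)
      (fderiv ℝ (ψ ∘ φ.symm) z.1 ∘L .fst ℝ _ _) z :=
    HasFDerivAt.comp z ((contDiffAt_trans hφ hψ hz hzψ).differentiableAt (by simp)).hasFDerivAt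
      hasFDerivAt_fst
  have h3 := DFunLike.congr_fun (h1.unique h2) v
  simpa [tr, φ.right_inv hz] using h3

/-- Invariance of the Liouville form `y dx` under cotangent lifts. -/
theorem cotLift_liouville (hφ : φ ∈ IsManifold.maximalAtlas 𝓘(ℝ, E) ∞ M)
    (hψ : ψ ∈ IsManifold.maximalAtlas 𝓘(ℝ, E) ∞ M) {z : E × (E →L[ℝ] ℝ)} (hz : z.1 ∈ φ.target)
    (hzψ : φ.symm z.1 ∈ ψ.source) (v : E × (E →L[ℝ] ℝ)) :
    (cotLift φ ψ z).2 (fderiv ℝ (cotLift φ ψ) z v).1 = z.2 v.1 := by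
  rw [fderiv_cotLift_fst hφ hψ hz hzψ]
  simp only [cotLift, ContinuousLinearMap.comp_apply]
  exact congrArg z.2 (DFunLike.congr_fun (tr_comp_tr hφ hψ (φ.map_target hz) hzψ) v.1)

/-- Cotangent lifts are symplectic. -/
theorem cotLift_symplectic (hφ : φ ∈ IsManifold.maximalAtlas 𝓘(ℝ, E) ∞ M)
    (hψ : ψ ∈ IsManifold.maximalAtlas 𝓘(ℝ, E) ∞ M) {z : E × (E →L[ℝ] ℝ)} (hz : z.1 ∈ φ.target)
    (hzψ : φ.symm z.1 ∈ ψ.source) (v w : E × (E →L[ℝ] ℝ)) :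
    (fderiv ℝ (cotLift φ ψ) z v).2 (fderiv ℝ (cotLift φ ψ) z w).1
      - (fderiv ℝ (cotLift φ ψ) z w).2 (fderiv ℝ (cotLift φ ψ) z v).1
      = v.2 w.1 - w.2 v.1 := by
  have hzt : φ.symm z.1 ∈ φ.source := φ.map_target hz
  have hσ : ContDiffAt ℝ ∞ (φ ∘ ψ.symm) (ψ (φ.symm z.1)) :=
    contDiffAt_trans hψ hφ (ψ.map_source hzψ) (by simpa [ψ.left_inv hzψ])
  have hsnd : ∀ v : E × (E →L[ℝ] ℝ), (fderiv ℝ (cotLift φ ψ) z v).2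
      = v.2 ∘L tr ψ φ (φ.symm z.1)
        + z.2 ∘L (fderiv ℝ (fderiv ℝ (φ ∘ ψ.symm)) (ψ (φ.symm z.1))
          (tr φ ψ (φ.symm z.1) v.1)) := by
    intro v
    have h1 := ((contDiffAt_cotLift hφ hψ hz hzψ).differentiableAt (by simp)).hasFDerivAt.snd
    have e0 : HasFDerivAt (ψ ∘ φ.symm) (tr φ ψ (φ.symm z.1)) z.1 := by
      have := ((contDiffAt_trans hφ hψ hz hzψ).differentiableAt (by simp)).hasFDerivAt
      rwa [tr, φ.right_inv hz]
    have e1 : HasFDerivAt (fun z : E × (E →L[ℝ] ℝ) => (ψ ∘ φ.symm) z.1)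
        (tr φ ψ (φ.symm z.1) ∘L .fst ℝ _ _) z := HasFDerivAt.comp z e0 hasFDerivAt_fst
    have e2 : HasFDerivAt (fderiv ℝ (φ ∘ ψ.symm))
        (fderiv ℝ (fderiv ℝ (φ ∘ ψ.symm)) (ψ (φ.symm z.1))) (ψ (φ.symm z.1)) :=
      ((hσ.fderiv_right (m := 1) (by rw [one_add_one_eq_two]; exact two_le_infty)).differentiableAt (by simp)).hasFDerivAt
    have e3 : HasFDerivAt (fun z : E × (E →L[ℝ] ℝ) => tr ψ φ (φ.symm z.1))
        (fderiv ℝ (fderiv ℝ (φ ∘ ψ.symm)) (ψ (φ.symm z.1)) ∘L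
          (tr φ ψ (φ.symm z.1) ∘L .fst ℝ _ _)) z := HasFDerivAt.comp z e2 e1
    have e4 := HasFDerivAt.clm_comp (hasFDerivAt_snd (𝕜 := ℝ) (p := z)) e3
    have e5 := DFunLike.congr_fun (h1.unique e4) v
    refine e5.trans ?_
    ext a
    simp [add_comm]
  have hsymm := hσ.isSymmSndFDerivAt (by simpa using two_le_infty)
  rw [hsnd v, hsnd w, fderiv_cotLift_fst hφ hψ hz hzψ, fderiv_cotLift_fst hφ hψ hz hzψ]
  have hid : ∀ u : E, tr ψ φ (φ.symm z.1) (tr φ ψ (φ.symm z.1) u) = u := fun u => by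
    rw [← ContinuousLinearMap.comp_apply, tr_comp_tr hφ hψ hzt hzψ]; rfl
  simp only [add_apply, ContinuousLinearMap.comp_apply, hid]
  rw [hsymm.eq (tr φ ψ (φ.symm z.1) v.1) (tr φ ψ (φ.symm z.1) w.1)]
  ring

/-- The derivative of a cotangent lift is bijective, because it is symplectic. -/
theorem fderiv_cotLift_surjective [FiniteDimensional ℝ E]
    (hφ : φ ∈ IsManifold.maximalAtlas 𝓘(ℝ, E) ∞ M)
    (hψ : ψ ∈ IsManifold.maximalAtlas 𝓘(ℝ, E) ∞ M) {z : E × (E →L[ℝ] ℝ)} (hz : z.1 ∈ φ.target)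
    (hzψ : φ.symm z.1 ∈ ψ.source) : Function.Surjective (fderiv ℝ (cotLift φ ψ) z) := by
  refine (LinearMap.injective_iff_surjective
    (f := (fderiv ℝ (cotLift φ ψ) z).toLinearMap)).1 ?_
  rw [injective_iff_map_eq_zero]
  intro v hv
  have hv' : fderiv ℝ (cotLift φ ψ) z v = 0 := hv
  have key : ∀ w : E × (E →L[ℝ] ℝ), v.2 w.1 - w.2 v.1 = 0 := fun w => by
    rw [← cotLift_symplectic hφ hψ hz hzψ, hv']; simp
  refine Prod.ext (eq_of_forall_dual fun f => ?_) (ContinuousLinearMap.ext fun a => ?_)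
  · simpa using key (0, f)
  · simpa using key (a, 0)

theorem phasePt_cotLift {q₀ q₁ : M} {z : E × (E →L[ℝ] ℝ)} (hz : z.1 ∈ (chartAt E q₀).target)
    (hz1 : (chartAt E q₀).symm z.1 ∈ (chartAt E q₁).source) :
    phasePt q₁ (cotLift (chartAt E q₀) (chartAt E q₁) z) = phasePt q₀ z := by
  refine phaseCoord_injOn (q₀ := q₁) ?_ ?_ ?_
  · exact phasePt_fst_mem ((chartAt E q₁).map_source hz1)
  · exact hz1
  · rw [phaseCoord_phasePt ((chartAt E q₁).map_source hz1),
      ← cotLift_phaseCoord_chart (phasePt_fst_mem hz) hz1, phaseCoord_phasePt hz]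

/-- A function on `T*M` that is `C³` in canonical coordinates. -/
def IsC3 (H : M → (E →L[ℝ] ℝ) → ℝ) : Prop :=
  ∀ q₀, ContDiffOn ℝ 3 (coordHam H q₀) ((chartAt E q₀).target ×ˢ univ)

variable {H : M → (E →L[ℝ] ℝ) → ℝ}

theorem IsC3.contDiffAt (hH : IsC3 H) {q₀ : M} {z : E × (E →L[ℝ] ℝ)}
    (hz : z.1 ∈ (chartAt E q₀).target) : ContDiffAt ℝ 3 (coordHam H q₀) z :=
  (hH q₀).contDiffAt (prod_mem_nhds ((chartAt E q₀).open_target.mem_nhds hz) univ_mem)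

theorem eventually_mem_source {φ ψ : OpenPartialHomeomorph M E} {z : E × (E →L[ℝ] ℝ)}
    (hz : z.1 ∈ φ.target) (hzψ : φ.symm z.1 ∈ ψ.source) :
    ∀ᶠ w : E × (E →L[ℝ] ℝ) in 𝓝 z, w.1 ∈ φ.target ∧ φ.symm w.1 ∈ ψ.source := by
  have h1 : ∀ᶠ x in 𝓝 z.1, x ∈ φ.target ∧ φ.symm x ∈ ψ.source :=
    Filter.Eventually.and (φ.open_target.mem_nhds hz)
      ((φ.symm.continuousAt hz).preimage_mem_nhds (ψ.open_source.mem_nhds hzψ))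
  exact continuousAt_fst.eventually h1

/-- Invariance of Hamilton's equations under changes of charts. -/
theorem hamField_cotLift [FiniteDimensional ℝ E] (hH : IsC3 H) {q₀ q₁ : M} {z : E × (E →L[ℝ] ℝ)}
    (hz : z.1 ∈ (chartAt E q₀).target) (hz1 : (chartAt E q₀).symm z.1 ∈ (chartAt E q₁).source) :
    hamField (coordHam H q₁) (cotLift (chartAt E q₀) (chartAt E q₁) z)
      = fderiv ℝ (cotLift (chartAt E q₀) (chartAt E q₁)) z (hamField (coordHam H q₀) z) := by
  set θ := cotLift (chartAt E q₀) (chartAt E q₁) with hθ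
  have hθd : HasFDerivAt θ (fderiv ℝ θ z) z :=
    ((contDiffAt_cotLift (chart_mem q₀) (chart_mem q₁) hz hz1).differentiableAt
      (by simp)).hasFDerivAt
  have hh1 : HasFDerivAt (coordHam H q₁) (fderiv ℝ (coordHam H q₁) (θ z)) (θ z) :=
    ((hH.contDiffAt ((chartAt E q₁).map_source hz1)).differentiableAt (by simp)).hasFDerivAt
  have heq : coordHam H q₁ ∘ θ =ᶠ[𝓝 z] coordHam H q₀ := by
    filter_upwards [eventually_mem_source hz hz1] with w hw
    simp only [Function.comp, coordHam_eq, hθ, phasePt_cotLift hw.1 hw.2]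
  have hd : fderiv ℝ (coordHam H q₀) z = fderiv ℝ (coordHam H q₁) (θ z) ∘L fderiv ℝ θ z := by
    rw [← heq.fderiv_eq]
    exact (hh1.comp z hθd).fderiv
  refine eq_hamField (xd := (fderiv ℝ θ z (hamField (coordHam H q₀) z)).1)
    (yd := (fderiv ℝ θ z (hamField (coordHam H q₀) z)).2) fun a b => ?_
  obtain ⟨c, hc⟩ := fderiv_cotLift_surjective (chart_mem q₀) (chart_mem q₁) hz hz1 (a, b)
  have h1 := cotLift_symplectic (chart_mem q₀) (chart_mem q₁) hz hz1 c
    (hamField (coordHam H q₀) z)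
  rw [hc, ← fderiv_eq_hamField, hd, ContinuousLinearMap.comp_apply, hc] at h1
  exact h1.symm

end Coordinates

end ThinBilliard

namespace ThinBilliard

/-! ### Trajectories -/

set_option synthInstance.maxHeartbeats 400000
set_option maxHeartbeats 1000000
set_option linter.unusedSectionVars false

section Trajectories

variable {E : Type*} [NormedAddCommGroup E] [NormedSpace ℝ E] [FiniteDimensional ℝ E]
  {M : Type*} [TopologicalSpace M] [ChartedSpace E M] [IsManifold 𝓘(ℝ, E) ∞ M]
  {H : M → (E →L[ℝ] ℝ) → ℝ}

/-- A curve in `T*M` that is a trajectory on `[a, b]`. -/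
def Traj (H : M → (E →L[ℝ] ℝ) → ℝ) (c : ℝ → M × (E →L[ℝ] ℝ)) (a b : ℝ) : Prop :=
  IsTrajectory H (fun s => (c s).1) (fun s => (c s).2) a b

/-- The Hamiltonian vector field in the canonical coordinates of the chart at `q₀`. -/
noncomputable def field (H : M → (E →L[ℝ] ℝ) → ℝ) (q₀ : M) : E × (E →L[ℝ] ℝ) → E × (E →L[ℝ] ℝ) :=
  hamField (coordHam H q₀)

theorem Traj.continuousOn {c : ℝ → M × (E →L[ℝ] ℝ)} {a b : ℝ} (h : Traj H c a b) :
    ContinuousOn (fun s => (c s).1) (Icc a b) := h.1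

theorem Traj.hasDerivWithinAt (hH : IsC3 H) {c : ℝ → M × (E →L[ℝ] ℝ)} {a b t : ℝ}
    (h : Traj H c a b) (ht : t ∈ Icc a b) {q₀ : M} (hq : (c t).1 ∈ (chartAt E q₀).source) :
    HasDerivWithinAt (fun s => phaseCoord q₀ (c s)) (field H q₀ (phaseCoord q₀ (c t)))
      (Icc a b) t := by
  obtain ⟨xd, yd, hx, hy, hH'⟩ := h.2 t ht
  set q₁ := (c t).1 with hq₁
  have h1 : HasDerivWithinAt (fun s => phaseCoord q₁ (c s)) (xd, yd) (Icc a b) t :=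
    hx.prodMk hy
  have hz : (phaseCoord q₁ (c t)).1 ∈ (chartAt E q₁).target :=
    (chartAt E q₁).map_source (mem_chart_source E q₁)
  have hz1 : (chartAt E q₁).symm (phaseCoord q₁ (c t)).1 ∈ (chartAt E q₀).source := by
    simpa [phaseCoord, ← hq₁] using hq
  have hX : field H q₁ (phaseCoord q₁ (c t)) = (xd, yd) := eq_hamField hH'
  have h2 := ((contDiffAt_cotLift (chart_mem q₁) (chart_mem q₀) hz hz1).differentiableAt
    (by simp)).hasFDerivAt.comp_hasDerivWithinAt t h1
  have hev : ∀ᶠ s in 𝓝[Icc a b] t,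
      (c s).1 ∈ (chartAt E q₁).source ∧ (c s).1 ∈ (chartAt E q₀).source :=
    (h.continuousOn t ht).eventually (Filter.Eventually.and
      ((chartAt E q₁).open_source.mem_nhds (mem_chart_source E q₁))
      ((chartAt E q₀).open_source.mem_nhds hq))
  have heq : ∀ s, (c s).1 ∈ (chartAt E q₁).source ∧ (c s).1 ∈ (chartAt E q₀).source →
      cotLift (chartAt E q₁) (chartAt E q₀) (phaseCoord q₁ (c s)) = phaseCoord q₀ (c s) :=
    fun s hs => cotLift_phaseCoord_chart hs.1 hs.2
  have ht' := heq t ⟨mem_chart_source E q₁, hq⟩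
  refine (h2.congr_of_eventuallyEq (hev.mono fun s hs => (heq s hs).symm) ht'.symm).congr_deriv ?_
  rw [← ht', ← hX]
  exact (hamField_cotLift hH hz hz1).symm

theorem traj_of_hasDerivWithinAt (hH : IsC3 H) {c : ℝ → M × (E →L[ℝ] ℝ)} {a b : ℝ}
    (hc : ContinuousOn (fun s => (c s).1) (Icc a b))
    (h : ∀ t ∈ Icc a b, ∃ q₀ : M, (c t).1 ∈ (chartAt E q₀).source ∧
      HasDerivWithinAt (fun s => phaseCoord q₀ (c s)) (field H q₀ (phaseCoord q₀ (c t)))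
        (Icc a b) t) : Traj H c a b := by
  refine ⟨hc, fun t ht => ?_⟩
  obtain ⟨q₀, hq, h1⟩ := h t ht
  set q₁ := (c t).1 with hq₁
  have hz : (phaseCoord q₀ (c t)).1 ∈ (chartAt E q₀).target := (chartAt E q₀).map_source hq
  have hz1 : (chartAt E q₀).symm (phaseCoord q₀ (c t)).1 ∈ (chartAt E q₁).source := by
    simp only [phaseCoord, ← hq₁, (chartAt E q₀).left_inv hq]
    exact mem_chart_source E q₁
  have h2 := ((contDiffAt_cotLift (chart_mem q₀) (chart_mem q₁) hz hz1).differentiableAt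
    (by simp)).hasFDerivAt.comp_hasDerivWithinAt t h1
  have hev : ∀ᶠ s in 𝓝[Icc a b] t,
      (c s).1 ∈ (chartAt E q₀).source ∧ (c s).1 ∈ (chartAt E q₁).source :=
    (hc t ht).eventually (Filter.Eventually.and
      ((chartAt E q₀).open_source.mem_nhds hq)
      ((chartAt E q₁).open_source.mem_nhds (mem_chart_source E q₁)))
  have heq : ∀ s, (c s).1 ∈ (chartAt E q₀).source ∧ (c s).1 ∈ (chartAt E q₁).source →
      cotLift (chartAt E q₀) (chartAt E q₁) (phaseCoord q₀ (c s)) = phaseCoord q₁ (c s) :=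
    fun s hs => cotLift_phaseCoord_chart hs.1 hs.2
  have ht' := heq t ⟨hq, mem_chart_source E q₁⟩
  have h3 : HasDerivWithinAt (fun s => phaseCoord q₁ (c s)) (field H q₁ (phaseCoord q₁ (c t)))
      (Icc a b) t := by
    refine (h2.congr_of_eventuallyEq (hev.mono fun s hs => (heq s hs).symm)
      ht'.symm).congr_deriv ?_
    rw [← ht']
    exact (hamField_cotLift hH hz hz1).symm
  refine ⟨_, _, HasFDerivAt.comp_hasDerivWithinAt (f := fun s => phaseCoord q₁ (c s)) t
    hasFDerivAt_fst h3, HasFDerivAt.comp_hasDerivWithinAt (f := fun s => phaseCoord q₁ (c s)) t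
    hasFDerivAt_snd h3, fun a b => ?_⟩
  exact fderiv_eq_hamField _ _ _

theorem Traj.mono {c : ℝ → M × (E →L[ℝ] ℝ)} {a b a' b' : ℝ} (h : Traj H c a b) (ha : a ≤ a')
    (hb : b' ≤ b) : Traj H c a' b' := by
  have hs : Icc a' b' ⊆ Icc a b := Icc_subset_Icc ha hb
  refine ⟨h.1.mono hs, fun t ht => ?_⟩
  obtain ⟨xd, yd, hx, hy, h'⟩ := h.2 t (hs ht)
  exact ⟨xd, yd, hx.mono hs, hy.mono hs, h'⟩

theorem Traj.congr {c c' : ℝ → M × (E →L[ℝ] ℝ)} {a b : ℝ} (h : Traj H c a b)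
    (hc : EqOn c' c (Icc a b)) : Traj H c' a b := by
  refine ⟨h.1.congr fun s hs => by simp only [hc hs], fun t ht => ?_⟩
  obtain ⟨xd, yd, hx, hy, h'⟩ := h.2 t ht
  simp only [hc ht]
  exact ⟨xd, yd, hx.congr (fun s hs => by simp only [hc hs]) (by simp only [hc ht]),
    hy.congr (fun s hs => by simp only [hc hs]) (by simp only [hc ht]), h'⟩

theorem Traj.comp_add {c : ℝ → M × (E →L[ℝ] ℝ)} {a b : ℝ} (h : Traj H c a b) (r : ℝ) :
    Traj H (fun s => c (s + r)) (a - r) (b - r) := by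
  have hm : MapsTo (fun s : ℝ => s + r) (Icc (a - r) (b - r)) (Icc a b) := fun s hs =>
    ⟨by linarith [hs.1], by linarith [hs.2]⟩
  refine ⟨h.1.comp (by fun_prop) hm, fun t ht => ?_⟩
  obtain ⟨xd, yd, hx, hy, h'⟩ := h.2 (t + r) (hm ht)
  have hd : HasDerivWithinAt (fun s : ℝ => s + r) 1 (Icc (a - r) (b - r)) t :=
    (hasDerivAt_id t).add_const r |>.hasDerivWithinAt
  refine ⟨xd, yd, ?_, ?_, h'⟩
  · exact (hx.scomp t hd hm).congr_deriv (one_smul _ _)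
  · exact (hy.scomp t hd hm).congr_deriv (one_smul _ _)

/-- A trajectory can be continued by another one. -/
theorem Traj.glue (hH : IsC3 H) {c₁ c₂ : ℝ → M × (E →L[ℝ] ℝ)} {a b d : ℝ} (hab : a ≤ b)
    (hbd : b ≤ d) (h₁ : Traj H c₁ a b) (h₂ : Traj H c₂ b d) (he : c₁ b = c₂ b) :
    ∃ c, Traj H c a d ∧ EqOn c c₁ (Icc a b) ∧ EqOn c c₂ (Icc b d) := by
  let c : ℝ → M × (E →L[ℝ] ℝ) := fun s => if s ≤ b then c₁ s else c₂ s
  have hc₁ : EqOn c c₁ (Icc a b) := fun s hs => if_pos hs.2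
  have hc₂ : EqOn c c₂ (Icc b d) := fun s hs => by
    rcases hs.1.eq_or_lt with rfl | h
    · simp [c, he]
    · simp [c, not_le.2 h]
  refine ⟨c, ?_, hc₁, hc₂⟩
  have h1 := h₁.congr hc₁
  have h2 := h₂.congr hc₂
  have hU : Icc a b ∪ Icc b d = Icc a d := Icc_union_Icc_eq_Icc hab hbd
  have hlt : ∀ t ∈ Icc a d, t < b → Icc a b ∈ 𝓝[Icc a d] t := fun t ht htb => by
    rw [mem_nhdsWithin]
    exact ⟨Iio b, isOpen_Iio, htb, fun s hs => ⟨hs.2.1, le_of_lt hs.1⟩⟩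
  have hgt : ∀ t ∈ Icc a d, b < t → Icc b d ∈ 𝓝[Icc a d] t := fun t ht htb => by
    rw [mem_nhdsWithin]
    exact ⟨Ioi b, isOpen_Ioi, htb, fun s hs => ⟨le_of_lt hs.1, hs.2.2⟩⟩
  refine traj_of_hasDerivWithinAt hH ?_ fun t ht => ⟨(c t).1, mem_chart_source E _, ?_⟩
  · rw [← hU]
    exact h1.continuousOn.union_of_isClosed h2.continuousOn isClosed_Icc isClosed_Icc
  · rcases lt_trichotomy t b with htb | rfl | htb
    · exact (h1.hasDerivWithinAt hH ⟨ht.1, htb.le⟩ (mem_chart_source E _)).mono_of_mem_nhdsWithin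
        (hlt t ht htb)
    · rw [← hU]
      exact (h1.hasDerivWithinAt hH ⟨ht.1, le_rfl⟩ (mem_chart_source E _)).union
        (h2.hasDerivWithinAt hH ⟨le_rfl, ht.2⟩ (mem_chart_source E _))
    · exact (h2.hasDerivWithinAt hH ⟨htb.le, ht.2⟩ (mem_chart_source E _)).mono_of_mem_nhdsWithin
        (hgt t ht htb)

theorem _root_.ContinuousWithinAt.eventually_ne_of_ne {X Y : Type*} [TopologicalSpace X]
    [TopologicalSpace Y] [T2Space Y] {f g : X → Y} {s : Set X} {x : X}
    (hf : ContinuousWithinAt f s x) (hg : ContinuousWithinAt g s x) (h : f x ≠ g x) :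
    ∀ᶠ y in 𝓝[s] x, f y ≠ g y :=
  (hf.prodMk hg).eventually ((isClosed_diagonal (X := Y)).isOpen_compl.mem_nhds h)

theorem iff_of_locally_iff_Icc {Q : ℝ → Prop} {a b : ℝ}
    (h : ∀ x ∈ Icc a b, ∀ᶠ y in 𝓝[Icc a b] x, (Q x ↔ Q y)) {x y : ℝ} (hx : x ∈ Icc a b)
    (hy : y ∈ Icc a b) : Q x ↔ Q y :=
  isPreconnected_Icc.induction₂ (fun x y => (Q x ↔ Q y)) h
    (fun _ _ _ _ _ _ h1 h2 => h1.trans h2) (fun _ _ _ _ h1 => h1.symm) hx hy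

theorem Traj.continuousWithinAt_phaseCoord (hH : IsC3 H) {c : ℝ → M × (E →L[ℝ] ℝ)} {a b t : ℝ}
    (h : Traj H c a b) (ht : t ∈ Icc a b) {q₀ : M} (hq : (c t).1 ∈ (chartAt E q₀).source) :
    ContinuousWithinAt (fun s => phaseCoord q₀ (c s)) (Icc a b) t :=
  (h.hasDerivWithinAt hH ht hq).continuousWithinAt

theorem contDiffAt_field (hH : IsC3 H) {q₀ : M} {z : E × (E →L[ℝ] ℝ)}
    (hz : z.1 ∈ (chartAt E q₀).target) : ContDiffAt ℝ 2 (field H q₀) z :=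
  contDiffAt_hamField (k := 2) (by exact_mod_cast hH.contDiffAt hz)

/-- Two trajectories that meet at one time coincide. -/
theorem Traj.eqOn [T2Space M] (hH : IsC3 H) {c₁ c₂ : ℝ → M × (E →L[ℝ] ℝ)} {a b s : ℝ}
    (h₁ : Traj H c₁ a b) (h₂ : Traj H c₂ a b) (hs : s ∈ Icc a b) (he : c₁ s = c₂ s) :
    EqOn c₁ c₂ (Icc a b) := by
  intro t ht
  refine (iff_of_locally_iff_Icc (Q := fun t => c₁ t = c₂ t) (fun t ht => ?_) hs ht).1 he
  by_cases heq : c₁ t = c₂ t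
  · simp only [heq, true_iff]
    set q₀ := (c₁ t).1 with hq₀
    have hq1 : (c₁ t).1 ∈ (chartAt E q₀).source := mem_chart_source E _
    have hq2 : (c₂ t).1 ∈ (chartAt E q₀).source := heq ▸ hq1
    obtain ⟨K, U, hU, hK⟩ := ((contDiffAt_field hH (q₀ := q₀) (z := phaseCoord q₀ (c₁ t))
      ((chartAt E q₀).map_source hq1)).of_le (by norm_num)).exists_lipschitzOnWith
    have hev : ∀ c : ℝ → M × (E →L[ℝ] ℝ), Traj H c a b → c t = c₁ t →
        ∀ᶠ s in 𝓝[Icc a b] t, (c s).1 ∈ (chartAt E q₀).source ∧ phaseCoord q₀ (c s) ∈ U := by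
      intro c hc hct
      have hcq : (c t).1 ∈ (chartAt E q₀).source := by rw [hct]; exact hq1
      exact ((hc.continuousOn t ht).eventually ((chartAt E q₀).open_source.mem_nhds hcq)).and
        ((hc.continuousWithinAt_phaseCoord hH ht hcq).eventually (by simp only [hct]; exact hU))
    obtain ⟨η, hη, hη'⟩ := Metric.mem_nhdsWithin_iff.1 ((hev c₁ h₁ rfl).and (hev c₂ h₂ heq.symm))
    have hin : ∀ s ∈ Icc a b, |s - t| < η → ((c₁ s).1 ∈ (chartAt E q₀).source ∧
        phaseCoord q₀ (c₁ s) ∈ U) ∧ (c₂ s).1 ∈ (chartAt E q₀).source ∧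
        phaseCoord q₀ (c₂ s) ∈ U := fun s hs hst => hη' ⟨by simpa [Real.dist_eq] using hst, hs⟩
    rw [eventually_iff, Metric.mem_nhdsWithin_iff]
    refine ⟨η, hη, fun s ⟨hst, hs⟩ => ?_⟩
    rw [Metric.mem_ball, Real.dist_eq] at hst
    have hsub : ∀ r ∈ uIcc t s, r ∈ Icc a b ∧ |r - t| < η := by
      intro r hr
      refine ⟨uIcc_subset_Icc ht hs hr, lt_of_le_of_lt ?_ hst⟩
      rw [abs_sub_comm r t, abs_sub_comm s t]
      rcases le_total t s with h | h
      · rw [uIcc_of_le h] at hr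
        rw [abs_sub_comm, abs_sub_comm t, abs_of_nonneg, abs_of_nonneg] <;> linarith [hr.1, hr.2]
      · rw [uIcc_of_ge h] at hr
        rw [abs_of_nonneg, abs_of_nonneg] <;> linarith [hr.1, hr.2]
    have hzt : phaseCoord q₀ (c₁ t) = phaseCoord q₀ (c₂ t) := by rw [heq]
    have hcont : ∀ c : ℝ → M × (E →L[ℝ] ℝ), Traj H c a b →
        (∀ r ∈ uIcc t s, (c r).1 ∈ (chartAt E q₀).source) →
        ContinuousOn (fun s => phaseCoord q₀ (c s)) (uIcc t s) := fun c hc hsrc r hr =>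
      (hc.continuousWithinAt_phaseCoord hH (hsub r hr).1 (hsrc r hr)).mono
        fun r hr => (hsub r hr).1
    have hfin : phaseCoord q₀ (c₁ s) = phaseCoord q₀ (c₂ s) := by
      have hc1 := hcont c₁ h₁ fun r hr => (hin r (hsub r hr).1 (hsub r hr).2).1.1
      have hc2 := hcont c₂ h₂ fun r hr => (hin r (hsub r hr).1 (hsub r hr).2).2.1
      rcases le_total t s with h | h
      · rw [uIcc_of_le h] at hsub hc1 hc2
        have hI : ∀ r ∈ Ico t s, Icc a b ∈ 𝓝[Ici r] r := fun r hr =>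
          mem_of_superset (Icc_mem_nhdsGE hr.2)
            (Icc_subset_Icc (hsub r (Ico_subset_Icc_self hr)).1.1 hs.2)
        refine ODE_solution_unique_of_mem_Icc_right (v := fun _ => field H q₀) (s := fun _ => U)
          (K := K) (fun _ _ => hK) hc1 (fun r hr => ?_) (fun r hr => ?_) hc2 (fun r hr => ?_)
          (fun r hr => ?_) hzt (right_mem_Icc.2 h)
        all_goals
          have h3 := hsub r (Ico_subset_Icc_self hr)
          have h4 := hin r h3.1 h3.2
        · exact (h₁.hasDerivWithinAt hH h3.1 h4.1.1).mono_of_mem_nhdsWithin (hI r hr)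
        · exact h4.1.2
        · exact (h₂.hasDerivWithinAt hH h3.1 h4.2.1).mono_of_mem_nhdsWithin (hI r hr)
        · exact h4.2.2
      · rw [uIcc_of_ge h] at hsub hc1 hc2
        have hI : ∀ r ∈ Ioc s t, Icc a b ∈ 𝓝[Iic r] r := fun r hr =>
          mem_of_superset (Icc_mem_nhdsLE hr.1)
            (Icc_subset_Icc hs.1 (hsub r (Ioc_subset_Icc_self hr)).1.2)
        refine ODE_solution_unique_of_mem_Icc_left (v := fun _ => field H q₀) (s := fun _ => U)
          (K := K) (fun _ _ => hK) hc1 (fun r hr => ?_) (fun r hr => ?_) hc2 (fun r hr => ?_)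
          (fun r hr => ?_) hzt (left_mem_Icc.2 h)
        all_goals
          have h3 := hsub r (Ioc_subset_Icc_self hr)
          have h4 := hin r h3.1 h3.2
        · exact (h₁.hasDerivWithinAt hH h3.1 h4.1.1).mono_of_mem_nhdsWithin (hI r hr)
        · exact h4.1.2
        · exact (h₂.hasDerivWithinAt hH h3.1 h4.2.1).mono_of_mem_nhdsWithin (hI r hr)
        · exact h4.2.2
    have h3 := hin s hs hst
    exact phaseCoord_injOn h3.1.1 h3.2.1 hfin
  · simp only [heq, false_iff]
    by_cases hq : (c₁ t).1 = (c₂ t).1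
    · set q₀ := (c₁ t).1 with hq₀
      have hq1 : (c₁ t).1 ∈ (chartAt E q₀).source := mem_chart_source E _
      have hq2 : (c₂ t).1 ∈ (chartAt E q₀).source := hq ▸ hq1
      have hne : phaseCoord q₀ (c₁ t) ≠ phaseCoord q₀ (c₂ t) := fun h =>
        heq (phaseCoord_injOn hq1 hq2 h)
      have := (h₁.continuousWithinAt_phaseCoord hH ht hq1).eventually_ne_of_ne
        (h₂.continuousWithinAt_phaseCoord hH ht hq2) hne
      exact this.mono fun s hs h => hs (by rw [h])
    · have := (h₁.continuousOn t ht).eventually_ne_of_ne (h₂.continuousOn t ht) hq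
      exact this.mono fun s hs h => hs (by rw [h])

/-- Two trajectories that meet at one time have a common extension. -/
theorem Traj.extend [T2Space M] (hH : IsC3 H) {c₁ c₂ : ℝ → M × (E →L[ℝ] ℝ)} {a₁ b₁ a₂ b₂ s : ℝ}
    (h₁ : Traj H c₁ a₁ b₁) (h₂ : Traj H c₂ a₂ b₂) (hs₁ : s ∈ Icc a₁ b₁) (hs₂ : s ∈ Icc a₂ b₂)
    (he : c₁ s = c₂ s) :
    ∃ c, Traj H c (min a₁ a₂) (max b₁ b₂) ∧ EqOn c c₁ (Icc a₁ b₁) ∧ EqOn c c₂ (Icc a₂ b₂) := by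
  have hl : ∃ c, Traj H c (min a₁ a₂) s ∧ c s = c₁ s := by
    rcases le_total a₁ a₂ with h | h
    · exact ⟨c₁, by rw [min_eq_left h]; exact h₁.mono le_rfl hs₁.2, rfl⟩
    · exact ⟨c₂, by rw [min_eq_right h]; exact h₂.mono le_rfl hs₂.2, he.symm⟩
  have hr : ∃ c, Traj H c s (max b₁ b₂) ∧ c s = c₁ s := by
    rcases le_total b₁ b₂ with h | h
    · exact ⟨c₂, by rw [max_eq_right h]; exact h₂.mono hs₂.1 le_rfl, he.symm⟩
    · exact ⟨c₁, by rw [max_eq_left h]; exact h₁.mono hs₁.1 le_rfl, rfl⟩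
  obtain ⟨cl, hcl, hcls⟩ := hl
  obtain ⟨cr, hcr, hcrs⟩ := hr
  have hsl : min a₁ a₂ ≤ s := (min_le_left _ _).trans hs₁.1
  have hsr : s ≤ max b₁ b₂ := hs₁.2.trans (le_max_left _ _)
  obtain ⟨c, hc, hc1, -⟩ := hcl.glue hH hsl hsr hcr (hcls.trans hcrs.symm)
  have hcs : c s = c₁ s := (hc1 ⟨hsl, le_rfl⟩).trans hcls
  refine ⟨c, hc, ?_, ?_⟩
  · exact (hc.mono (min_le_left _ _) (le_max_left _ _)).eqOn hH h₁ hs₁ hcs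
  · exact (hc.mono (min_le_right _ _) (le_max_right _ _)).eqOn hH h₂ hs₂ (hcs.trans he)

/-- Conservation of energy. -/
theorem Traj.energy (hH : IsC3 H) {c : ℝ → M × (E →L[ℝ] ℝ)} {a b s t : ℝ} (h : Traj H c a b)
    (hs : s ∈ Icc a b) (ht : t ∈ Icc a b) : H (c s).1 (c s).2 = H (c t).1 (c t).2 := by
  have hd : ∀ t ∈ Icc a b, HasDerivWithinAt (fun s => H (c s).1 (c s).2) 0 (Icc a b) t := by
    intro t ht
    have h1 := h.hasDerivWithinAt hH ht (mem_chart_source E (c t).1)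
    have h2 : HasFDerivAt (coordHam H (c t).1) _ (phaseCoord (c t).1 (c t)) :=
      ((hH.contDiffAt ((chartAt E (c t).1).map_source
        (mem_chart_source E (c t).1))).differentiableAt (by simp)).hasFDerivAt
    have h3 := h2.comp_hasDerivWithinAt t h1
    rw [fderiv_eq_hamField, field, sub_self] at h3
    have hev : ∀ᶠ s in 𝓝[Icc a b] t, H (c s).1 (c s).2
        = coordHam H (c t).1 (phaseCoord (c t).1 (c s)) := by
      filter_upwards [(h.continuousOn t ht).eventually
        ((chartAt E (c t).1).open_source.mem_nhds (mem_chart_source E _))] with s hs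
      rw [coordHam_eq, phasePt_phaseCoord hs]
    exact h3.congr_of_eventuallyEq hev (by
      simp only [Function.comp, coordHam_eq]; rw [phasePt_phaseCoord (mem_chart_source E _)])
  have h0 := (convex_Icc a b).norm_image_sub_le_of_norm_hasDerivWithin_le (C := 0) hd
    (fun _ _ => by simp) ht hs
  rw [zero_mul, norm_le_zero_iff, sub_eq_zero] at h0
  exact h0

end Trajectories

end ThinBilliard

namespace ThinBilliard

/-! ### The Hamiltonian flow on the cotangent bundle -/

set_option synthInstance.maxHeartbeats 400000
set_option maxHeartbeats 1000000
set_option linter.unusedSectionVars false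

section Flow

variable {E : Type*} [NormedAddCommGroup E] [NormedSpace ℝ E] [FiniteDimensional ℝ E]
  {M : Type*} [TopologicalSpace M] [ChartedSpace E M] [IsManifold 𝓘(ℝ, E) ∞ M]
  {H : M → (E →L[ℝ] ℝ) → ℝ}

/-- The trajectory with the initial value `m` at time `0` exists up to (and a little beyond) the
time `s`, which may be negative. -/
def Good (H : M → (E →L[ℝ] ℝ) → ℝ) (m : M × (E →L[ℝ] ℝ)) (s : ℝ) : Prop :=
  ∃ (c : ℝ → M × (E →L[ℝ] ℝ)) (a b : ℝ), a < 0 ∧ 0 < b ∧ s ∈ Ioo a b ∧ Traj H c a b ∧ c 0 = m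

open Classical in
/-- The Hamiltonian flow, with the value `m` where the trajectory of `m` is not defined. -/
noncomputable def flow (H : M → (E →L[ℝ] ℝ) → ℝ) (m : M × (E →L[ℝ] ℝ)) (s : ℝ) :
    M × (E →L[ℝ] ℝ) :=
  if h : Good H m s then h.choose s else m

theorem Good.flow_eq [T2Space M] (hH : IsC3 H) {m : M × (E →L[ℝ] ℝ)} {s : ℝ} (hg : Good H m s)
    {c : ℝ → M × (E →L[ℝ] ℝ)} {a b : ℝ} (hc : Traj H c a b) (h0 : (0 : ℝ) ∈ Icc a b)
    (hs : s ∈ Icc a b) (hcm : c 0 = m) : flow H m s = c s := by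
  rw [flow, dif_pos hg]
  obtain ⟨a', b', ha', hb', hs', hc', hcm'⟩ := hg.choose_spec
  have h1 := hc'.mono (le_max_left a' a) (min_le_left b' b)
  have h2 := hc.mono (le_max_right a' a) (min_le_right b' b)
  exact h1.eqOn hH h2 (s := 0) ⟨max_le ha'.le h0.1, le_min hb'.le h0.2⟩ (hcm'.trans hcm.symm)
    ⟨max_le hs'.1.le hs.1, le_min hs'.2.le hs.2⟩

theorem Traj.good {c : ℝ → M × (E →L[ℝ] ℝ)} {a b s : ℝ} (hc : Traj H c a b)
    (h0 : (0 : ℝ) ∈ Ioo a b) (hs : s ∈ Ioo a b) : Good H (c 0) s :=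
  ⟨c, a, b, h0.1, h0.2, hs, hc, rfl⟩

theorem Traj.flow_eq [T2Space M] (hH : IsC3 H) {c : ℝ → M × (E →L[ℝ] ℝ)} {a b s : ℝ}
    (hc : Traj H c a b) (h0 : (0 : ℝ) ∈ Ioo a b) (hs : s ∈ Ioo a b) :
    flow H (c 0) s = c s :=
  (hc.good h0 hs).flow_eq hH hc (Ioo_subset_Icc_self h0) (Ioo_subset_Icc_self hs) rfl

theorem flow_zero (m : M × (E →L[ℝ] ℝ)) : flow H m 0 = m := by
  by_cases h : Good H m 0
  · rw [flow, dif_pos h]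
    obtain ⟨a', b', ha', hb', hs', hc', hcm'⟩ := h.choose_spec
    exact hcm'
  · rw [flow, dif_neg h]

/-- The flow line of `m` is a trajectory. -/
theorem Good.exists_traj [T2Space M] (hH : IsC3 H) {m : M × (E →L[ℝ] ℝ)} {s : ℝ}
    (hg : Good H m s) : ∃ a b : ℝ, a < 0 ∧ 0 < b ∧ s ∈ Ioo a b ∧ Traj H (flow H m) a b ∧
      ∀ r ∈ Icc a b, Good H m r := by
  obtain ⟨c, a, b, ha, hb, hs, hc, rfl⟩ := hg
  obtain ⟨a', ha1, ha2⟩ := exists_between (lt_min ha hs.1)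
  obtain ⟨b', hb1, hb2⟩ := exists_between (max_lt hb hs.2)
  rw [lt_min_iff] at ha2
  rw [max_lt_iff] at hb1
  have hsub : Icc a' b' ⊆ Ioo a b := fun r hr => ⟨ha1.trans_le hr.1, hr.2.trans_lt hb2⟩
  exact ⟨a', b', ha2.1, hb1.1, ⟨ha2.2, hb1.2⟩, (hc.mono ha1.le hb2.le).congr fun r hr =>
    hc.flow_eq hH ⟨ha, hb⟩ (hsub hr), fun r hr => hc.good ⟨ha, hb⟩ (hsub hr)⟩

theorem Good.add [T2Space M] (hH : IsC3 H) {m : M × (E →L[ℝ] ℝ)} {s r : ℝ} (h1 : Good H m s)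
    (h2 : Good H (flow H m s) r) :
    Good H m (s + r) ∧ flow H m (s + r) = flow H (flow H m s) r := by
  obtain ⟨a, b, ha, hb, hs, hc, -⟩ := h1.exists_traj hH
  obtain ⟨a', b', ha', hb', hr', hc', -⟩ := h2.exists_traj hH
  have hc'' := hc'.comp_add (-s)
  simp only [sub_neg_eq_add] at hc''
  obtain ⟨c, hcT, hc1, hc2⟩ := hc.extend hH (s := s) hc'' (Ioo_subset_Icc_self hs)
    ⟨by linarith, by linarith⟩ (by simp [flow_zero])
  have hc0 : c 0 = m := by rw [hc1 ⟨ha.le, hb.le⟩, flow_zero]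
  have h0 : (0 : ℝ) ∈ Ioo (min a (a' + s)) (max b (b' + s)) :=
    ⟨(min_le_left _ _).trans_lt ha, hb.trans_le (le_max_left _ _)⟩
  have hsr : s + r ∈ Ioo (min a (a' + s)) (max b (b' + s)) :=
    ⟨(min_le_right _ _).trans_lt (by linarith [hr'.1]),
      lt_of_lt_of_le (by linarith [hr'.2]) (le_max_right _ _)⟩
  have hg := hcT.good h0 hsr
  have he := hcT.flow_eq hH h0 hsr
  rw [hc0] at hg he
  refine ⟨hg, ?_⟩
  rw [he, hc2 ⟨by linarith [hr'.1], by linarith [hr'.2]⟩]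
  show flow H (flow H m s) (s + r + -s) = _
  rw [show s + r + -s = r by ring]

/-- The integrand `⟨p, q̇⟩` of the Maupertuis action. -/
noncomputable def lag (H : M → (E →L[ℝ] ℝ) → ℝ) (m : M × (E →L[ℝ] ℝ)) : ℝ :=
  m.2 (field H m.1 (phaseCoord m.1 m)).1

theorem lag_eq (hH : IsC3 H) {m : M × (E →L[ℝ] ℝ)} {q₀ : M} (hq : m.1 ∈ (chartAt E q₀).source) :
    lag H m = (phaseCoord q₀ m).2 (field H q₀ (phaseCoord q₀ m)).1 := by
  have hz : (phaseCoord m.1 m).1 ∈ (chartAt E m.1).target :=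
    (chartAt E m.1).map_source (mem_chart_source E _)
  have hz1 : (chartAt E m.1).symm (phaseCoord m.1 m).1 ∈ (chartAt E q₀).source := by
    simpa [phaseCoord] using hq
  have h1 := hamField_cotLift hH hz hz1
  have h2 := cotLift_liouville (chart_mem m.1) (chart_mem q₀) hz hz1
    (hamField (coordHam H m.1) (phaseCoord m.1 m))
  rw [← h1, cotLift_phaseCoord_chart (mem_chart_source E _) hq] at h2
  rw [field, h2, lag, field]
  congr 1
  simp [phaseCoord_self]

theorem Traj.continuousOn_lag (hH : IsC3 H) {c : ℝ → M × (E →L[ℝ] ℝ)} {a b : ℝ}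
    (hc : Traj H c a b) : ContinuousOn (fun s => lag H (c s)) (Icc a b) := by
  intro t ht
  have hz := (hc.continuousWithinAt_phaseCoord hH ht (mem_chart_source E (c t).1))
  have hX : ContinuousAt (field H (c t).1) (phaseCoord (c t).1 (c t)) :=
    (contDiffAt_field hH ((chartAt E (c t).1).map_source (mem_chart_source E _))).continuousAt
  have h1 : ContinuousWithinAt (fun s => field H (c t).1 (phaseCoord (c t).1 (c s))) (Icc a b) t :=
    ContinuousAt.comp_continuousWithinAt (f := fun s => phaseCoord (c t).1 (c s)) hX hz
  have h2 : ContinuousWithinAt (fun s => (phaseCoord (c t).1 (c s)).2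
      (field H (c t).1 (phaseCoord (c t).1 (c s))).1) (Icc a b) t := hz.snd.clm_apply h1.fst
  refine h2.congr_of_eventuallyEq ?_ (lag_eq hH (mem_chart_source E _))
  filter_upwards [(hc.continuousOn t ht).eventually
    ((chartAt E (c t).1).open_source.mem_nhds (mem_chart_source E _))] with s hs
  exact lag_eq hH hs

/-- The Maupertuis action of the flow line of `m` from time `0` to time `s`. -/
noncomputable def act (H : M → (E →L[ℝ] ℝ) → ℝ) (m : M × (E →L[ℝ] ℝ)) (s : ℝ) : ℝ :=
  ∫ r in (0 : ℝ)..s, lag H (flow H m r)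

theorem Good.act_add [T2Space M] (hH : IsC3 H) {m : M × (E →L[ℝ] ℝ)} {s r : ℝ} (h1 : Good H m s)
    (h2 : Good H (flow H m s) r) : act H m (s + r) = act H m s + act H (flow H m s) r := by
  obtain ⟨a', b', ha', hb', hs', hc', hg'⟩ := h1.exists_traj hH
  obtain ⟨a'', b'', ha'', hb'', hs'', hc'', hg''⟩ := h2.exists_traj hH
  have hr : ∀ τ ∈ uIcc 0 r, τ ∈ Icc a'' b'' := fun τ hτ =>
    uIcc_subset_Icc ⟨ha''.le, hb''.le⟩ (Ioo_subset_Icc_self hs'') hτ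
  have hadd : ∀ τ ∈ uIcc 0 r, flow H m (τ + s) = flow H (flow H m s) τ := fun τ hτ => by
    rw [add_comm, (h1.add hH (hg'' τ (hr τ hτ))).2]
  have e1 : act H (flow H m s) r = ∫ τ in s..s + r, lag H (flow H m τ) := by
    have := intervalIntegral.integral_comp_add_right (a := 0) (b := r)
      (fun τ => lag H (flow H m τ)) s
    rw [zero_add, add_comm r s] at this
    rw [act, ← this]
    exact intervalIntegral.integral_congr fun τ hτ => by simp only [hadd τ hτ]
  have hi1 : IntervalIntegrable (fun r => lag H (flow H m r)) MeasureTheory.volume 0 s :=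
    ((hc'.continuousOn_lag hH).mono (uIcc_subset_Icc ⟨ha'.le, hb'.le⟩
      (Ioo_subset_Icc_self hs'))).intervalIntegrable
  have hi2 : IntervalIntegrable (fun r => lag H (flow H m r)) MeasureTheory.volume s (s + r) := by
    have hsub : ∀ τ ∈ uIcc s (s + r), τ - s ∈ uIcc 0 r := fun τ hτ => by
      rw [mem_uIcc] at hτ ⊢
      rcases hτ with h | h
      · exact Or.inl ⟨by linarith [h.1], by linarith [h.2]⟩
      · exact Or.inr ⟨by linarith [h.1], by linarith [h.2]⟩
    have h3 : ContinuousOn (fun τ => lag H (flow H (flow H m s) (τ - s))) (uIcc s (s + r)) :=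
      (hc''.continuousOn_lag hH).comp (f := fun τ => τ - s) (by fun_prop)
        fun τ hτ => hr _ (hsub τ hτ)
    refine ContinuousOn.intervalIntegrable (h3.congr fun τ hτ => ?_)
    change lag H (flow H m τ) = lag H (flow H (flow H m s) (τ - s))
    rw [← hadd _ (hsub τ hτ), sub_add_cancel]
  rw [e1, act, act, intervalIntegral.integral_add_adjacent_intervals hi1 hi2]

/-- The flow in the canonical coordinates of the charts at `q₀` (initially) and `q₁` (finally). -/
noncomputable def flowC (H : M → (E →L[ℝ] ℝ) → ℝ) (q₀ q₁ : M)
    (w : (E × (E →L[ℝ] ℝ)) × ℝ) : E × (E →L[ℝ] ℝ) :=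
  phaseCoord q₁ (flow H (phasePt q₀ w.1) w.2)

/-- The action of flow lines as a function of canonical coordinates of the initial value. -/
noncomputable def actC (H : M → (E →L[ℝ] ℝ) → ℝ) (q₀ : M) (w : (E × (E →L[ℝ] ℝ)) × ℝ) : ℝ :=
  act H (phasePt q₀ w.1) w.2

/-- Near the initial value with coordinates `z` in the chart at `q₀` and the time `s`, the flow is
defined, of class `C²`, has values in the chart at `q₁`, and satisfies the first variation
formula. -/
structure SmoothFlow (H : M → (E →L[ℝ] ℝ) → ℝ) (q₀ q₁ : M) (z : E × (E →L[ℝ] ℝ)) (s : ℝ) :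
    Prop where
  mem_target : z.1 ∈ (chartAt E q₀).target
  good : ∀ᶠ w in 𝓝 (z, s), Good H (phasePt q₀ w.1) w.2
  mem_source : ∀ᶠ w in 𝓝 (z, s), (flow H (phasePt q₀ w.1) w.2).1 ∈ (chartAt E q₁).source
  contDiffAt : ContDiffAt ℝ 2 (flowC H q₀ q₁) (z, s)
  contDiffAt_act : ContDiffAt ℝ 2 (actC H q₀) (z, s)
  variation : ∀ᶠ w in 𝓝 (z, s), ∀ δ, fderiv ℝ (actC H q₀) w δ
    = (flowC H q₀ q₁ w).2 (fderiv ℝ (flowC H q₀ q₁) w δ).1 - w.1.2 δ.1.1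
      + w.2 * fderiv ℝ (coordHam H q₀) w.1 δ.1

/-- Smoothness of the flow for small times. -/
theorem exists_smoothFlow [T2Space M] (hH : IsC3 H) {q₀ : M} {z₀ : E × (E →L[ℝ] ℝ)}
    (hz₀ : z₀.1 ∈ (chartAt E q₀).target) :
    ∃ V ∈ 𝓝 z₀, ∃ δ > 0, ∀ z ∈ V, ∀ t ∈ Ioo (-δ) δ, SmoothFlow H q₀ q₀ z t := by
  have hU : (chartAt E q₀).target ×ˢ univ ∈ 𝓝 z₀ :=
    prod_mem_nhds ((chartAt E q₀).open_target.mem_nhds hz₀) univ_mem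
  obtain ⟨Φ, S, V, hV, δ, hδ, hall⟩ := exists_localHamFlow (hH.contDiffAt hz₀) hU
  have hkey : ∀ z ∈ V, ∀ t ∈ Ioo (-δ) δ, Good H (phasePt q₀ z) t ∧
      flow H (phasePt q₀ z) t = phasePt q₀ (Φ (z, t)) ∧ act H (phasePt q₀ z) t = S (z, t) := by
    intro z hz t ht
    obtain ⟨hz0, hS0, hzall⟩ := hall z hz
    have hΦt : ∀ s ∈ Ioo (-δ) δ, (Φ (z, s)).1 ∈ (chartAt E q₀).target := fun s hs =>
      (hzall s hs).2.2.1.1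
    obtain ⟨δ', hδ1, hδ2⟩ := exists_between (abs_lt.2 ht)
    have hsub : Icc (-δ') δ' ⊆ Ioo (-δ) δ := fun s hs =>
      ⟨by linarith [hs.1], by linarith [hs.2]⟩
    have hδ' : 0 < δ' := (abs_nonneg t).trans_lt hδ1
    have hΦd : ∀ s ∈ Ioo (-δ) δ, HasDerivAt (fun s => Φ (z, s)) (field H q₀ (Φ (z, s))) s :=
      fun s hs => (hzall s hs).2.2.2.1
    have hT : Traj H (fun s => phasePt q₀ (Φ (z, s))) (-δ') δ' := by
      refine traj_of_hasDerivWithinAt hH ?_ fun s hs => ⟨q₀, phasePt_fst_mem (hΦt s (hsub hs)), ?_⟩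
      · intro s hs
        have h1 : ContinuousAt (fun s => (Φ (z, s)).1) s := (hΦd s (hsub hs)).continuousAt.fst
        exact (ContinuousAt.comp (f := fun s => (Φ (z, s)).1)
          ((chartAt E q₀).symm.continuousAt (hΦt s (hsub hs))) h1).continuousWithinAt
      · rw [phaseCoord_phasePt (hΦt s (hsub hs))]
        refine (hΦd s (hsub hs)).hasDerivWithinAt.congr (fun r hr => ?_) ?_
        · exact phaseCoord_phasePt (hΦt r (hsub hr))
        · exact phaseCoord_phasePt (hΦt s (hsub hs))
    have h0 : (0 : ℝ) ∈ Ioo (-δ') δ' := ⟨by linarith, hδ'⟩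
    have hflow : ∀ s ∈ Ioo (-δ') δ', flow H (phasePt q₀ z) s = phasePt q₀ (Φ (z, s)) :=
      fun s hs => by
        have := hT.flow_eq hH h0 hs
        rwa [hz0] at this
    have ht' : t ∈ Ioo (-δ') δ' := abs_lt.1 hδ1
    refine ⟨?_, hflow t ht', ?_⟩
    · have := hT.good h0 ht'
      rwa [hz0] at this
    · have hsubu : ∀ s ∈ uIcc 0 t, s ∈ Ioo (-δ') δ' := fun s hs => by
        rw [mem_uIcc] at hs
        rcases hs with h | h
        · exact ⟨by linarith [h.1], by linarith [h.2, ht'.2]⟩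
        · exact ⟨by linarith [h.1, ht'.1], by linarith [h.2]⟩
      have hlag : ∀ s ∈ uIcc 0 t, lag H (flow H (phasePt q₀ z) s)
          = (Φ (z, s)).2 (field H q₀ (Φ (z, s))).1 := fun s hs => by
        have hs' := hΦt s (hsub (Ioo_subset_Icc_self (hsubu s hs)))
        rw [hflow s (hsubu s hs), lag_eq hH (phasePt_fst_mem hs'), phaseCoord_phasePt hs']
      rw [act, intervalIntegral.integral_congr hlag,
        intervalIntegral.integral_eq_sub_of_hasDerivAt (f := fun s => S (z, s)), hS0, sub_zero]
      · exact fun s hs => (hzall s (hsub (Ioo_subset_Icc_self (hsubu s hs)))).2.2.2.2.1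
      · refine ContinuousOn.intervalIntegrable (ContinuousOn.congr ?_ fun s hs => (hlag s hs).symm)
        refine ContinuousOn.congr (f := fun s => lag H (phasePt q₀ (Φ (z, s)))) ?_
          fun s hs => by simp only [hflow s (hsubu s hs)]
        exact (hT.continuousOn_lag hH).mono fun s hs => Ioo_subset_Icc_self (hsubu s hs)
  obtain ⟨V', hV'V, hV'o, hzV'⟩ := mem_nhds_iff.1 hV
  refine ⟨V', hV'o.mem_nhds hzV', δ, hδ, fun z hz t ht => ?_⟩
  have hev : ∀ᶠ w in 𝓝 (z, t), w.1 ∈ V ∧ w.2 ∈ Ioo (-δ) δ :=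
    prod_mem_nhds (mem_of_superset (hV'o.mem_nhds hz) hV'V) (isOpen_Ioo.mem_nhds ht)
  have hΦt : ∀ w : (E × (E →L[ℝ] ℝ)) × ℝ, w.1 ∈ V ∧ w.2 ∈ Ioo (-δ) δ →
      (Φ w).1 ∈ (chartAt E q₀).target := fun w hw => ((hall w.1 hw.1).2.2 w.2 hw.2).2.2.1.1
  have hC : flowC H q₀ q₀ =ᶠ[𝓝 (z, t)] Φ := hev.mono fun w hw => by
    rw [flowC, (hkey w.1 hw.1 w.2 hw.2).2.1, phaseCoord_phasePt (hΦt w hw)]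
  have hA : actC H q₀ =ᶠ[𝓝 (z, t)] S := hev.mono fun w hw => (hkey w.1 hw.1 w.2 hw.2).2.2
  have hz0 := hall z (hV'V hz)
  refine ⟨?_, ?_, ?_, ?_, ?_, ?_⟩
  · have := hΦt (z, 0) ⟨hV'V hz, ⟨by simpa using hδ, hδ⟩⟩
    rwa [hz0.1] at this
  · exact hev.mono fun w hw => (hkey w.1 hw.1 w.2 hw.2).1
  · refine hev.mono fun w hw => ?_
    rw [(hkey w.1 hw.1 w.2 hw.2).2.1]
    exact phasePt_fst_mem (hΦt w hw)
  · exact (hz0.2.2 t ht).1.congr_of_eventuallyEq hC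
  · exact (hz0.2.2 t ht).2.1.congr_of_eventuallyEq hA
  · filter_upwards [hev, hC.eventuallyEq_nhds, hA.eventuallyEq_nhds] with w hw hCw hAw δ
    rw [hCw.fderiv_eq, hAw.fderiv_eq, hCw.eq_of_nhds]
    exact ((hall w.1 hw.1).2.2 w.2 hw.2).2.2.2.2.2.2 δ

theorem continuousAt_phasePt_fst {q₀ : M} {z : E × (E →L[ℝ] ℝ)}
    (hz : z.1 ∈ (chartAt E q₀).target) : ContinuousAt (fun z => (phasePt q₀ z).1) z :=
  ContinuousAt.comp (g := (chartAt E q₀).symm) ((chartAt E q₀).symm.continuousAt hz)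
    continuousAt_fst

theorem SmoothFlow.continuousAt_base {q₀ q₁ : M} {z : E × (E →L[ℝ] ℝ)} {s : ℝ}
    (h : SmoothFlow H q₀ q₁ z s) :
    ContinuousAt (fun w : (E × (E →L[ℝ] ℝ)) × ℝ => (flow H (phasePt q₀ w.1) w.2).1) (z, s) := by
  have hz : (flowC H q₀ q₁ (z, s)).1 ∈ (chartAt E q₁).target :=
    (chartAt E q₁).map_source h.mem_source.self_of_nhds
  refine ((continuousAt_phasePt_fst hz).comp h.contDiffAt.continuousAt).congr ?_
  filter_upwards [h.mem_source] with w hw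
  simp only [Function.comp, flowC, phasePt_phaseCoord hw]

theorem SmoothFlow.change_right {q₀ q₁ q₂ : M} {z : E × (E →L[ℝ] ℝ)} {s : ℝ}
    (h : SmoothFlow H q₀ q₁ z s)
    (h2 : (flow H (phasePt q₀ z) s).1 ∈ (chartAt E q₂).source) : SmoothFlow H q₀ q₂ z s := by
  have hs2 : ∀ᶠ w in 𝓝 (z, s), (flow H (phasePt q₀ w.1) w.2).1 ∈ (chartAt E q₂).source :=
    h.continuousAt_base.eventually ((chartAt E q₂).open_source.mem_nhds h2)
  have hC : flowC H q₀ q₂ =ᶠ[𝓝 (z, s)]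
      fun w => cotLift (chartAt E q₁) (chartAt E q₂) (flowC H q₀ q₁ w) := by
    filter_upwards [h.mem_source, hs2] with w hw hw2
    simp only [flowC, cotLift_phaseCoord_chart hw hw2]
  have hθ : ∀ w : (E × (E →L[ℝ] ℝ)) × ℝ,
      (flow H (phasePt q₀ w.1) w.2).1 ∈ (chartAt E q₁).source →
      (flow H (phasePt q₀ w.1) w.2).1 ∈ (chartAt E q₂).source →
      (flowC H q₀ q₁ w).1 ∈ (chartAt E q₁).target ∧
      (chartAt E q₁).symm (flowC H q₀ q₁ w).1 ∈ (chartAt E q₂).source := fun w hw hw2 =>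
    ⟨(chartAt E q₁).map_source hw, by simpa [flowC, phaseCoord, (chartAt E q₁).left_inv hw]⟩
  refine ⟨h.mem_target, h.good, hs2, ?_, h.contDiffAt_act, ?_⟩
  · have h3 := hθ (z, s) h.mem_source.self_of_nhds h2
    exact (ContDiffAt.comp (z, s) ((contDiffAt_cotLift (chart_mem q₁) (chart_mem q₂)
      h3.1 h3.2).of_le two_le_infty) h.contDiffAt).congr_of_eventuallyEq hC
  · filter_upwards [h.variation, h.mem_source, hs2, hC.eventuallyEq_nhds,
      h.contDiffAt.eventually (by simp)] with w hw hw1 hw2 hwC hwd δ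
    rw [hw δ, hwC.eq_of_nhds, hwC.fderiv_eq]
    have h3 := hθ w hw1 hw2
    have hd : HasFDerivAt (fun w => cotLift (chartAt E q₁) (chartAt E q₂) (flowC H q₀ q₁ w)) _ w :=
      HasFDerivAt.comp w (((contDiffAt_cotLift (chart_mem q₁) (chart_mem q₂)
        h3.1 h3.2).differentiableAt (by simp)).hasFDerivAt)
        (hwd.differentiableAt two_ne_zero).hasFDerivAt
    rw [hd.fderiv, ContinuousLinearMap.comp_apply,
      cotLift_liouville (chart_mem q₁) (chart_mem q₂) h3.1 h3.2]

/-- Composition of flows: the first variation formulas of consecutive pieces add up. -/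
theorem SmoothFlow.comp [T2Space M] (hH : IsC3 H) {q₀ q₁ q₂ : M} {z : E × (E →L[ℝ] ℝ)} {s r : ℝ}
    (h₁ : SmoothFlow H q₀ q₁ z s) (h₂ : SmoothFlow H q₁ q₂ (flowC H q₀ q₁ (z, s)) r) :
    SmoothFlow H q₀ q₂ z (s + r) := by
  let j : (E × (E →L[ℝ] ℝ)) × ℝ → (E × (E →L[ℝ] ℝ)) × ℝ := fun w => (w.1, s)
  let k : (E × (E →L[ℝ] ℝ)) × ℝ → (E × (E →L[ℝ] ℝ)) × ℝ := fun w => (flowC H q₀ q₁ (j w), w.2 - s)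
  have hj0 : j (z, s + r) = (z, s) := rfl
  have hk0 : k (z, s + r) = (flowC H q₀ q₁ (z, s), r) := by simp [k, j]
  have hjC : ContDiff ℝ 2 j := by fun_prop
  have hjt : Tendsto j (𝓝 (z, s + r)) (𝓝 (z, s)) := hjC.continuous.continuousAt
  have hFj : ContDiffAt ℝ 2 (fun w => flowC H q₀ q₁ (j w)) (z, s + r) :=
    ContDiffAt.comp (g := flowC H q₀ q₁) (f := j) (z, s + r) h₁.contDiffAt hjC.contDiffAt
  have hkC : ContDiffAt ℝ 2 k (z, s + r) := hFj.prodMk (by fun_prop)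
  have hkt : Tendsto k (𝓝 (z, s + r)) (𝓝 (flowC H q₀ q₁ (z, s), r)) := by
    rw [← hk0]; exact hkC.continuousAt
  have hpt : ∀ᶠ w in 𝓝 (z, s + r), phasePt q₁ (k w).1 = flow H (phasePt q₀ w.1) s :=
    (hjt.eventually h₁.mem_source).mono fun w hw => phasePt_phaseCoord hw
  have hG : ∀ᶠ w in 𝓝 (z, s + r), Good H (phasePt q₀ w.1) s ∧
      Good H (flow H (phasePt q₀ w.1) s) (w.2 - s) := by
    filter_upwards [hjt.eventually h₁.good, hkt.eventually h₂.good, hpt] with w h1 h2 h3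
    exact ⟨h1, h3 ▸ h2⟩
  have hflow : ∀ᶠ w in 𝓝 (z, s + r), flow H (phasePt q₀ w.1) w.2
      = flow H (phasePt q₁ (k w).1) (k w).2 := by
    filter_upwards [hG, hpt] with w hw hw2
    rw [hw2, ← (hw.1.add hH hw.2).2, add_sub_cancel]
  have hC : flowC H q₀ q₂ =ᶠ[𝓝 (z, s + r)] fun w => flowC H q₁ q₂ (k w) :=
    hflow.mono fun w hw => by simp only [flowC, hw]
  have hA : actC H q₀ =ᶠ[𝓝 (z, s + r)] fun w => actC H q₀ (j w) + actC H q₁ (k w) := by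
    filter_upwards [hG, hpt] with w hw hw2
    have := hw.1.act_add hH hw.2
    rw [add_sub_cancel] at this
    simp only [actC, this, hw2, j, k]
  refine ⟨h₁.mem_target, ?_, ?_, ?_, ?_, ?_⟩
  · filter_upwards [hG] with w hw
    have := (hw.1.add hH hw.2).1
    rwa [add_sub_cancel] at this
  · filter_upwards [hflow, hkt.eventually h₂.mem_source] with w hw hw2
    rwa [hw]
  · refine ContDiffAt.congr_of_eventuallyEq ?_ hC
    exact ContDiffAt.comp (g := flowC H q₁ q₂) (f := k) (z, s + r)
      (by rw [hk0]; exact h₂.contDiffAt) hkC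
  · refine ContDiffAt.congr_of_eventuallyEq ?_ hA
    exact (ContDiffAt.comp (g := actC H q₀) (f := j) (z, s + r) h₁.contDiffAt_act hjC.contDiffAt).add
      (ContDiffAt.comp (g := actC H q₁) (f := k) (z, s + r)
        (by rw [hk0]; exact h₂.contDiffAt_act) hkC)
  · -- conservation of energy in coordinates
    have hE : ∀ᶠ w in 𝓝 (z, s), coordHam H q₁ (flowC H q₀ q₁ w) = coordHam H q₀ w.1 := by
      filter_upwards [h₁.good, h₁.mem_source] with w hw hw1
      obtain ⟨a, b, ha, hb, hs, hc, -⟩ := hw.exists_traj hH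
      have := hc.energy hH (Ioo_subset_Icc_self hs) (show (0 : ℝ) ∈ Icc a b from ⟨ha.le, hb.le⟩)
      rw [flow_zero] at this
      rw [coordHam_eq, coordHam_eq, flowC, phasePt_phaseCoord hw1, this]
    have ht1 : ∀ᶠ w in 𝓝 (z, s), w.1.1 ∈ (chartAt E q₀).target := by
      have : ContinuousAt (fun w : (E × (E →L[ℝ] ℝ)) × ℝ => w.1.1) (z, s) := by fun_prop
      exact this.eventually ((chartAt E q₀).open_target.mem_nhds h₁.mem_target)
    filter_upwards [hjt.eventually h₁.variation, hkt.eventually h₂.variation,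
      hC.eventuallyEq_nhds, hA.eventuallyEq_nhds, hjt.eventually hE.eventually_nhds,
      hjt.eventually (h₁.contDiffAt.eventually (by simp)),
      hjt.eventually (h₁.contDiffAt_act.eventually (by simp)),
      hkt.eventually (h₂.contDiffAt.eventually (by simp)),
      hkt.eventually (h₂.contDiffAt_act.eventually (by simp)),
      hjt.eventually h₁.mem_source, hjt.eventually ht1]
      with w v1 v2 hwC hwA hwE d1 d2 d3 d4 hsrc htar δ
    have hdj : HasFDerivAt j ((ContinuousLinearMap.fst ℝ (E × (E →L[ℝ] ℝ)) ℝ).prod 0) w :=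
      hasFDerivAt_fst.prodMk (hasFDerivAt_const s w)
    have hdF : HasFDerivAt (fun w => flowC H q₀ q₁ (j w)) _ w :=
      HasFDerivAt.comp (g := flowC H q₀ q₁) (f := j) w (d1.differentiableAt two_ne_zero).hasFDerivAt hdj
    have hdk : HasFDerivAt k _ w := hdF.prodMk (hasFDerivAt_snd.sub_const s)
    have hdC : HasFDerivAt (fun w => flowC H q₁ q₂ (k w)) _ w :=
      HasFDerivAt.comp (g := flowC H q₁ q₂) (f := k) w (d3.differentiableAt two_ne_zero).hasFDerivAt hdk
    have hdA : HasFDerivAt (fun w => actC H q₀ (j w) + actC H q₁ (k w)) _ w :=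
      (HasFDerivAt.comp (g := actC H q₀) (f := j) w (d2.differentiableAt two_ne_zero).hasFDerivAt hdj).add
        (HasFDerivAt.comp (g := actC H q₁) (f := k) w (d4.differentiableAt two_ne_zero).hasFDerivAt hdk)
    have hdE : fderiv ℝ (coordHam H q₁) (k w).1 (fderiv ℝ (flowC H q₀ q₁) (j w) (δ.1, 0))
        = fderiv ℝ (coordHam H q₀) w.1 δ.1 := by
      have e1 : HasFDerivAt (fun w => coordHam H q₁ (flowC H q₀ q₁ w)) _ (j w) :=
        HasFDerivAt.comp (g := coordHam H q₁) (f := flowC H q₀ q₁) (j w)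
          ((hH.contDiffAt (q₀ := q₁) (z := flowC H q₀ q₁ (j w))
          ((chartAt E q₁).map_source hsrc)).differentiableAt (by simp)).hasFDerivAt
          (d1.differentiableAt two_ne_zero).hasFDerivAt
      have e2 : HasFDerivAt (fun w : (E × (E →L[ℝ] ℝ)) × ℝ => coordHam H q₀ w.1) _ (j w) :=
        HasFDerivAt.comp (g := coordHam H q₀) (f := Prod.fst) (j w)
          ((hH.contDiffAt (q₀ := q₀) (z := (j w).1)
          htar).differentiableAt (by simp)).hasFDerivAt hasFDerivAt_fst
      exact DFunLike.congr_fun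
        ((e1.congr_of_eventuallyEq (Filter.EventuallyEq.symm hwE)).unique e2) (δ.1, 0)
    rw [hwA.fderiv_eq, hdA.fderiv, hwC.fderiv_eq, hdC.fderiv, hwC.eq_of_nhds]
    simp only [add_apply, ContinuousLinearMap.comp_apply]
    rw [v1, v2]
    simp only [ContinuousLinearMap.prod_apply, ContinuousLinearMap.comp_apply,
      ContinuousLinearMap.coe_fst', ContinuousLinearMap.coe_snd', zero_apply, hdE]
    have e3 : (k w).2 = w.2 - s := rfl
    have e4 : (j w).2 = s := rfl
    have e5 : (j w).1 = w.1 := rfl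
    have e6 : (k w).1 = flowC H q₀ q₁ (j w) := rfl
    rw [e3, e4, e5, e6]
    ring

/-- The flow is smooth along every trajectory. -/
theorem Traj.smoothFlow [T2Space M] (hH : IsC3 H) {c : ℝ → M × (E →L[ℝ] ℝ)} {T s : ℝ}
    (hc : Traj H c 0 T) (hs : s ∈ Icc 0 T) {q₀ q₁ : M} (h0 : (c 0).1 ∈ (chartAt E q₀).source)
    (h1 : (c s).1 ∈ (chartAt E q₁).source) :
    flow H (c 0) s = c s ∧ SmoothFlow H q₀ q₁ (phaseCoord q₀ (c 0)) s := by
  have hT : 0 ≤ T := hs.1.trans hs.2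
  -- the times at which the flow is smooth form an open and closed subset of `[0, T]`
  let Q : ℝ → Prop := fun s => flow H (c 0) s = c s ∧
    ∃ q₁, SmoothFlow H q₀ q₁ (phaseCoord q₀ (c 0)) s
  have hpt0 : phasePt q₀ (phaseCoord q₀ (c 0)) = c 0 := phasePt_phaseCoord h0
  have hchange : ∀ s, Q s → ∀ q, (c s).1 ∈ (chartAt E q).source →
      SmoothFlow H q₀ q (phaseCoord q₀ (c 0)) s := fun s hQ q hq => by
    obtain ⟨hfl, q₁, hS⟩ := hQ
    exact hS.change_right (by rw [hpt0, hfl]; exact hq)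
  have hstep : ∀ t ∈ Icc 0 T, ∀ᶠ t' in 𝓝[Icc 0 T] t, (Q t ↔ Q t') := by
    intro t ht
    set q := (c t).1 with hq
    have hqs : (c t).1 ∈ (chartAt E q).source := mem_chart_source E _
    obtain ⟨V, hV, δ, hδ, hVδ⟩ := exists_smoothFlow hH (q₀ := q) (z₀ := phaseCoord q (c t))
      ((chartAt E q).map_source hqs)
    have hnear : ∀ u ∈ Icc 0 T, ∀ v ∈ Icc 0 T, (c u).1 ∈ (chartAt E q).source →
        (c v).1 ∈ (chartAt E q).source → phaseCoord q (c u) ∈ V → |v - u| < δ → Q u → Q v := by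
      intro u hu v hv huq hvq huV huv hQ
      have hS := hVδ _ huV (v - u) (abs_lt.1 huv)
      have hptu : phasePt q (phaseCoord q (c u)) = c u := phasePt_phaseCoord huq
      have hG : Good H (c u) (v - u) := hptu ▸ hS.good.self_of_nhds
      have hcu : flow H (c u) (v - u) = c v := by
        have h2 := (hc.comp_add u)
        have := Good.flow_eq hH hG h2 ⟨by linarith [hu.1], by linarith [hu.2]⟩
          ⟨by linarith [hv.1], by linarith [hv.2]⟩ (by simp)
        simpa using this
      have hS1 := hchange u hQ q huq
      have hfu : flowC H q₀ q (phaseCoord q₀ (c 0), u) = phaseCoord q (c u) := by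
        simp only [flowC, hpt0, hQ.1]
      have hS2 := hS1.comp hH (by rw [hfu]; exact hS)
      rw [add_sub_cancel] at hS2
      refine ⟨?_, q, hS2⟩
      have hGu : Good H (c 0) u := by
        have := hS1.good.self_of_nhds
        rwa [hpt0] at this
      have := (hGu.add hH (r := v - u) (by rwa [hQ.1])).2
      rw [add_sub_cancel] at this
      rw [this, hQ.1, hcu]
    filter_upwards [self_mem_nhdsWithin, (hc.continuousOn t ht).eventually
        ((chartAt E q).open_source.mem_nhds hqs),
      (hc.continuousWithinAt_phaseCoord hH ht hqs).eventually hV,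
      nhdsWithin_le_nhds (Metric.ball_mem_nhds t hδ)] with t' ht' hqt' hVt' hδt'
    rw [Metric.mem_ball, Real.dist_eq] at hδt'
    exact ⟨hnear t ht t' ht' hqs hqt' (mem_of_mem_nhds hV) hδt',
      hnear t' ht' t ht hqt' hqs hVt' (by rwa [abs_sub_comm])⟩
  have hQ0 : Q 0 := by
    refine ⟨flow_zero _, q₀, ?_⟩
    obtain ⟨V, hV, δ, hδ, hVδ⟩ := exists_smoothFlow hH (q₀ := q₀) (z₀ := phaseCoord q₀ (c 0))
      ((chartAt E q₀).map_source h0)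
    exact hVδ _ (mem_of_mem_nhds hV) 0 ⟨by simpa using hδ, hδ⟩
  have hQs : Q s := (iff_of_locally_iff_Icc hstep ⟨le_rfl, hT⟩ hs).1 hQ0
  exact ⟨hQs.1, hchange s hQs q₁ h1⟩

end Flow

end ThinBilliard

namespace ThinBilliard

/-! ### Calculus: implicit functions, multipliers and supporting hyperplanes -/

set_option synthInstance.maxHeartbeats 400000
set_option maxHeartbeats 1000000
set_option linter.unusedSectionVars false

section Calculus

/-- The implicit function theorem in finite dimension, with the regularity of the solution and its
local uniqueness. -/
theorem exists_implicit {P Y G : Type*} [NormedAddCommGroup P] [NormedSpace ℝ P]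
    [NormedAddCommGroup Y] [NormedSpace ℝ Y] [NormedAddCommGroup G] [NormedSpace ℝ G]
    [FiniteDimensional ℝ P] [FiniteDimensional ℝ Y] [FiniteDimensional ℝ G]
    {F : P × Y → G} {p₀ : P} {y₀ : Y} {k : WithTop ℕ∞} (hk0 : k ≠ 0)
    (hF : ContDiffAt ℝ k F (p₀, y₀)) (hinj : ∀ v, fderiv ℝ F (p₀, y₀) (0, v) = 0 → v = 0)
    (hdim : Module.finrank ℝ Y = Module.finrank ℝ G) :
    ∃ f : P → Y, ContDiffAt ℝ k f p₀ ∧ f p₀ = y₀ ∧ (∀ᶠ p in 𝓝 p₀, F (p, f p) = F (p₀, y₀)) ∧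
      ∀ᶠ w in 𝓝 (p₀, y₀), F w = F (p₀, y₀) → f w.1 = w.2 := by
  have : CompleteSpace P := FiniteDimensional.complete ℝ P
  have : CompleteSpace Y := FiniteDimensional.complete ℝ Y
  have : CompleteSpace G := FiniteDimensional.complete ℝ G
  have hinv : (fderiv ℝ F (p₀, y₀) ∘L .inr ℝ P Y).IsInvertible := by
    let A : Y →L[ℝ] G := fderiv ℝ F (p₀, y₀) ∘L .inr ℝ P Y
    have hA : Function.Injective A := by
      rw [injective_iff_map_eq_zero]
      exact hinj
    let e : Y ≃ₗ[ℝ] G := LinearEquiv.ofInjectiveOfFinrankEq (A : Y →ₗ[ℝ] G) hA hdim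
    exact ⟨e.toContinuousLinearEquiv, by ext v; rfl⟩
  exact ⟨hF.implicitFunction hk0 hinv, hF.contDiffAt_implicitFunction hk0 hinv,
    hF.implicitFunction_apply_self hk0 hinv, hF.eventually_apply_implicitFunction hk0 hinv,
    (hF.eventually_apply_eq_iff_implicitFunction hk0 hinv).mono fun w hw h => hw.1 h⟩

/-- A property of points `(w, r)` which holds near `{w₀} × [0, T]` holds on `{w} × [0, T']` for
`(w, T')` near `(w₀, T)`. -/
theorem eventually_forall_Icc {Z : Type*} [TopologicalSpace Z] {w₀ : Z} {T : ℝ} (hT : 0 ≤ T)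
    {Q : Z × ℝ → Prop} (hQ : ∀ r ∈ Icc 0 T, ∀ᶠ w in 𝓝 (w₀, r), Q w) :
    ∀ᶠ w in 𝓝 (w₀, T), ∀ r ∈ Icc 0 w.2, Q (w.1, r) := by
  have h1 : ∀ᶠ z in 𝓝 w₀, ∀ r ∈ Icc 0 T, Q (z, r) :=
    isCompact_Icc.eventually_forall_of_forall_eventually hQ
  have h2 := hQ T ⟨hT, le_rfl⟩
  rw [nhds_prod_eq, eventually_prod_iff] at h2
  obtain ⟨A, hA, B, hB, hAB⟩ := h2
  obtain ⟨δ, hδ, hδB⟩ := Metric.eventually_nhds_iff_ball.1 hB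
  have ht1 : Tendsto (Prod.fst : Z × ℝ → Z) (𝓝 (w₀, T)) (𝓝 w₀) := continuousAt_fst
  have ht2 : Tendsto (Prod.snd : Z × ℝ → ℝ) (𝓝 (w₀, T)) (𝓝 T) := continuousAt_snd
  have h3 : ∀ᶠ w : Z × ℝ in 𝓝 (w₀, T), A w.1 ∧ (∀ r ∈ Icc 0 T, Q (w.1, r)) ∧
      w.2 ∈ Metric.ball T δ :=
    (ht1.eventually hA).and ((ht1.eventually h1).and
      (ht2.eventually (Metric.ball_mem_nhds T hδ)))
  filter_upwards [h3] with w hw r hr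
  rcases le_total r T with h | h
  · exact hw.2.1 r ⟨hr.1, h⟩
  · refine hAB hw.1 (hδB r ?_)
    have := hw.2.2
    rw [Metric.mem_ball, Real.dist_eq, abs_lt] at this ⊢
    constructor <;> linarith [hr.2]

/-- Perturbation of a Lagrange multiplier problem in which the constrained variable `η` is rescaled
by `ε`. At `ε = 0` the problem decouples: `ξ = 0` is a nondegenerate critical point of `G(·, 0)`,
and `η₀` is a nondegenerate extremum of the linear function `∂G/∂η (0, 0)` on `{R(0, ·) = 0}`. -/
theorem exists_scaled_multipliers {V W L : Type*} [NormedAddCommGroup V] [NormedSpace ℝ V]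
    [FiniteDimensional ℝ V] [NormedAddCommGroup W] [NormedSpace ℝ W] [FiniteDimensional ℝ W]
    [NormedAddCommGroup L] [NormedSpace ℝ L] [FiniteDimensional ℝ L]
    {G : V × W → ℝ} {R : V × W → L} {η₀ : W} {μ₀ : L →L[ℝ] ℝ}
    (hG : ContDiffAt ℝ 2 G 0) (hR : ContDiffAt ℝ 2 R (0, η₀)) (hR0 : R (0, η₀) = 0)
    (hV : ∀ v, fderiv ℝ G 0 (v, 0) = 0)
    (hW : ∀ w, fderiv ℝ G 0 (0, w) + μ₀ (fderiv ℝ R (0, η₀) (0, w)) = 0)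
    (hnd : ∀ v, (∀ v', fderiv ℝ (fderiv ℝ G) 0 (v, 0) (v', 0) = 0) → v = 0)
    (hconv : ∀ w, fderiv ℝ R (0, η₀) (0, w) = 0 →
      μ₀ (fderiv ℝ (fderiv ℝ R) (0, η₀) (0, w) (0, w)) = 0 → w = 0)
    (hsurj : ∀ l : L →L[ℝ] ℝ, (∀ w, l (fderiv ℝ R (0, η₀) (0, w)) = 0) → l = 0) :
    ∃ ζ : ℝ → (V × W) × (L →L[ℝ] ℝ), ContDiffAt ℝ 1 ζ 0 ∧ ζ 0 = ((0, η₀), μ₀) ∧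
      ∀ᶠ ε in 𝓝 0, R (ζ ε).1 = 0 ∧ ∀ v w,
        fderiv ℝ G ((ζ ε).1.1, ε • (ζ ε).1.2) (v, w)
          + (ζ ε).2 (fderiv ℝ R (ζ ε).1 (ε • v, w)) = 0 := by
  -- `S ε` rescales the variation of `ξ`; `Φ = 0` are the multiplier equations and the constraint
  let S : ℝ → V × W →L[ℝ] V × W := fun ε =>
    (ε • ContinuousLinearMap.fst ℝ V W).prod (ContinuousLinearMap.snd ℝ V W)
  have hS : ContDiff ℝ 1 S := by
    have h : S = fun ε => ε • ((ContinuousLinearMap.fst ℝ V W).prod 0)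
        + (0 : V × W →L[ℝ] V).prod (ContinuousLinearMap.snd ℝ V W) := by
      funext ε
      ext z <;> simp [S]
    rw [h]
    fun_prop
  let Φ : ℝ × ((V × W) × (L →L[ℝ] ℝ)) → (V × W →L[ℝ] ℝ) × L := fun x =>
    (fderiv ℝ G (x.2.1.1, x.1 • x.2.1.2) + (x.2.2 ∘L fderiv ℝ R x.2.1) ∘L S x.1, R x.2.1)
  have hdG : ContDiffAt ℝ 1 (fderiv ℝ G) 0 := hG.fderiv_right (by norm_num)
  have hdR : ContDiffAt ℝ 1 (fderiv ℝ R) (0, η₀) := hR.fderiv_right (by norm_num)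
  have hΦ : ContDiffAt ℝ 1 Φ (0, ((0, η₀), μ₀)) := by
    refine ContDiffAt.prodMk (ContDiffAt.add ?_ (ContDiffAt.clm_comp (ContDiffAt.clm_comp ?_ ?_)
      ?_)) ?_
    · refine ContDiffAt.comp (g := fderiv ℝ G)
        (f := fun x : ℝ × ((V × W) × (L →L[ℝ] ℝ)) => (x.2.1.1, x.1 • x.2.1.2)) _ ?_ (by fun_prop)
      simpa [Prod.mk_zero_zero] using hdG
    · fun_prop
    · exact ContDiffAt.comp (g := fderiv ℝ R)
        (f := fun x : ℝ × ((V × W) × (L →L[ℝ] ℝ)) => x.2.1) _ hdR (by fun_prop)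
    · exact ContDiffAt.comp (g := S) (f := fun x : ℝ × ((V × W) × (L →L[ℝ] ℝ)) => x.1) _
        hS.contDiffAt (by fun_prop)
    · exact ContDiffAt.comp (g := R)
        (f := fun x : ℝ × ((V × W) × (L →L[ℝ] ℝ)) => x.2.1) _ (hR.of_le (by norm_num))
        (by fun_prop)
  have hΦ0 : Φ (0, ((0, η₀), μ₀)) = 0 := by
    refine Prod.ext ?_ hR0
    ext z
    · have := hV z
      simpa [Φ, S, Prod.mk_zero_zero] using this
    · have := hW z
      simpa [Φ, S, Prod.mk_zero_zero] using this
  -- at `ε = 0` the linearized equations are triangular: they give first `δv`, then `δw`, then `δμ`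
  have hinj : ∀ δ, fderiv ℝ Φ (0, ((0, η₀), μ₀)) (0, δ) = 0 → δ = 0 := by
    rintro ⟨⟨δv, δw⟩, δμ⟩ h
    have hline : HasDerivAt (fun t : ℝ => ((0 : ℝ), (((0 : V), η₀), μ₀) + t • ((δv, δw), δμ)))
        (0, ((δv, δw), δμ)) 0 := by
      refine (hasDerivAt_const _ _).prodMk ?_
      simpa using ((hasDerivAt_id (0 : ℝ)).smul_const ((δv, δw), δμ)).const_add
        (((0 : V), η₀), μ₀)
    have hd : HasDerivAt (fun t : ℝ => Φ (0, (((0 : V), η₀), μ₀) + t • ((δv, δw), δμ))) 0 0 := by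
      rw [← h]
      refine HasFDerivAt.comp_hasDerivAt (l := Φ) (f := fun t : ℝ =>
        ((0 : ℝ), (((0 : V), η₀), μ₀) + t • ((δv, δw), δμ))) 0 ?_ hline
      have := (hΦ.differentiableAt one_ne_zero).hasFDerivAt
      simpa using this
    have h2 : fderiv ℝ R (0, η₀) (δv, δw) = 0 := by
      have e1 : HasDerivAt (fun t : ℝ => R ((0, η₀) + t • (δv, δw)))
          (fderiv ℝ R (0, η₀) (δv, δw)) 0 := by
        refine HasFDerivAt.comp_hasDerivAt (l := R)
          (f := fun t : ℝ => ((0 : V), η₀) + t • (δv, δw)) 0 ?_ ?_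
        · have := (hR.differentiableAt two_ne_zero).hasFDerivAt
          simpa using this
        · simpa using ((hasDerivAt_id (0 : ℝ)).smul_const (δv, δw)).const_add ((0 : V), η₀)
      exact e1.unique hd.snd
    have h1 : ∀ v w, fderiv ℝ (fderiv ℝ G) 0 (δv, 0) (v, w) + (δμ (fderiv ℝ R (0, η₀) (0, w))
        + μ₀ (fderiv ℝ (fderiv ℝ R) (0, η₀) (δv, δw) (0, w))) = 0 := by
      intro v w
      have e1 : HasDerivAt (fun t : ℝ => fderiv ℝ G (t • (δv, 0)) (v, w))
          (fderiv ℝ (fderiv ℝ G) 0 (δv, 0) (v, w)) 0 := by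
        have : HasDerivAt (fun t : ℝ => fderiv ℝ G (t • (δv, 0)))
            (fderiv ℝ (fderiv ℝ G) 0 (δv, 0)) 0 := by
          refine HasFDerivAt.comp_hasDerivAt (l := fderiv ℝ G)
            (f := fun t : ℝ => t • (δv, (0 : W))) 0 ?_ ?_
          · have := (hdG.differentiableAt one_ne_zero).hasFDerivAt
            simpa using this
          · simpa using (hasDerivAt_id (0 : ℝ)).smul_const (δv, (0 : W))
        simpa using this.clm_apply (hasDerivAt_const _ (v, w))
      have e2 : HasDerivAt (fun t : ℝ => fderiv ℝ R ((0, η₀) + t • (δv, δw)) (0, w))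
          (fderiv ℝ (fderiv ℝ R) (0, η₀) (δv, δw) (0, w)) 0 := by
        have : HasDerivAt (fun t : ℝ => fderiv ℝ R ((0, η₀) + t • (δv, δw)))
            (fderiv ℝ (fderiv ℝ R) (0, η₀) (δv, δw)) 0 := by
          refine HasFDerivAt.comp_hasDerivAt (l := fderiv ℝ R)
            (f := fun t : ℝ => ((0 : V), η₀) + t • (δv, δw)) 0 ?_ ?_
          · have := (hdR.differentiableAt one_ne_zero).hasFDerivAt
            simpa using this
          · simpa using ((hasDerivAt_id (0 : ℝ)).smul_const (δv, δw)).const_add ((0 : V), η₀)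
        simpa using this.clm_apply (hasDerivAt_const _ (0, w))
      have e3 : HasDerivAt (fun t : ℝ => μ₀ + t • δμ) δμ 0 := by
        simpa using ((hasDerivAt_id (0 : ℝ)).smul_const δμ).const_add μ₀
      have e4 := e1.add (e3.clm_apply e2)
      have e5 : HasDerivAt (fun t : ℝ =>
          (Φ (0, (((0 : V), η₀), μ₀) + t • ((δv, δw), δμ))).1 (v, w)) 0 0 := by
        have hd1 : HasDerivAt (fun t : ℝ =>
            (Φ (0, (((0 : V), η₀), μ₀) + t • ((δv, δw), δμ))).1) 0 0 := hd.fst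
        simpa using hd1.clm_apply (hasDerivAt_const _ (v, w))
      have e6 := e4.unique (e5.congr_of_eventuallyEq (Eventually.of_forall fun t => by
        simp [Φ, S]))
      simpa using e6
    have hδv : δv = 0 := hnd δv fun v' => by
      have := h1 v' 0
      simpa [Prod.mk_zero_zero] using this
    subst hδv
    have hδw : δw = 0 := hconv δw h2 (by
      have := h1 0 δw
      rw [h2] at this
      simpa [Prod.mk_zero_zero] using this)
    subst hδw
    have hδμ : δμ = 0 := hsurj δμ fun w => by
      have := h1 0 w
      simpa [Prod.mk_zero_zero] using this
    simp [hδμ]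
  have hdim : Module.finrank ℝ ((V × W) × (L →L[ℝ] ℝ))
      = Module.finrank ℝ ((V × W →L[ℝ] ℝ) × L) := by
    rw [Module.finrank_prod, Module.finrank_prod (M := V × W →L[ℝ] ℝ), finrank_dual, finrank_dual]
  obtain ⟨ζ, hζ, hζ0, hev, -⟩ := exists_implicit one_ne_zero hΦ hinj hdim
  refine ⟨ζ, hζ, hζ0, hev.mono fun ε hε => ?_⟩
  rw [hΦ0] at hε
  refine ⟨congrArg Prod.snd hε, fun v w => ?_⟩
  have := DFunLike.congr_fun (congrArg Prod.fst hε) (v, w)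
  simpa [Φ, S] using this

/-- The distance by which a convex set `B(ξ')` may cross the supporting hyperplane of `B(ξ)` at a
boundary point is at most of order `ξ' - ξ`. -/
theorem exists_support_bound {V W : Type*} [NormedAddCommGroup V] [NormedSpace ℝ V]
    [FiniteDimensional ℝ V] [NormedAddCommGroup W] [NormedSpace ℝ W] [FiniteDimensional ℝ W]
    {r : V × W → ℝ} {B : V → Set W} {η₀ e : W} {R : ℝ} (hr : ContDiffAt ℝ 2 r (0, η₀))
    (hr0 : r (0, η₀) = 0) (he : fderiv ℝ r (0, η₀) (0, e) ≠ 0)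
    (hconv : ∀ᶠ ξ in 𝓝 0, Convex ℝ (B ξ)) (hbdd : ∀ᶠ ξ in 𝓝 0, ∀ η ∈ B ξ, ‖η‖ ≤ R)
    (hB : ∀ᶠ z in 𝓝 (0, η₀), z.2 ∈ B z.1 ↔ r z ≤ 0) :
    ∃ C : ℝ, ∀ᶠ z : (V × W) × V in 𝓝 ((0, η₀), 0), r z.1 = 0 → ∀ η ∈ B z.2,
      fderiv ℝ r z.1 (0, η - z.1.2) ≤ C * ‖z.2 - z.1.1‖ := by
  -- the equation `F = 0` describes the boundary as a graph in the direction `e`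
  let F : (V × W) × ℝ → ℝ := fun x => r (x.1.1, x.1.2 + x.2 • e)
  have hr' : ContDiffAt ℝ 2 r ((0 : V), η₀ + (0 : ℝ) • e) := by simpa using hr
  have hF : ContDiffAt ℝ 2 F ((0, η₀), 0) :=
    ContDiffAt.comp (g := r) (f := fun x : (V × W) × ℝ => (x.1.1, x.1.2 + x.2 • e)) _ hr'
      (by fun_prop)
  have hdF : fderiv ℝ F ((0, η₀), 0) (0, 1) = fderiv ℝ r (0, η₀) (0, e) := by
    have h1 : HasDerivAt (fun t : ℝ => F ((0, η₀), t)) (fderiv ℝ F ((0, η₀), 0) (0, 1)) 0 :=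
      HasFDerivAt.comp_hasDerivAt (l := F) (f := fun t : ℝ => (((0 : V), η₀), t)) 0
        (hF.differentiableAt two_ne_zero).hasFDerivAt
        ((hasDerivAt_const _ _).prodMk (hasDerivAt_id _))
    have h2 : HasDerivAt (fun t : ℝ => F ((0, η₀), t)) (fderiv ℝ r (0, η₀) (0, e)) 0 := by
      refine HasFDerivAt.comp_hasDerivAt (l := r) (f := fun t : ℝ => ((0 : V), η₀ + t • e)) 0 ?_ ?_
      · have := (hr'.differentiableAt two_ne_zero).hasFDerivAt
        simpa using this
      · refine (hasDerivAt_const _ _).prodMk ?_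
        simpa using ((hasDerivAt_id (0 : ℝ)).smul_const e).const_add η₀
    exact h1.unique h2
  have hF0 : F ((0, η₀), 0) = 0 := by simp [F, hr0]
  obtain ⟨f, hf, hf0, hfF, hfu⟩ := exists_implicit two_ne_zero hF
    (fun v hv => by
      have h : ((0 : V × W), v) = v • ((0 : V × W), (1 : ℝ)) := by simp
      rw [h, map_smul, hdF, smul_eq_mul] at hv
      exact (mul_eq_zero.1 hv).resolve_right he) rfl
  rw [hF0] at hfF hfu
  have hf1 : ContDiffAt ℝ 1 f (0, η₀) := hf.of_le (by norm_num)
  obtain ⟨K₁, U₁, hU₁, hL₁⟩ := hf1.exists_lipschitzOnWith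
  obtain ⟨K₂, U₂, hU₂, hL₂⟩ := (hr.fderiv_right (m := 1) (by norm_num)).exists_lipschitzOnWith
  have hD : ∀ᶠ z in 𝓝 ((0 : V), η₀), ‖fderiv ℝ r z‖ < ‖fderiv ℝ r (0, η₀)‖ + 1 :=
    ((hr.fderiv_right (m := 1) (by norm_num)).continuousAt.norm).eventually
      (Iio_mem_nhds (by linarith))
  set D := ‖fderiv ℝ r (0, η₀)‖ + 1 with hDdef
  -- the boundary point of `B(ξ')` near the boundary point `z` of `B(ξ)`
  let s : (V × W) × V → V × W := fun z => (z.2, z.1.2 + f (z.2, z.1.2) • e)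
  have hsw : ContinuousAt (fun z : (V × W) × V => (z.2, z.1.2)) ((0, η₀), 0) := by fun_prop
  have hs : ContinuousAt s ((0, η₀), 0) := by
    refine ContinuousAt.prodMk continuousAt_snd (ContinuousAt.add (by fun_prop)
      (ContinuousAt.smul ?_ continuousAt_const))
    exact ContinuousAt.comp (g := f) (f := fun z : (V × W) × V => (z.2, z.1.2)) hf.continuousAt hsw
  have hs0 : s ((0, η₀), 0) = (0, η₀) := by simp [s, hf0]
  have hst : Tendsto s (𝓝 ((0, η₀), 0)) (𝓝 (0, η₀)) := by
    have := hs.tendsto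
    rwa [hs0] at this
  have hη : ∀ᶠ z : (V × W) × V in 𝓝 ((0, η₀), 0), ‖z.1.2‖ < ‖η₀‖ + 1 := by
    have : ContinuousAt (fun z : (V × W) × V => ‖z.1.2‖) ((0, η₀), 0) := by fun_prop
    exact this.eventually (Iio_mem_nhds (by simp))
  have hfst : Tendsto (fun z : (V × W) × V => z.1) (𝓝 ((0, η₀), 0)) (𝓝 (0, η₀)) :=
    continuousAt_fst
  have hsnd : Tendsto (fun z : (V × W) × V => z.2) (𝓝 ((0, η₀), 0)) (𝓝 0) :=
    continuousAt_snd
  have hfst0 : Tendsto (fun z : (V × W) × V => (z.1, (0 : ℝ))) (𝓝 ((0, η₀), 0))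
      (𝓝 ((0, η₀), 0)) := by
    have : ContinuousAt (fun z : (V × W) × V => (z.1, (0 : ℝ))) ((0, η₀), 0) := by fun_prop
    exact this
  refine ⟨K₂ * (1 + K₁ * ‖e‖) * (R + (‖η₀‖ + 1)) + D * (K₁ * ‖e‖), ?_⟩
  filter_upwards [hfst.eventually hU₁, hsw.eventually hU₁, hfst.eventually hU₂,
    hst.eventually hU₂, hst.eventually hD, hst.eventually hB.eventually_nhds, hη,
    hsw.eventually hfF, hfst0.eventually hfu, hsnd.eventually hconv, hsnd.eventually hbdd,
    hst.eventually (hr.eventually (by simp))] with z a1 a2 a3 a4 a5 a6 a7 a8 a9 a10 a11 a12 hz η hη'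
  have hfz : f z.1 = 0 := a9 (by simpa [F] using hz)
  have hd : ‖z.2 - z.1.1‖ = dist (z.2, z.1.2) z.1 := by
    rw [Prod.dist_eq, dist_self, max_eq_left dist_nonneg, dist_eq_norm]
  have hfb : |f (z.2, z.1.2)| ≤ K₁ * ‖z.2 - z.1.1‖ := by
    have := hL₁.dist_le_mul _ a2 _ a1
    rwa [hfz, Real.dist_eq, sub_zero, ← hd] at this
  have hsz : dist (s z) z.1 ≤ (1 + K₁ * ‖e‖) * ‖z.2 - z.1.1‖ := by
    refine (dist_triangle _ (z.2, z.1.2) _).trans ?_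
    rw [← hd]
    have : dist (s z) (z.2, z.1.2) = |f (z.2, z.1.2)| * ‖e‖ := by
      rw [Prod.dist_eq, dist_self, max_eq_right dist_nonneg, dist_eq_norm]
      simp [s, norm_smul]
    rw [this]
    nlinarith [mul_le_mul_of_nonneg_right hfb (norm_nonneg e)]
  have hsB : (s z).2 ∈ B z.2 := a6.self_of_nhds.2 (le_of_eq a8)
  -- the convex set `B(ξ')` lies on one side of its tangent plane at the boundary point `s z`
  have hneg : fderiv ℝ r (s z) (0, η - (s z).2) ≤ 0 := by
    by_contra! hpos
    have hline : HasDerivAt (fun t : ℝ => s z + t • ((0 : V), η - (s z).2))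
        (0, η - (s z).2) 0 := by
      simpa using ((hasDerivAt_id (0 : ℝ)).smul_const ((0 : V), η - (s z).2)).const_add (s z)
    have hdr : HasDerivAt (fun t : ℝ => r (s z + t • ((0 : V), η - (s z).2)))
        (fderiv ℝ r (s z) (0, η - (s z).2)) 0 := by
      refine HasFDerivAt.comp_hasDerivAt (l := r)
        (f := fun t : ℝ => s z + t • ((0 : V), η - (s z).2)) 0 ?_ hline
      have := (a12.differentiableAt two_ne_zero).hasFDerivAt
      simpa using this
    have hr00 : r (s z) = 0 := a8
    have hgt : ∀ᶠ t in 𝓝[>] (0 : ℝ), 0 < r (s z + t • ((0 : V), η - (s z).2)) := by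
      have h1 := (hasDerivAt_iff_tendsto_slope.1 hdr).eventually (lt_mem_nhds hpos)
      have h2 : 𝓝[>] (0 : ℝ) ≤ 𝓝[≠] 0 := nhdsWithin_mono _ fun t ht => ne_of_gt ht
      filter_upwards [h2 h1, self_mem_nhdsWithin] with t ht ht0
      rw [slope_def_field] at ht
      simp only [zero_smul, add_zero, hr00, sub_zero] at ht
      exact (div_pos_iff_of_pos_right ht0).1 ht
    have hmem : ∀ᶠ t in 𝓝[>] (0 : ℝ), t < 1 :=
      nhdsWithin_le_nhds (Iio_mem_nhds one_pos)
    have hnear : ∀ᶠ t in 𝓝[>] (0 : ℝ), (s z + t • ((0 : V), η - (s z).2)).2 ∈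
        B (s z + t • ((0 : V), η - (s z).2)).1 ↔ r (s z + t • ((0 : V), η - (s z).2)) ≤ 0 := by
      have ht : Tendsto (fun t : ℝ => s z + t • ((0 : V), η - (s z).2)) (𝓝[>] 0) (𝓝 (s z)) := by
        have := hline.continuousAt.tendsto
        simp only [zero_smul, add_zero] at this
        exact this.mono_left nhdsWithin_le_nhds
      exact ht.eventually a6
    obtain ⟨t, ht1, ht2, ht3, ht4⟩ := (hgt.and (hmem.and (hnear.and self_mem_nhdsWithin))).exists
    refine absurd (ht3.1 ?_) (not_le.2 ht1)
    have : (s z).2 + t • (η - (s z).2) ∈ B z.2 :=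
      a10.add_smul_sub_mem hsB hη' ⟨le_of_lt ht4, ht2.le⟩
    simpa [s] using this
  have hηn : ‖η - z.1.2‖ ≤ R + (‖η₀‖ + 1) := (norm_sub_le _ _).trans (add_le_add (a11 η hη') a7.le)
  -- comparison of the tangent planes at `z` and at `s z`, which are at a distance `O(ξ' - ξ)`
  have e1 : fderiv ℝ r z.1 (0, η - z.1.2) = (fderiv ℝ r z.1 - fderiv ℝ r (s z)) (0, η - z.1.2)
      + fderiv ℝ r (s z) (0, η - (s z).2) + fderiv ℝ r (s z) (0, f (z.2, z.1.2) • e) := by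
    have e2 : η - (s z).2 + f (z.2, z.1.2) • e = η - z.1.2 := by
      simp only [s]
      abel
    rw [sub_apply, add_assoc, ← map_add, Prod.mk_add_mk, e2]
    simp
  have b1 : (fderiv ℝ r z.1 - fderiv ℝ r (s z)) (0, η - z.1.2)
      ≤ K₂ * (1 + K₁ * ‖e‖) * (R + (‖η₀‖ + 1)) * ‖z.2 - z.1.1‖ := by
    have h1 : ‖fderiv ℝ r z.1 - fderiv ℝ r (s z)‖ ≤ K₂ * ((1 + K₁ * ‖e‖) * ‖z.2 - z.1.1‖) := by
      rw [← dist_eq_norm]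
      refine (hL₂.dist_le_mul _ a3 _ a4).trans ?_
      rw [dist_comm]
      exact mul_le_mul_of_nonneg_left hsz K₂.2
    have h2 : ‖((0 : V), η - z.1.2)‖ ≤ R + (‖η₀‖ + 1) := by
      rw [Prod.norm_mk, norm_zero, max_eq_right (norm_nonneg _)]; exact hηn
    calc _ ≤ ‖(fderiv ℝ r z.1 - fderiv ℝ r (s z)) (0, η - z.1.2)‖ := Real.le_norm_self _
      _ ≤ _ := ContinuousLinearMap.le_opNorm _ _
      _ ≤ (K₂ * ((1 + K₁ * ‖e‖) * ‖z.2 - z.1.1‖)) * (R + (‖η₀‖ + 1)) :=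
        mul_le_mul h1 h2 (norm_nonneg _) ((norm_nonneg _).trans h1)
      _ = _ := by ring
  have b2 : fderiv ℝ r (s z) (0, f (z.2, z.1.2) • e) ≤ D * (K₁ * ‖e‖) * ‖z.2 - z.1.1‖ := by
    have h2 : ‖((0 : V), f (z.2, z.1.2) • e)‖ ≤ K₁ * ‖z.2 - z.1.1‖ * ‖e‖ := by
      rw [Prod.norm_mk, norm_zero, max_eq_right (norm_nonneg _), norm_smul, Real.norm_eq_abs]
      exact mul_le_mul_of_nonneg_right hfb (norm_nonneg _)
    calc _ ≤ ‖fderiv ℝ r (s z) (0, f (z.2, z.1.2) • e)‖ := Real.le_norm_self _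
      _ ≤ _ := ContinuousLinearMap.le_opNorm _ _
      _ ≤ D * (K₁ * ‖z.2 - z.1.1‖ * ‖e‖) :=
        mul_le_mul a5.le h2 (norm_nonneg _) ((norm_nonneg _).trans a5.le)
      _ = _ := by ring
  rw [e1, add_mul]
  linarith

end Calculus

end ThinBilliard

namespace ThinBilliard

/-! ### Convex Hamiltonians -/

set_option synthInstance.maxHeartbeats 400000
set_option maxHeartbeats 1000000
set_option linter.unusedSectionVars false

section Convexity

variable {E : Type*} [NormedAddCommGroup E] [NormedSpace ℝ E] [FiniteDimensional ℝ E]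
  {M : Type*} [TopologicalSpace M] [ChartedSpace E M] [IsManifold 𝓘(ℝ, E) ∞ M]
  {H : M → (E →L[ℝ] ℝ) → ℝ}

theorem IsHamiltonian.isC3 (hH : IsHamiltonian H) : IsC3 H := hH.contDiffOn

/-- The velocity `∂H/∂p` at the point `m` of `T*M`. -/
noncomputable def vel (H : M → (E →L[ℝ] ℝ) → ℝ) (m : M × (E →L[ℝ] ℝ)) : E :=
  (field H m.1 (phaseCoord m.1 m)).1

theorem coordHam_self (q : M) (y : E →L[ℝ] ℝ) : coordHam H q (chartAt E q q, y) = H q y := by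
  have h := phasePt_phaseCoord (m := (q, y)) (mem_chart_source E q)
  rw [phaseCoord_self (q, y)] at h
  rw [coordHam_eq, h]

theorem contDiffAt_fiber (hH : IsC3 H) (q : M) (p : E →L[ℝ] ℝ) : ContDiffAt ℝ 3 (H q) p := by
  have h : H q = fun y => coordHam H q (chartAt E q q, y) := funext fun y => (coordHam_self q y).symm
  rw [h]
  exact ContDiffAt.comp (g := coordHam H q) (f := fun y => (chartAt E q q, y)) p
    (hH.contDiffAt ((chartAt E q).map_source (mem_chart_source E q))) (by fun_prop)

theorem isVelocity_vel (hH : IsC3 H) (q : M) (p : E →L[ℝ] ℝ) : IsVelocity H q p (vel H (q, p)) := by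
  intro ξ
  have h : H q = fun y => coordHam H q (chartAt E q q, y) := funext fun y => (coordHam_self q y).symm
  have h1 : HasFDerivAt (fun y => coordHam H q (chartAt E q q, y))
      (fderiv ℝ (coordHam H q) (chartAt E q q, p) ∘L
        (0 : (E →L[ℝ] ℝ) →L[ℝ] E).prod (ContinuousLinearMap.id ℝ _)) p :=
    HasFDerivAt.comp (g := coordHam H q) (f := fun y => (chartAt E q q, y)) p
      ((hH.contDiffAt ((chartAt E q).map_source (mem_chart_source E q))).differentiableAt
        (by simp)).hasFDerivAt ((hasFDerivAt_const _ _).prodMk (hasFDerivAt_id p))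
  rw [← h] at h1
  rw [h1.fderiv, ContinuousLinearMap.comp_apply, fderiv_eq_hamField, vel, field,
    phaseCoord_self (q, p)]
  simp

theorem lag_eq_vel (m : M × (E →L[ℝ] ℝ)) : lag H m = m.2 (vel H m) := rfl

theorem hasDerivAt_line (hH : IsC3 H) (q : M) (p d : E →L[ℝ] ℝ) :
    HasDerivAt (fun τ : ℝ => H q (p + τ • d)) (d (vel H (q, p))) 0 := by
  rw [← isVelocity_vel hH q p d]
  refine HasFDerivAt.comp_hasDerivAt (l := H q) (f := fun τ : ℝ => p + τ • d) 0 ?_ ?_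
  · have := ((contDiffAt_fiber hH q p).differentiableAt (by simp)).hasFDerivAt
    simpa using this
  · simpa using ((hasDerivAt_id (0 : ℝ)).smul_const d).const_add p

/-- The gradient inequality for the Hamiltonian. -/
theorem IsHamiltonian.add_le (hH : IsHamiltonian H) (q : M) (p p' : E →L[ℝ] ℝ) :
    H q p + (p' - p) (vel H (q, p)) ≤ H q p' := by
  have h1 := (hasDerivAt_iff_tendsto_slope.1 (hasDerivAt_line hH.isC3 q p (p' - p)))
  have h2 : 𝓝[>] (0 : ℝ) ≤ 𝓝[≠] 0 := nhdsWithin_mono _ fun t ht => ne_of_gt ht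
  have h3 : (p' - p) (vel H (q, p)) ≤ H q p' - H q p := by
    refine le_of_tendsto (h1.mono_left h2) ?_
    filter_upwards [self_mem_nhdsWithin, nhdsWithin_le_nhds (Iio_mem_nhds one_pos)] with t ht ht1
    have ht0 : (0 : ℝ) < t := ht
    have ht1' : t < 1 := ht1
    have h4 := (hH.strictConvex q).convexOn.2 (mem_univ p) (mem_univ p')
      (show 0 ≤ 1 - t by linarith) ht0.le (by ring)
    have h5 : (1 - t) • p + t • p' = p + t • (p' - p) := by module
    rw [h5, smul_eq_mul, smul_eq_mul] at h4
    rw [slope_def_field, div_le_iff₀ (by linarith)]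
    simp only [zero_smul, add_zero, sub_zero]
    linarith
  linarith

theorem IsHamiltonian.add_lt (hH : IsHamiltonian H) {q : M} {p p' : E →L[ℝ] ℝ} (h : p ≠ p') :
    H q p + (p' - p) (vel H (q, p)) < H q p' := by
  have h1 := (hH.strictConvex q).2 (mem_univ p) (mem_univ p') h
    (show (0 : ℝ) < 1 / 2 by norm_num) (show (0 : ℝ) < 1 / 2 by norm_num) (by norm_num)
  have h2 := hH.add_le q p ((1 / 2 : ℝ) • p + (1 / 2 : ℝ) • p')
  have h3 : (1 / 2 : ℝ) • p + (1 / 2 : ℝ) • p' - p = (1 / 2 : ℝ) • (p' - p) := by module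
  rw [h3] at h2
  have h4 : ((1 / 2 : ℝ) • (p' - p)) (vel H (q, p)) = 1 / 2 * (p' - p) (vel H (q, p)) := rfl
  rw [h4] at h2
  simp only [smul_eq_mul] at h1
  linarith

theorem IsHamiltonian.bddBelow (hH : IsHamiltonian H) (q : M) : BddBelow (range (H q)) := by
  have h1 := (hH.superlinear q).eventually (eventually_ge_atTop 0)
  rw [Filter.Eventually, mem_cocompact] at h1
  obtain ⟨t, ht, htc⟩ := h1
  have hc : Continuous (H q) :=
    continuous_iff_continuousAt.2 fun p => (contDiffAt_fiber hH.isC3 q p).continuousAt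
  obtain ⟨b, hb⟩ := ((ht.insert 0).image hc).bddBelow
  refine ⟨min b 0, ?_⟩
  rintro _ ⟨p, rfl⟩
  by_cases hp : p ∈ insert 0 t
  · exact (min_le_left _ _).trans (hb (mem_image_of_mem _ hp))
  · rw [mem_insert_iff, not_or] at hp
    have h2 : 0 ≤ H q p / ‖p‖ := htc hp.2
    refine (min_le_right _ _).trans ?_
    by_contra! hneg
    exact absurd h2 (not_le.2 (div_neg_of_neg_of_pos hneg (norm_pos_iff.2 hp.1)))

theorem IsHamiltonian.mem_possibleMotion (hH : IsHamiltonian H) {e : ℝ} {q : M}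
    {p : E →L[ℝ] ℝ} (h : H q p < e) : q ∈ possibleMotion H e :=
  (ciInf_le (hH.bddBelow q) p).trans_lt h

theorem IsHamiltonian.isOpen_possibleMotion (hH : IsHamiltonian H) (e : ℝ) :
    IsOpen (possibleMotion H e) := by
  rw [isOpen_iff_mem_nhds]
  intro q hq
  obtain ⟨p, hp⟩ := exists_lt_of_ciInf_lt (show iInf (H q) < e from hq)
  have h1 : ContinuousAt (fun q' => coordHam H q (chartAt E q q', p)) q := by
    refine ContinuousAt.comp (g := coordHam H q) (f := fun q' => (chartAt E q q', p)) ?_ ?_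
    · exact (hH.isC3.contDiffAt
        ((chartAt E q).map_source (mem_chart_source E q))).continuousAt
    · exact ((chartAt E q).continuousAt (mem_chart_source E q)).prodMk continuousAt_const
  have h2 : ∀ᶠ q' in 𝓝 q, coordHam H q (chartAt E q q', p) < e :=
    h1.eventually (Iio_mem_nhds (by simpa only [coordHam_self] using hp))
  filter_upwards [h2, (chartAt E q).open_source.mem_nhds (mem_chart_source E q)] with q' hq' hs
  rw [coordHam_eq] at hq'
  have h3 : (phasePt q (chartAt E q q', p)).1 = q' := (chartAt E q).left_inv hs
  rw [h3] at hq'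
  exact hH.mem_possibleMotion hq'

/-- In the domain of possible motion the velocity does not vanish. -/
theorem IsHamiltonian.vel_ne_zero (hH : IsHamiltonian H) {e : ℝ} {q : M} {p : E →L[ℝ] ℝ}
    (hq : q ∈ possibleMotion H e) (hp : H q p = e) : vel H (q, p) ≠ 0 := by
  intro h
  obtain ⟨p', hp'⟩ := exists_lt_of_ciInf_lt (show iInf (H q) < e from hq)
  have := hH.add_le q p p'
  rw [h, map_zero] at this
  linarith

/-- By convexity, the maximum defining the Jacobi norm of the velocity `∂H/∂p (q, p)` is attained
at `p`. -/
theorem IsHamiltonian.jacobiNorm_vel (hH : IsHamiltonian H) {e : ℝ} {q : M} {p : E →L[ℝ] ℝ}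
    (hp : H q p = e) : jacobiNorm H e q (vel H (q, p)) = lag H (q, p) := by
  refine IsGreatest.csSup_eq ⟨⟨p, hp, rfl⟩, ?_⟩
  rintro _ ⟨p', hp', rfl⟩
  have := hH.add_le q p p'
  rw [sub_apply] at this
  rw [lag_eq_vel]
  simp only
  linarith

end Convexity

/-! ### Orbits joining two points -/

section Segments

variable {E : Type*} [NormedAddCommGroup E] [NormedSpace ℝ E] [FiniteDimensional ℝ E]
  {M : Type*} [TopologicalSpace M] [ChartedSpace E M] [IsManifold 𝓘(ℝ, E) ∞ M]
  {H : M → (E →L[ℝ] ℝ) → ℝ} {e : ℝ} {γ : ℝ → M} {p : ℝ → E →L[ℝ] ℝ} {t₀ t₁ : ℝ}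

theorem phasePt_self (q : M) (y : E →L[ℝ] ℝ) : phasePt q (chartAt E q q, y) = (q, y) := by
  have h := phasePt_phaseCoord (m := (q, y)) (mem_chart_source E q)
  rwa [phaseCoord_self (q, y)] at h

theorem IsOrbit.traj (h : IsOrbit H e γ p t₀ t₁) :
    Traj H (fun s => (γ (s + t₀), p (s + t₀))) 0 (t₁ - t₀) := by
  have h1 : Traj H (fun s => (γ s, p s)) t₀ t₁ := h.trajectory
  have h2 := h1.comp_add t₀
  rwa [sub_self] at h2

/-- Orbits are flow lines, and the flow is smooth along them. -/
theorem IsOrbit.smoothFlow [T2Space M] (hH : IsC3 H) (h : IsOrbit H e γ p t₀ t₁) {s : ℝ}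
    (hs : s ∈ Icc 0 (t₁ - t₀)) :
    flow H (γ t₀, p t₀) s = (γ (s + t₀), p (s + t₀)) ∧
      ∀ q, γ (s + t₀) ∈ (chartAt E q).source →
        SmoothFlow H (γ t₀) q (chartAt E (γ t₀) (γ t₀), p t₀) s := by
  have h0 : (γ (0 + t₀), p (0 + t₀)) = (γ t₀, p t₀) := by rw [zero_add]
  have key : ∀ q, γ (s + t₀) ∈ (chartAt E q).source → _ := fun q hq =>
    h.traj.smoothFlow hH hs (q₀ := γ t₀) (q₁ := q) (by simp) hq
  simp only [h0, phaseCoord_self (γ t₀, p t₀)] at key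
  exact ⟨(key (γ (s + t₀)) (mem_chart_source E _)).1, fun q hq => (key q hq).2⟩

/-- Orbits with nearby initial values and the same energy exist for nearly the same time. -/
theorem IsOrbit.eventually_flow [T2Space M] (hH : IsHamiltonian H) (h : IsOrbit H e γ p t₀ t₁)
    (ht : t₀ ≤ t₁) :
    ∀ᶠ w in 𝓝 ((chartAt E (γ t₀) (γ t₀), p t₀), t₁ - t₀), ∀ r ∈ Icc 0 w.2,
      Good H (phasePt (γ t₀) w.1) r ∧ (flow H (phasePt (γ t₀) w.1) r).1 ∈ possibleMotion H e := by
  refine eventually_forall_Icc (sub_nonneg.2 ht) (Q := fun w => Good H (phasePt (γ t₀) w.1) w.2 ∧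
    (flow H (phasePt (γ t₀) w.1) w.2).1 ∈ possibleMotion H e) fun r hr => ?_
  obtain ⟨h1, h2⟩ := h.smoothFlow hH.isC3 hr
  have h3 := h2 (γ (r + t₀)) (mem_chart_source E _)
  refine h3.good.and (h3.continuousAt_base.eventually ((hH.isOpen_possibleMotion e).mem_nhds ?_))
  simp only [phasePt_self, h1]
  exact h.motion _ ⟨by linarith [hr.1], by linarith [hr.2]⟩

theorem Good.energy [T2Space M] (hH : IsC3 H) {m : M × (E →L[ℝ] ℝ)} {s : ℝ} (h : Good H m s) :
    H (flow H m s).1 (flow H m s).2 = H m.1 m.2 := by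
  obtain ⟨a, b, ha, hb, hs, hc, -⟩ := h.exists_traj hH
  have := hc.energy hH (Ioo_subset_Icc_self hs) (show (0 : ℝ) ∈ Icc a b from ⟨ha.le, hb.le⟩)
  rwa [flow_zero] at this

theorem isOrbit_flow [T2Space M] (hH : IsC3 H) {m : M × (E →L[ℝ] ℝ)} {T : ℝ} (t : ℝ)
    (hT : 0 ≤ T) (he : H m.1 m.2 = e)
    (h : ∀ r ∈ Icc 0 T, Good H m r ∧ (flow H m r).1 ∈ possibleMotion H e) :
    IsOrbit H e (fun s => (flow H m (s - t)).1) (fun s => (flow H m (s - t)).2) t (t + T) := by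
  refine ⟨?_, fun s hs => ?_, fun s hs => ?_⟩
  · obtain ⟨a, b, ha, hb, hs, hc, -⟩ := (h T ⟨hT, le_rfl⟩).1.exists_traj hH
    have h1 := (hc.comp_add (-t)).mono (a' := t) (b' := t + T) (by linarith) (by linarith [hs.2])
    exact h1
  · rw [← he]
    exact (h (s - t) ⟨by linarith [hs.1], by linarith [hs.2]⟩).1.energy hH
  · exact (h (s - t) ⟨by linarith [hs.1], by linarith [hs.2]⟩).2

theorem SmoothFlow.fderiv_time [T2Space M] (hH : IsC3 H) {q₀ q₁ : M} {z : E × (E →L[ℝ] ℝ)} {s : ℝ}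
    (h : SmoothFlow H q₀ q₁ z s) :
    fderiv ℝ (flowC H q₀ q₁) (z, s) (0, 1) = field H q₁ (flowC H q₀ q₁ (z, s)) := by
  obtain ⟨a, b, ha, hb, hs, hc, -⟩ := h.good.self_of_nhds.exists_traj hH
  have h1 := (hc.hasDerivWithinAt hH (Ioo_subset_Icc_self hs) h.mem_source.self_of_nhds).hasDerivAt
    (Icc_mem_nhds hs.1 hs.2)
  have h2 : HasDerivAt (fun r : ℝ => flowC H q₀ q₁ (z, r))
      (fderiv ℝ (flowC H q₀ q₁) (z, s) (0, 1)) s :=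
    HasFDerivAt.comp_hasDerivAt (l := flowC H q₀ q₁) (f := fun r : ℝ => (z, r)) s
      (h.contDiffAt.differentiableAt two_ne_zero).hasFDerivAt
      ((hasDerivAt_const _ _).prodMk (hasDerivAt_id _))
  exact h2.unique h1

/-- Non-conjugate end points: infinitesimally, an orbit of energy `E` starting at `γ(t₀)` is
determined by its end point. -/
theorem NonConjugate.injective [T2Space M] (hH : IsHamiltonian H) (h : IsOrbit H e γ p t₀ t₁)
    (ht : t₀ < t₁) (hc : NonConjugate H e γ p t₀ t₁) {dy : E →L[ℝ] ℝ} {dT : ℝ}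
    (h1 : (fderiv ℝ (flowC H (γ t₀) (γ t₁)) ((chartAt E (γ t₀) (γ t₀), p t₀), t₁ - t₀)
      ((0, dy), dT)).1 = 0) (h2 : dy (vel H (γ t₀, p t₀)) = 0) : dy = 0 ∧ dT = 0 := by
  set q₀ := γ t₀ with hq₀
  set q₁ := γ t₁ with hq₁
  set z₀ : E × (E →L[ℝ] ℝ) := (chartAt E q₀ q₀, p t₀) with hz₀
  have ht0 : t₀ ∈ Icc t₀ t₁ := ⟨le_rfl, ht.le⟩
  have ht1 : t₁ ∈ Icc t₀ t₁ := ⟨ht.le, le_rfl⟩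
  have hv0 : vel H (q₀, p t₀) ≠ 0 := hH.vel_ne_zero (h.motion _ ht0) (h.energy _ ht0)
  have hv1 : vel H (q₁, p t₁) ≠ 0 := hH.vel_ne_zero (h.motion _ ht1) (h.energy _ ht1)
  obtain ⟨η₀, hη₀⟩ := SeparatingDual.exists_eq_one (R := ℝ) hv0
  -- a curve of momenta of energy `E` with the tangent vector `dy`
  let F : ℝ × ℝ → ℝ := fun x => H q₀ (p t₀ + x.1 • dy + x.2 • η₀)
  have hH0 : ContDiffAt ℝ 3 (H q₀) (p t₀ + (0 : ℝ) • dy + (0 : ℝ) • η₀) := by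
    simpa using contDiffAt_fiber hH.isC3 q₀ (p t₀)
  have hF : ContDiffAt ℝ 3 F (0, 0) :=
    ContDiffAt.comp (g := H q₀) (f := fun x : ℝ × ℝ => p t₀ + x.1 • dy + x.2 • η₀) _ hH0
      (by fun_prop)
  have hHd : HasFDerivAt (H q₀) (fderiv ℝ (H q₀) (p t₀)) (p t₀ + (0 : ℝ) • dy + (0 : ℝ) • η₀) := by
    have := (hH0.differentiableAt (by simp)).hasFDerivAt
    simpa using this
  have hdF : ∀ a b : ℝ, fderiv ℝ F (0, 0) (a, b) = b := by
    intro a b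
    have e1 : HasDerivAt (fun t : ℝ => F (t * a, t * b)) (fderiv ℝ F (0, 0) (a, b)) 0 := by
      refine HasFDerivAt.comp_hasDerivAt (l := F) (f := fun t : ℝ => (t * a, t * b)) 0 ?_ ?_
      · have := (hF.differentiableAt (by simp)).hasFDerivAt
        simpa using this
      · simpa using ((hasDerivAt_id (0 : ℝ)).mul_const a).prodMk
          ((hasDerivAt_id (0 : ℝ)).mul_const b)
    have e2 : HasDerivAt (fun t : ℝ => F (t * a, t * b)) (fderiv ℝ (H q₀) (p t₀) (a • dy + b • η₀))
        0 := by
      refine HasFDerivAt.comp_hasDerivAt (l := H q₀)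
        (f := fun t : ℝ => p t₀ + (t * a) • dy + (t * b) • η₀) 0 ?_ ?_
      · simpa using hHd
      · have := ((((hasDerivAt_id (0 : ℝ)).mul_const a).smul_const dy).const_add (p t₀)).fun_add
          (((hasDerivAt_id (0 : ℝ)).mul_const b).smul_const η₀)
        simpa using this
    rw [e1.unique e2, isVelocity_vel hH.isC3]
    have : (a • dy + b • η₀) (vel H (q₀, p t₀))
      = a * dy (vel H (q₀, p t₀)) + b * η₀ (vel H (q₀, p t₀)) := rfl
    rw [this, h2, hη₀]
    ring
  obtain ⟨f, hf, hf0, hfF, -⟩ := exists_implicit (by simp) hF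
    (fun v hv => by rwa [hdF] at hv) rfl
  have hF0 : F (0, 0) = e := by
    simp only [F, zero_smul, add_zero]
    exact h.energy _ ht0
  have hfd : HasDerivAt f 0 0 := by
    have e1 := (hf.differentiableAt (by simp)).hasFDerivAt.hasDerivAt
    have e2 : HasDerivAt (fun σ : ℝ => F (σ, f σ)) (fderiv ℝ F (0, 0) (1, fderiv ℝ f 0 1)) 0 := by
      refine HasFDerivAt.comp_hasDerivAt (l := F) (f := fun σ : ℝ => (σ, f σ)) 0 ?_
        ((hasDerivAt_id _).prodMk e1)
      rw [hf0]
      exact (hF.differentiableAt (by simp)).hasFDerivAt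
    have e3 : HasDerivAt (fun σ : ℝ => F (σ, f σ)) 0 0 :=
      (hasDerivAt_const 0 (F (0, 0))).congr_of_eventuallyEq hfF
    have e4 := e2.unique e3
    rw [hdF] at e4
    rwa [e4] at e1
  let Y : ℝ → E →L[ℝ] ℝ := fun σ => p t₀ + σ • dy + f σ • η₀
  have hY0 : Y 0 = p t₀ := by simp [Y, hf0]
  have hYd : HasDerivAt Y dy 0 := by
    have := (((hasDerivAt_id (0 : ℝ)).smul_const dy).const_add (p t₀)).fun_add (hfd.smul_const η₀)
    simpa using this
  let w : ℝ → (E × (E →L[ℝ] ℝ)) × ℝ := fun σ => ((chartAt E q₀ q₀, Y σ), t₁ - t₀)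
  have hw0 : w 0 = (z₀, t₁ - t₀) := by simp only [w, hY0, hz₀]
  have hwd : HasDerivAt w ((0, dy), 0) 0 :=
    ((hasDerivAt_const _ _).prodMk hYd).prodMk (hasDerivAt_const _ _)
  have hwt : Tendsto w (𝓝 0) (𝓝 (z₀, t₁ - t₀)) := by
    rw [← hw0]
    exact hwd.continuousAt
  have hT : t₁ - t₀ ∈ Icc 0 (t₁ - t₀) := ⟨by linarith, le_rfl⟩
  obtain ⟨hfl, hsm⟩ := h.smoothFlow hH.isC3 hT
  rw [sub_add_cancel] at hfl hsm
  have hS : SmoothFlow H q₀ q₁ z₀ (t₁ - t₀) := hsm q₁ (mem_chart_source E _)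
  have hpt : ∀ σ, phasePt q₀ (w σ).1 = (q₀, Y σ) := fun σ => phasePt_self q₀ (Y σ)
  have hC0 : flowC H q₀ q₁ (z₀, t₁ - t₀) = phaseCoord q₁ (q₁, p t₁) := by
    simp only [flowC, hz₀, phasePt_self, hq₀, hfl, hq₁]
  have htime := hS.fderiv_time hH.isC3
  rw [hC0] at htime
  have hsplit : fderiv ℝ (flowC H q₀ q₁) (z₀, t₁ - t₀) ((0, dy), dT)
      = fderiv ℝ (flowC H q₀ q₁) (z₀, t₁ - t₀) ((0, dy), 0)
        + dT • field H q₁ (phaseCoord q₁ (q₁, p t₁)) := by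
    rw [← htime, ← map_smul, ← map_add]
    simp
  have hv : (fderiv ℝ (flowC H q₀ q₁) (z₀, t₁ - t₀) ((0, dy), 0)).1
      = (-dT) • vel H (q₁, p t₁) := by
    rw [hsplit] at h1
    have h1' : (fderiv ℝ (flowC H q₀ q₁) (z₀, t₁ - t₀) ((0, dy), 0)).1
      + dT • vel H (q₁, p t₁) = 0 := h1
    rw [neg_smul]
    exact eq_neg_of_add_eq_zero_left h1'
  have hdy : dy = 0 := by
    refine hc (fun σ s => (flow H (q₀, Y σ) (s - t₀)).1) (fun σ s => (flow H (q₀, Y σ) (s - t₀)).2)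
      dy (vel H (q₁, p t₁)) (-dT) ?_ ?_ ?_ (isVelocity_vel hH.isC3 _ _) ?_
    · filter_upwards [hwt.eventually (h.eventually_flow hH ht.le), hfF] with σ hσ hσF
      rw [hpt] at hσ
      refine ⟨?_, ?_⟩
      · have := isOrbit_flow (e := e) hH.isC3 t₀ (sub_nonneg.2 ht.le) (hσF.trans hF0) hσ
        rwa [add_sub_cancel] at this
      · simp only [sub_self, flow_zero]
        rfl
    · intro s hs
      have := (h.smoothFlow hH.isC3 (s := s - t₀) ⟨by linarith [hs.1], by linarith [hs.2]⟩).1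
      rw [sub_add_cancel] at this
      simp only [hY0, hq₀, this, and_self]
    · simpa only [sub_self, flow_zero] using hYd
    · have hb := hS.continuousAt_base
      have hcomp : (fun σ => (flow H (q₀, Y σ) (t₁ - t₀)).1)
          = (fun w : (E × (E →L[ℝ] ℝ)) × ℝ => (flow H (phasePt q₀ w.1) w.2).1) ∘ w := by
        funext σ
        simp only [Function.comp, hpt]
        rfl
      have hend : (flow H (q₀, Y 0) (t₁ - t₀)).1 = q₁ := by
        rw [hY0]
        exact congrArg Prod.fst hfl
      refine ⟨?_, ?_⟩
      · show ContinuousAt (fun σ => (flow H (q₀, Y σ) (t₁ - t₀)).1) 0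
        rw [hcomp]
        refine ContinuousAt.comp ?_ hwd.continuousAt
        rw [hw0]
        exact hb
      · show HasDerivAt (fun τ => chartAt E (flow H (q₀, Y 0) (t₁ - t₀)).1
          (flow H (q₀, Y τ) (t₁ - t₀)).1) _ 0
        rw [hend, ← hv]
        have e1 : HasDerivAt (fun σ => flowC H q₀ q₁ (w σ))
            (fderiv ℝ (flowC H q₀ q₁) (z₀, t₁ - t₀) ((0, dy), 0)) 0 := by
          refine HasFDerivAt.comp_hasDerivAt (l := flowC H q₀ q₁) (f := w) 0 ?_ hwd
          rw [hw0]
          exact (hS.contDiffAt.differentiableAt two_ne_zero).hasFDerivAt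
        have e2 : HasDerivAt (fun σ => (flowC H q₀ q₁ (w σ)).1)
            (fderiv ℝ (flowC H q₀ q₁) (z₀, t₁ - t₀) ((0, dy), 0)).1 0 := e1.fst
        refine e2.congr_of_eventuallyEq (Eventually.of_forall fun σ => ?_)
        simp only [flowC, hpt]
        rfl
  refine ⟨hdy, ?_⟩
  subst hdy
  have : fderiv ℝ (flowC H q₀ q₁) (z₀, t₁ - t₀) ((0, 0), 0) = 0 := map_zero _
  rw [this] at hv
  have h3 : -dT = 0 := (smul_eq_zero.1 hv.symm).resolve_right hv1
  linarith

end Segments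

end ThinBilliard

namespace ThinBilliard

/-! ### Action functions -/

set_option synthInstance.maxHeartbeats 400000
set_option maxHeartbeats 1000000
set_option linter.unusedSectionVars false

section Action

variable {E : Type*} [NormedAddCommGroup E] [NormedSpace ℝ E] [FiniteDimensional ℝ E]
  {M : Type*} [TopologicalSpace M] [ChartedSpace E M] [IsManifold 𝓘(ℝ, E) ∞ M]
  {H : M → (E →L[ℝ] ℝ) → ℝ} {e : ℝ} {γ : ℝ → M} {p : ℝ → E →L[ℝ] ℝ} {t₀ t₁ : ℝ}

/-- The initial value and the travel time of the orbit with the end points `x`, in coordinates,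
if its initial momentum and travel time are `Y x`. -/
def segInit (Y : E × E → (E →L[ℝ] ℝ) × ℝ) (x : E × E) : (E × (E →L[ℝ] ℝ)) × ℝ :=
  ((x.1, (Y x).1), (Y x).2)

/-- `Y` gives the initial momenta and the travel times of a family of orbits of energy `e` joining
points near `q₀` to points near `q₁`; everything is written in the charts at `q₀` and `q₁`. -/
structure SegmentFamily (H : M → (E →L[ℝ] ℝ) → ℝ) (e : ℝ) (q₀ q₁ : M)
    (Y : E × E → (E →L[ℝ] ℝ) × ℝ) : Prop where
  smooth : SmoothFlow H q₀ q₁ (segInit Y (chartAt E q₀ q₀, chartAt E q₁ q₁)).1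
    (segInit Y (chartAt E q₀ q₀, chartAt E q₁ q₁)).2
  contDiffAt : ContDiffAt ℝ 2 Y (chartAt E q₀ q₀, chartAt E q₁ q₁)
  solves : ∀ᶠ x in 𝓝 (chartAt E q₀ q₀, chartAt E q₁ q₁),
    (flowC H q₀ q₁ (segInit Y x)).1 = x.2 ∧ coordHam H q₀ (segInit Y x).1 = e

theorem SegmentFamily.contDiffAt_segInit {q₀ q₁ : M} {Y : E × E → (E →L[ℝ] ℝ) × ℝ}
    (h : SegmentFamily H e q₀ q₁ Y) :
    ContDiffAt ℝ 2 (segInit Y) (chartAt E q₀ q₀, chartAt E q₁ q₁) := by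
  have h1 : ContDiffAt ℝ 2 (fun x => (Y x).1) (chartAt E q₀ q₀, chartAt E q₁ q₁) :=
    h.contDiffAt.fst
  have h2 : ContDiffAt ℝ 2 (fun x => (Y x).2) (chartAt E q₀ q₀, chartAt E q₁ q₁) :=
    h.contDiffAt.snd
  exact (contDiffAt_fst.prodMk h1).prodMk h2

/-- The action of the orbits of the family, as a function of the end points. -/
noncomputable def segAction (H : M → (E →L[ℝ] ℝ) → ℝ) (q₀ : M) (Y : E × E → (E →L[ℝ] ℝ) × ℝ)
    (x : E × E) : ℝ :=
  actC H q₀ (segInit Y x)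

theorem SegmentFamily.contDiffAt_segAction {q₀ q₁ : M} {Y : E × E → (E →L[ℝ] ℝ) × ℝ}
    (h : SegmentFamily H e q₀ q₁ Y) :
    ContDiffAt ℝ 2 (segAction H q₀ Y) (chartAt E q₀ q₀, chartAt E q₁ q₁) :=
  ContDiffAt.comp (g := actC H q₀) (f := segInit Y) _ h.smooth.contDiffAt_act h.contDiffAt_segInit

/-- First variation: `dL = y₊ dx₊ - y₋ dx₋`. -/
theorem SegmentFamily.fderiv_segAction (hH : IsC3 H) {q₀ q₁ : M}
    {Y : E × E → (E →L[ℝ] ℝ) × ℝ} (h : SegmentFamily H e q₀ q₁ Y) :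
    ∀ᶠ x in 𝓝 (chartAt E q₀ q₀, chartAt E q₁ q₁), ∀ δ : E × E,
      fderiv ℝ (segAction H q₀ Y) x δ
        = (flowC H q₀ q₁ (segInit Y x)).2 δ.2 - (Y x).1 δ.1 := by
  have hI := h.contDiffAt_segInit
  have ht : Tendsto (segInit Y) (𝓝 (chartAt E q₀ q₀, chartAt E q₁ q₁))
      (𝓝 (segInit Y (chartAt E q₀ q₀, chartAt E q₁ q₁))) := hI.continuousAt
  have htar : ∀ᶠ w in 𝓝 (segInit Y (chartAt E q₀ q₀, chartAt E q₁ q₁)),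
      w.1.1 ∈ (chartAt E q₀).target := by
    have : ContinuousAt (fun w : (E × (E →L[ℝ] ℝ)) × ℝ => w.1.1)
      (segInit Y (chartAt E q₀ q₀, chartAt E q₁ q₁)) := by fun_prop
    exact this.eventually ((chartAt E q₀).open_target.mem_nhds h.smooth.mem_target)
  filter_upwards [hI.eventually (by simp), ht.eventually h.smooth.variation,
    ht.eventually (h.smooth.contDiffAt.eventually (by simp)),
    ht.eventually (h.smooth.contDiffAt_act.eventually (by simp)), h.solves.eventually_nhds,
    ht.eventually htar] with x hx hv hC hA hs htx δ
  have hIx := (hx.differentiableAt two_ne_zero).hasFDerivAt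
  have e0 : HasFDerivAt (fun x => segInit Y x) (fderiv ℝ (segInit Y) x) x := hIx
  have e1 : HasFDerivAt (segAction H q₀ Y)
      (fderiv ℝ (actC H q₀) (segInit Y x) ∘L fderiv ℝ (segInit Y) x) x :=
    HasFDerivAt.comp (g := actC H q₀) (f := segInit Y) x
      (hA.differentiableAt two_ne_zero).hasFDerivAt hIx
  have e2 : HasFDerivAt (fun x => flowC H q₀ q₁ (segInit Y x))
      (fderiv ℝ (flowC H q₀ q₁) (segInit Y x) ∘L fderiv ℝ (segInit Y) x) x :=
    HasFDerivAt.comp (g := flowC H q₀ q₁) (f := segInit Y) x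
      (hC.differentiableAt two_ne_zero).hasFDerivAt hIx
  have e3 : (fderiv ℝ (flowC H q₀ q₁) (segInit Y x) (fderiv ℝ (segInit Y) x δ)).1 = δ.2 := by
    have e4 : HasFDerivAt (fun x : E × E => x.2) _ x :=
      e2.fst.congr_of_eventuallyEq (hs.mono fun y hy => hy.1.symm)
    exact DFunLike.congr_fun (e4.unique hasFDerivAt_snd) δ
  have e5 : fderiv ℝ (coordHam H q₀) (segInit Y x).1 (fderiv ℝ (segInit Y) x δ).1 = 0 := by
    have e6 : HasFDerivAt (fun x => coordHam H q₀ (segInit Y x).1) _ x :=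
      HasFDerivAt.comp (g := coordHam H q₀) (f := fun x => (segInit Y x).1) x
        ((hH.contDiffAt htx).differentiableAt (by simp)).hasFDerivAt e0.fst
    have e7 : HasFDerivAt (fun _ : E × E => e) _ x :=
      e6.congr_of_eventuallyEq (hs.mono fun y hy => hy.2.symm)
    exact DFunLike.congr_fun (e7.unique (hasFDerivAt_const e x)) δ
  have e8 : (fderiv ℝ (segInit Y) x δ).1.1 = δ.1 :=
    DFunLike.congr_fun (e0.fst.fst.unique hasFDerivAt_fst) δ
  rw [e1.fderiv, ContinuousLinearMap.comp_apply, hv, e3, e5, e8, mul_zero, add_zero]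
  rfl

/-- An orbit with non-conjugate end points is contained in a locally unique family of orbits of the
same energy. -/
theorem NonConjugate.exists_segmentFamily [T2Space M] (hH : IsHamiltonian H)
    (h : IsOrbit H e γ p t₀ t₁) (ht : t₀ < t₁) (hc : NonConjugate H e γ p t₀ t₁) :
    ∃ Y, SegmentFamily H e (γ t₀) (γ t₁) Y ∧
      Y (chartAt E (γ t₀) (γ t₀), chartAt E (γ t₁) (γ t₁)) = (p t₀, t₁ - t₀) ∧
      ∀ᶠ w : (E × E) × (E →L[ℝ] ℝ) × ℝ in
          𝓝 ((chartAt E (γ t₀) (γ t₀), chartAt E (γ t₁) (γ t₁)), (p t₀, t₁ - t₀)),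
        (flowC H (γ t₀) (γ t₁) ((w.1.1, w.2.1), w.2.2)).1 = w.1.2 →
        coordHam H (γ t₀) (w.1.1, w.2.1) = e → Y w.1 = w.2 := by
  set q₀ := γ t₀ with hq₀
  set q₁ := γ t₁ with hq₁
  have hT : t₁ - t₀ ∈ Icc 0 (t₁ - t₀) := ⟨by linarith, le_rfl⟩
  obtain ⟨hfl, hsm⟩ := h.smoothFlow hH.isC3 hT
  rw [sub_add_cancel] at hfl hsm
  have hS : SmoothFlow H q₀ q₁ (chartAt E q₀ q₀, p t₀) (t₁ - t₀) := hsm q₁ (mem_chart_source E _)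
  have he : coordHam H q₀ (chartAt E q₀ q₀, p t₀) = e := by
    rw [coordHam_self]
    exact h.energy _ ⟨le_rfl, ht.le⟩
  have hend : flowC H q₀ q₁ ((chartAt E q₀ q₀, p t₀), t₁ - t₀) = (chartAt E q₁ q₁, p t₁) := by
    rw [flowC, phasePt_self, hq₀, hfl, ← hq₁, phaseCoord_self (q₁, p t₁)]
  let ι : (E × E) × (E →L[ℝ] ℝ) × ℝ → (E × (E →L[ℝ] ℝ)) × ℝ := fun w => ((w.1.1, w.2.1), w.2.2)
  let b : (E × E) × (E →L[ℝ] ℝ) × ℝ := ((chartAt E q₀ q₀, chartAt E q₁ q₁), (p t₀, t₁ - t₀))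
  have hι : ContDiff ℝ 2 ι := by fun_prop
  have hSb : ContDiffAt ℝ 2 (fun w => flowC H q₀ q₁ (ι w)) b :=
    ContDiffAt.comp (g := flowC H q₀ q₁) (f := ι) b hS.contDiffAt hι.contDiffAt
  have hHb : ContDiffAt ℝ 3 (coordHam H q₀) (ι b).1 := hH.isC3.contDiffAt hS.mem_target
  -- the two equations for the momentum and the time: the end point is `w.1.2`, the energy is `e`
  let F : (E × E) × (E →L[ℝ] ℝ) × ℝ → E × ℝ := fun w =>
    ((flowC H q₀ q₁ (ι w)).1 - w.1.2, coordHam H q₀ (ι w).1 - e)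
  have hF1 : ContDiffAt ℝ 2 (fun w => (flowC H q₀ q₁ (ι w)).1) b := hSb.fst
  have hF : ContDiffAt ℝ 2 F b := by
    refine (hF1.sub (by fun_prop)).prodMk (ContDiffAt.sub ?_ contDiffAt_const)
    exact ContDiffAt.comp (g := coordHam H q₀) (f := fun w => (ι w).1) b
      (hHb.of_le (by norm_num)) (by fun_prop)
  have hF0 : F b = 0 := by
    simp only [F, ι, b, hend, he, sub_self]
    rfl
  have hinj : ∀ v, fderiv ℝ F b (0, v) = 0 → v = 0 := by
    rintro ⟨dy, dT⟩ hv
    let l : ℝ → (E × E) × (E →L[ℝ] ℝ) × ℝ := fun t => b + t • (0, (dy, dT))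
    have hl : HasDerivAt l (0, (dy, dT)) 0 := by
      have := ((hasDerivAt_id (0 : ℝ)).smul_const ((0 : E × E), (dy, dT))).const_add b
      rwa [one_smul] at this
    have hl0 : l 0 = b := by simp [l]
    have hFl : HasDerivAt (fun t => F (l t)) 0 0 := by
      rw [← hv]
      refine HasFDerivAt.comp_hasDerivAt (l := F) (f := l) 0 ?_ hl
      rw [hl0]
      exact (hF.differentiableAt two_ne_zero).hasFDerivAt
    have hιl : HasDerivAt (fun t => ι (l t)) ((0, dy), dT) 0 := by
      have h1 : HasDerivAt (fun t => (l t).1) 0 0 := hl.fst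
      have h2 : HasDerivAt (fun t => (l t).2) (dy, dT) 0 := hl.snd
      exact (h1.fst.prodMk h2.fst).prodMk h2.snd
    have hx : HasDerivAt (fun t => (F (l t)).1)
        (fderiv ℝ (flowC H q₀ q₁) ((chartAt E q₀ q₀, p t₀), t₁ - t₀) ((0, dy), dT)).1 0 := by
      have h1 : HasDerivAt (fun t => flowC H q₀ q₁ (ι (l t)))
          (fderiv ℝ (flowC H q₀ q₁) ((chartAt E q₀ q₀, p t₀), t₁ - t₀) ((0, dy), dT)) 0 := by
        refine HasFDerivAt.comp_hasDerivAt (l := flowC H q₀ q₁) (f := fun t => ι (l t)) 0 ?_ hιl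
        rw [hl0]
        exact (hS.contDiffAt.differentiableAt two_ne_zero).hasFDerivAt
      have h2 : HasDerivAt (fun t => (l t).1) 0 0 := hl.fst
      have h3 : HasDerivAt (fun t => (flowC H q₀ q₁ (ι (l t))).1)
        (fderiv ℝ (flowC H q₀ q₁) ((chartAt E q₀ q₀, p t₀), t₁ - t₀) ((0, dy), dT)).1 0 := h1.fst
      have h4 : HasDerivAt (fun t => (l t).1.2) 0 0 := h2.snd
      have h5 := h3.fun_sub h4
      rwa [sub_zero] at h5
    have hy : HasDerivAt (fun t => (F (l t)).2) (dy (vel H (q₀, p t₀))) 0 := by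
      have h1 : HasDerivAt (fun t => coordHam H q₀ (ι (l t)).1)
          (fderiv ℝ (coordHam H q₀) (chartAt E q₀ q₀, p t₀) (0, dy)) 0 := by
        refine HasFDerivAt.comp_hasDerivAt (l := coordHam H q₀) (f := fun t => (ι (l t)).1) 0 ?_
          hιl.fst
        rw [hl0]
        exact (hHb.differentiableAt (by simp)).hasFDerivAt
      rw [fderiv_eq_hamField] at h1
      have h2 := h1.sub_const e
      simp only [map_zero, sub_zero] at h2
      rw [vel, phaseCoord_self (q₀, p t₀)]
      exact h2
    have h1 := hx.unique hFl.fst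
    have h2 := hy.unique hFl.snd
    obtain ⟨h3, h4⟩ := hc.injective hH h ht h1 h2
    rw [h3, h4]
    rfl
  have hdim : Module.finrank ℝ ((E →L[ℝ] ℝ) × ℝ) = Module.finrank ℝ (E × ℝ) := by
    rw [Module.finrank_prod, Module.finrank_prod, finrank_dual]
  obtain ⟨Y, hY, hY0, hYF, hYu⟩ := exists_implicit (p₀ := b.1) (y₀ := b.2) two_ne_zero hF hinj hdim
  have hFb : F (b.1, b.2) = 0 := hF0
  have hI0 : segInit Y (chartAt E q₀ q₀, chartAt E q₁ q₁)
      = ((chartAt E q₀ q₀, p t₀), t₁ - t₀) := by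
    have : Y (chartAt E q₀ q₀, chartAt E q₁ q₁) = (p t₀, t₁ - t₀) := hY0
    rw [segInit, this]
  refine ⟨Y, ⟨by rw [hI0]; exact hS, hY, ?_⟩, hY0, ?_⟩
  · filter_upwards [hYF] with x hx
    rw [hFb] at hx
    exact ⟨sub_eq_zero.1 (congrArg Prod.fst hx), sub_eq_zero.1 (congrArg Prod.snd hx)⟩
  · filter_upwards [hYu] with w hw h1 h2
    refine hw ?_
    rw [hFb]
    exact Prod.ext (sub_eq_zero.2 h1) (sub_eq_zero.2 h2)

/-- The Maupertuis action of an orbit. -/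
theorem IsOrbit.maupertuis_eq [T2Space M] (hH : IsHamiltonian H) (h : IsOrbit H e γ p t₀ t₁)
    (ht : t₀ ≤ t₁) : maupertuis H e γ t₀ t₁ = act H (γ t₀, p t₀) (t₁ - t₀) := by
  have h1 : Traj H (fun s => (γ s, p s)) t₀ t₁ := h.trajectory
  have e1 : maupertuis H e γ t₀ t₁ = ∫ s in t₀..t₁, lag H (γ s, p s) := by
    refine intervalIntegral.integral_congr_ae ?_
    -- `velocity` is a two-sided derivative, hence a junk value is possible at the end points
    have hae : ∀ᵐ s : ℝ ∂MeasureTheory.volume, s ≠ t₁ := by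
      rw [MeasureTheory.ae_iff]
      simp
    filter_upwards [hae] with s hs1 hs
    rw [uIoc_of_le ht] at hs
    have hsI : s ∈ Icc t₀ t₁ := Ioc_subset_Icc_self hs
    have hd : HasDerivAt (fun τ => phaseCoord (γ s) (γ τ, p τ))
        (field H (γ s) (phaseCoord (γ s) (γ s, p s))) s :=
      (h1.hasDerivWithinAt hH.isC3 hsI (q₀ := γ s) (mem_chart_source E _)).hasDerivAt
        (Icc_mem_nhds hs.1 (lt_of_le_of_ne hs.2 hs1))
    have hd1 : HasDerivAt (fun τ => chartAt E (γ s) (γ τ)) (vel H (γ s, p s)) s := hd.fst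
    have hv : velocity γ s = vel H (γ s, p s) := hd1.deriv
    rw [hv, hH.jacobiNorm_vel (h.energy s hsI)]
  have e2 : act H (γ t₀, p t₀) (t₁ - t₀)
      = ∫ s in (0 : ℝ)..(t₁ - t₀), lag H (γ (s + t₀), p (s + t₀)) := by
    refine intervalIntegral.integral_congr fun s hs => ?_
    rw [uIcc_of_le (sub_nonneg.2 ht)] at hs
    simp only [(h.smoothFlow hH.isC3 hs).1]
  rw [e1, e2, intervalIntegral.integral_comp_add_right (fun s => lag H (γ s, p s))]
  simp

/-- The action function of an orbit with non-conjugate end points is the action of the family of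
orbits given by the implicit function theorem. -/
theorem IsActionFunction.eventually_eq [T2Space M] (hH : IsHamiltonian H)
    {S : M × M → ℝ} (hS : IsActionFunction H e γ p t₀ t₁ S) {Y : E × E → (E →L[ℝ] ℝ) × ℝ}
    (hYu : ∀ᶠ w : (E × E) × (E →L[ℝ] ℝ) × ℝ in
        𝓝 ((chartAt E (γ t₀) (γ t₀), chartAt E (γ t₁) (γ t₁)), (p t₀, t₁ - t₀)),
      (flowC H (γ t₀) (γ t₁) ((w.1.1, w.2.1), w.2.2)).1 = w.1.2 →
      coordHam H (γ t₀) (w.1.1, w.2.1) = e → Y w.1 = w.2) :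
    ∀ᶠ q in 𝓝 (γ t₀, γ t₁),
      S q = segAction H (γ t₀) Y (chartAt E (γ t₀) q.1, chartAt E (γ t₁) q.2) := by
  obtain ⟨Γ, P, T, hΓ, hP0, hT0, hPc, hTc⟩ := hS
  set q₀ := γ t₀ with hq₀
  set q₁ := γ t₁ with hq₁
  have hsrc : ∀ᶠ q in 𝓝 (q₀, q₁), q.1 ∈ (chartAt E q₀).source ∧ q.2 ∈ (chartAt E q₁).source :=
    prod_mem_nhds ((chartAt E q₀).open_source.mem_nhds (mem_chart_source E _))
      ((chartAt E q₁).open_source.mem_nhds (mem_chart_source E _))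
  -- the family of orbits in coordinates
  let w : M × M → (E × E) × (E →L[ℝ] ℝ) × ℝ := fun q =>
    ((chartAt E q₀ q.1, chartAt E q₁ q.2), (cotCoord q₀ q.1 (P q t₀), T q - t₀))
  have hcc : cotCoord q₀ q₀ (P (q₀, q₁) t₀) = p t₀ := by
    rw [hP0]
    exact congrArg Prod.snd (phaseCoord_self (q₀, p t₀))
  have hw0 : w (q₀, q₁) = ((chartAt E q₀ q₀, chartAt E q₁ q₁), (p t₀, t₁ - t₀)) := by
    simp only [w, hcc, hT0]
  have hwc : ContinuousAt w (q₀, q₁) := by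
    refine ContinuousAt.prodMk (ContinuousAt.prodMk ?_ ?_)
      (ContinuousAt.prodMk hPc (hTc.sub continuousAt_const))
    · exact ContinuousAt.comp (g := chartAt E q₀) (f := fun q : M × M => q.1)
        ((chartAt E q₀).continuousAt (mem_chart_source E _)) continuousAt_fst
    · exact ContinuousAt.comp (g := chartAt E q₁) (f := fun q : M × M => q.2)
        ((chartAt E q₁).continuousAt (mem_chart_source E _)) continuousAt_snd
  have hwt : Tendsto w (𝓝 (q₀, q₁))
      (𝓝 ((chartAt E q₀ q₀, chartAt E q₁ q₁), (p t₀, t₁ - t₀))) := by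
    rw [← hw0]
    exact hwc
  filter_upwards [hΓ, hsrc, hwt.eventually hYu] with q hq hs hu
  obtain ⟨hTq, horb, hq1, hq2, hSq⟩ := hq
  have hTI : T q - t₀ ∈ Icc 0 (T q - t₀) := ⟨by linarith, le_rfl⟩
  have hfl := (horb.smoothFlow hH.isC3 hTI).1
  rw [sub_add_cancel, hq1, hq2] at hfl
  have hpt : phasePt q₀ (chartAt E q₀ q.1, cotCoord q₀ q.1 (P q t₀)) = (q.1, P q t₀) :=
    phasePt_phaseCoord (m := (q.1, P q t₀)) hs.1
  have hYw : Y (w q).1 = (w q).2 := by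
    refine hu ?_ ?_
    · show (flowC H q₀ q₁ ((chartAt E q₀ q.1, cotCoord q₀ q.1 (P q t₀)), T q - t₀)).1 = _
      rw [flowC, hpt, hfl]
      rfl
    · show coordHam H q₀ (chartAt E q₀ q.1, cotCoord q₀ q.1 (P q t₀)) = e
      rw [coordHam_eq, hpt]
      have := horb.energy t₀ ⟨le_rfl, hTq.le⟩
      rwa [hq1] at this
  have hYw' : Y (chartAt E q₀ q.1, chartAt E q₁ q.2)
      = (cotCoord q₀ q.1 (P q t₀), T q - t₀) := hYw
  rw [hSq, horb.maupertuis_eq hH hTq.le, segAction, segInit, hYw', actC, hpt, hq1]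

end Action

end ThinBilliard

namespace ThinBilliard

/-! ### The Riemannian metric in coordinates -/

set_option synthInstance.maxHeartbeats 400000
set_option maxHeartbeats 1000000
set_option linter.unusedSectionVars false

section MetricCoord

variable {E : Type*} [NormedAddCommGroup E] [NormedSpace ℝ E] [FiniteDimensional ℝ E]
  {M : Type*} [TopologicalSpace M] [ChartedSpace E M] [IsManifold 𝓘(ℝ, E) ∞ M]

/-- A map into the tangent bundle is smooth if its components in a chart are smooth. -/
theorem contMDiffAt_tangentBundle_mk {X : Type*} [NormedAddCommGroup X] [NormedSpace ℝ X]
    {f : X → M} {u : X → E} {x₀ : X} {q : M} (hq : f x₀ ∈ (chartAt E q).source)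
    (hf : ContinuousAt f x₀) (hx : ContDiffAt ℝ ∞ (fun x => chartAt E q (f x)) x₀)
    (hu : ContDiffAt ℝ ∞ (fun x => tr (chartAt E (f x)) (chartAt E q) (f x) (u x)) x₀) :
    ContMDiffAt 𝓘(ℝ, X) 𝓘(ℝ, E).tangent ∞
      (fun x => (⟨f x, u x⟩ : TangentBundle 𝓘(ℝ, E) M)) x₀ := by
  set q₁ := f x₀ with hq₁
  have hs : ∀ᶠ x in 𝓝 x₀, f x ∈ (chartAt E q).source ∧ f x ∈ (chartAt E q₁).source :=
    (hf.eventually ((chartAt E q).open_source.mem_nhds hq)).and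
      (hf.eventually ((chartAt E q₁).open_source.mem_nhds (mem_chart_source E _)))
  have hz : chartAt E q (f x₀) ∈ (chartAt E q).target := (chartAt E q).map_source hq
  have hz1 : (chartAt E q).symm (chartAt E q (f x₀)) = f x₀ := (chartAt E q).left_inv hq
  have hz2 : (chartAt E q).symm (chartAt E q (f x₀)) ∈ (chartAt E q₁).source := by
    rw [hz1]; exact mem_chart_source E _
  have h1 : ContDiffAt ℝ ∞ (fun x => chartAt E q₁ (f x)) x₀ := by
    have h2 : ContDiffAt ℝ ∞ (fun x => (chartAt E q₁ ∘ (chartAt E q).symm) (chartAt E q (f x))) x₀ :=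
      ContDiffAt.comp (g := chartAt E q₁ ∘ (chartAt E q).symm) (f := fun x => chartAt E q (f x)) x₀
        (contDiffAt_trans (chart_mem q) (chart_mem q₁) hz hz2) hx
    refine h2.congr_of_eventuallyEq (hs.mono fun x h => ?_)
    simp only [Function.comp, (chartAt E q).left_inv h.1]
  have h3 : ContDiffAt ℝ ∞ (fun x => tr (chartAt E (f x)) (chartAt E q₁) (f x) (u x)) x₀ := by
    have h4 : ContDiffAt ℝ ∞ (fun x => tr (chartAt E q) (chartAt E q₁)
        ((chartAt E q).symm (chartAt E q (f x)))
        (tr (chartAt E (f x)) (chartAt E q) (f x) (u x))) x₀ := by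
      refine ContDiffAt.clm_apply ?_ hu
      refine ContDiffAt.comp (g := fun x => tr (chartAt E q) (chartAt E q₁)
        ((chartAt E q).symm x)) (f := fun x => chartAt E q (f x)) x₀ ?_ hx
      have h5 : ContDiffAt ℝ ∞ (fun y => fderiv ℝ (chartAt E q₁ ∘ (chartAt E q).symm) y)
          (chartAt E q (f x₀)) :=
        (contDiffAt_trans (chart_mem q) (chart_mem q₁) hz hz2).fderiv_right (m := ∞) (by simp)
      refine h5.congr_of_eventuallyEq ?_
      filter_upwards [(chartAt E q).open_target.mem_nhds hz] with y hy
      rw [tr, (chartAt E q).right_inv hy]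
    refine h4.congr_of_eventuallyEq (hs.mono fun x h => ?_)
    simp only [(chartAt E q).left_inv h.1]
    rw [← ContinuousLinearMap.comp_apply, tr_comp (chart_mem _) (chart_mem _) (chart_mem _)
      (mem_chart_source E _) h.1 h.2]
  rw [Bundle.contMDiffAt_totalSpace]
  refine ⟨?_, ?_⟩
  · rw [contMDiffAt_iff_target]
    refine ⟨hf, ?_⟩
    rw [contMDiffAt_iff_contDiffAt]
    exact h1
  · rw [contMDiffAt_iff_contDiffAt]
    refine h3.congr_of_eventuallyEq (Eventually.of_forall fun x => ?_)
    simp only [TangentBundle.trivializationAt_apply, tr]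
    simp only [mfld_simps, fderivWithin_univ]
    rfl

/-- The metric in the chart at `q`. -/
noncomputable def metricC (g : Metric E M) (q : M) (x : E) : E →L[ℝ] E →L[ℝ] ℝ :=
  (g.at ((chartAt E q).symm x)).bilinearComp
    (tr (chartAt E q) (chartAt E ((chartAt E q).symm x)) ((chartAt E q).symm x))
    (tr (chartAt E q) (chartAt E ((chartAt E q).symm x)) ((chartAt E q).symm x))

theorem Metric.at_pos (g : Metric E M) (q : M) {u : E} (hu : u ≠ 0) : 0 < g.at q u u :=
  g.pos q u hu

theorem Metric.at_symm (g : Metric E M) (q : M) (u v : E) : g.at q u v = g.at q v u :=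
  g.symm q u v

theorem isInvertible_of_pos {A : E →L[ℝ] E →L[ℝ] ℝ} (h : ∀ u, u ≠ 0 → 0 < A u u) :
    A.IsInvertible := by
  have hA : Function.Injective A := by
    rw [injective_iff_map_eq_zero]
    intro u hu
    by_contra hne
    have := h u hne
    rw [hu] at this
    exact lt_irrefl _ this
  exact ⟨(LinearEquiv.ofInjectiveOfFinrankEq (A : E →ₗ[ℝ] E →L[ℝ] ℝ) hA
    (finrank_dual E).symm).toContinuousLinearEquiv, by ext v; rfl⟩

theorem Metric.isInvertible (g : Metric E M) (q : M) : (g.at q).IsInvertible :=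
  isInvertible_of_pos fun _ hu => g.at_pos q hu

theorem tr_injective {q q' : M} (h : q' ∈ (chartAt E q).source) :
    Function.Injective (tr (chartAt E q) (chartAt E q') q') := by
  have h1 := tr_comp_tr (chart_mem q) (chart_mem q') h (mem_chart_source E q')
  exact Function.LeftInverse.injective (g := tr (chartAt E q') (chartAt E q) q') fun v =>
    DFunLike.congr_fun h1 v

theorem metricC_pos (g : Metric E M) {q : M} {x : E} (hx : x ∈ (chartAt E q).target) {u : E}
    (hu : u ≠ 0) : 0 < metricC g q x u u := by
  refine g.at_pos _ fun h => hu (tr_injective ((chartAt E q).map_target hx) ?_)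
  exact Eq.trans h (map_zero _).symm

theorem metricC_isInvertible (g : Metric E M) {q : M} {x : E} (hx : x ∈ (chartAt E q).target) :
    (metricC g q x).IsInvertible :=
  isInvertible_of_pos fun _ hu => metricC_pos g hx hu

theorem metricC_symm (g : Metric E M) (q : M) (x u v : E) :
    metricC g q x u v = metricC g q x v u := g.at_symm _ _ _

theorem contDiffAt_clm_of_apply {X A B : Type*} [NormedAddCommGroup X] [NormedSpace ℝ X]
    [NormedAddCommGroup A] [NormedSpace ℝ A] [FiniteDimensional ℝ A] [NormedAddCommGroup B]
    [NormedSpace ℝ B] {f : X → A →L[ℝ] B} {x : X} {n : WithTop ℕ∞}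
    (h : ∀ a, ContDiffAt ℝ n (fun x => f x a) x) : ContDiffAt ℝ n f x := by
  let d := Module.finrank ℝ A
  have hd : d = Module.finrank ℝ (Fin d → ℝ) := (Module.finrank_fin_fun ℝ).symm
  let e₁ := ContinuousLinearEquiv.ofFinrankEq hd
  let e₂ := (e₁.arrowCongr (1 : B ≃L[ℝ] B)).trans (ContinuousLinearEquiv.piRing (Fin d))
  rw [← Function.id_comp f, ← e₂.symm_comp_self]
  exact e₂.symm.contDiff.contDiffAt.comp x (contDiffAt_pi.mpr fun i => h _)

theorem contDiffAt_metricC (g : Metric E M) {q : M} {x : E} (hx : x ∈ (chartAt E q).target) :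
    ContDiffAt ℝ ∞ (metricC g q) x := by
  refine contDiffAt_clm_of_apply fun v => contDiffAt_clm_of_apply fun w => ?_
  let f : E → M := (chartAt E q).symm
  have hfx : f x ∈ (chartAt E q).source := (chartAt E q).map_target hx
  have hfc : ContinuousAt f x := (chartAt E q).symm.continuousAt hx
  have hev : ∀ᶠ y in 𝓝 x, y ∈ (chartAt E q).target := (chartAt E q).open_target.mem_nhds hx
  have hch : ContDiffAt ℝ ∞ (fun y => chartAt E q (f y)) x :=
    contDiffAt_id.congr_of_eventuallyEq (hev.mono fun y hy => (chartAt E q).right_inv hy)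
  let V : E → E → E := fun v y => tr (chartAt E q) (chartAt E (f y)) (f y) v
  have hV : ∀ v, ContMDiffAt 𝓘(ℝ, E) 𝓘(ℝ, E).tangent ∞
      (fun y => (⟨f y, V v y⟩ : TangentBundle 𝓘(ℝ, E) M)) x := fun v => by
    refine contMDiffAt_tangentBundle_mk hfx hfc hch ?_
    refine (contDiffAt_const (c := v)).congr_of_eventuallyEq (hev.mono fun y hy => ?_)
    have h1 := tr_comp_tr (chart_mem q) (chart_mem (f y)) ((chartAt E q).map_target hy)
      (mem_chart_source E (f y))
    exact DFunLike.congr_fun h1 v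
  have hfm : ContMDiffAt 𝓘(ℝ, E) 𝓘(ℝ, E) ∞ f x := by
    have := hV 0
    rw [Bundle.contMDiffAt_totalSpace] at this
    exact this.1
  have h2 : ContMDiffAt 𝓘(ℝ, E) (𝓘(ℝ, E).prod 𝓘(ℝ, ℝ)) ∞
      (fun y => Bundle.TotalSpace.mk' ℝ (E := Bundle.Trivial M ℝ) (f y)
        (g.inner (f y) (V v y) (V w y))) x := by
    apply ContMDiffAt.clm_bundle_apply₂ (F₁ := E) (F₂ := E)
    · exact ContMDiffAt.comp x g.contMDiff.contMDiffAt hfm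
    · exact hV v
    · exact hV w
  rw [Bundle.contMDiffAt_totalSpace] at h2
  exact contMDiffAt_iff_contDiffAt.1 h2.2

theorem contDiffAt_metricC_inverse (g : Metric E M) {q : M} {x : E}
    (hx : x ∈ (chartAt E q).target) : ContDiffAt ℝ ∞ (fun x => (metricC g q x).inverse) x := by
  have : CompleteSpace E := FiniteDimensional.complete ℝ E
  exact ContDiffAt.comp (g := ContinuousLinearMap.inverse) (f := metricC g q) x
    (metricC_isInvertible g hx).contDiffAt_map_inverse (contDiffAt_metricC g hx)

/-- Raising an index commutes with the change of charts. -/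
theorem inverse_phasePt (g : Metric E M) {q : M} {z : E × (E →L[ℝ] ℝ)}
    (hz : z.1 ∈ (chartAt E q).target) :
    (g.at (phasePt q z).1).inverse (phasePt q z).2
      = tr (chartAt E q) (chartAt E (phasePt q z).1) (phasePt q z).1
        ((metricC g q z.1).inverse z.2) := by
  set q' := (phasePt q z).1 with hq'
  have hs : q' ∈ (chartAt E q).source := (chartAt E q).map_target hz
  rw [← (g.isInvertible q').inverse_apply_self (tr (chartAt E q) (chartAt E q') q'
        ((metricC g q z.1).inverse z.2))]
  congr 1
  ext w
  have h1 := (metricC_isInvertible g hz).self_apply_inverse z.2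
  have h2 := DFunLike.congr_fun (tr_comp_tr (chart_mem q') (chart_mem q) (mem_chart_source E q') hs)
    w
  have h3 := DFunLike.congr_fun h1 (tr (chartAt E q') (chartAt E q) q' w)
  have h4 : metricC g q z.1 ((metricC g q z.1).inverse z.2) (tr (chartAt E q') (chartAt E q) q' w)
    = g.at q' (tr (chartAt E q) (chartAt E q') q' ((metricC g q z.1).inverse z.2))
        (tr (chartAt E q) (chartAt E q') q' (tr (chartAt E q') (chartAt E q) q' w)) := rfl
  have h5 : tr (chartAt E q) (chartAt E q') q' (tr (chartAt E q') (chartAt E q) q' w) = w := h2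
  rw [h4, h5] at h3
  rw [h3]
  rfl

theorem coordHam_kinetic (g : Metric E M) {q : M} {z : E × (E →L[ℝ] ℝ)}
    (hz : z.1 ∈ (chartAt E q).target) :
    coordHam (kinetic g) q z = z.2 ((metricC g q z.1).inverse z.2) / 2 := by
  have hs : (phasePt q z).1 ∈ (chartAt E q).source := (chartAt E q).map_target hz
  rw [coordHam_eq, kinetic, inverse_phasePt g hz]
  congr 1
  have h2 := DFunLike.congr_fun (tr_comp_tr (chart_mem q) (chart_mem (phasePt q z).1) hs
    (mem_chart_source E _)) ((metricC g q z.1).inverse z.2)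
  exact congrArg z.2 h2

theorem three_le_infty : (3 : WithTop ℕ∞) ≤ ∞ :=
  WithTop.coe_le_coe.2 (le_top : (3 : ℕ∞) ≤ ⊤)

theorem isC3_kinetic (g : Metric E M) : IsC3 (kinetic g) := by
  intro q z hz
  have hz1 : z.1 ∈ (chartAt E q).target := hz.1
  refine ContDiffAt.contDiffWithinAt ?_
  have h1 : ContDiffAt ℝ ∞ (fun z : E × (E →L[ℝ] ℝ) => (metricC g q z.1).inverse) z :=
    ContDiffAt.comp (g := fun x => (metricC g q x).inverse) (f := fun z : E × (E →L[ℝ] ℝ) => z.1) z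
      (contDiffAt_metricC_inverse g hz1) contDiffAt_fst
  have h2 : ContDiffAt ℝ 3 (fun z : E × (E →L[ℝ] ℝ) => z.2 ((metricC g q z.1).inverse z.2) / 2) z :=
    ((contDiffAt_snd.clm_apply (h1.clm_apply contDiffAt_snd)).div_const 2).of_le (m := 3) three_le_infty
  refine h2.congr_of_eventuallyEq ?_
  have h3 : ∀ᶠ w : E × (E →L[ℝ] ℝ) in 𝓝 z, w.1 ∈ (chartAt E q).target :=
    continuousAt_fst.eventually ((chartAt E q).open_target.mem_nhds hz1)
  exact h3.mono fun w hw => coordHam_kinetic g hw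

/-- The velocity of a geodesic, in coordinates. -/
theorem fderiv_coordHam_kinetic (g : Metric E M) {q : M} {z : E × (E →L[ℝ] ℝ)}
    (hz : z.1 ∈ (chartAt E q).target) (η : E →L[ℝ] ℝ) :
    fderiv ℝ (coordHam (kinetic g) q) z (0, η) = η ((metricC g q z.1).inverse z.2) := by
  set A := (metricC g q z.1).inverse with hA
  have hsymm : ∀ y y' : E →L[ℝ] ℝ, y (A y') = y' (A y) := fun y y' => by
    have h1 := (metricC_isInvertible g hz).self_apply_inverse y
    have h2 := (metricC_isInvertible g hz).self_apply_inverse y'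
    calc y (A y') = metricC g q z.1 (A y) (A y') := by rw [hA, h1]
      _ = metricC g q z.1 (A y') (A y) := metricC_symm _ _ _ _ _
      _ = y' (A y) := by rw [hA, h2]
  have hl : HasDerivAt (fun t : ℝ => z + t • ((0 : E), η)) (0, η) 0 := by
    simpa using ((hasDerivAt_id (0 : ℝ)).smul_const ((0 : E), η)).const_add z
  have h1 : HasDerivAt (fun t : ℝ => coordHam (kinetic g) q (z + t • ((0 : E), η)))
      (fderiv ℝ (coordHam (kinetic g) q) z (0, η)) 0 := by
    refine HasFDerivAt.comp_hasDerivAt (l := coordHam (kinetic g) q)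
      (f := fun t : ℝ => z + t • ((0 : E), η)) 0 ?_ hl
    have := (((isC3_kinetic g).contDiffAt hz).differentiableAt (by simp)).hasFDerivAt
    simpa using this
  have h2 : HasDerivAt (fun t : ℝ => (z.2 + t • η) (A (z.2 + t • η)) / 2) (η (A z.2)) 0 := by
    have e1 : HasDerivAt (fun t : ℝ => z.2 + t • η) η 0 := by
      simpa using ((hasDerivAt_id (0 : ℝ)).smul_const η).const_add z.2
    have e2 : HasDerivAt (fun t : ℝ => A (z.2 + t • η)) (A η) 0 :=
      HasFDerivAt.comp_hasDerivAt (l := A) (f := fun t : ℝ => z.2 + t • η) 0 A.hasFDerivAt e1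
    have e3 := (e1.clm_apply e2).div_const 2
    simp only [zero_smul, add_zero] at e3
    rw [hsymm z.2 η] at e3
    convert! e3 using 1
    ring
  refine h1.unique (h2.congr_of_eventuallyEq (Eventually.of_forall fun t => ?_))
  have h3 : (z + t • ((0 : E), η)).1 = z.1 := by simp
  have h4 : (z + t • ((0 : E), η)).2 = z.2 + t • η := by simp
  have h5 : (z + t • ((0 : E), η)).1 ∈ (chartAt E q).target := by rw [h3]; exact hz
  show coordHam (kinetic g) q (z + t • ((0 : E), η)) = _
  rw [coordHam_kinetic g h5, h3, h4]

theorem vel_kinetic (g : Metric E M) (q : M) (p : E →L[ℝ] ℝ) :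
    vel (kinetic g) (q, p) = (g.at q).inverse p := by
  have hz : chartAt E q q ∈ (chartAt E q).target :=
    (chartAt E q).map_source (mem_chart_source E q)
  have h1 := inverse_phasePt g (z := (chartAt E q q, p)) hz
  rw [phasePt_self] at h1
  have h2 : (g.at q).inverse p = (metricC g q (chartAt E q q)).inverse p := by
    rw [h1]
    simp only [tr_self (mem_chart_source E q)]
    rfl
  rw [h2]
  refine eq_of_forall_dual fun η => ?_
  rw [← fderiv_coordHam_kinetic g (z := (chartAt E q q, p)) hz η, fderiv_eq_hamField, vel,
    phaseCoord_self (q, p)]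
  simp [field]

theorem lag_kinetic (g : Metric E M) (m : M × (E →L[ℝ] ℝ)) :
    lag (kinetic g) m = 2 * kinetic g m.1 m.2 := by
  rw [lag_eq_vel, show m = (m.1, m.2) from rfl, vel_kinetic, kinetic]
  ring

end MetricCoord

end ThinBilliard

namespace ThinBilliard

/-! ### The exponential map near a submanifold -/

set_option synthInstance.maxHeartbeats 400000
set_option maxHeartbeats 1000000
set_option linter.unusedSectionVars false

section Exponential

variable {E : Type*} [NormedAddCommGroup E] [NormedSpace ℝ E] [FiniteDimensional ℝ E]
  {M : Type*} [TopologicalSpace M] [ChartedSpace E M] [IsManifold 𝓘(ℝ, E) ∞ M]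

/-- Constant geodesics. -/
theorem traj_zero (g : Metric E M) (x : M) (a b : ℝ) : Traj (kinetic g) (fun _ => (x, 0)) a b := by
  refine traj_of_hasDerivWithinAt (isC3_kinetic g) continuousOn_const fun t ht =>
    ⟨x, mem_chart_source E x, ?_⟩
  have hz : chartAt E x x ∈ (chartAt E x).target := (chartAt E x).map_source (mem_chart_source E x)
  have h0 : field (kinetic g) x (phaseCoord x (x, 0)) = (0, 0) := by
    rw [phaseCoord_self (x, 0)]
    refine eq_hamField fun a b => ?_
    have h1 : ((a, b) : E × (E →L[ℝ] ℝ)) = (a, 0) + (0, b) := by simp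
    have h2 : fderiv ℝ (coordHam (kinetic g) x) (chartAt E x x, 0) (a, 0) = 0 := by
      have e1 : HasDerivAt (fun t : ℝ => coordHam (kinetic g) x (chartAt E x x + t • a, 0))
          (fderiv ℝ (coordHam (kinetic g) x) (chartAt E x x, 0) (a, 0)) 0 := by
        refine HasFDerivAt.comp_hasDerivAt (l := coordHam (kinetic g) x)
          (f := fun t : ℝ => (chartAt E x x + t • a, (0 : E →L[ℝ] ℝ))) 0 ?_ ?_
        · have := (((isC3_kinetic g).contDiffAt (z := (chartAt E x x, 0)) hz).differentiableAt
            (by simp)).hasFDerivAt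
          simpa using this
        · refine HasDerivAt.prodMk ?_ (hasDerivAt_const _ _)
          simpa using ((hasDerivAt_id (0 : ℝ)).smul_const a).const_add (chartAt E x x)
      have e2 : ∀ y, coordHam (kinetic g) x (y, 0) = 0 := fun y => by
        rw [coordHam_eq, kinetic]
        have : (phasePt x ((y, 0) : E × (E →L[ℝ] ℝ))).2 = 0 := ContinuousLinearMap.zero_comp _
        rw [this]
        simp
      simp only [e2] at e1
      exact e1.unique (hasDerivAt_const _ _)
    rw [h1, map_add, h2, fderiv_coordHam_kinetic g hz]
    simp
  rw [h0]
  exact hasDerivWithinAt_const _ _ _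

/-- The exponential map as a map from canonical coordinates on `T*M` to coordinates on `M`. -/
noncomputable def expC (g : Metric E M) (x : M) (z : E × (E →L[ℝ] ℝ)) : E :=
  (flowC (kinetic g) x x (z, 1)).1

variable [T2Space M]

theorem smoothFlow_zero (g : Metric E M) (x : M) :
    flow (kinetic g) (x, 0) 1 = (x, 0) ∧
      SmoothFlow (kinetic g) x x (chartAt E x x, 0) 1 := by
  have h := (traj_zero g x 0 1).smoothFlow (isC3_kinetic g) (s := 1) (q₀ := x) (q₁ := x)
    ⟨zero_le_one, le_rfl⟩ (mem_chart_source E x) (mem_chart_source E x)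
  rwa [phaseCoord_self (x, 0)] at h

theorem contDiffAt_expC (g : Metric E M) (x : M) :
    ContDiffAt ℝ 2 (expC g x) (chartAt E x x, 0) := by
  have h : ContDiffAt ℝ 2 (fun z => flowC (kinetic g) x x (z, 1)) (chartAt E x x, 0) :=
    ContDiffAt.comp (g := flowC (kinetic g) x x)
      (f := fun z : E × (E →L[ℝ] ℝ) => (z, (1 : ℝ))) _
      (smoothFlow_zero g x).2.contDiffAt (by fun_prop)
  exact h.fst

theorem expC_zero (g : Metric E M) (x : M) {y : E} (hy : y ∈ (chartAt E x).target) :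
    expC g x (y, 0) = y := by
  have h : phasePt x ((y, 0) : E × (E →L[ℝ] ℝ)) = ((chartAt E x).symm y, 0) := by
    rw [phasePt]
    exact Prod.ext rfl (ContinuousLinearMap.zero_comp _)
  rw [expC, flowC, h, (smoothFlow_zero g _).1]
  exact (chartAt E x).right_inv hy

/-- For small covectors the exponential map is the time one map of the geodesic flow. -/
theorem eventually_isExp_iff (g : Metric E M) (x : M) :
    ∀ᶠ z in 𝓝 ((chartAt E x x, 0) : E × (E →L[ℝ] ℝ)), ∀ (u : E) (q : M),
      g.at (phasePt x z).1 u = (phasePt x z).2 →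
      (IsExp g (phasePt x z).1 u q ↔ q ∈ (chartAt E x).source ∧ chartAt E x q = expC g x z) := by
  have hS := (smoothFlow_zero g x).2
  have ht : Tendsto (fun z : E × (E →L[ℝ] ℝ) => (z, (1 : ℝ))) (𝓝 (chartAt E x x, 0))
      (𝓝 ((chartAt E x x, 0), 1)) := by
    have : ContinuousAt (fun z : E × (E →L[ℝ] ℝ) => (z, (1 : ℝ))) (chartAt E x x, 0) := by fun_prop
    exact this
  filter_upwards [ht.eventually hS.good, ht.eventually hS.mem_source] with z hg hs u q hu
  have hC3 := isC3_kinetic g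
  constructor
  · rintro ⟨c, p, hc, hc0, hp0, hc1⟩
    have h1 : flow (kinetic g) (phasePt x z) 1 = (c 1, p 1) :=
      hg.flow_eq hC3 (c := fun s => (c s, p s)) hc ⟨le_rfl, zero_le_one⟩ ⟨zero_le_one, le_rfl⟩
        (Prod.ext hc0 (hp0.trans hu))
    have h2 : (flow (kinetic g) (phasePt x z) 1).1 = q := by rw [h1]; exact hc1
    simp only [h2] at hs
    refine ⟨hs, ?_⟩
    rw [expC, flowC, phaseCoord]
    simp only [h2]
  · rintro ⟨hq, hqe⟩
    have h2 : (flow (kinetic g) (phasePt x z) 1).1 = q :=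
      (chartAt E x).injOn hs hq hqe.symm
    obtain ⟨a, b, ha, hb, hs1, hc, -⟩ := hg.exists_traj hC3
    refine ⟨fun s => (flow (kinetic g) (phasePt x z) s).1,
      fun s => (flow (kinetic g) (phasePt x z) s).2, hc.mono ha.le hs1.2.le, ?_, ?_, h2⟩
    · simp only [flow_zero]
    · simp only [flow_zero, hu]

/-- The differential of the exponential map is injective on pairs `(ξ, η)` with `η(ξ) = 0`. This
comes from differentiating the first variation formula for the action `2H` of geodesics. -/
theorem expC_injective (g : Metric E M) (x : M) {ξ : E} {η : E →L[ℝ] ℝ}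
    (h : fderiv ℝ (expC g x) (chartAt E x x, 0) (ξ, η) = 0) (hηξ : η ξ = 0) : ξ = 0 ∧ η = 0 := by
  set z₀ : E × (E →L[ℝ] ℝ) := (chartAt E x x, 0) with hz₀
  have hz : chartAt E x x ∈ (chartAt E x).target := (chartAt E x).map_source (mem_chart_source E x)
  have hS := (smoothFlow_zero g x).2
  set h₀ := coordHam (kinetic g) x with hh₀
  set X := flowC (kinetic g) x x with hX
  have hC3 := isC3_kinetic g
  have ht : Tendsto (fun z : E × (E →L[ℝ] ℝ) => (z, (1 : ℝ))) (𝓝 z₀) (𝓝 (z₀, 1)) := by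
    have : ContinuousAt (fun z : E × (E →L[ℝ] ℝ) => (z, (1 : ℝ))) z₀ := by fun_prop
    exact this
  have hact : ∀ᶠ w in 𝓝 (z₀, (1 : ℝ)), actC (kinetic g) x w = w.2 * (2 * h₀ w.1) := by
    filter_upwards [hS.good] with w hw
    obtain ⟨a, b, ha, hb, hs1, hc, hall⟩ := hw.exists_traj hC3
    have e1 : ∀ r ∈ uIcc 0 w.2, lag (kinetic g) (flow (kinetic g) (phasePt x w.1) r)
        = 2 * h₀ w.1 := fun r hr => by
      rw [lag_kinetic, (hall r (uIcc_subset_Icc ⟨ha.le, hb.le⟩ (Ioo_subset_Icc_self hs1) hr)).energy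
        hC3, hh₀, coordHam_eq]
    rw [actC, act, intervalIntegral.integral_congr (g := fun _ => 2 * h₀ w.1) e1,
      intervalIntegral.integral_const, smul_eq_mul, sub_zero]
  have htar : ∀ᶠ z : E × (E →L[ℝ] ℝ) in 𝓝 z₀, z.1 ∈ (chartAt E x).target :=
    continuousAt_fst.eventually ((chartAt E x).open_target.mem_nhds hz)
  have hid : ∀ᶠ z in 𝓝 z₀, ∀ δ, fderiv ℝ h₀ z δ
      = (X (z, 1)).2 (fderiv ℝ X (z, 1) (δ, 0)).1 - z.2 δ.1 := by
    filter_upwards [ht.eventually hS.variation, ht.eventually hact.eventually_nhds, htar]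
      with z hv ha hzt δ
    have hd : HasFDerivAt h₀ (fderiv ℝ h₀ z) z :=
      ((hC3.contDiffAt hzt).differentiableAt (by simp)).hasFDerivAt
    have e1 : HasFDerivAt (fun w : (E × (E →L[ℝ] ℝ)) × ℝ => h₀ w.1)
        (fderiv ℝ h₀ z ∘L ContinuousLinearMap.fst ℝ _ _) (z, 1) :=
      HasFDerivAt.comp (g := h₀) (f := Prod.fst) (z, (1 : ℝ)) hd hasFDerivAt_fst
    have e2 : HasFDerivAt (fun w : (E × (E →L[ℝ] ℝ)) × ℝ => w.2 * (2 * h₀ w.1)) _ (z, 1) :=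
      hasFDerivAt_snd.mul (e1.const_mul 2)
    have e3 := hv (δ, 0)
    rw [EventuallyEq.fderiv_eq ha, e2.fderiv] at e3
    simp only [add_apply, smul_apply, ContinuousLinearMap.comp_apply,
      ContinuousLinearMap.coe_fst', ContinuousLinearMap.coe_snd', smul_eq_mul, mul_zero, add_zero,
      one_mul] at e3
    linarith
  have hexp : fderiv ℝ X (z₀, 1) ((ξ, η), 0) = (0, (fderiv ℝ X (z₀, 1) ((ξ, η), 0)).2) := by
    refine Prod.ext ?_ rfl
    rw [← h]
    have e1 : HasFDerivAt (fun z : E × (E →L[ℝ] ℝ) => X (z, 1))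
        (fderiv ℝ X (z₀, 1) ∘L (ContinuousLinearMap.id ℝ _).prod 0) z₀ :=
      HasFDerivAt.comp (g := X) (f := fun z : E × (E →L[ℝ] ℝ) => (z, (1 : ℝ))) z₀
        (hS.contDiffAt.differentiableAt two_ne_zero).hasFDerivAt
        ((hasFDerivAt_id z₀).prodMk (hasFDerivAt_const _ _))
    have e2 : HasFDerivAt (expC g x) _ z₀ := e1.fst
    rw [e2.fderiv]
    rfl
  have hX0 : (X (z₀, 1)).2 = 0 := by
    rw [hX, flowC, hz₀, phasePt_self, (smoothFlow_zero g x).1, phaseCoord_self (x, 0)]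
  set A := (metricC g x (chartAt E x x)).inverse with hA
  have hAξ : ξ = -A η := by
    refine eq_of_forall_dual fun y => ?_
    have hD : DifferentiableAt ℝ (fderiv ℝ h₀) z₀ :=
      ((hC3.contDiffAt (z := z₀) hz).fderiv_right (m := 2) (by norm_num)).differentiableAt
        two_ne_zero
    -- the second derivative of the kinetic energy in the directions `(0, y)` and `(ξ, η)`
    have e1 : fderiv ℝ (fderiv ℝ h₀) z₀ (0, y) (ξ, η) = - y ξ := by
      have hl : HasDerivAt (fun t : ℝ => z₀ + t • ((0 : E), y)) (0, y) 0 := by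
        simpa using ((hasDerivAt_id (0 : ℝ)).smul_const ((0 : E), y)).const_add z₀
      have hl0 : Tendsto (fun t : ℝ => z₀ + t • ((0 : E), y)) (𝓝 0) (𝓝 z₀) := by
        have := hl.continuousAt.tendsto
        simpa using this
      have hd1 : HasDerivAt (fun t : ℝ => fderiv ℝ h₀ (z₀ + t • ((0 : E), y)) (ξ, η))
          (fderiv ℝ (fderiv ℝ h₀) z₀ (0, y) (ξ, η)) 0 := by
        have : HasDerivAt (fun t : ℝ => fderiv ℝ h₀ (z₀ + t • ((0 : E), y)))
            (fderiv ℝ (fderiv ℝ h₀) z₀ (0, y)) 0 := by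
          refine HasFDerivAt.comp_hasDerivAt (l := fderiv ℝ h₀)
            (f := fun t : ℝ => z₀ + t • ((0 : E), y)) 0 ?_ hl
          simpa using hD.hasFDerivAt
        simpa using this.clm_apply (hasDerivAt_const _ (ξ, η))
      have hl1 : HasDerivAt (fun t : ℝ => (z₀ + t • ((0 : E), y), (1 : ℝ))) ((0, y), 0) 0 :=
        hl.prodMk (hasDerivAt_const _ _)
      have hXt : HasDerivAt (fun t : ℝ => X (z₀ + t • ((0 : E), y), 1))
          (fderiv ℝ X (z₀, 1) ((0, y), 0)) 0 := by
        refine HasFDerivAt.comp_hasDerivAt (l := X)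
          (f := fun t : ℝ => (z₀ + t • ((0 : E), y), (1 : ℝ))) 0 ?_ hl1
        have := (hS.contDiffAt.differentiableAt two_ne_zero).hasFDerivAt
        simpa using this
      have hdX : HasDerivAt (fun t : ℝ => fderiv ℝ X (z₀ + t • ((0 : E), y), 1) ((ξ, η), 0))
          (fderiv ℝ (fderiv ℝ X) (z₀, 1) ((0, y), 0) ((ξ, η), 0)) 0 := by
        have : HasDerivAt (fun t : ℝ => fderiv ℝ X (z₀ + t • ((0 : E), y), 1))
            (fderiv ℝ (fderiv ℝ X) (z₀, 1) ((0, y), 0)) 0 := by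
          refine HasFDerivAt.comp_hasDerivAt (l := fderiv ℝ X)
            (f := fun t : ℝ => (z₀ + t • ((0 : E), y), (1 : ℝ))) 0 ?_ hl1
          have := ((hS.contDiffAt.fderiv_right (m := 1) (by norm_num)).differentiableAt
            one_ne_zero).hasFDerivAt
          simpa using this
        simpa using this.clm_apply (hasDerivAt_const _ ((ξ, η), (0 : ℝ)))
      have hY2 : HasDerivAt (fun t : ℝ => (X (z₀ + t • ((0 : E), y), 1)).2)
          (fderiv ℝ X (z₀, 1) ((0, y), 0)).2 0 := hXt.snd
      have hdX1 : HasDerivAt (fun t : ℝ => (fderiv ℝ X (z₀ + t • ((0 : E), y), 1) ((ξ, η), 0)).1)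
          (fderiv ℝ (fderiv ℝ X) (z₀, 1) ((0, y), 0) ((ξ, η), 0)).1 0 := hdX.fst
      have hlin : HasDerivAt (fun t : ℝ => (z₀ + t • ((0 : E), y)).2 ξ) (y ξ) 0 := by
        have : (fun t : ℝ => (z₀ + t • ((0 : E), y)).2 ξ) = fun t => t * y ξ := by
          funext t
          simp [hz₀]
        rw [this]
        simpa using (hasDerivAt_id (0 : ℝ)).mul_const (y ξ)
      have hd2 := (hY2.clm_apply hdX1).fun_sub hlin
      simp only [zero_smul, add_zero, hX0, zero_apply] at hd2
      rw [hexp] at hd2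
      simp only [map_zero, zero_sub] at hd2
      exact hd1.unique (hd2.congr_of_eventuallyEq ((hl0.eventually hid).mono fun t ht => ht (ξ, η)))
    have e2 : fderiv ℝ (fderiv ℝ h₀) z₀ (ξ, η) (0, y) = y (A η) := by
      have hl : HasDerivAt (fun t : ℝ => z₀ + t • (ξ, η)) (ξ, η) 0 := by
        simpa using ((hasDerivAt_id (0 : ℝ)).smul_const (ξ, η)).const_add z₀
      have hl0 : Tendsto (fun t : ℝ => z₀ + t • (ξ, η)) (𝓝 0) (𝓝 z₀) := by
        have := hl.continuousAt.tendsto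
        simpa using this
      have hd1 : HasDerivAt (fun t : ℝ => fderiv ℝ h₀ (z₀ + t • (ξ, η)) (0, y))
          (fderiv ℝ (fderiv ℝ h₀) z₀ (ξ, η) (0, y)) 0 := by
        have : HasDerivAt (fun t : ℝ => fderiv ℝ h₀ (z₀ + t • (ξ, η)))
            (fderiv ℝ (fderiv ℝ h₀) z₀ (ξ, η)) 0 := by
          refine HasFDerivAt.comp_hasDerivAt (l := fderiv ℝ h₀)
            (f := fun t : ℝ => z₀ + t • (ξ, η)) 0 ?_ hl
          simpa using hD.hasFDerivAt
        simpa using this.clm_apply (hasDerivAt_const _ ((0 : E), y))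
      have hI : HasDerivAt (fun t : ℝ => (metricC g x (z₀ + t • (ξ, η)).1).inverse)
          (fderiv ℝ (fun x' => (metricC g x x').inverse) (chartAt E x x) ξ) 0 := by
        refine HasFDerivAt.comp_hasDerivAt (l := fun x' => (metricC g x x').inverse)
          (f := fun t : ℝ => (z₀ + t • (ξ, η)).1) 0 ?_ hl.fst
        have := ((contDiffAt_metricC_inverse g hz).differentiableAt (by simp)).hasFDerivAt
        simpa [hz₀] using this
      have hl2 : HasDerivAt (fun t : ℝ => (z₀ + t • (ξ, η)).2) η 0 := hl.snd
      have hd2 := (hasDerivAt_const (0 : ℝ) y).clm_apply (hI.clm_apply hl2)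
      simp only [zero_smul, add_zero, zero_add, hz₀, map_zero] at hd2
      exact hd1.unique (hd2.congr_of_eventuallyEq ((hl0.eventually htar).mono fun t ht =>
        fderiv_coordHam_kinetic g ht y))
    have hsym : IsSymmSndFDerivAt ℝ h₀ z₀ :=
      ((hC3.contDiffAt (z := z₀) hz).of_le (by norm_num)).isSymmSndFDerivAt (n := 2) (by simp)
    have e3 := hsym (0, y) (ξ, η)
    rw [e1, e2] at e3
    rw [map_neg]
    linarith
  have hη : η = 0 := by
    have h1 := (metricC_isInvertible g hz).self_apply_inverse η
    have h2 : A η = 0 := by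
      by_contra hne
      have h3 := metricC_pos g hz hne
      rw [hA, h1, ← hA] at h3
      rw [hAξ, map_neg] at hηξ
      linarith
    rw [← h1, ← hA, h2, map_zero]
  refine ⟨?_, hη⟩
  rw [hAξ, hη, map_zero, neg_zero]

end Exponential

end ThinBilliard

namespace ThinBilliard

/-! ### Coordinates on the normal bundle of a submanifold -/

set_option synthInstance.maxHeartbeats 400000
set_option maxHeartbeats 1000000
set_option linter.unusedSectionVars false

section Slices

variable {E : Type*} [NormedAddCommGroup E] [NormedSpace ℝ E] [FiniteDimensional ℝ E]
  {M : Type*} [TopologicalSpace M] [ChartedSpace E M] [IsManifold 𝓘(ℝ, E) ∞ M]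
  {N : Set M} {x : M}

/-- The covectors which vanish on `F`. The structure of a module on the dual space is the one which
underlies its structure of a normed space. -/
def conormal (F : Submodule ℝ E) : @Submodule ℝ (E →L[ℝ] ℝ) _
    NormedAddCommGroup.toAddCommGroup.toAddCommMonoid NormedSpace.toModule where
  carrier := {η | ∀ v ∈ F, η v = 0}
  add_mem' h h' v hv := by
    rw [add_apply, h v hv, h' v hv, add_zero]
  zero_mem' _ _ := rfl
  smul_mem' c η h v hv := by
    rw [smul_apply, h v hv, smul_zero]

theorem mem_conormal {F : Submodule ℝ E} {η : E →L[ℝ] ℝ} :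
    η ∈ conormal F ↔ ∀ v ∈ F, η v = 0 := Iff.rfl

theorem finrank_add_finrank_conormal (F : Submodule ℝ E) :
    Module.finrank ℝ F + Module.finrank ℝ (conormal F) = Module.finrank ℝ E := by
  have h : conormal F = F.dualAnnihilator.map
      (LinearMap.toContinuousLinearMap : (E →ₗ[ℝ] ℝ) ≃ₗ[ℝ] E →L[ℝ] ℝ).toLinearMap := by
    ext η
    rw [mem_conormal, Submodule.mem_map]
    constructor
    · intro hη
      exact ⟨η, (Submodule.mem_dualAnnihilator _).2 hη, by ext; rfl⟩
    · rintro ⟨y, hy, rfl⟩ v hv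
      exact (Submodule.mem_dualAnnihilator _).1 hy v hv
  rw [h, LinearEquiv.finrank_map_eq]
  exact Subspace.finrank_add_finrank_dualAnnihilator_eq F

/-- The coordinates `(ξ, η)` on the conormal bundle of `N` given by a slice chart: `ξ ∈ F` is the
position in `N` relative to `x`, and `η` is the normal covector. -/
abbrev SliceSpace (s : SliceChart (E := E) N x) : Type _ := s.F × conormal s.F

variable (s : SliceChart (E := E) N x)

/-- The point of `N` with the coordinate `ξ`. -/
def slicePt (ξ : E) : M := s.φ.symm (s.φ x + ξ)

/-- The point `(ξ, η)` of the conormal bundle, in the canonical coordinates of the chart at `x`. -/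
noncomputable def slicePhase (ζ : SliceSpace s) : E × (E →L[ℝ] ℝ) :=
  cotLift s.φ (chartAt E x) (s.φ x + ζ.1, ζ.2)

/-- The normal covector with the coordinates `(ξ, η)`, as a function of `η`. -/
noncomputable def sliceCovec (ξ : E) : conormal s.F →L[ℝ] (E →L[ℝ] ℝ) :=
  ((ContinuousLinearMap.compL ℝ E E ℝ).flip
    (tr (chartAt E (slicePt s ξ)) s.φ (slicePt s ξ))) ∘L (conormal s.F).subtypeL

/-- The normal vector which corresponds to the normal covector with the coordinates `(ξ, η)`, as a
function of `η`. -/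
noncomputable def sliceVec (g : Metric E M) (ξ : E) : conormal s.F →L[ℝ] E :=
  (g.at (slicePt s ξ)).inverse ∘L sliceCovec s ξ

/-- `ξ` is the coordinate of a point of `N` in the chart at `x`. -/
def SliceDom (ξ : E) : Prop :=
  s.φ x + ξ ∈ s.φ.target ∧ slicePt s ξ ∈ (chartAt E x).source

theorem slicePt_zero : slicePt s 0 = x := by
  rw [slicePt, add_zero, s.φ.left_inv s.mem_source]

theorem sliceDom_zero : SliceDom s 0 := by
  refine ⟨?_, ?_⟩
  · rw [add_zero]; exact s.φ.map_source s.mem_source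
  · rw [slicePt_zero]; exact mem_chart_source E x

theorem eventually_sliceDom : ∀ᶠ ξ in 𝓝 (0 : E), SliceDom s ξ := by
  have h0 := sliceDom_zero s
  have h1 : ContinuousAt (fun ξ : E => s.φ x + ξ) 0 := by fun_prop
  have h2 : ContinuousAt (slicePt s) 0 :=
    ContinuousAt.comp (g := s.φ.symm) (f := fun ξ : E => s.φ x + ξ)
      (s.φ.symm.continuousAt h0.1) h1
  exact (h1.eventually (s.φ.open_target.mem_nhds h0.1)).and
    (h2.eventually ((chartAt E x).open_source.mem_nhds h0.2))

variable {s}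

theorem SliceDom.mem_source {ξ : E} (h : SliceDom s ξ) : slicePt s ξ ∈ s.φ.source :=
  s.φ.map_target h.1

theorem SliceDom.apply {ξ : E} (h : SliceDom s ξ) : s.φ (slicePt s ξ) = s.φ x + ξ :=
  s.φ.right_inv h.1

theorem SliceDom.mem (hx : x ∈ N) {ξ : s.F} (h : SliceDom s ξ) : slicePt s ξ ∈ N := by
  rw [s.slice _ h.mem_source, h.apply]
  exact s.F.add_mem ((s.slice x s.mem_source).1 hx) ξ.2

theorem SliceDom.continuousAt {ξ : E} (h : SliceDom s ξ) : ContinuousAt (slicePt s) ξ :=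
  ContinuousAt.comp (g := s.φ.symm) (f := fun ξ : E => s.φ x + ξ)
    (s.φ.symm.continuousAt h.1) (by fun_prop)

theorem phasePt_slicePhase {ζ : SliceSpace s} (h : SliceDom s ζ.1) :
    phasePt x (slicePhase s ζ) = (slicePt s ζ.1, sliceCovec s ζ.1 ζ.2) := by
  have h1 : (chartAt E x).symm (slicePhase s ζ).1 = slicePt s ζ.1 := (chartAt E x).left_inv h.2
  have h2 := tr_comp (chart_mem (slicePt s ζ.1)) (chart_mem x) s.mem_atlas
    (mem_chart_source E (slicePt s ζ.1)) h.2 h.mem_source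
  rw [phasePt, h1, chartDeriv_eq_tr]
  refine Prod.ext rfl ?_
  show ((ζ.2 : E →L[ℝ] ℝ) ∘L tr (chartAt E x) s.φ (slicePt s ζ.1)) ∘L _ = _
  rw [ContinuousLinearMap.comp_assoc, h2]
  rfl

theorem SliceDom.sliceCovec_injective {ξ : E} (h : SliceDom s ξ) :
    Function.Injective (sliceCovec s ξ) := by
  intro η η' he
  have h2 := tr_comp_tr s.mem_atlas (chart_mem (slicePt s ξ)) h.mem_source
    (mem_chart_source E (slicePt s ξ))
  refine Subtype.ext (ContinuousLinearMap.ext fun v => ?_)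
  have h3 := DFunLike.congr_fun he (tr s.φ (chartAt E (slicePt s ξ)) (slicePt s ξ) v)
  have h4 : ∀ η : conormal s.F, sliceCovec s ξ η (tr s.φ (chartAt E (slicePt s ξ)) (slicePt s ξ) v)
      = (η : E →L[ℝ] ℝ) v := fun η => congrArg (η : E →L[ℝ] ℝ) (DFunLike.congr_fun h2 v)
  rwa [h4, h4] at h3

theorem at_sliceVec (g : Metric E M) (ξ : E) (η : conormal s.F) :
    g.at (slicePt s ξ) (sliceVec s g ξ η) = sliceCovec s ξ η :=
  (g.isInvertible _).self_apply_inverse _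

theorem SliceDom.sliceVec_injective (g : Metric E M) {ξ : E} (h : SliceDom s ξ) :
    Function.Injective (sliceVec s g ξ) := by
  intro η η' he
  apply h.sliceCovec_injective
  rw [← at_sliceVec g, ← at_sliceVec g, he]

/-- The tangent space of `N` in a slice chart. -/
theorem mem_tangentTo_iff {y : M} (hy : y ∈ s.φ.source) (hyN : y ∈ N) (v : E) :
    v ∈ tangentTo (E := E) N y ↔ tr (chartAt E y) s.φ y v ∈ s.F := by
  have hyF : s.φ y ∈ s.F := (s.slice y hy).1 hyN
  have hz : chartAt E y y ∈ (chartAt E y).target := (chartAt E y).map_source (mem_chart_source E y)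
  have hzs : (chartAt E y).symm (chartAt E y y) = y := (chartAt E y).left_inv (mem_chart_source E y)
  constructor
  · rintro ⟨c, hc0, hcN, hcc, hcd⟩
    rw [hc0] at hcd
    have h1 : HasFDerivAt (s.φ ∘ (chartAt E y).symm) (tr (chartAt E y) s.φ y)
        (chartAt E y (c 0)) := by
      rw [hc0]
      exact ((contDiffAt_trans (chart_mem y) s.mem_atlas hz (by rw [hzs]; exact hy)).differentiableAt
        (by simp)).hasFDerivAt
    have h2 : HasDerivAt (fun τ => (s.φ ∘ (chartAt E y).symm) (chartAt E y (c τ)))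
        (tr (chartAt E y) s.φ y v) 0 :=
      HasFDerivAt.comp_hasDerivAt (l := s.φ ∘ (chartAt E y).symm)
        (f := fun τ => chartAt E y (c τ)) 0 h1 hcd
    have hsrc : ∀ᶠ τ in 𝓝 (0 : ℝ), c τ ∈ s.φ.source ∧ c τ ∈ (chartAt E y).source := by
      refine (hcc.eventually (s.φ.open_source.mem_nhds ?_)).and
        (hcc.eventually ((chartAt E y).open_source.mem_nhds ?_))
      · rw [hc0]; exact hy
      · rw [hc0]; exact mem_chart_source E y
    have h3 : ∀ᶠ τ in 𝓝 (0 : ℝ), (s.φ ∘ (chartAt E y).symm) (chartAt E y (c τ)) ∈ s.F := by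
      filter_upwards [hsrc, hcN] with τ hτ hτN
      rw [Function.comp, (chartAt E y).left_inv hτ.2]
      exact (s.slice _ hτ.1).1 hτN
    refine (Submodule.closed_of_finiteDimensional s.F).mem_of_tendsto
      (hasDerivAt_iff_tendsto_slope.1 h2) ?_
    filter_upwards [nhdsWithin_le_nhds h3] with τ hτ
    rw [slope_def_module]
    exact s.F.smul_mem _ (s.F.sub_mem hτ h3.self_of_nhds)
  · intro hv
    set w := tr (chartAt E y) s.φ y v with hw
    have hφy : s.φ y ∈ s.φ.target := s.φ.map_source hy
    have hφs : s.φ.symm (s.φ y) = y := s.φ.left_inv hy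
    let l : ℝ → E := fun t => s.φ y + t • w
    have hl : HasDerivAt l w 0 := by
      have := ((hasDerivAt_id (0 : ℝ)).smul_const w).const_add (s.φ y)
      rwa [one_smul] at this
    have hl0 : l 0 = s.φ y := by simp [l]
    have hc0 : s.φ.symm (l 0) = y := by rw [hl0, hφs]
    have hlt : ∀ᶠ t in 𝓝 (0 : ℝ), l t ∈ s.φ.target :=
      hl.continuousAt.eventually (s.φ.open_target.mem_nhds (by rw [hl0]; exact hφy))
    refine ⟨fun t => s.φ.symm (l t), hc0, ?_, ?_, ?_⟩
    · filter_upwards [hlt] with t ht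
      rw [s.slice _ (s.φ.map_target ht), s.φ.right_inv ht]
      exact s.F.add_mem hyF (s.F.smul_mem _ hv)
    · exact ContinuousAt.comp (g := s.φ.symm) (f := l)
        (s.φ.symm.continuousAt (by rw [hl0]; exact hφy)) hl.continuousAt
    · show HasDerivAt (fun τ => chartAt E (s.φ.symm (l 0)) (s.φ.symm (l τ))) v 0
      rw [hc0]
      have h1 : HasFDerivAt (chartAt E y ∘ s.φ.symm) (tr s.φ (chartAt E y) y) (l 0) := by
        rw [hl0]
        exact ((contDiffAt_trans s.mem_atlas (chart_mem y) hφy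
          (by rw [hφs]; exact mem_chart_source E y)).differentiableAt (by simp)).hasFDerivAt
      have h2 : HasDerivAt (fun τ => (chartAt E y ∘ s.φ.symm) (l τ)) (tr s.φ (chartAt E y) y w) 0 :=
        HasFDerivAt.comp_hasDerivAt (l := chartAt E y ∘ s.φ.symm) (f := l) 0 h1 hl
      have h3 : tr s.φ (chartAt E y) y w = v :=
        DFunLike.congr_fun (tr_comp_tr (chart_mem y) s.mem_atlas (mem_chart_source E y) hy) v
      rwa [h3] at h2

/-- The normal space of `N` in the coordinates given by a slice chart. -/
theorem SliceDom.normalTo_eq (g : Metric E M) (hx : x ∈ N) {ξ : s.F} (h : SliceDom s ξ) :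
    normalTo g N (slicePt s ξ) = range (sliceVec s g ξ) := by
  have hN := h.mem hx
  set y := slicePt s ξ with hy
  ext u
  constructor
  · intro hu
    have h2 := tr_comp_tr (chart_mem y) s.mem_atlas (mem_chart_source E y) h.mem_source
    have h2' := tr_comp_tr s.mem_atlas (chart_mem y) h.mem_source (mem_chart_source E y)
    have hη : g.at y u ∘L tr s.φ (chartAt E y) y ∈ conormal s.F := fun w hw => by
      refine hu _ ((mem_tangentTo_iff h.mem_source hN _).2 ?_)
      have : tr (chartAt E y) s.φ y (tr s.φ (chartAt E y) y w) = w := DFunLike.congr_fun h2' w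
      exact (congrArg (· ∈ s.F) this).mpr hw
    refine ⟨⟨_, hη⟩, (g.isInvertible y).injective ?_⟩
    rw [at_sliceVec g]
    ext v
    exact congrArg (g.at y u) (DFunLike.congr_fun h2 v)
  · rintro ⟨η, rfl⟩ v hv
    rw [at_sliceVec g]
    exact η.2 _ ((mem_tangentTo_iff h.mem_source hN v).1 hv)

theorem exists_slice (hx : x ∈ N) {y : M} (hy : y ∈ s.φ.source) (hyN : y ∈ N)
    (hyx : y ∈ (chartAt E x).source) :
    ∃ ξ : s.F, (ξ : E) = s.φ y - s.φ x ∧ SliceDom s ξ ∧ slicePt s ξ = y := by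
  have h1 : slicePt s (s.φ y - s.φ x) = y := by
    rw [slicePt, add_sub_cancel, s.φ.left_inv hy]
  refine ⟨⟨s.φ y - s.φ x, s.F.sub_mem ((s.slice y hy).1 hyN) ((s.slice x s.mem_source).1 hx)⟩, rfl,
    ⟨?_, ?_⟩, h1⟩
  · show s.φ x + (s.φ y - s.φ x) ∈ _
    rw [add_sub_cancel]
    exact s.φ.map_source hy
  · show slicePt s (s.φ y - s.φ x) ∈ _
    rw [h1]; exact hyx

variable (s)

theorem contDiffAt_slicePhase {ζ : SliceSpace s} (h : SliceDom s ζ.1) :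
    ContDiffAt ℝ ∞ (slicePhase s) ζ := by
  have h1 : ContDiff ℝ ∞ (fun ζ : SliceSpace s =>
      ((s.φ x + (ζ.1 : E), (ζ.2 : E →L[ℝ] ℝ)) : E × (E →L[ℝ] ℝ))) := by
    refine ContDiff.prodMk (contDiff_const.add (s.F.subtypeL.contDiff.comp contDiff_fst))
      (ContDiff.comp (g := (conormal s.F).subtypeL) (f := fun ζ : SliceSpace s => ζ.2)
        (conormal s.F).subtypeL.contDiff contDiff_snd)
  exact ContDiffAt.comp (g := cotLift s.φ (chartAt E x)) (f := fun ζ : SliceSpace s =>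
      ((s.φ x + (ζ.1 : E), (ζ.2 : E →L[ℝ] ℝ)) : E × (E →L[ℝ] ℝ))) ζ
    (contDiffAt_cotLift s.mem_atlas (chart_mem x) h.1 h.2) h1.contDiffAt

theorem slicePhase_zero_right (ξ : s.F) : slicePhase s (ξ, 0) = (chartAt E x (slicePt s ξ), 0) :=
  Prod.ext rfl (ContinuousLinearMap.zero_comp _)

theorem slicePhase_zero : slicePhase s 0 = (chartAt E x x, 0) := by
  have := slicePhase_zero_right s 0
  rw [Submodule.coe_zero, slicePt_zero] at this
  exact this

/-- Near a normal covector the base point and the normal vector depend smoothly on the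
coordinates. -/
theorem contMDiffAt_slice (g : Metric E M) {ζ : SliceSpace s} (h : SliceDom s ζ.1) :
    ContMDiffAt 𝓘(ℝ, SliceSpace s) 𝓘(ℝ, E).tangent ∞
      (fun ζ : SliceSpace s =>
        (⟨slicePt s ζ.1, sliceVec s g ζ.1 ζ.2⟩ : TangentBundle 𝓘(ℝ, E) M)) ζ := by
  have hP := contDiffAt_slicePhase s h
  have hP1 : ContDiffAt ℝ ∞ (fun ζ => (slicePhase s ζ).1) ζ := hP.fst
  have hP2 : ContDiffAt ℝ ∞ (fun ζ => (slicePhase s ζ).2) ζ := hP.snd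
  have hcont : ContinuousAt (fun ζ : SliceSpace s => slicePt s ζ.1) ζ :=
    ContinuousAt.comp (g := slicePt s) (f := fun ζ : SliceSpace s => (ζ.1 : E)) h.continuousAt
      (by fun_prop)
  have hdom : ∀ᶠ ζ' : SliceSpace s in 𝓝 ζ, SliceDom s ζ'.1 := by
    have h1 : ContinuousAt (fun ζ : SliceSpace s => s.φ x + (ζ.1 : E)) ζ := by fun_prop
    exact (h1.eventually (s.φ.open_target.mem_nhds h.1)).and
      (hcont.eventually ((chartAt E x).open_source.mem_nhds h.2))
  refine contMDiffAt_tangentBundle_mk h.2 hcont hP1 ?_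
  have hz : (slicePhase s ζ).1 ∈ (chartAt E x).target := (chartAt E x).map_source h.2
  have h2 : ContDiffAt ℝ ∞ (fun ζ => (metricC g x (slicePhase s ζ).1).inverse (slicePhase s ζ).2)
      ζ := by
    refine ContDiffAt.clm_apply ?_ hP2
    exact ContDiffAt.comp (g := fun x' => (metricC g x x').inverse)
      (f := fun ζ => (slicePhase s ζ).1) ζ (contDiffAt_metricC_inverse g hz) hP1
  refine h2.congr_of_eventuallyEq (hdom.mono fun ζ' h' => ?_)
  have h3 := inverse_phasePt g (q := x) (z := slicePhase s ζ') ((chartAt E x).map_source h'.2)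
  rw [phasePt_slicePhase h'] at h3
  have h4 : sliceVec s g ζ'.1 ζ'.2 = (g.at (slicePt s ζ'.1)).inverse (sliceCovec s ζ'.1 ζ'.2) := rfl
  have h5 := tr_comp_tr (chart_mem x) (chart_mem (slicePt s ζ'.1)) h'.2
    (mem_chart_source E (slicePt s ζ'.1))
  simp only at h3
  show tr (chartAt E (slicePt s ζ'.1)) (chartAt E x) (slicePt s ζ'.1) (sliceVec s g ζ'.1 ζ'.2) = _
  rw [h4, h3]
  exact DFunLike.congr_fun h5 _

variable [T2Space M]

/-- The exponential map on the normal bundle of `N`, with values in the chart at `x`. -/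
noncomputable def tubeMap (g : Metric E M) (ζ : SliceSpace s) : E := expC g x (slicePhase s ζ)

theorem contDiffAt_tubeMap (g : Metric E M) : ContDiffAt ℝ 2 (tubeMap s g) 0 := by
  refine ContDiffAt.comp (g := expC g x) (f := slicePhase s) 0 ?_
    ((contDiffAt_slicePhase s (sliceDom_zero s)).of_le two_le_infty)
  rw [slicePhase_zero]
  exact contDiffAt_expC g x

theorem tubeMap_zero_right (g : Metric E M) {ξ : s.F} (h : SliceDom s ξ) :
    tubeMap s g (ξ, 0) = chartAt E x (slicePt s ξ) := by
  rw [tubeMap, slicePhase_zero_right, expC_zero g x ((chartAt E x).map_source h.2)]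

theorem tubeMap_zero (g : Metric E M) : tubeMap s g 0 = chartAt E x x := by
  have := tubeMap_zero_right s g (ξ := 0) (sliceDom_zero s)
  rw [Submodule.coe_zero, slicePt_zero] at this
  exact this

/-- The normal exponential map is a local diffeomorphism at the zero section, since normal vectors
are transversal to `N`. -/
theorem fderiv_tubeMap_injective (g : Metric E M) (δ : SliceSpace s)
    (h : fderiv ℝ (tubeMap s g) 0 δ = 0) : δ = 0 := by
  obtain ⟨ξ, η⟩ := δ
  set θ := cotLift s.φ (chartAt E x) with hθ
  set z : E × (E →L[ℝ] ℝ) := (s.φ x, 0) with hz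
  have hz1 : z.1 ∈ s.φ.target := s.φ.map_source s.mem_source
  have hz2 : s.φ.symm z.1 ∈ (chartAt E x).source := by
    rw [hz, s.φ.left_inv s.mem_source]; exact mem_chart_source E x
  have hθd : HasFDerivAt θ (fderiv ℝ θ z) z :=
    ((contDiffAt_cotLift s.mem_atlas (chart_mem x) hz1 hz2).differentiableAt (by simp)).hasFDerivAt
  have hθz : θ z = (chartAt E x x, 0) := by
    rw [hθ, cotLift, hz]
    simp only [s.φ.left_inv s.mem_source]
    exact Prod.ext rfl (ContinuousLinearMap.zero_comp _)
  -- the derivative of the exponential map along the line through `(ξ, η)`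
  have hl : HasDerivAt (fun t : ℝ => z + t • ((ξ : E), (η : E →L[ℝ] ℝ))) (ξ, η) 0 := by
    have := ((hasDerivAt_id (0 : ℝ)).smul_const ((ξ : E), (η : E →L[ℝ] ℝ))).const_add z
    rwa [one_smul] at this
  have hd1 : HasDerivAt (fun t : ℝ => tubeMap s g (t • (ξ, η))) (fderiv ℝ (tubeMap s g) 0 (ξ, η))
      0 := by
    refine HasFDerivAt.comp_hasDerivAt (l := tubeMap s g)
      (f := fun t : ℝ => t • ((ξ, η) : SliceSpace s)) 0 ?_ ?_
    · have := ((contDiffAt_tubeMap s g).differentiableAt two_ne_zero).hasFDerivAt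
      simpa using this
    · have := (hasDerivAt_id (0 : ℝ)).smul_const ((ξ, η) : SliceSpace s)
      rwa [one_smul] at this
  have hd2 : HasDerivAt (fun t : ℝ => expC g x (θ (z + t • ((ξ : E), (η : E →L[ℝ] ℝ)))))
      (fderiv ℝ (expC g x) (chartAt E x x, 0) (fderiv ℝ θ z (ξ, η))) 0 := by
    refine HasFDerivAt.comp_hasDerivAt (l := expC g x)
      (f := fun t : ℝ => θ (z + t • ((ξ : E), (η : E →L[ℝ] ℝ)))) 0 ?_ ?_
    · have := ((contDiffAt_expC g x).differentiableAt two_ne_zero).hasFDerivAt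
      simpa [hθz] using this
    · refine HasFDerivAt.comp_hasDerivAt (l := θ)
        (f := fun t : ℝ => z + t • ((ξ : E), (η : E →L[ℝ] ℝ))) 0 ?_ hl
      simpa using hθd
  have he : fderiv ℝ (expC g x) (chartAt E x x, 0) (fderiv ℝ θ z (ξ, η)) = 0 := by
    rw [← h]
    refine hd2.unique (hd1.congr_of_eventuallyEq (Eventually.of_forall fun t => ?_))
    have h1 : z + t • ((ξ : E), (η : E →L[ℝ] ℝ))
        = (s.φ x + ((t • ξ : s.F) : E), ((t • η : conormal s.F) : E →L[ℝ] ℝ)) := by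
      refine Prod.ext rfl ?_
      show 0 + t • (η : E →L[ℝ] ℝ) = _
      rw [zero_add]; rfl
    show expC g x (θ (z + t • ((ξ : E), (η : E →L[ℝ] ℝ)))) = _
    rw [h1]
    rfl
  -- the derivative of the cotangent lift in the directions `(ξ, 0)` and `(0, η)`
  have hdξ : (fderiv ℝ θ z ((ξ : E), 0)).2 = 0 := by
    have hl' : HasDerivAt (fun t : ℝ => z + t • ((ξ : E), (0 : E →L[ℝ] ℝ))) (ξ, 0) 0 := by
      have := ((hasDerivAt_id (0 : ℝ)).smul_const ((ξ : E), (0 : E →L[ℝ] ℝ))).const_add z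
      rwa [one_smul] at this
    have h1 : HasDerivAt (fun t : ℝ => θ (z + t • ((ξ : E), (0 : E →L[ℝ] ℝ))))
        (fderiv ℝ θ z (ξ, 0)) 0 := by
      refine HasFDerivAt.comp_hasDerivAt (l := θ)
        (f := fun t : ℝ => z + t • ((ξ : E), (0 : E →L[ℝ] ℝ))) 0 ?_ hl'
      simpa using hθd
    have h2 : HasDerivAt (fun t : ℝ => (θ (z + t • ((ξ : E), (0 : E →L[ℝ] ℝ)))).2)
        (fderiv ℝ θ z (ξ, 0)).2 0 := h1.snd
    have h3 : ∀ t : ℝ, (θ (z + t • ((ξ : E), (0 : E →L[ℝ] ℝ)))).2 = 0 := fun t => by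
      rw [hθ, cotLift, hz]
      simp
    simp only [h3] at h2
    exact h2.unique (hasDerivAt_const _ _)
  have hdη : (fderiv ℝ θ z (0, (η : E →L[ℝ] ℝ))).1 = 0 := by
    rw [fderiv_cotLift_fst s.mem_atlas (chart_mem x) hz1 hz2, map_zero]
  have hsplit : fderiv ℝ θ z ((ξ : E), (η : E →L[ℝ] ℝ))
      = ((fderiv ℝ θ z ((ξ : E), 0)).1, (fderiv ℝ θ z (0, (η : E →L[ℝ] ℝ))).2) := by
    have h1 : ((ξ : E), (η : E →L[ℝ] ℝ)) = ((ξ : E), (0 : E →L[ℝ] ℝ)) + ((0 : E), (η : E →L[ℝ] ℝ)) := by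
      rw [Prod.mk_add_mk, add_zero, zero_add]
    rw [h1, map_add]
    refine Prod.ext ?_ ?_
    · simp [hdη]
    · simp [hdξ]
  have hpair := cotLift_symplectic s.mem_atlas (chart_mem x) hz1 hz2 (0, (η : E →L[ℝ] ℝ))
    ((ξ : E), 0)
  rw [← hθ, hdη, hdξ, zero_apply, sub_zero] at hpair
  simp only [sub_zero] at hpair
  rw [η.2 ξ ξ.2] at hpair
  rw [hsplit] at he
  obtain ⟨e1, e2⟩ := expC_injective g x he hpair
  have hξ : (ξ : E) = 0 := by
    have h1 := cotLift_symplectic s.mem_atlas (chart_mem x) hz1 hz2 ((ξ : E), 0) 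
    refine eq_of_forall_dual fun y => ?_
    have h2 := h1 (0, y)
    rw [← hθ, hdξ, e1] at h2
    simp at h2
    rw [map_zero, h2]
  have hη : (η : E →L[ℝ] ℝ) = 0 := by
    ext v
    have h1 := cotLift_symplectic s.mem_atlas (chart_mem x) hz1 hz2 (0, (η : E →L[ℝ] ℝ)) (v, 0)
    rw [← hθ, hdη, e2] at h1
    simpa using h1.symm
  exact Prod.ext (Subtype.ext hξ) (Subtype.ext hη)

theorem finrank_sliceSpace : Module.finrank ℝ (SliceSpace s) = Module.finrank ℝ E := by
  rw [Module.finrank_prod, finrank_add_finrank_conormal]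

theorem fderiv_tubeMap_surjective (g : Metric E M) :
    Function.Surjective (fderiv ℝ (tubeMap s g) 0) := by
  have h : Function.Injective (fderiv ℝ (tubeMap s g) 0 : SliceSpace s →ₗ[ℝ] E) :=
    (injective_iff_map_eq_zero _).2 (fderiv_tubeMap_injective s g)
  exact (LinearMap.injective_iff_surjective_of_finrank_eq_finrank
    (f := (fderiv ℝ (tubeMap s g) 0 : SliceSpace s →ₗ[ℝ] E)) (finrank_sliceSpace s)).1 h

/-- The tubular neighborhood theorem: the exponential map on the normal bundle is a local
diffeomorphism at the zero section. -/
theorem exists_tubeInv (g : Metric E M) :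
    ∃ Θ : E → SliceSpace s, ContDiffAt ℝ 2 Θ (chartAt E x x) ∧ Θ (chartAt E x x) = 0 ∧
      (∀ᶠ y in 𝓝 (chartAt E x x), tubeMap s g (Θ y) = y) ∧
      (∀ᶠ ζ in 𝓝 0, Θ (tubeMap s g ζ) = ζ) := by
  let F : E × SliceSpace s → E := fun w => tubeMap s g w.2 - w.1
  have hF : ContDiffAt ℝ 2 F (chartAt E x x, 0) := by
    refine ContDiffAt.sub ?_ contDiffAt_fst
    exact ContDiffAt.comp (g := tubeMap s g) (f := fun w : E × SliceSpace s => w.2) _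
      (contDiffAt_tubeMap s g) contDiffAt_snd
  have hF0 : F (chartAt E x x, 0) = 0 := by simp only [F, tubeMap_zero, sub_self]
  have hdF : ∀ v, fderiv ℝ F (chartAt E x x, 0) (0, v) = fderiv ℝ (tubeMap s g) 0 v := by
    intro v
    have h1 : HasFDerivAt F _ (chartAt E x x, 0) :=
      (HasFDerivAt.comp (g := tubeMap s g) (f := fun w : E × SliceSpace s => w.2)
        (chartAt E x x, 0) ((contDiffAt_tubeMap s g).differentiableAt two_ne_zero).hasFDerivAt
        hasFDerivAt_snd).sub hasFDerivAt_fst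
    rw [h1.fderiv]
    exact sub_zero _
  obtain ⟨Θ, hΘ, hΘ0, h1, h2⟩ := exists_implicit two_ne_zero hF
    (fun v hv => fderiv_tubeMap_injective s g v (by rwa [hdF] at hv)) (finrank_sliceSpace s)
  rw [hF0] at h1 h2
  refine ⟨Θ, hΘ, hΘ0, h1.mono fun y hy => sub_eq_zero.1 hy, ?_⟩
  have ht : Tendsto (fun ζ => (tubeMap s g ζ, ζ)) (𝓝 0) (𝓝 (chartAt E x x, 0)) := by
    have : ContinuousAt (fun ζ => (tubeMap s g ζ, ζ)) 0 :=
      (contDiffAt_tubeMap s g).continuousAt.prodMk continuousAt_id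
    have h3 := this.tendsto
    rwa [tubeMap_zero] at h3
  exact (ht.eventually h2).mono fun ζ hζ => hζ (sub_self _)

/-- Near the zero section of the normal bundle, `tubeMap` describes all geodesics issuing from `N`
orthogonally. -/
theorem eventually_isExp_slice_iff (g : Metric E M) :
    ∀ᶠ ζ : SliceSpace s in 𝓝 0, SliceDom s ζ.1 ∧ ∀ q : M,
      IsExp g (slicePt s ζ.1) (sliceVec s g ζ.1 ζ.2) q ↔
        q ∈ (chartAt E x).source ∧ chartAt E x q = tubeMap s g ζ := by
  have h1 : Tendsto (slicePhase s) (𝓝 0) (𝓝 (chartAt E x x, 0)) := by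
    rw [← slicePhase_zero s]
    exact (contDiffAt_slicePhase s (sliceDom_zero s)).continuousAt
  have h2 : Tendsto (fun ζ : SliceSpace s => (ζ.1 : E)) (𝓝 0) (𝓝 0) := by
    have : ContinuousAt (fun ζ : SliceSpace s => (ζ.1 : E)) 0 := by fun_prop
    exact this
  filter_upwards [h1.eventually (eventually_isExp_iff g x), h2.eventually (eventually_sliceDom s)]
    with ζ hζ hd
  refine ⟨hd, fun q => ?_⟩
  have h3 := hζ (sliceVec s g ζ.1 ζ.2) q
  rw [phasePt_slicePhase hd] at h3
  exact h3 (at_sliceVec g _ _)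

end Slices

end ThinBilliard

namespace ThinBilliard

/-! ### Convex bodies with a smooth boundary -/

set_option synthInstance.maxHeartbeats 400000
set_option maxHeartbeats 1000000
set_option linter.unusedSectionVars false

section ConvexBody

variable {V W : Type*} [NormedAddCommGroup V] [NormedSpace ℝ V] [NormedAddCommGroup W]
  [NormedSpace ℝ W]

theorem hasDerivAt_vertLine (ξ : V) (η w : W) (τ : ℝ) :
    HasDerivAt (fun t : ℝ => (ξ, η + t • w)) (0, w) τ := by
  have h := ((hasDerivAt_id τ).smul_const w).const_add η
  rw [one_smul] at h
  exact (hasDerivAt_const _ _).prodMk h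

theorem eventually_hasDerivAt_vertLine {r : V × W → ℝ} {ξ : V} {η : W} (hr : ContDiffAt ℝ 2 r (ξ, η))
    (w : W) : ∀ᶠ τ in 𝓝 (0 : ℝ),
      HasDerivAt (fun τ : ℝ => r (ξ, η + τ • w)) (fderiv ℝ r (ξ, η + τ • w) (0, w)) τ := by
  have h : Tendsto (fun t : ℝ => (ξ, η + t • w)) (𝓝 0) (𝓝 (ξ, η + (0 : ℝ) • w)) :=
    (hasDerivAt_vertLine ξ η w 0).continuousAt
  rw [zero_smul, add_zero] at h
  filter_upwards [h.eventually (hr.eventually (by simp))] with τ hτ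
  exact HasFDerivAt.comp_hasDerivAt (l := r) (f := fun t : ℝ => (ξ, η + t • w)) τ
    (hτ.differentiableAt two_ne_zero).hasFDerivAt (hasDerivAt_vertLine ξ η w τ)

theorem deriv_line {r : V × W → ℝ} {ξ : V} {η : W} (hr : ContDiffAt ℝ 2 r (ξ, η)) (w : W) :
    deriv (fun τ : ℝ => r (ξ, η + τ • w)) 0 = fderiv ℝ r (ξ, η) (0, w) := by
  have := (eventually_hasDerivAt_vertLine hr w).self_of_nhds.deriv
  rwa [zero_smul, add_zero] at this

theorem iteratedDeriv_two_line {r : V × W → ℝ} {ξ : V} {η : W} (hr : ContDiffAt ℝ 2 r (ξ, η))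
    (w : W) : iteratedDeriv 2 (fun τ : ℝ => r (ξ, η + τ • w)) 0
      = fderiv ℝ (fderiv ℝ r) (ξ, η) (0, w) (0, w) := by
  rw [iteratedDeriv_succ, iteratedDeriv_one]
  have h3 : deriv (fun τ : ℝ => r (ξ, η + τ • w))
      =ᶠ[𝓝 0] fun τ : ℝ => fderiv ℝ r (ξ, η + τ • w) (0, w) :=
    (eventually_hasDerivAt_vertLine hr w).mono fun τ hτ => hτ.deriv
  rw [h3.deriv_eq]
  have h4 : HasFDerivAt (fderiv ℝ r) (fderiv ℝ (fderiv ℝ r) (ξ, η)) (ξ, η + (0 : ℝ) • w) := by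
    rw [zero_smul, add_zero]
    exact ((hr.fderiv_right (m := 1) (by norm_num)).differentiableAt one_ne_zero).hasFDerivAt
  have h5 : HasDerivAt (fun τ : ℝ => fderiv ℝ r (ξ, η + τ • w))
      (fderiv ℝ (fderiv ℝ r) (ξ, η) (0, w)) 0 :=
    HasFDerivAt.comp_hasDerivAt (l := fderiv ℝ r) (f := fun t : ℝ => (ξ, η + t • w)) 0 h4
      (hasDerivAt_vertLine ξ η w 0)
  have h6 := h5.clm_apply (hasDerivAt_const (0 : ℝ) ((0, w) : V × W))
  rw [h6.deriv, map_zero, add_zero]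

/-- The boundary of a body is the zero set of a regular function defining it. -/
theorem eventually_boundary_iff {r : V × W → ℝ} {B : V → Set W} {η₀ e : W}
    (hr : ContDiffAt ℝ 2 r (0, η₀)) (he : fderiv ℝ r (0, η₀) (0, e) ≠ 0)
    (hB : ∀ᶠ z in 𝓝 (0, η₀), z.2 ∈ B z.1 ↔ r z ≤ 0) :
    ∀ᶠ z in 𝓝 ((0 : V), η₀), (z.2 ∈ B z.1 ∧ B z.1 ∉ 𝓝 z.2) ↔ r z = 0 := by
  have hd : ContinuousAt (fun z => fderiv ℝ r z (0, e)) (0, η₀) :=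
    (hr.fderiv_right (m := 1) (by norm_num)).continuousAt.clm_apply continuousAt_const
  filter_upwards [hB.eventually_nhds, hr.eventually (by simp), hd.eventually_ne he] with z hz hrz hez
  have hz0 := hz.self_of_nhds
  constructor
  · rintro ⟨h1, h2⟩
    by_contra h3
    have h4 : r z < 0 := lt_of_le_of_ne (hz0.1 h1) h3
    have h5 : ∀ᶠ w in 𝓝 z, w.2 ∈ B w.1 := by
      filter_upwards [hz, hrz.continuousAt.eventually_lt_const h4] with w hw hw'
      exact hw.2 hw'.le
    have h6 : Tendsto (fun η => (z.1, η)) (𝓝 z.2) (𝓝 z) :=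
      (continuous_const.prodMk continuous_id).continuousAt (x := z.2)
    exact h2 (h6.eventually h5)
  · intro h1
    refine ⟨hz0.2 h1.le, fun h2 => hez ?_⟩
    have hl := hasDerivAt_vertLine z.1 z.2 e 0
    have hl0 : (z.1, z.2 + (0 : ℝ) • e) = z := by simp
    have h4 : HasDerivAt (fun t : ℝ => r (z.1, z.2 + t • e)) (fderiv ℝ r z (0, e)) 0 := by
      refine HasFDerivAt.comp_hasDerivAt (l := r) (f := fun t : ℝ => (z.1, z.2 + t • e)) 0 ?_ hl
      rw [hl0]
      exact (hrz.differentiableAt two_ne_zero).hasFDerivAt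
    have hlc : Tendsto (fun t : ℝ => (z.1, z.2 + t • e)) (𝓝 0) (𝓝 (z.1, z.2 + (0 : ℝ) • e)) :=
      hl.continuousAt
    rw [hl0] at hlc
    have hlc2 : Tendsto (fun t : ℝ => z.2 + t • e) (𝓝 0) (𝓝 z.2) :=
      (continuous_snd.tendsto z).comp hlc
    refine IsLocalMax.hasDerivAt_eq_zero ?_ h4
    filter_upwards [hlc.eventually hz, hlc2.eventually h2] with t ht ht'
    have h5 : r (z.1, z.2 + (0 : ℝ) • e) = 0 := by simpa using h1
    show r (z.1, z.2 + t • e) ≤ r (z.1, z.2 + (0 : ℝ) • e)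
    rw [h5]
    exact ht.1 ht'

/-- A linear function attains its maximum over a compact set at a boundary point. -/
theorem exists_boundary_max {B : Set W} (hB : IsCompact B) (hne : B.Nonempty) {l : W →L[ℝ] ℝ}
    (hl : l ≠ 0) : ∃ η₀ ∈ B, B ∉ 𝓝 η₀ ∧ ∀ η ∈ B, l η ≤ l η₀ := by
  obtain ⟨η₀, h1, h2⟩ := hB.exists_isMaxOn hne l.continuous.continuousOn
  refine ⟨η₀, h1, fun h => hl ?_, h2⟩
  ext w
  have h3 : HasDerivAt (fun t : ℝ => l (η₀ + t • w)) (l w) 0 := by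
    have h4 := ((hasDerivAt_id (0 : ℝ)).smul_const w).const_add η₀
    rw [one_smul] at h4
    exact HasFDerivAt.comp_hasDerivAt (l := l) (f := fun t : ℝ => η₀ + t • w) 0 l.hasFDerivAt h4
  have h5 : ContinuousAt (fun t : ℝ => η₀ + t • w) 0 := by fun_prop
  have h6 : Tendsto (fun t : ℝ => η₀ + t • w) (𝓝 0) (𝓝 η₀) := by
    have := h5.tendsto
    simpa using this
  refine IsLocalMax.hasDerivAt_eq_zero ?_ h3
  filter_upwards [h6.eventually h] with t ht
  simpa using h2 ht

/-- The Lagrange multiplier of a linear function at its maximum over a convex body. -/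
theorem exists_pos_smul_eq {m l : W →L[ℝ] ℝ} (hm : m ≠ 0) (hl : l ≠ 0)
    (h : ∀ w, m w < 0 → l w ≤ 0) : ∃ μ > (0 : ℝ), l = μ • m := by
  obtain ⟨e, he⟩ : ∃ e, m e < 0 := by
    obtain ⟨e, he⟩ := DFunLike.ne_iff.1 hm
    rcases lt_or_gt_of_ne he with he | he
    · exact ⟨e, he⟩
    · exact ⟨-e, by rw [map_neg]; exact neg_lt_zero.2 he⟩
  have hk : ∀ w, m w = 0 → l w ≤ 0 := fun w hw => by
    have h1 : Tendsto (fun t : ℝ => l (w + t • e)) (𝓝[>] 0) (𝓝 (l (w + (0 : ℝ) • e))) :=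
      ((by fun_prop : Continuous fun t : ℝ => l (w + t • e)).tendsto 0).mono_left
        nhdsWithin_le_nhds
    rw [zero_smul, add_zero] at h1
    refine le_of_tendsto h1 ?_
    filter_upwards [self_mem_nhdsWithin] with t ht
    refine h _ ?_
    rw [map_add, map_smul, hw, zero_add]
    exact mul_neg_of_pos_of_neg ht he
  have hk' : ∀ w, m w = 0 → l w = 0 := fun w hw => by
    refine le_antisymm (hk w hw) ?_
    have := hk (-w) (by rw [map_neg, hw, neg_zero])
    rw [map_neg] at this
    linarith
  have hlm : l = (l e / m e) • m := by
    ext w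
    have h1 := hk' (w - (m w / m e) • e) (by
      rw [map_sub, map_smul, smul_eq_mul, div_mul_cancel₀ _ he.ne, sub_self])
    rw [map_sub, map_smul, smul_eq_mul, sub_eq_zero] at h1
    rw [smul_apply, smul_eq_mul, h1]
    ring
  refine ⟨l e / m e, lt_of_le_of_ne (div_nonneg_of_nonpos (h e he) he.le) fun h0 => hl ?_, hlm⟩
  rw [hlm, ← h0, zero_smul]

variable {B : V → Set W}

/-- The complements of convex bodies with a smooth boundary form an open set. -/
theorem eventually_not_mem_body (hK : IsCompact (B 0))
    (hc : ∀ᶠ ξ in 𝓝 0, Convex ℝ (B ξ) ∧ 0 ∈ B ξ)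
    (hbd : ∀ η₀ ∈ B 0, B 0 ∉ 𝓝 η₀ → ∃ r : V × W → ℝ, ContDiffAt ℝ 2 r (0, η₀) ∧
      ∀ᶠ z in 𝓝 (0, η₀), z.2 ∈ B z.1 ↔ r z ≤ 0)
    {η : W} (hη : η ∉ B 0) : ∀ᶠ z : V × W in 𝓝 (0, η), z.2 ∉ B z.1 := by
  have h0 := hc.self_of_nhds.2
  -- the point `τ • η` at which the ray through `η` leaves the body
  let I : Set ℝ := Icc 0 1 ∩ (fun τ : ℝ => τ • η) ⁻¹' B 0
  have hI : IsCompact I := isCompact_Icc.inter_right (hK.isClosed.preimage (by fun_prop))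
  obtain ⟨τ, ⟨⟨hτ0, hτ1⟩, hτB⟩, hτmax⟩ := hI.exists_isGreatest
    ⟨0, ⟨le_rfl, zero_le_one⟩, by rw [mem_preimage, zero_smul]; exact h0⟩
  have hτB : τ • η ∈ B 0 := hτB
  have hτ1' : τ < 1 := lt_of_le_of_ne hτ1 fun h => hη (by rwa [h, one_smul] at hτB)
  have hout : ∀ σ, τ < σ → σ ≤ 1 → σ • η ∉ B 0 := fun σ h1 h2 h3 =>
    absurd (hτmax ⟨⟨hτ0.trans h1.le, h2⟩, h3⟩) (not_le.2 h1)
  have htend : Tendsto (fun σ : ℝ => σ • η) (𝓝[>] τ) (𝓝 (τ • η)) :=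
    ((by fun_prop : Continuous fun σ : ℝ => σ • η).tendsto τ).mono_left nhdsWithin_le_nhds
  have hlt : ∀ᶠ σ in 𝓝[>] τ, τ < σ ∧ σ ≤ 1 := by
    filter_upwards [self_mem_nhdsWithin, nhdsWithin_le_nhds (Iio_mem_nhds hτ1')] with σ h1 h2
    exact ⟨h1, le_of_lt h2⟩
  have hbdτ : B 0 ∉ 𝓝 (τ • η) := fun h => by
    obtain ⟨σ, h1, h2⟩ := (hlt.and (htend.eventually h)).exists
    exact hout σ h1.1 h1.2 h2
  obtain ⟨r, hr, hiff⟩ := hbd _ hτB hbdτ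
  have ht2 : Tendsto (fun σ : ℝ => ((0 : V), σ • η)) (𝓝[>] τ) (𝓝 (0, τ • η)) :=
    tendsto_const_nhds.prodMk_nhds htend
  obtain ⟨σ, ⟨hσ1, hσ2⟩, hσ3, hσ4⟩ := (hlt.and
    ((ht2.eventually hiff.eventually_nhds).and
      (ht2.eventually (hr.eventually (by simp))))).exists
  have hσr : 0 < r (0, σ • η) := by
    by_contra h
    exact hout σ hσ1 hσ2 (hσ3.self_of_nhds.2 (not_lt.1 h))
  have hev : ∀ᶠ z : V × W in 𝓝 (0, σ • η), z.2 ∉ B z.1 := by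
    filter_upwards [hσ3, hσ4.continuousAt.eventually_const_lt hσr] with z h1 h2
    rw [h1]
    exact not_le.2 h2
  have hs : Tendsto (fun z : V × W => (z.1, σ • z.2)) (𝓝 (0, η)) (𝓝 (0, σ • η)) :=
    (by fun_prop : Continuous fun z : V × W => (z.1, σ • z.2)).tendsto (0, η)
  have hfst : Tendsto Prod.fst (𝓝 ((0 : V), η)) (𝓝 0) := continuousAt_fst
  filter_upwards [hs.eventually hev, hfst.eventually hc] with z hz hzc hzB
  exact hz (hzc.1.smul_mem_of_zero_mem hzc.2 hzB ⟨hτ0.trans hσ1.le, hσ2⟩)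

/-- The bodies `B(ξ)` are uniformly bounded for small `ξ`: being convex and containing `0`, they are
contained in a ball as soon as they do not meet its boundary sphere. -/
theorem exists_eventually_norm_le [FiniteDimensional ℝ W] (hK : IsCompact (B 0))
    (hc : ∀ᶠ ξ in 𝓝 0, Convex ℝ (B ξ) ∧ 0 ∈ B ξ)
    (hbd : ∀ η₀ ∈ B 0, B 0 ∉ 𝓝 η₀ → ∃ r : V × W → ℝ, ContDiffAt ℝ 2 r (0, η₀) ∧
      ∀ᶠ z in 𝓝 (0, η₀), z.2 ∈ B z.1 ↔ r z ≤ 0) :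
    ∃ R : ℝ, ∀ᶠ ξ in 𝓝 0, ∀ η ∈ B ξ, ‖η‖ ≤ R := by
  obtain ⟨R, hR0, hR⟩ := hK.isBounded.exists_pos_norm_lt
  have h1 : ∀ᶠ ξ in 𝓝 0, ∀ η ∈ Metric.sphere (0 : W) R, η ∉ B ξ := by
    refine (isCompact_sphere _ _).eventually_forall_of_forall_eventually fun η hη => ?_
    refine eventually_not_mem_body hK hc hbd fun h => ?_
    have := hR η h
    rw [mem_sphere_zero_iff_norm.1 hη] at this
    exact lt_irrefl _ this
  refine ⟨R, ?_⟩
  filter_upwards [h1, hc] with ξ hξ hξc η hη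
  by_contra h2
  have h2 : R < ‖η‖ := not_le.1 h2
  refine hξ ((R / ‖η‖) • η) ?_ (hξc.1.smul_mem_of_zero_mem hξc.2 hη
    ⟨by positivity, (div_le_one (hR0.trans h2)).2 h2.le⟩)
  rw [mem_sphere_zero_iff_norm, norm_smul, Real.norm_of_nonneg (by positivity),
    div_mul_cancel₀ _ (hR0.trans h2).ne']

end ConvexBody

/-! ### The normal bodies in slice coordinates -/

section SliceBody

variable {E : Type*} [NormedAddCommGroup E] [NormedSpace ℝ E] [FiniteDimensional ℝ E]
  {M : Type*} [TopologicalSpace M] [ChartedSpace E M] [IsManifold 𝓘(ℝ, E) ∞ M]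
  {N : Set M} {x : M} (s : SliceChart (E := E) N x) (g : Metric E M) (B : M → Set E)

/-- The body `B_y`, where `y` has the coordinate `ξ`, in the coordinate `η`. -/
def sliceBody (ξ : E) : Set (conormal s.F) := sliceVec s g ξ ⁻¹' B (slicePt s ξ)

variable {s g B}

theorem convex_sliceBody (hB : IsConvexFamily g N B) (hx : x ∈ N) {ξ : s.F} (h : SliceDom s ξ) :
    Convex ℝ (sliceBody s g B ξ) :=
  (hB.convex _ (h.mem hx)).linear_preimage (sliceVec s g ξ : conormal s.F →ₗ[ℝ] E)

theorem isClosedEmbedding_sliceVec {ξ : s.F} (h : SliceDom s ξ) :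
    IsClosedEmbedding (sliceVec s g ξ) :=
  LinearMap.isClosedEmbedding_of_injective (f := (sliceVec s g ξ : conormal s.F →ₗ[ℝ] E))
    (LinearMap.ker_eq_bot.2 (h.sliceVec_injective g))

theorem isCompact_sliceBody (hB : IsConvexFamily g N B) (hx : x ∈ N) {ξ : s.F}
    (h : SliceDom s ξ) : IsCompact (sliceBody s g B ξ) :=
  (isClosedEmbedding_sliceVec h).isCompact_preimage (hB.compact _ (h.mem hx))

theorem sliceBody_mem_nhds_iff (hx : x ∈ N) {ξ : s.F} (h : SliceDom s ξ) (η : conormal s.F) :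
    sliceBody s g B ξ ∈ 𝓝 η ↔ B (slicePt s ξ) ∈ 𝓝[normalTo g N (slicePt s ξ)] sliceVec s g ξ η := by
  rw [h.normalTo_eq g hx, ← (isClosedEmbedding_sliceVec h).isInducing.map_nhds_eq, mem_map]
  rfl

theorem mem_sphereOf_iff (hx : x ∈ N) {ξ : s.F} (h : SliceDom s ξ) (η : conormal s.F) :
    sliceVec s g ξ η ∈ sphereOf g N B (slicePt s ξ) ↔
      η ∈ sliceBody s g B ξ ∧ sliceBody s g B ξ ∉ 𝓝 η := by
  rw [sliceBody_mem_nhds_iff hx h]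
  rfl

theorem zero_mem_sliceBody (hB : IsConvexFamily g N B) (hx : x ∈ N) {ξ : s.F}
    (h : SliceDom s ξ) : (0 : conormal s.F) ∈ sliceBody s g B ξ := by
  refine mem_of_mem_nhds ((sliceBody_mem_nhds_iff hx h 0).2 ?_)
  rw [map_zero]
  exact hB.nhds_zero _ (h.mem hx)

/-- The boundaries of the bodies are the level sets of a smooth function `r`, which is regular and
convex to second order in `η`. -/
theorem exists_boundary_function (hB : IsConvexFamily g N B) (hx : x ∈ N) {η₀ : conormal s.F}
    (h1 : η₀ ∈ sliceBody s g B 0) (h2 : sliceBody s g B 0 ∉ 𝓝 η₀) :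
    ∃ r : SliceSpace s → ℝ, ContDiffAt ℝ 2 r (0, η₀) ∧
      (∀ᶠ z : SliceSpace s in 𝓝 (0, η₀), z.2 ∈ sliceBody s g B z.1 ↔ r z ≤ 0) ∧
      (∃ e, fderiv ℝ r (0, η₀) (0, e) ≠ 0) ∧
      ∀ w ≠ 0, fderiv ℝ r (0, η₀) (0, w) = 0 →
        0 < fderiv ℝ (fderiv ℝ r) (0, η₀) (0, w) (0, w) := by
  have hd : SliceDom s ((0 : s.F) : E) := sliceDom_zero s
  obtain ⟨ρ, hρ, hiff, ⟨w₀, hw₀, hw₀'⟩, hconv⟩ := hB.boundary _ (hd.mem hx) (sliceVec s g 0 η₀)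
    ((mem_sphereOf_iff hx hd η₀).2 ⟨h1, h2⟩)
  let ι : SliceSpace s → TangentBundle 𝓘(ℝ, E) M := fun ζ => ⟨slicePt s ζ.1, sliceVec s g ζ.1 ζ.2⟩
  have hι := contMDiffAt_slice s g (ζ := (0, η₀)) hd
  let r : SliceSpace s → ℝ := fun ζ => ρ (ι ζ)
  have hr : ContDiffAt ℝ ∞ r (0, η₀) :=
    (ContMDiffAt.comp (g := ρ) (f := ι) (0, η₀) hρ hι).contDiffAt
  have hr2 : ContDiffAt ℝ 2 r (0, η₀) := hr.of_le two_le_infty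
  -- the restriction of `ρ` to a line in the fibre is the restriction of `r` to a line
  have hline : ∀ w : conormal s.F,
      (fun τ : ℝ => ρ ⟨slicePt s ((0 : s.F) : E), sliceVec s g 0 η₀ + τ • sliceVec s g 0 w⟩)
        = fun τ : ℝ => r (0, η₀ + τ • w) := fun w => by
    funext τ
    show _ = ρ ⟨_, sliceVec s g _ (η₀ + τ • w)⟩
    rw [map_add, map_smul]
    rfl
  refine ⟨r, hr2, ?_, ?_, ?_⟩
  · have h3 : Tendsto (fun ζ : SliceSpace s => (ζ.1 : E)) (𝓝 (0, η₀)) (𝓝 0) := by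
      have : ContinuousAt (fun ζ : SliceSpace s => (ζ.1 : E)) (0, η₀) := by fun_prop
      exact this
    filter_upwards [hι.continuousAt.eventually hiff, h3.eventually (eventually_sliceDom s)]
      with z hz hzd
    refine hz (hzd.mem hx) ?_
    show sliceVec s g z.1 z.2 ∈ normalTo g N (slicePt s z.1)
    rw [hzd.normalTo_eq g hx]
    exact mem_range_self _
  · rw [hd.normalTo_eq g hx] at hw₀
    obtain ⟨e, rfl⟩ := hw₀
    refine ⟨e, ?_⟩
    rw [← deriv_line hr2, ← hline]
    exact hw₀'
  · intro w hw hw'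
    rw [← iteratedDeriv_two_line hr2, ← hline]
    refine hconv _ ?_ ?_ ?_
    · rw [hd.normalTo_eq g hx]; exact mem_range_self _
    · intro h0
      exact hw (hd.sliceVec_injective g (h0.trans (map_zero _).symm))
    · have := deriv_line hr2 w
      rw [← hline] at this
      exact this.trans hw'

theorem tendsto_coe_fst (s : SliceChart (E := E) N x) (η : conormal s.F) :
    Tendsto (fun ζ : SliceSpace s => (ζ.1 : E)) (𝓝 (0, η)) (𝓝 0) := by
  have : ContinuousAt (fun ζ : SliceSpace s => (ζ.1 : E)) (0, η) := by fun_prop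
  exact this

theorem eventually_sliceDom' (s : SliceChart (E := E) N x) :
    ∀ᶠ ξ : s.F in 𝓝 0, SliceDom s ξ := by
  have h : Tendsto (fun ξ : s.F => (ξ : E)) (𝓝 0) (𝓝 0) := by
    have : ContinuousAt (fun ξ : s.F => (ξ : E)) 0 := by fun_prop
    exact this
  exact h.eventually (eventually_sliceDom s)

/-- The bodies are locally bounded. -/
theorem exists_sliceBody_bound (hB : IsConvexFamily g N B) (hx : x ∈ N) :
    ∃ R : ℝ, ∀ᶠ ξ : s.F in 𝓝 0, ∀ η ∈ sliceBody s g B ξ, ‖η‖ ≤ R := by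
  have hd : SliceDom s ((0 : s.F) : E) := sliceDom_zero s
  refine exists_eventually_norm_le (B := fun ξ : s.F => sliceBody s g B ξ)
    (isCompact_sliceBody hB hx hd) ?_ fun η₀ h1 h2 => ?_
  · exact (eventually_sliceDom' s).mono fun ξ h =>
      ⟨convex_sliceBody hB hx h, zero_mem_sliceBody hB hx h⟩
  · obtain ⟨r, hr, hiff, -, -⟩ := exists_boundary_function hB hx h1 h2
    exact ⟨r, hr, hiff⟩

/-- The vectors of `ε B_y`, for small `ε` and `y` close to `x`, are small in slice coordinates. -/
theorem eventually_scaled_mem (hB : IsConvexFamily g N B) (hx : x ∈ N)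
    {Q : SliceSpace s → Prop} (hQ : ∀ᶠ ζ in 𝓝 0, Q ζ) :
    ∀ᶠ z : ℝ × M in 𝓝 (0, x), z.2 ∈ N → ∀ u ∈ B z.2, ∃ (ξ : s.F) (η : conormal s.F),
      SliceDom s ξ ∧ slicePt s ξ = z.2 ∧ sliceVec s g ξ η = u ∧ Q (ξ, z.1 • η) := by
  obtain ⟨R, hR⟩ := exists_sliceBody_bound (s := s) hB hx
  obtain ⟨δ, hδ, hball⟩ := Metric.eventually_nhds_iff_ball.1 hQ
  have h1 : ∀ᶠ ξ : s.F in 𝓝 0, ‖ξ‖ < δ := by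
    have : Tendsto (fun ξ : s.F => ‖ξ‖) (𝓝 0) (𝓝 0) := tendsto_norm_zero
    exact this.eventually_lt_const hδ
  have h2 : ∀ᶠ v : E in 𝓝 0, ∀ ξ : s.F, (ξ : E) = v → ‖ξ‖ < δ ∧ ∀ η ∈ sliceBody s g B ξ,
      ‖η‖ ≤ R := by
    have h3 := h1.and hR
    rw [nhds_subtype_eq_comap, eventually_comap] at h3
    exact h3
  have h4 : Tendsto (fun y : M => s.φ y - s.φ x) (𝓝 x) (𝓝 0) := by
    have h5 : ContinuousAt (fun y : M => s.φ y - s.φ x) x :=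
      (s.φ.continuousAt s.mem_source).sub continuousAt_const
    have := h5.tendsto
    rwa [sub_self] at this
  have h6 : ∀ᶠ ε : ℝ in 𝓝 0, |ε| * (|R| + 1) < δ := by
    have h7 : ContinuousAt (fun ε : ℝ => |ε| * (|R| + 1)) 0 := by fun_prop
    refine h7.eventually_lt_const ?_
    simpa using hδ
  have hfst : Tendsto Prod.fst (𝓝 ((0 : ℝ), x)) (𝓝 0) := continuousAt_fst
  have hsnd : Tendsto Prod.snd (𝓝 ((0 : ℝ), x)) (𝓝 x) := continuousAt_snd
  filter_upwards [hfst.eventually h6, hsnd.eventually (h4.eventually h2),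
    hsnd.eventually (s.φ.open_source.mem_nhds s.mem_source),
    hsnd.eventually ((chartAt E x).open_source.mem_nhds (mem_chart_source E x))]
    with z hz1 hz2 hz3 hz4 hzN u hu
  obtain ⟨ξ, hξ, hξd, hξz⟩ := exists_slice hx hz3 hzN hz4
  have hu' := hB.subset _ hzN hu
  rw [← hξz, hξd.normalTo_eq g hx] at hu'
  obtain ⟨η, rfl⟩ := hu'
  obtain ⟨h7, h8⟩ := hz2 ξ hξ
  have hη : ‖η‖ ≤ R := h8 η (by show _ ∈ B _; rw [hξz]; exact hu)
  refine ⟨ξ, η, hξd, hξz, rfl, hball _ ?_⟩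
  rw [mem_ball_zero_iff, Prod.norm_def]
  refine max_lt h7 ?_
  rw [norm_smul, Real.norm_eq_abs]
  refine lt_of_le_of_lt (mul_le_mul_of_nonneg_left ?_ (abs_nonneg _)) hz1
  exact hη.trans ((le_abs_self R).trans (by linarith))

variable [T2Space M]

/-- Thin tubes are close to the scatterer. -/
theorem eventually_not_mem_tube (hN : IsScatterer (E := E) N) (hB : IsConvexFamily g N B)
    {K : Set M} (hK : IsCompact K) (hKN : K ⊆ N) {y : M} (hy : y ∉ K) :
    ∀ᶠ z : ℝ × M in 𝓝 (0, y), z.2 ∉ tube g B K z.1 := by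
  have h : ∀ᶠ z : ℝ × M in 𝓝 (0, y), ∀ x ∈ K, x ∈ N → ∀ u ∈ B x, ¬ IsExp g x (z.1 • u) z.2 := by
    refine hK.eventually_forall_of_forall_eventually fun x hxK => ?_
    have hx := hKN hxK
    obtain ⟨s, -⟩ := hN x hx
    obtain ⟨U, V, hU, hV, hxU, hyV, hUV⟩ := t2_separation (ne_of_mem_of_not_mem hxK hy)
    have h1 : Tendsto (fun ζ => (chartAt E x).symm (tubeMap s g ζ)) (𝓝 0) (𝓝 x) := by
      have h2 : Tendsto (tubeMap s g) (𝓝 0) (𝓝 (chartAt E x x)) := by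
        rw [← tubeMap_zero s g]
        exact (contDiffAt_tubeMap s g).continuousAt
      have h3 := (chartAt E x).symm.continuousAt ((chartAt E x).map_source (mem_chart_source E x))
      have h4 := h3.tendsto.comp h2
      rwa [(chartAt E x).left_inv (mem_chart_source E x)] at h4
    have h5 := eventually_scaled_mem hB hx ((eventually_isExp_slice_iff s g).and
      (h1.eventually (hU.mem_nhds hxU)))
    have h6 : Tendsto (fun w : (ℝ × M) × M => (w.1.1, w.2)) (𝓝 ((0, y), x)) (𝓝 (0, x)) :=
      (by fun_prop : Continuous fun w : (ℝ × M) × M => (w.1.1, w.2)).tendsto ((0, y), x)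
    have h7 : Tendsto (fun w : (ℝ × M) × M => w.1.2) (𝓝 ((0, y), x)) (𝓝 y) :=
      (by fun_prop : Continuous fun w : (ℝ × M) × M => w.1.2).tendsto ((0, y), x)
    filter_upwards [h6.eventually h5, h7.eventually (hV.mem_nhds hyV)] with w hw hwV hwN u hu he
    obtain ⟨ξ, η, -, h8, rfl, ⟨-, h9⟩, h10⟩ := hw hwN u hu
    have h8 : slicePt s ξ = w.2 := h8
    rw [← map_smul, ← h8, h9] at he
    refine disjoint_left.1 hUV h10 ?_
    show (chartAt E x).symm (tubeMap s g (ξ, w.1.1 • η)) ∈ V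
    rw [← he.2, (chartAt E x).left_inv he.1]
    exact hwV
  filter_upwards [h] with z hz
  rintro ⟨x, hxK, u, hu, he⟩
  exact hz x hxK (hKN hxK) u hu he

/-- Points of a thin tube which are close to `x` come from points of the scatterer close to `x`. -/
theorem eventually_tube_coord (hN : IsScatterer (E := E) N) (hB : IsConvexFamily g N B)
    {K : Set M} (hK : IsCompact K) (hKN : K ⊆ N) (hx : x ∈ N) {B' : M → Set E}
    (hB' : ∀ y ∈ N, B' y ⊆ B y) {Θ : E → SliceSpace s}
    (hΘ : ∀ᶠ ζ in 𝓝 0, Θ (tubeMap s g ζ) = ζ) :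
    ∀ᶠ z : ℝ × M in 𝓝 (0, x), z.2 ∈ tube g B' K z.1 → ∃ (ξ : s.F) (η : conormal s.F),
      SliceDom s ξ ∧ sliceVec s g ξ η ∈ B' (slicePt s ξ) ∧
      Θ (chartAt E x z.2) = (ξ, z.1 • η) := by
  have h1 := eventually_scaled_mem hB hx ((eventually_isExp_slice_iff s g).and hΘ)
  rw [nhds_prod_eq] at h1
  obtain ⟨U, hU, V, hV, hUV⟩ := Filter.mem_prod_iff.1 h1
  obtain ⟨O, hOV, hO, hxO⟩ := mem_nhds_iff.1 hV
  have h2 := eventually_not_mem_tube hN hB (hK.diff hO) (sdiff_subset.trans hKN)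
    (fun h : x ∈ K \ O => h.2 hxO)
  have hfst : Tendsto Prod.fst (𝓝 ((0 : ℝ), x)) (𝓝 0) := continuousAt_fst
  filter_upwards [hfst.eventually hU, h2] with z hzU hz
  rintro ⟨y, hyK, u, hu, he⟩
  have hyO : y ∈ O := by
    by_contra h
    exact hz ⟨y, ⟨hyK, h⟩, u, hB' y (hKN hyK) hu, he⟩
  have h3 : (z.1, y) ∈ U ×ˢ V := ⟨hzU, hOV hyO⟩
  obtain ⟨ξ, η, hd, h8, h7, ⟨-, h9⟩, h10⟩ := hUV h3 (hKN hyK) u (hB' y (hKN hyK) hu)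
  simp only at h8 h7 h10
  refine ⟨ξ, η, hd, by rw [h8, h7]; exact hu, ?_⟩
  rw [← h7, ← map_smul, ← h8, h9] at he
  rw [he.2, h10]

end SliceBody

end ThinBilliard

namespace ThinBilliard

/-! ### Leaving a thin tube after a reflection -/

set_option synthInstance.maxHeartbeats 400000
set_option maxHeartbeats 1000000
set_option linter.unusedSectionVars false

section Leave

variable {V W Z : Type*} [NormedAddCommGroup V] [NormedSpace ℝ V] [FiniteDimensional ℝ V]
  [NormedAddCommGroup W] [NormedSpace ℝ W] [FiniteDimensional ℝ W]
  [NormedAddCommGroup Z] [NormedSpace ℝ Z]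

/-- A curve which starts at a boundary point `(ξ, ε η)` of the scaled family of bodies
`{(ξ, ε η) | η ∈ B(ξ)}` with a velocity pointing outwards does not return to this family for small
times, uniformly in the scale `ε`. -/
theorem eventually_not_mem_scaled {r : V × W → ℝ} {B : V → Set W} {η₀ : W} {R : ℝ}
    {F : Z × ℝ → V × W} {z₀ : Z} (hr : ContDiffAt ℝ 2 r (0, η₀))
    (hr0 : r (0, η₀) = 0) (hconv : ∀ᶠ ξ in 𝓝 0, Convex ℝ (B ξ))
    (hbdd : ∀ᶠ ξ in 𝓝 0, ∀ η ∈ B ξ, ‖η‖ ≤ R)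
    (hB : ∀ᶠ z in 𝓝 (0, η₀), z.2 ∈ B z.1 ↔ r z ≤ 0)
    (hF : ContDiffAt ℝ 1 F (z₀, 0)) (hF0 : F (z₀, 0) = 0)
    (hd : fderiv ℝ r (0, η₀) (0, (fderiv ℝ F (z₀, 0) (0, 1)).2) ≠ 0) :
    ∀ᶠ w : (ℝ × (V × W)) × (Z × ℝ) in 𝓝 ((0, (0, η₀)), (z₀, 0)),
      0 < w.1.1 → r w.1.2 = 0 → F (w.2.1, 0) = (w.1.2.1, w.1.1 • w.1.2.2) →
      0 < w.2.2 * fderiv ℝ r (0, η₀) (0, (fderiv ℝ F (z₀, 0) (0, 1)).2) →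
      ∀ ξ, ∀ η ∈ B ξ, F w.2 ≠ (ξ, w.1.1 • η) := by
  obtain ⟨C, hC⟩ := exists_support_bound hr hr0 hd hconv hbdd hB
  set A := fderiv ℝ F (z₀, 0) (0, 1) with hA
  set d := fderiv ℝ r (0, η₀) (0, A.2) with hdd
  have hdpos : 0 < |d| := abs_pos.2 hd
  -- the constant `c` is such that the error `c |σ|` of the linear approximation of `F` changes `r` by
  -- at most `|d| |σ| / 8`
  set Λ := ‖fderiv ℝ r (0, η₀)‖ + 1 with hΛ
  have hΛpos : 0 < Λ := by positivity
  set c := |d| / (8 * Λ) with hc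
  have hcpos : 0 < c := by positivity
  have hstrict : ∀ᶠ w : Z × ℝ in 𝓝 (z₀, 0), ‖F w - F (w.1, 0) - w.2 • A‖ ≤ c * |w.2| := by
    have h1 := ((hF.hasStrictFDerivAt one_ne_zero).isLittleO.def hcpos)
    have h2 : Tendsto (fun w : Z × ℝ => (w, (w.1, (0 : ℝ)))) (𝓝 (z₀, 0))
        (𝓝 ((z₀, 0), (z₀, 0))) :=
      (by fun_prop : Continuous fun w : Z × ℝ => (w, (w.1, (0 : ℝ)))).tendsto (z₀, 0)
    filter_upwards [h2.eventually h1] with w hw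
    have h3 : w - (w.1, (0 : ℝ)) = w.2 • ((0 : Z), (1 : ℝ)) := by
      ext <;> simp
    simp only [h3, map_smul, norm_smul] at hw
    have h4 : ‖((0 : Z), (1 : ℝ))‖ = 1 := by simp
    rw [h4, mul_one, Real.norm_eq_abs] at hw
    exact hw
  have hdr : ContinuousAt (fderiv ℝ r) (0, η₀) := (hr.fderiv_right (m := 1) (by norm_num)).continuousAt
  have hdr1 : ∀ᶠ ζ in 𝓝 ((0 : V), η₀), |fderiv ℝ r ζ (0, A.2) - d| < |d| / 2 := by
    have h1 : ContinuousAt (fun ζ => |fderiv ℝ r ζ (0, A.2) - d|) (0, η₀) :=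
      ((hdr.clm_apply continuousAt_const).sub continuousAt_const).abs
    refine h1.eventually_lt_const ?_
    show |d - d| < |d| / 2
    rw [sub_self, abs_zero]
    positivity
  have hdr2 : ∀ᶠ ζ in 𝓝 ((0 : V), η₀), ‖fderiv ℝ r ζ‖ < Λ :=
    hdr.norm.eventually_lt_const (by rw [hΛ]; linarith)
  have hε : ∀ᶠ ε in 𝓝 (0 : ℝ), |ε| * (|C| * (‖A‖ + c)) < |d| / 4 := by
    have h1 : ContinuousAt (fun ε : ℝ => |ε| * (|C| * (‖A‖ + c))) 0 := by fun_prop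
    refine h1.eventually_lt_const ?_
    show |(0 : ℝ)| * (|C| * (‖A‖ + c)) < |d| / 4
    rw [abs_zero, zero_mul]
    positivity
  have t1 : Tendsto (fun w : (ℝ × (V × W)) × (Z × ℝ) => w.1.1) (𝓝 ((0, (0, η₀)), (z₀, 0))) (𝓝 0) :=
    (by fun_prop : Continuous fun w : (ℝ × (V × W)) × (Z × ℝ) => w.1.1).tendsto
      ((0, (0, η₀)), (z₀, 0))
  have t2 : Tendsto (fun w : (ℝ × (V × W)) × (Z × ℝ) => w.1.2) (𝓝 ((0, (0, η₀)), (z₀, 0)))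
      (𝓝 (0, η₀)) :=
    (by fun_prop : Continuous fun w : (ℝ × (V × W)) × (Z × ℝ) => w.1.2).tendsto
      ((0, (0, η₀)), (z₀, 0))
  have t3 : Tendsto (fun w : (ℝ × (V × W)) × (Z × ℝ) => w.2) (𝓝 ((0, (0, η₀)), (z₀, 0)))
      (𝓝 (z₀, 0)) :=
    (by fun_prop : Continuous fun w : (ℝ × (V × W)) × (Z × ℝ) => w.2).tendsto
      ((0, (0, η₀)), (z₀, 0))
  have t4 : Tendsto (fun w => (F w).1) (𝓝 (z₀, 0)) (𝓝 0) := by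
    have h1 : Tendsto (fun w => (F w).1) (𝓝 (z₀, 0)) (𝓝 (F (z₀, 0)).1) :=
      hF.continuousAt.fst
    rwa [hF0] at h1
  have t5 := t2.prodMk_nhds (t4.comp t3)
  filter_upwards [t1.eventually hε, t2.eventually hdr1, t2.eventually hdr2, t3.eventually hstrict,
    t5.eventually hC] with w h1 h2 h3 h4 h5 hε0 hr0' hw0 hsgn ξ η hη hwF
  obtain ⟨⟨ε, ζ⟩, z, σ⟩ := w
  simp only [Function.comp] at h1 h2 h3 h4 h5 hε0 hr0' hw0 hsgn hwF
  rw [hwF] at h5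
  have h6 := h5 hr0' η hη
  rw [hwF, hw0] at h4
  have h7 : ‖ξ - ζ.1 - σ • A.1‖ ≤ c * |σ| := (norm_fst_le _).trans h4
  have h8 : ‖ε • η - ε • ζ.2 - σ • A.2‖ ≤ c * |σ| := (norm_snd_le _).trans h4
  -- the base point moves by `O(σ)`, so that after multiplication by `ε` the support bound is small
  -- compared with `|σ|`
  have h9 : ‖ξ - ζ.1‖ ≤ (‖A‖ + c) * |σ| := by
    have e1 : ξ - ζ.1 = (ξ - ζ.1 - σ • A.1) + σ • A.1 := by abel
    rw [e1]
    refine (norm_add_le _ _).trans ?_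
    have e2 : ‖σ • A.1‖ ≤ |σ| * ‖A‖ := by
      rw [norm_smul, Real.norm_eq_abs]
      exact mul_le_mul_of_nonneg_left (norm_fst_le _) (abs_nonneg _)
    linarith
  have h10 : ε * fderiv ℝ r ζ (0, η - ζ.2) ≤ |σ| * (|d| / 4) := by
    have e1 : fderiv ℝ r ζ (0, η - ζ.2) ≤ |C| * ((‖A‖ + c) * |σ|) :=
      h6.trans ((mul_le_mul_of_nonneg_right (le_abs_self C) (norm_nonneg _)).trans
        (mul_le_mul_of_nonneg_left h9 (abs_nonneg _)))
    have e2 := mul_le_mul_of_nonneg_left e1 hε0.le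
    rw [abs_of_pos hε0] at h1
    have e3 := mul_le_mul_of_nonneg_left h1.le (abs_nonneg σ)
    calc _ ≤ ε * (|C| * ((‖A‖ + c) * |σ|)) := e2
      _ = |σ| * (ε * (|C| * (‖A‖ + c))) := by ring
      _ ≤ _ := e3
  have h11 : ε * fderiv ℝ r ζ (0, η - ζ.2)
      = σ * fderiv ℝ r ζ (0, A.2) + fderiv ℝ r ζ (0, ε • η - ε • ζ.2 - σ • A.2) := by
    rw [← smul_eq_mul, ← map_smul, ← smul_eq_mul, ← map_smul, ← map_add]
    congr 1
    ext
    · simp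
    · simp only [Prod.smul_snd, Prod.snd_add, smul_sub]
      abel
  have h12 : |fderiv ℝ r ζ (0, ε • η - ε • ζ.2 - σ • A.2)| ≤ |σ| * (|d| / 8) := by
    have e1 := (fderiv ℝ r ζ).le_opNorm (0, ε • η - ε • ζ.2 - σ • A.2)
    rw [Real.norm_eq_abs, Prod.norm_def, norm_zero, max_eq_right (norm_nonneg _)] at e1
    refine e1.trans ((mul_le_mul h3.le h8 (norm_nonneg _) hΛpos.le).trans (le_of_eq ?_))
    rw [hc]
    field_simp
  -- the outward velocity contributes a term of size at least `|d| |σ| / 2`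
  have h13 : |σ| * (|d| / 2) ≤ σ * fderiv ℝ r ζ (0, A.2) := by
    have e1 : σ * d = |σ| * |d| := by rw [← abs_mul, abs_of_pos hsgn]
    have e2 : |σ * (fderiv ℝ r ζ (0, A.2) - d)| ≤ |σ| * (|d| / 2) := by
      rw [abs_mul]
      exact mul_le_mul_of_nonneg_left h2.le (abs_nonneg _)
    have e3 := (abs_le.1 e2).1
    have e4 : σ * fderiv ℝ r ζ (0, A.2) = σ * d + σ * (fderiv ℝ r ζ (0, A.2) - d) := by ring
    rw [e4, e1]
    linarith
  have hσ : 0 < |σ| := abs_pos.2 fun h => by simp [h] at hsgn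
  have h14 := (abs_le.1 h12).1
  have h15 : 0 < |σ| * |d| := mul_pos hσ hdpos
  linarith

end Leave

section Collision

variable {E : Type*} [NormedAddCommGroup E] [NormedSpace ℝ E] [FiniteDimensional ℝ E]
  {M : Type*} [TopologicalSpace M] [ChartedSpace E M] [IsManifold 𝓘(ℝ, E) ∞ M] [T2Space M]
  {H : M → (E →L[ℝ] ℝ) → ℝ} {N : Set M} {x : M} {s : SliceChart (E := E) N x} {g : Metric E M}
  {B : M → Set E}

theorem fderiv_tubeMap_mem_tangentTo (hx : x ∈ N) (ξ : s.F) :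
    fderiv ℝ (tubeMap s g) 0 (ξ, 0) ∈ tangentTo (E := E) N x := by
  have hl : Tendsto (fun t : ℝ => t • ξ) (𝓝 0) (𝓝 0) := by
    have : ContinuousAt (fun t : ℝ => t • ξ) 0 := by fun_prop
    have h := this.tendsto
    rwa [zero_smul] at h
  have hd := hl.eventually (eventually_sliceDom' s)
  have h0 : slicePt s (((0 : ℝ) • ξ : s.F) : E) = x := by
    rw [zero_smul]; exact slicePt_zero s
  refine ⟨fun t => slicePt s ((t • ξ : s.F) : E), h0, hd.mono fun t ht => ht.mem hx, ?_, ?_⟩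
  · have h1 := hd.self_of_nhds.continuousAt
    refine ContinuousAt.comp (g := slicePt s) (f := fun t : ℝ => ((t • ξ : s.F) : E)) h1 ?_
    fun_prop
  · show HasDerivAt (fun t : ℝ => chartAt E (slicePt s (((0 : ℝ) • ξ : s.F) : E))
      (slicePt s ((t • ξ : s.F) : E))) _ 0
    rw [h0]
    have h1 : HasDerivAt (fun t : ℝ => (((t • ξ : s.F), (0 : conormal s.F)) : SliceSpace s))
        (ξ, 0) 0 := by
      have := (hasDerivAt_id (0 : ℝ)).smul_const ξ
      rw [one_smul] at this
      exact this.prodMk (hasDerivAt_const _ _)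
    have h2 : HasDerivAt (fun t : ℝ => tubeMap s g ((t • ξ : s.F), (0 : conormal s.F)))
        (fderiv ℝ (tubeMap s g) 0 (ξ, 0)) 0 := by
      refine HasFDerivAt.comp_hasDerivAt (l := tubeMap s g)
        (f := fun t : ℝ => (((t • ξ : s.F), (0 : conormal s.F)) : SliceSpace s)) 0 ?_ h1
      rw [zero_smul]
      exact ((contDiffAt_tubeMap s g).differentiableAt two_ne_zero).hasFDerivAt
    refine h2.congr_of_eventuallyEq (hd.mono fun t ht => ?_)
    exact (tubeMap_zero_right s g ht).symm

/-- The boundary point `η₀` of the body over `x` at which a billiard particle with the jump of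
momentum `J` is reflected in the limit `ε → 0`, a function `r` defining the boundaries near this
point, and the Lagrange multiplier `μ`. -/
structure Reflection (s : SliceChart (E := E) N x) (g : Metric E M) (B : M → Set E)
    (J : E →L[ℝ] ℝ) (η₀ : conormal s.F) (r : SliceSpace s → ℝ) (μ : ℝ) : Prop where
  contDiffAt : ContDiffAt ℝ 2 r (0, η₀)
  zero : r (0, η₀) = 0
  mem_iff : ∀ᶠ z : SliceSpace s in 𝓝 (0, η₀), z.2 ∈ sliceBody s g B z.1 ↔ r z ≤ 0
  regular : ∃ e, fderiv ℝ r (0, η₀) (0, e) ≠ 0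
  convex : ∀ w ≠ 0, fderiv ℝ r (0, η₀) (0, w) = 0 →
    0 < fderiv ℝ (fderiv ℝ r) (0, η₀) (0, w) (0, w)
  pos : 0 < μ
  jump : ∀ δ : SliceSpace s, J (fderiv ℝ (tubeMap s g) 0 δ) = μ * fderiv ℝ r (0, η₀) (0, δ.2)

/-- A nonzero covector `J` normal to `N` determines a point of the boundary of the body: the one
with the outer normal `J`. -/
theorem exists_reflection (hB : IsConvexFamily g N B) (hx : x ∈ N) {J : E →L[ℝ] ℝ} (hJ : J ≠ 0)
    (hJN : ∀ v ∈ tangentTo (E := E) N x, J v = 0) : ∃ η₀ r μ, Reflection s g B J η₀ r μ := by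
  have hd : SliceDom s ((0 : s.F) : E) := sliceDom_zero s
  let T := fderiv ℝ (tubeMap s g) 0
  let l : conormal s.F →L[ℝ] ℝ := (J ∘L T) ∘L ContinuousLinearMap.inr ℝ s.F (conormal s.F)
  have hT : ∀ δ : SliceSpace s, J (T δ) = l δ.2 := fun δ => by
    have h1 : δ = (δ.1, 0) + (0, δ.2) := by rw [Prod.mk_add_mk, add_zero, zero_add]
    have h2 : J (T (δ.1, 0)) = 0 := hJN _ (fderiv_tubeMap_mem_tangentTo hx δ.1)
    have h3 : J (T δ) = J (T (δ.1, 0)) + J (T (0, δ.2)) := by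
      rw [← map_add, ← map_add, ← h1]
    rw [h3, h2, zero_add]
    rfl
  have hl : l ≠ 0 := fun h => hJ (by
    ext v
    obtain ⟨δ, rfl⟩ := fderiv_tubeMap_surjective s g v
    exact (hT δ).trans (by rw [h]; rfl))
  obtain ⟨η₀, h1, h2, hmax⟩ := exists_boundary_max (isCompact_sliceBody (g := g) hB hx hd)
    ⟨0, zero_mem_sliceBody hB hx hd⟩ hl
  obtain ⟨r, hr, hiff, ⟨e, he⟩, hconv⟩ := exists_boundary_function hB hx h1 h2
  have hr0 : r (0, η₀) = 0 :=
    (eventually_boundary_iff (B := fun ξ : s.F => sliceBody s g B ξ) hr he hiff).self_of_nhds.1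
      ⟨h1, h2⟩
  let m : conormal s.F →L[ℝ] ℝ :=
    fderiv ℝ r (0, η₀) ∘L ContinuousLinearMap.inr ℝ s.F (conormal s.F)
  have hm : m ≠ 0 := fun h => he (DFunLike.congr_fun h e)
  obtain ⟨μ, hμ, hlm⟩ := exists_pos_smul_eq hm hl fun w hw => by
    have hd1 : HasDerivAt (fun τ : ℝ => r (0, η₀ + τ • w)) (m w) 0 := by
      have := (eventually_hasDerivAt_vertLine hr w).self_of_nhds
      rwa [zero_smul, add_zero] at this
    -- `r` decreases along `w`, so that `η₀ + τ • w` belongs to the body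
    have hev : ∀ᶠ τ in 𝓝[>] (0 : ℝ), r (0, η₀ + τ • w) < 0 := by
      have h3 := (hasDerivAt_iff_tendsto_slope.1 hd1).mono_left
        (nhdsWithin_mono (0 : ℝ) (fun τ hτ => ne_of_gt hτ : Ioi (0 : ℝ) ⊆ {0}ᶜ))
      filter_upwards [h3.eventually_lt_const hw, self_mem_nhdsWithin] with τ h4 hτ
      have hτ : 0 < τ := hτ
      rw [slope_def_field, zero_smul, add_zero, hr0, sub_zero, sub_zero] at h4
      by_contra h5
      exact absurd (div_nonneg (not_lt.1 h5) hτ.le) (not_le.2 h4)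
    have hlt : Tendsto (fun t : ℝ => (((0 : s.F), η₀ + t • w) : SliceSpace s)) (𝓝[>] 0)
        (𝓝 (0, η₀)) := by
      have h3 := (hasDerivAt_vertLine (0 : s.F) η₀ w 0).continuousAt.tendsto
      rw [zero_smul, add_zero] at h3
      exact h3.mono_left nhdsWithin_le_nhds
    obtain ⟨τ, ⟨hτ, hτ0⟩, hτB⟩ :=
      ((hev.and self_mem_nhdsWithin).and (hlt.eventually hiff)).exists
    have h4 := hmax _ (hτB.2 hτ.le)
    rw [map_add, map_smul] at h4
    by_contra h5
    have := mul_pos hτ0 (not_le.1 h5)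
    rw [smul_eq_mul] at h4
    linarith
  refine ⟨η₀, r, μ, hr, hr0, hiff, ⟨e, he⟩, hconv, hμ, fun δ => ?_⟩
  rw [hT δ, hlm]
  rfl

theorem fderiv_tubeMap_comp_fderiv {Θ : E → SliceSpace s} (hΘ : ContDiffAt ℝ 2 Θ (chartAt E x x))
    (hΘ0 : Θ (chartAt E x x) = 0) (hΘ1 : ∀ᶠ y in 𝓝 (chartAt E x x), tubeMap s g (Θ y) = y)
    (v : E) : fderiv ℝ (tubeMap s g) 0 (fderiv ℝ Θ (chartAt E x x) v) = v := by
  have h1 : HasFDerivAt (fun y => tubeMap s g (Θ y))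
      (fderiv ℝ (tubeMap s g) 0 ∘L fderiv ℝ Θ (chartAt E x x)) (chartAt E x x) := by
    refine HasFDerivAt.comp (g := tubeMap s g) (f := Θ) _ ?_
      (hΘ.differentiableAt two_ne_zero).hasFDerivAt
    rw [hΘ0]
    exact ((contDiffAt_tubeMap s g).differentiableAt two_ne_zero).hasFDerivAt
  have h2 : HasFDerivAt (fun y => tubeMap s g (Θ y)) (ContinuousLinearMap.id ℝ E) (chartAt E x x) :=
    (hasFDerivAt_id _).congr_of_eventuallyEq hΘ1
  exact DFunLike.congr_fun (h1.unique h2) v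

/-- Orbits which start at a boundary point of a thin tube, on the outer side, do not meet the tube
for small times. -/
theorem Reflection.eventually_not_mem_tube (hH : IsC3 H) (hN : IsScatterer (E := E) N)
    (hB : IsConvexFamily g N B) {K : Set M} (hK : IsCompact K) (hKN : K ⊆ N) (hx : x ∈ N)
    {J : E →L[ℝ] ℝ} {η₀ : conormal s.F} {r : SliceSpace s → ℝ} {μ : ℝ}
    (hr : Reflection s g B J η₀ r μ)
    {Θ : E → SliceSpace s} (hΘ : ContDiffAt ℝ 2 Θ (chartAt E x x)) (hΘ0 : Θ (chartAt E x x) = 0)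
    (hΘ1 : ∀ᶠ y in 𝓝 (chartAt E x x), tubeMap s g (Θ y) = y)
    (hΘ2 : ∀ᶠ ζ in 𝓝 0, Θ (tubeMap s g ζ) = ζ) {y : E →L[ℝ] ℝ} (hy : J (vel H (x, y)) ≠ 0) :
    ∀ᶠ w : (ℝ × SliceSpace s) × ((E × (E →L[ℝ] ℝ)) × ℝ) in
        𝓝 ((0, (0, η₀)), ((chartAt E x x, y), 0)),
      0 < w.1.1 → r w.1.2 = 0 → Θ w.2.1.1 = (w.1.2.1, w.1.1 • w.1.2.2) →
      0 < w.2.2 * J (vel H (x, y)) → (flow H (phasePt x w.2.1) w.2.2).1 ∉ tube g B K w.1.1 := by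
  have hz₀ : chartAt E x x ∈ (chartAt E x).target := (chartAt E x).map_source (mem_chart_source E x)
  obtain ⟨U, hU, δ, hδ, hflow⟩ := exists_smoothFlow hH (q₀ := x) (z₀ := (chartAt E x x, y)) hz₀
  have hS : SmoothFlow H x x (chartAt E x x, y) 0 :=
    hflow _ (mem_of_mem_nhds hU) 0 ⟨by linarith, hδ⟩
  have hC0 : ∀ z : E × (E →L[ℝ] ℝ), z.1 ∈ (chartAt E x).target → flowC H x x (z, 0) = z :=
    fun z hz => by simp only [flowC, flow_zero, phaseCoord_phasePt hz]
  -- the orbits in the coordinates `(ξ, η)` on the normal bundle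
  let F : (E × (E →L[ℝ] ℝ)) × ℝ → SliceSpace s := fun w => Θ (flowC H x x w).1
  have hC1 : ContDiffAt ℝ 2 (fun w => (flowC H x x w).1) ((chartAt E x x, y), 0) :=
    hS.contDiffAt.fst
  have hΘ' : ContDiffAt ℝ 2 Θ (flowC H x x ((chartAt E x x, y), 0)).1 := by
    rw [hC0 _ hz₀]; exact hΘ
  have hF : ContDiffAt ℝ 2 F ((chartAt E x x, y), 0) :=
    ContDiffAt.comp (g := Θ) (f := fun w => (flowC H x x w).1) _ hΘ' hC1
  have hF0 : F ((chartAt E x x, y), 0) = 0 := by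
    show Θ _ = 0
    rw [hC0 _ hz₀, hΘ0]
  have hA : fderiv ℝ F ((chartAt E x x, y), 0) (0, 1)
      = fderiv ℝ Θ (chartAt E x x) (vel H (x, y)) := by
    have h1 : HasFDerivAt F (fderiv ℝ Θ (chartAt E x x) ∘L
        (ContinuousLinearMap.fst ℝ E (E →L[ℝ] ℝ) ∘L
          fderiv ℝ (flowC H x x) ((chartAt E x x, y), 0))) ((chartAt E x x, y), 0) := by
      refine HasFDerivAt.comp (g := Θ) (f := fun w => (flowC H x x w).1) _ ?_
        (hS.contDiffAt.differentiableAt two_ne_zero).hasFDerivAt.fst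
      rw [hC0 _ hz₀]
      exact (hΘ.differentiableAt two_ne_zero).hasFDerivAt
    rw [h1.fderiv]
    show fderiv ℝ Θ _ (fderiv ℝ (flowC H x x) ((chartAt E x x, y), 0) (0, 1)).1 = _
    rw [hS.fderiv_time hH, hC0 _ hz₀, vel, phaseCoord_self (x, y)]
  have hJ : J (vel H (x, y))
      = μ * fderiv ℝ r (0, η₀) (0, (fderiv ℝ F ((chartAt E x x, y), 0) (0, 1)).2) := by
    rw [hA, ← hr.jump, fderiv_tubeMap_comp_fderiv hΘ hΘ0 hΘ1]
  have hd : fderiv ℝ r (0, η₀) (0, (fderiv ℝ F ((chartAt E x x, y), 0) (0, 1)).2) ≠ 0 :=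
    fun h => hy (by rw [hJ, h, mul_zero])
  obtain ⟨R, hR⟩ := exists_sliceBody_bound (s := s) hB hx
  have hmain := eventually_not_mem_scaled (B := fun ξ : s.F => sliceBody s g B ξ)
    hr.contDiffAt hr.zero ((eventually_sliceDom' s).mono fun ξ h => convex_sliceBody hB hx h) hR
    hr.mem_iff (hF.of_le one_le_two) hF0 hd
  have htube := eventually_tube_coord hN hB hK hKN hx (B' := B) (fun _ _ => subset_rfl) hΘ2
  have t1 : Tendsto (fun w : (ℝ × SliceSpace s) × ((E × (E →L[ℝ] ℝ)) × ℝ) => w.1.1)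
      (𝓝 ((0, (0, η₀)), ((chartAt E x x, y), 0))) (𝓝 0) :=
    (by fun_prop : Continuous fun w : (ℝ × SliceSpace s) × ((E × (E →L[ℝ] ℝ)) × ℝ) =>
      w.1.1).tendsto ((0, (0, η₀)), ((chartAt E x x, y), 0))
  have t2 : Tendsto (fun w : (ℝ × SliceSpace s) × ((E × (E →L[ℝ] ℝ)) × ℝ) => w.2)
      (𝓝 ((0, (0, η₀)), ((chartAt E x x, y), 0))) (𝓝 ((chartAt E x x, y), 0)) :=
    (by fun_prop : Continuous fun w : (ℝ × SliceSpace s) × ((E × (E →L[ℝ] ℝ)) × ℝ) =>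
      w.2).tendsto ((0, (0, η₀)), ((chartAt E x x, y), 0))
  have t3 : Tendsto (fun w : (E × (E →L[ℝ] ℝ)) × ℝ => (flow H (phasePt x w.1) w.2).1)
      (𝓝 ((chartAt E x x, y), 0)) (𝓝 x) := by
    have h := hS.continuousAt_base.tendsto
    simp only [flow_zero, phasePt_self] at h
    exact h
  have hsrc : ∀ᶠ w : (E × (E →L[ℝ] ℝ)) × ℝ in 𝓝 ((chartAt E x x, y), 0),
      w.1.1 ∈ (chartAt E x).target := by
    have h : ContinuousAt (fun w : (E × (E →L[ℝ] ℝ)) × ℝ => w.1.1) ((chartAt E x x, y), 0) := by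
      fun_prop
    exact h.eventually ((chartAt E x).open_target.mem_nhds hz₀)
  filter_upwards [hmain, (t1.prodMk_nhds (t3.comp t2)).eventually htube, t2.eventually hsrc]
    with w hw1 hw2 hw3 hε hr0 hΘw hsgn hmem
  obtain ⟨ξ, η, -, hη, he⟩ := hw2 hmem
  refine hw1 hε hr0 ?_ ?_ ξ η hη he
  · show Θ (flowC H x x (w.2.1, 0)).1 = _
    rw [hC0 _ hw3, hΘw]
  · rw [hJ] at hsgn
    have h1 := hr.pos
    have h2 : 0 < μ * (w.2.2 * fderiv ℝ r (0, η₀)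
        (0, (fderiv ℝ F ((chartAt E x x, y), 0) (0, 1)).2)) := by
      linarith
    exact pos_of_mul_pos_right h2 h1.le

end Collision

end ThinBilliard

namespace ThinBilliard

/-! ### The Riemannian distance in a chart -/

set_option synthInstance.maxHeartbeats 400000
set_option maxHeartbeats 1000000
set_option linter.unusedSectionVars false

section RiemDist

variable {E : Type*} [NormedAddCommGroup E] [NormedSpace ℝ E] [FiniteDimensional ℝ E]
  {M : Type*} [TopologicalSpace M] [ChartedSpace E M] [IsManifold 𝓘(ℝ, E) ∞ M]

/-- The distance is at most the length of a path whose velocity is bounded by `c`. -/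
theorem riemDist_le_of_velocity (g : Metric E M) {γ : ℝ → M} {v : ℝ → E} {c : ℝ} 
    (hγ : ContMDiffOn 𝓘(ℝ, ℝ) 𝓘(ℝ, E) 1 γ (Icc 0 1))
    (hv : ∀ t ∈ Icc (0 : ℝ) 1, HasTangentAt γ t (v t) ∧ g.at (γ t) (v t) (v t) ≤ c ^ 2)
    (hc : 0 ≤ c) :
    riemDist g (γ 0) (γ 1) ≤ ENNReal.ofReal c := by
  let _ : Bundle.RiemannianBundle (fun x : M => TangentSpace 𝓘(ℝ, E) x) := ⟨g.toRiemannianMetric⟩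
  have h1 : riemDist g (γ 0) (γ 1) ≤ pathELength 𝓘(ℝ, E) γ 0 1 :=
    riemannianEDist_le_pathELength hγ rfl rfl zero_le_one
  have hnorm : ∀ (q : M) (u : TangentSpace 𝓘(ℝ, E) q),
      ‖u‖ₑ = ENNReal.ofReal (√(g.inner q u u)) := fun q u => by
    rw [← ofReal_norm, norm_eq_sqrt_real_inner]
    rfl
  refine h1.trans ?_
  rw [pathELength_eq_lintegral_mfderiv_Icc]
  have h2 : ∀ t ∈ Icc (0 : ℝ) 1, ‖mfderiv 𝓘(ℝ, ℝ) 𝓘(ℝ, E) γ t 1‖ₑ ≤ ENNReal.ofReal c := by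
    intro t ht
    obtain ⟨⟨h3, h4⟩, h5⟩ := hv t ht
    have h6 : HasMFDerivAt 𝓘(ℝ, ℝ) 𝓘(ℝ, E) γ t (ContinuousLinearMap.toSpanSingleton ℝ (v t)) := by
      refine ⟨h3, ?_⟩
      have h7 : HasFDerivAt (fun τ => chartAt E (γ t) (γ τ))
        (ContinuousLinearMap.toSpanSingleton ℝ (v t)) t := h4.hasFDerivAt
      exact h7.hasFDerivWithinAt
    have h8 : mfderiv 𝓘(ℝ, ℝ) 𝓘(ℝ, E) γ t 1 = v t := by
      rw [h6.mfderiv]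
      exact one_smul ℝ (v t)
    rw [h8]
    refine (hnorm (γ t) (v t)).trans_le (ENNReal.ofReal_le_ofReal ?_)
    exact Real.sqrt_le_iff.2 ⟨hc, h5⟩
  calc _ ≤ ∫⁻ t in Icc (0 : ℝ) 1, ENNReal.ofReal c :=
        MeasureTheory.setLIntegral_mono' measurableSet_Icc h2
    _ = ENNReal.ofReal c := by simp

/-- Charts are locally Lipschitz, in both arguments of the distance. -/
theorem exists_riemDist_le (g : Metric E M) (x : M) :
    ∃ C : ℝ, 0 ≤ C ∧ ∀ᶠ w : M × M in 𝓝 (x, x),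
      riemDist g w.1 w.2 ≤ ENNReal.ofReal (C * ‖chartAt E x w.2 - chartAt E x w.1‖) := by
  set φ := chartAt E x with hφ
  have hx : φ x ∈ φ.target := φ.map_source (mem_chart_source E x)
  have hcont := ContinuousAt.norm (E := E →L[ℝ] E →L[ℝ] ℝ) (contDiffAt_metricC g hx).continuousAt
  set C := √(‖metricC g x (φ x)‖ + 1) with hC
  have hC2 : C ^ 2 = ‖metricC g x (φ x)‖ + 1 := Real.sq_sqrt (by positivity)
  have hev : ∀ᶠ z in 𝓝 (φ x), z ∈ φ.target ∧ ‖metricC g x z‖ < C ^ 2 :=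
    Eventually.and (φ.open_target.mem_nhds hx) (hcont.eventually_lt_const (by rw [hC2]; linarith))
  obtain ⟨r, hr, hball⟩ := Metric.eventually_nhds_iff_ball.1 hev
  have hφc : Tendsto φ (𝓝 x) (𝓝 (φ x)) := φ.continuousAt (mem_chart_source E x)
  have hM : ∀ᶠ y in 𝓝 x, y ∈ φ.source ∧ φ y ∈ Metric.ball (φ x) r :=
    Eventually.and (φ.open_source.mem_nhds (mem_chart_source E x))
      (hφc.eventually (Metric.ball_mem_nhds _ hr))
  have hfst : Tendsto Prod.fst (𝓝 (x, x)) (𝓝 x) := continuousAt_fst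
  have hsnd : Tendsto Prod.snd (𝓝 (x, x)) (𝓝 x) := continuousAt_snd
  refine ⟨C, Real.sqrt_nonneg _, ?_⟩
  filter_upwards [hfst.eventually hM, hsnd.eventually hM] with w hw1 hw2
  obtain ⟨y₁, y₂⟩ := w
  simp only at hw1 hw2 ⊢
  set u := φ y₂ - φ y₁ with hu
  let l : ℝ → E := fun t => φ y₁ + t • u
  have hl : ∀ t, HasDerivAt l u t := fun t => by
    have := ((hasDerivAt_id t).smul_const u).const_add (φ y₁)
    rwa [one_smul] at this
  have hlb : ∀ t ∈ Icc (0 : ℝ) 1, l t ∈ Metric.ball (φ x) r := fun t ht => by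
    have h1 := (convex_ball (φ x) r).add_smul_sub_mem hw1.2 hw2.2 ht
    exact h1
  have h0 : φ.symm (l 0) = y₁ := by
    show φ.symm (φ y₁ + (0 : ℝ) • u) = y₁
    rw [zero_smul, add_zero, φ.left_inv hw1.1]
  have h1 : φ.symm (l 1) = y₂ := by
    show φ.symm (φ y₁ + (1 : ℝ) • u) = y₂
    rw [one_smul, hu, add_sub_cancel, φ.left_inv hw2.1]
  have hmain := riemDist_le_of_velocity g (γ := fun t => φ.symm (l t))
    (v := fun t => tr φ (chartAt E (φ.symm (l t))) (φ.symm (l t)) u) (c := C * ‖u‖) ?_ ?_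
    (mul_nonneg (Real.sqrt_nonneg _) (norm_nonneg _))
  · simp only [h0, h1] at hmain
    exact hmain
  · have hl1 : ContMDiff 𝓘(ℝ, ℝ) 𝓘(ℝ, E) 1 l := by
      rw [contMDiff_iff_contDiff]
      exact contDiff_const.add (contDiff_id.smul contDiff_const)
    have h2 : ContMDiffOn 𝓘(ℝ, E) 𝓘(ℝ, E) 1 φ.symm φ.target := contMDiffOn_chart_symm
    exact h2.comp hl1.contMDiffOn fun t ht => (hball _ (hlb t ht)).1
  · intro t ht
    have hlt := (hball _ (hlb t ht)).1
    have hy : φ.symm (l t) ∈ φ.source := φ.map_target hlt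
    refine ⟨⟨?_, ?_⟩, ?_⟩
    · exact ContinuousAt.comp (g := φ.symm) (f := l) (φ.symm.continuousAt hlt) (hl t).continuousAt
    · refine HasFDerivAt.comp_hasDerivAt (l := chartAt E (φ.symm (l t)) ∘ φ.symm) (f := l) t ?_
        (hl t)
      have h2 := (contDiffAt_trans (chart_mem x) (chart_mem (φ.symm (l t))) hlt
        (mem_chart_source E _)).differentiableAt (by simp)
      have h3 := h2.hasFDerivAt
      rw [tr, φ.right_inv hlt]
      exact h3
    · show metricC g x (l t) u u ≤ _
      have h2 := (metricC g x (l t)).le_opNorm₂ u u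
      rw [mul_pow]
      have h3 := (hball _ (hlb t ht)).2
      calc metricC g x (l t) u u ≤ ‖metricC g x (l t)‖ * ‖u‖ * ‖u‖ := (le_abs_self _).trans h2
        _ = ‖metricC g x (l t)‖ * ‖u‖ ^ 2 := by ring
        _ ≤ C ^ 2 * ‖u‖ ^ 2 := mul_le_mul_of_nonneg_right h3.le (sq_nonneg _)

end RiemDist

end ThinBilliard

namespace ThinBilliard

/-! ### The discrete action on the normal bundle -/

set_option synthInstance.maxHeartbeats 400000
set_option maxHeartbeats 1000000
set_option linter.unusedSectionVars false

section Nodes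

/-- The sequence `a, x₁, …, xₙ, b`. -/
def nodes {X : Type*} {n : ℕ} (a b : X) (x : Fin n → X) : Fin (n + 2) → X :=
  Fin.cons (α := fun _ => X) a (Fin.snoc (α := fun _ => X) x b)

variable {X : Type*} {n : ℕ} (a b : X) (x : Fin n → X)

theorem nodes_zero : nodes a b x 0 = a := rfl

theorem nodes_last : nodes a b x (Fin.last (n + 1)) = b := by
  rw [nodes, ← Fin.succ_last, Fin.cons_succ, Fin.snoc_last]

theorem nodes_castSucc_succ (i : Fin n) : nodes a b x i.castSucc.succ = x i := by
  rw [nodes, Fin.cons_succ, Fin.snoc_castSucc]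

theorem nodes_succ_castSucc (i : Fin n) : nodes a b x i.succ.castSucc = x i := by
  rw [← Fin.succ_castSucc, nodes_castSucc_succ]

theorem discreteAction_eq (L : Fin (n + 1) → X × X → ℝ) :
    discreteAction L a b x = ∑ j, L j (nodes a b x j.castSucc, nodes a b x j.succ) := rfl

/-- A property of the elements of `Fin (n + 2)` holds if it holds at both ends and at the inner
elements. -/
theorem forall_nodes {P : Fin (n + 2) → Prop} (h0 : P 0) (h1 : P (Fin.last (n + 1)))
    (h : ∀ i : Fin n, P i.succ.castSucc) (j : Fin (n + 2)) : P j := by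
  refine Fin.cases h0 (fun k => ?_) j
  refine Fin.lastCases (by rw [Fin.succ_last]; exact h1) (fun i => ?_) k
  rw [Fin.succ_castSucc]
  exact h i

end Nodes

section NodesCalculus

variable {X : Type*} [NormedAddCommGroup X] [NormedSpace ℝ X] {n : ℕ} {a b : X}

/-- The derivative of a node with respect to the inner nodes. -/
def nodesL (X : Type*) [NormedAddCommGroup X] [NormedSpace ℝ X] {n : ℕ} (j : Fin (n + 2)) :
    (Fin n → X) →L[ℝ] X :=
  nodes 0 0 (fun i => ContinuousLinearMap.proj (R := ℝ) (φ := fun _ : Fin n => X) i) j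

theorem hasFDerivAt_nodes (x : Fin n → X) (j : Fin (n + 2)) :
    HasFDerivAt (fun x : Fin n → X => nodes a b x j) (nodesL X j) x := by
  refine forall_nodes (P := fun j => HasFDerivAt (fun x : Fin n → X => nodes a b x j)
    (nodesL X j) x) ?_ ?_ (fun i => ?_) j
  · simp only [nodesL, nodes_zero]
    exact hasFDerivAt_const _ _
  · simp only [nodesL, nodes_last]
    exact hasFDerivAt_const _ _
  · simp only [nodesL, nodes_succ_castSucc]
    exact (ContinuousLinearMap.proj (R := ℝ) (φ := fun _ : Fin n => X) i).hasFDerivAt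

theorem contDiff_nodes (j : Fin (n + 2)) {k : WithTop ℕ∞} :
    ContDiff ℝ k (fun x : Fin n → X => nodes a b x j) := by
  refine forall_nodes (P := fun j => ContDiff ℝ k (fun x : Fin n → X => nodes a b x j))
    ?_ ?_ (fun i => ?_) j
  · simp only [nodes_zero]
    exact contDiff_const
  · simp only [nodes_last]
    exact contDiff_const
  · simp only [nodes_succ_castSucc]
    exact contDiff_apply _ _ i

theorem nodesL_apply (δ : Fin n → X) (j : Fin (n + 2)) : nodesL X j δ = nodes 0 0 δ j := by
  refine forall_nodes (P := fun j => nodesL X j δ = nodes 0 0 δ j) ?_ ?_ (fun i => ?_) j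
  · simp only [nodesL, nodes_zero]; rfl
  · simp only [nodesL, nodes_last]; rfl
  · simp only [nodesL, nodes_succ_castSucc]; rfl

theorem contDiffAt_discreteAction {S : Fin (n + 1) → X × X → ℝ} {x : Fin n → X}
    (hS : ∀ j, ContDiffAt ℝ 2 (S j) (nodes a b x j.castSucc, nodes a b x j.succ)) :
    ContDiffAt ℝ 2 (discreteAction S a b) x := by
  have h : discreteAction S a b
      = fun x => ∑ j, S j (nodes a b x j.castSucc, nodes a b x j.succ) := rfl
  rw [h]
  refine ContDiffAt.sum fun j _ => ?_
  exact ContDiffAt.comp (g := S j)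
    (f := fun x : Fin n → X => (nodes a b x j.castSucc, nodes a b x j.succ)) x (hS j)
    ((contDiff_nodes _).contDiffAt.prodMk (contDiff_nodes _).contDiffAt)

/-- The first variation of the discrete action: only the jumps of the momenta contribute. -/
theorem hasFDerivAt_discreteAction {S : Fin (n + 1) → X × X → ℝ} {x : Fin n → X}
    {P Q : Fin (n + 1) → X →L[ℝ] ℝ}
    (hS : ∀ j, HasFDerivAt (S j) (Q j ∘L .snd ℝ X X - P j ∘L .fst ℝ X X)
      (nodes a b x j.castSucc, nodes a b x j.succ)) :
    HasFDerivAt (discreteAction S a b)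
      (-∑ i : Fin n, (P i.succ - Q i.castSucc) ∘L
        ContinuousLinearMap.proj (R := ℝ) (φ := fun _ : Fin n => X) i) x := by
  have h : discreteAction S a b
      = fun x => ∑ j, S j (nodes a b x j.castSucc, nodes a b x j.succ) := rfl
  rw [h]
  have h1 : HasFDerivAt (fun x => ∑ j, S j (nodes a b x j.castSucc, nodes a b x j.succ)) _ x :=
    HasFDerivAt.fun_sum fun j (_ : j ∈ Finset.univ) =>
      HasFDerivAt.comp (g := S j)
        (f := fun x : Fin n → X => (nodes a b x j.castSucc, nodes a b x j.succ)) x (hS j)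
        ((hasFDerivAt_nodes x j.castSucc).prodMk (hasFDerivAt_nodes x j.succ))
  refine h1.congr_fderiv ?_
  ext δ
  rw [sum_apply, neg_apply, sum_apply]
  have h2 : ∀ j : Fin (n + 1), ((Q j ∘L .snd ℝ X X - P j ∘L .fst ℝ X X) ∘L
      (ContinuousLinearMap.prod (nodesL X j.castSucc) (nodesL X j.succ))) δ
      = Q j (nodes 0 0 δ j.succ) - P j (nodes 0 0 δ j.castSucc) := fun j => by
    rw [← nodesL_apply, ← nodesL_apply]
    rfl
  rw [Finset.sum_congr rfl fun j _ => h2 j, Finset.sum_sub_distrib, Fin.sum_univ_castSucc,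
    Fin.sum_univ_succ (fun j => P j _)]
  simp only [nodes_castSucc_succ, nodes_succ_castSucc, Fin.succ_last, nodes_last, Fin.castSucc_zero,
    nodes_zero, map_zero]
  rw [add_zero, zero_add, ← Finset.sum_sub_distrib, ← Finset.sum_neg_distrib]
  refine Finset.sum_congr rfl fun i _ => ?_
  show _ = -((P i.succ) (δ i) - (Q i.castSucc) (δ i))
  rw [neg_sub]

/-- The second derivative of a composition with linear maps. -/
theorem fderiv_fderiv_clm_comp {X' Y Y' : Type*} [NormedAddCommGroup X'] [NormedSpace ℝ X']
    [NormedAddCommGroup Y] [NormedSpace ℝ Y] [NormedAddCommGroup Y'] [NormedSpace ℝ Y']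
    {f : X → Y} (A : X' →L[ℝ] X) (D : Y →L[ℝ] Y') {z : X'} (hf : ContDiffAt ℝ 2 f (A z))
    (u v : X') : fderiv ℝ (fderiv ℝ (fun z => D (f (A z)))) z u v
      = D (fderiv ℝ (fderiv ℝ f) (A z) (A u) (A v)) := by
  have hA : Tendsto A (𝓝 z) (𝓝 (A z)) := A.continuous.continuousAt
  have h1 : fderiv ℝ (fun z => D (f (A z))) =ᶠ[𝓝 z] fun z => (D ∘L fderiv ℝ f (A z)) ∘L A := by
    filter_upwards [hA.eventually (hf.eventually (by simp))] with z' hz'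
    have h2 : HasFDerivAt (fun z => D (f (A z))) ((D ∘L fderiv ℝ f (A z')) ∘L A) z' :=
      (D.hasFDerivAt.comp (A z') (hz'.differentiableAt two_ne_zero).hasFDerivAt).comp z'
        A.hasFDerivAt
    exact h2.fderiv
  rw [h1.fderiv_eq]
  have h3 : HasFDerivAt (fderiv ℝ f) (fderiv ℝ (fderiv ℝ f) (A z)) (A z) :=
    ((hf.fderiv_right (m := 1) (by norm_num)).differentiableAt one_ne_zero).hasFDerivAt
  let Φ : (X →L[ℝ] Y) →L[ℝ] (X' →L[ℝ] Y') :=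
    (ContinuousLinearMap.compL ℝ X' X Y').flip A ∘L ContinuousLinearMap.compL ℝ X Y Y' D
  have h4 : HasFDerivAt (fun z => Φ (fderiv ℝ f (A z))) (Φ ∘L fderiv ℝ (fderiv ℝ f) (A z) ∘L A) z :=
    Φ.hasFDerivAt.comp z (h3.comp z A.hasFDerivAt)
  have h5 : HasFDerivAt (fun z => (D ∘L fderiv ℝ f (A z)) ∘L A)
    (Φ ∘L fderiv ℝ (fderiv ℝ f) (A z) ∘L A) z := h4
  rw [h5.fderiv]
  rfl

end NodesCalculus

section Multipliers

variable {E : Type*} [NormedAddCommGroup E] [NormedSpace ℝ E] [FiniteDimensional ℝ E]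
  {M : Type*} [TopologicalSpace M] [ChartedSpace E M] [IsManifold 𝓘(ℝ, E) ∞ M] [T2Space M]
  {N : Set M} {g : Metric E M} {B : M → Set E} {n : ℕ} {x : Fin n → M}

/-- The chain of points of the scaled tubes with the given coordinates. -/
noncomputable def tubeNodes (s : ∀ i, SliceChart (E := E) N (x i)) (g : Metric E M) (a b : E)
    (ζ : ∀ i, SliceSpace (s i)) (ε : ℝ) : Fin (n + 2) → E :=
  nodes a b fun i => tubeMap (s i) g ((ζ i).1, ε • (ζ i).2)

/-- A nondegenerate critical point of the discrete action on `Nⁿ` can be continued to constrained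
critical points of the discrete action on the boundaries of the thin tubes; the multipliers express
the law of reflection. -/
theorem exists_reflected_nodes (s : ∀ i, SliceChart (E := E) N (x i)) {a b : E}
    {S : Fin (n + 1) → E × E → ℝ} {P Q : Fin (n + 1) → E × E → E →L[ℝ] ℝ}
    {X₀ : Fin (n + 2) → E} (hX₀ : X₀ = nodes a b fun i => chartAt E (x i) (x i))
    (hS : ∀ j, ContDiffAt ℝ 2 (S j) (X₀ j.castSucc, X₀ j.succ))
    (hPQ : ∀ j, ∀ᶠ w in 𝓝 (X₀ j.castSucc, X₀ j.succ), ∀ δ : E × E,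
      fderiv ℝ (S j) w δ = Q j w δ.2 - P j w δ.1)
    {η₀ : ∀ i, conormal (s i).F} {r : ∀ i, SliceSpace (s i) → ℝ} {μ : Fin n → ℝ}
    (hr : ∀ i, Reflection (s i) g B
      (P i.succ (X₀ i.succ.castSucc, X₀ i.succ.succ)
        - Q i.castSucc (X₀ i.castSucc.castSucc, X₀ i.castSucc.succ)) (η₀ i) (r i) (μ i))
    (hnd : ∀ u : ∀ i, (s i).F, (∀ w, fderiv ℝ (fderiv ℝ (fun u : ∀ i, (s i).F =>
      discreteAction S a b fun i => tubeMap (s i) g (u i, 0))) 0 u w = 0) → u = 0) :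
    ∃ ζ : ∀ i, ℝ → SliceSpace (s i), (∀ i, ContDiffAt ℝ 1 (ζ i) 0 ∧ ζ i 0 = (0, η₀ i)) ∧
      ∀ᶠ ε in 𝓝 0, ∀ i, r i (ζ i ε) = 0 ∧ ∀ (X : Fin (n + 2) → E),
        X = tubeNodes s g a b (fun i => ζ i ε) ε → ∀ δ : SliceSpace (s i),
        fderiv ℝ (r i) (ζ i ε) (ε • δ.1, δ.2) = 0 →
          (P i.succ (X i.succ.castSucc, X i.succ.succ)
            - Q i.castSucc (X i.castSucc.castSucc, X i.castSucc.succ))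
              (fderiv ℝ (tubeMap (s i) g) ((ζ i ε).1, ε • (ζ i ε).2) δ) = 0 := by
  let V : Type _ := ∀ i, (s i).F
  let W : Type _ := ∀ i, conormal (s i).F
  let A : ∀ i, V × W →L[ℝ] SliceSpace (s i) := fun i =>
    ((ContinuousLinearMap.proj (R := ℝ) (φ := fun i => (s i).F) i) ∘L .fst ℝ V W).prod
      ((ContinuousLinearMap.proj (R := ℝ) (φ := fun i => conormal (s i).F) i) ∘L .snd ℝ V W)
  have hA : ∀ i z, A i z = (z.1 i, z.2 i) := fun _ _ => rfl
  let τ : V × W → Fin n → E := fun z i => tubeMap (s i) g (A i z)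
  let G : V × W → ℝ := fun z => discreteAction S a b (τ z)
  let R : V × W → Fin n → ℝ := fun z i => r i (A i z)
  have hA0 : ∀ i, A i 0 = 0 := fun i => map_zero _
  have htube : ∀ i, ContDiffAt ℝ 2 (tubeMap (s i) g) (A i 0) := fun i => by
    rw [hA0]; exact contDiffAt_tubeMap (s i) g
  have hτ0 : nodes a b (τ 0) = X₀ := by
    rw [hX₀]
    congr 1
    funext i
    show tubeMap (s i) g (A i 0) = _
    rw [hA0, tubeMap_zero]
  have hτ : ContDiffAt ℝ 2 τ 0 := contDiffAt_pi.2 fun i =>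
    ContDiffAt.comp (g := tubeMap (s i) g) (f := A i) 0 (htube i) (A i).contDiff.contDiffAt
  have hG : ContDiffAt ℝ 2 G 0 := by
    refine ContDiffAt.comp (g := discreteAction S a b) (f := τ) 0
      (contDiffAt_discreteAction fun j => ?_) hτ
    rw [hτ0]
    exact hS j
  have hrA : ∀ i, ContDiffAt ℝ 2 (r i) (A i (0, η₀)) := fun i => (hr i).contDiffAt
  have hR : ContDiffAt ℝ 2 R (0, η₀) := contDiffAt_pi.2 fun i =>
    ContDiffAt.comp (g := r i) (f := A i) (0, η₀) (hrA i) (A i).contDiff.contDiffAt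
  -- the derivatives of `G` and `R`
  let jump : V × W → Fin n → E →L[ℝ] ℝ := fun z i =>
    P i.succ (nodes a b (τ z) i.succ.castSucc, nodes a b (τ z) i.succ.succ)
      - Q i.castSucc (nodes a b (τ z) i.castSucc.castSucc, nodes a b (τ z) i.castSucc.succ)
  have hGd : ∀ᶠ z in 𝓝 (0 : V × W), ∀ δ : V × W,
      fderiv ℝ G z δ = -∑ i, jump z i (fderiv ℝ (tubeMap (s i) g) (A i z) (A i δ)) := by
    have hn : ∀ j, ContinuousAt (fun z => nodes a b (τ z) j) 0 := fun j =>
      ContinuousAt.comp (g := fun x : Fin n → E => nodes a b x j) (f := τ)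
        (contDiff_nodes (k := 0) j).continuous.continuousAt hτ.continuousAt
    have h1 : ∀ᶠ z in 𝓝 (0 : V × W), ∀ j : Fin (n + 1),
        ContDiffAt ℝ 2 (S j) (nodes a b (τ z) j.castSucc, nodes a b (τ z) j.succ) ∧
        ∀ δ : E × E, fderiv ℝ (S j) (nodes a b (τ z) j.castSucc, nodes a b (τ z) j.succ) δ
          = Q j (nodes a b (τ z) j.castSucc, nodes a b (τ z) j.succ) δ.2
            - P j (nodes a b (τ z) j.castSucc, nodes a b (τ z) j.succ) δ.1 := by
      refine eventually_all.2 fun j => ?_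
      have h2 : Tendsto (fun z => (nodes a b (τ z) j.castSucc, nodes a b (τ z) j.succ)) (𝓝 0)
          (𝓝 (nodes a b (τ 0) j.castSucc, nodes a b (τ 0) j.succ)) :=
        (hn j.castSucc).prodMk (hn j.succ)
      rw [hτ0] at h2
      exact h2.eventually (((hS j).eventually (by simp)).and (hPQ j))
    have h3 : ∀ᶠ z in 𝓝 (0 : V × W), ∀ i, ContDiffAt ℝ 2 (tubeMap (s i) g) (A i z) :=
      eventually_all.2 fun i => (A i).continuous.continuousAt.eventually
        ((htube i).eventually (by simp))
    filter_upwards [h1, h3] with z hz1 hz3 δ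
    have h4 := hasFDerivAt_discreteAction (a := a) (b := b) (S := S) (x := τ z)
      (P := fun j => P j (nodes a b (τ z) j.castSucc, nodes a b (τ z) j.succ))
      (Q := fun j => Q j (nodes a b (τ z) j.castSucc, nodes a b (τ z) j.succ)) fun j => by
        refine ((hz1 j).1.differentiableAt two_ne_zero).hasFDerivAt.congr_fderiv ?_
        exact ContinuousLinearMap.ext (hz1 j).2
    have h5 : HasFDerivAt τ (ContinuousLinearMap.pi fun i =>
        fderiv ℝ (tubeMap (s i) g) (A i z) ∘L A i) z := hasFDerivAt_pi.2 fun i =>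
      HasFDerivAt.comp (g := tubeMap (s i) g) (f := A i) z
        ((hz3 i).differentiableAt two_ne_zero).hasFDerivAt (A i).hasFDerivAt
    have h6 : HasFDerivAt G _ z := HasFDerivAt.comp (g := discreteAction S a b) (f := τ) z h4 h5
    rw [h6.fderiv, ContinuousLinearMap.comp_apply, neg_apply, sum_apply]
    rfl
  have hRd : ∀ z, (∀ i, ContDiffAt ℝ 2 (r i) (A i z)) → ∀ δ i,
      fderiv ℝ R z δ i = fderiv ℝ (r i) (A i z) (A i δ) := by
    intro z hz δ i
    have h1 : HasFDerivAt R (ContinuousLinearMap.pi fun i => fderiv ℝ (r i) (A i z) ∘L A i) z :=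
      hasFDerivAt_pi.2 fun i => HasFDerivAt.comp (g := r i) (f := A i) z
        ((hz i).differentiableAt two_ne_zero).hasFDerivAt (A i).hasFDerivAt
    rw [h1.fderiv]
    rfl
  have hRdd : ∀ δ i, fderiv ℝ (fderiv ℝ R) (0, η₀) δ δ i
      = fderiv ℝ (fderiv ℝ (r i)) (0, η₀ i) (A i δ) (A i δ) := by
    intro δ i
    have h1 := fderiv_fderiv_clm_comp (f := R) (ContinuousLinearMap.id ℝ (V × W))
      (ContinuousLinearMap.proj (R := ℝ) (φ := fun _ : Fin n => ℝ) i) (z := (0, η₀)) hR δ δ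
    have h2 := fderiv_fderiv_clm_comp (f := r i) (A i) (ContinuousLinearMap.id ℝ ℝ)
      (z := (0, η₀)) (hrA i) δ δ
    exact h1.symm.trans h2
  have hjump0 : ∀ i (δ : SliceSpace (s i)), jump 0 i (fderiv ℝ (tubeMap (s i) g) (A i 0) δ)
      = μ i * fderiv ℝ (r i) (0, η₀ i) (0, δ.2) := by
    intro i δ
    rw [hA0, ← (hr i).jump δ]
    simp only [jump, hτ0]
  let μ₀ : (Fin n → ℝ) →L[ℝ] ℝ :=
    ∑ i, μ i • ContinuousLinearMap.proj (R := ℝ) (φ := fun _ : Fin n => ℝ) i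
  have hμ₀ : ∀ c, μ₀ c = ∑ i, μ i * c i := fun c => by
    rw [sum_apply]
    rfl
  -- the jumps are normal to `N`, so that `∂G/∂ξ = 0`; they are positive multiples of the outer normals
  -- of the bodies, so that `-∂G/∂η` is the combination of the `∂r/∂η` with the coefficients `μ`
  have hcV : ∀ v : V, fderiv ℝ G 0 (v, 0) = 0 := by
    intro v
    rw [hGd.self_of_nhds, neg_eq_zero]
    refine Finset.sum_eq_zero fun i _ => ?_
    rw [hjump0]
    show μ i * fderiv ℝ (r i) (0, η₀ i) 0 = 0
    rw [map_zero, mul_zero]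
  have hcW : ∀ w : W, fderiv ℝ G 0 (0, w) + μ₀ (fderiv ℝ R (0, η₀) (0, w)) = 0 := by
    intro w
    rw [hGd.self_of_nhds, hμ₀, neg_add_eq_zero]
    refine Finset.sum_congr rfl fun i _ => ?_
    rw [hjump0, hRd _ hrA]
    rfl
  have hcnd : ∀ v : V, (∀ v' : V, fderiv ℝ (fderiv ℝ G) 0 (v, 0) (v', 0) = 0) → v = 0 := by
    intro v hv
    refine hnd v fun w => ?_
    have h1 := fderiv_fderiv_clm_comp (f := G) (ContinuousLinearMap.inl ℝ V W)
      (ContinuousLinearMap.id ℝ ℝ) (z := 0) (by rw [map_zero]; exact hG) v w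
    rw [map_zero] at h1
    exact h1.trans (hv w)
  -- the multipliers are positive and the second fundamental forms positive definite
  have hcc : ∀ w : W, fderiv ℝ R (0, η₀) (0, w) = 0 →
      μ₀ (fderiv ℝ (fderiv ℝ R) (0, η₀) (0, w) (0, w)) = 0 → w = 0 := by
    intro w hw1 hw2
    have h1 : ∀ i, fderiv ℝ (r i) (0, η₀ i) (0, w i) = 0 := fun i => by
      have := congrFun hw1 i
      rw [hRd _ hrA] at this
      exact this
    rw [hμ₀] at hw2
    have h2 : ∀ i, 0 ≤ μ i * fderiv ℝ (fderiv ℝ R) (0, η₀) (0, w) (0, w) i := fun i => by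
      rw [hRdd]
      refine mul_nonneg (hr i).pos.le ?_
      by_cases hwi : w i = 0
      · show 0 ≤ fderiv ℝ (fderiv ℝ (r i)) (0, η₀ i) (0, w i) (0, w i)
        rw [hwi]
        show 0 ≤ fderiv ℝ (fderiv ℝ (r i)) (0, η₀ i) 0 0
        rw [map_zero]
      · exact ((hr i).convex (w i) hwi (h1 i)).le
    have h3 := (Finset.sum_eq_zero_iff_of_nonneg fun i _ => h2 i).1 hw2
    funext i
    by_contra hwi
    have h4 := h3 i (Finset.mem_univ i)
    rw [hRdd] at h4
    exact (mul_pos (hr i).pos ((hr i).convex (w i) hwi (h1 i))).ne' h4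
  have hcs : ∀ l : (Fin n → ℝ) →L[ℝ] ℝ, (∀ w : W, l (fderiv ℝ R (0, η₀) (0, w)) = 0) → l = 0 := by
    intro l hl
    have h1 : ∀ i, l (Pi.single i 1) = 0 := fun i => by
      obtain ⟨e, he⟩ := (hr i).regular
      have h2 : fderiv ℝ R (0, η₀) (0, (Pi.single i e : W))
          = fderiv ℝ (r i) (0, η₀ i) (0, e) • Pi.single i (1 : ℝ) := by
        funext k
        rw [hRd _ hrA, Pi.smul_apply, smul_eq_mul]
        show fderiv ℝ (r k) (0, η₀ k) (0, (Pi.single i e : W) k) = _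
        by_cases hk : k = i
        · subst hk
          rw [Pi.single_eq_same, Pi.single_eq_same, mul_one]
        · rw [Pi.single_eq_of_ne hk, Pi.single_eq_of_ne hk, mul_zero]
          show fderiv ℝ (r k) (0, η₀ k) 0 = 0
          rw [map_zero]
      have h3 := hl (Pi.single i e)
      rw [h2, map_smul, smul_eq_mul] at h3
      exact (mul_eq_zero.1 h3).resolve_left he
    exact ContinuousLinearMap.coe_injective (LinearMap.pi_ext' fun i => LinearMap.ext_ring (h1 i))
  obtain ⟨ζ, hζ, hζ0, hζev⟩ := exists_scaled_multipliers (V := V) (W := W) (L := Fin n → ℝ)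
    (G := G) (R := R) (η₀ := η₀) (μ₀ := μ₀) hG hR (funext fun i => (hr i).zero) hcV hcW hcnd hcc hcs
  refine ⟨fun i ε => A i (ζ ε).1, fun i => ⟨?_, ?_⟩, ?_⟩
  · exact ContDiffAt.comp (g := A i) (f := fun ε => (ζ ε).1) 0 (A i).contDiff.contDiffAt hζ.fst
  · simp only [hζ0]; rfl
  · have hζc : Tendsto (fun ε => (ζ ε).1) (𝓝 0) (𝓝 (0, η₀)) := by
      have h1 : Tendsto (fun ε => (ζ ε).1) (𝓝 0) (𝓝 (ζ 0).1) := hζ.continuousAt.fst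
      rwa [hζ0] at h1
    have h1 : Tendsto (fun ε : ℝ => ((ζ ε).1.1, ε • (ζ ε).1.2)) (𝓝 0) (𝓝 (0 : V × W)) := by
      have h2 : ContinuousAt (fun ε : ℝ => ((ζ ε).1.1, ε • (ζ ε).1.2)) 0 :=
        hζ.continuousAt.fst.fst.prodMk (continuousAt_id.smul hζ.continuousAt.fst.snd)
      have h3 := h2.tendsto
      simp only [hζ0, zero_smul, Prod.mk_zero_zero] at h3
      exact h3
    have h4 : ∀ᶠ z in 𝓝 ((0, η₀) : V × W), ∀ i, ContDiffAt ℝ 2 (r i) (A i z) :=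
      eventually_all.2 fun i => (A i).continuous.continuousAt.eventually
        ((hrA i).eventually (by simp))
    filter_upwards [hζev, h1.eventually hGd, hζc.eventually h4] with ε h5 h6 h7 i
    refine ⟨congrFun h5.1 i, fun X hX δ hδ => ?_⟩
    have h8 : X = nodes a b (τ ((ζ ε).1.1, ε • (ζ ε).1.2)) := hX
    -- the variation of the `i`-th collision point only
    let v : V := Pi.single i δ.1
    let w : W := Pi.single i δ.2
    have hAi : A i (v, w) = δ := by
      rw [hA]
      simp only [v, w, Pi.single_eq_same]
    have hAi' : A i (ε • v, w) = (ε • δ.1, δ.2) := by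
      show (ε • v i, w i) = _
      simp only [v, w, Pi.single_eq_same]
    have hAk : ∀ k, k ≠ i → A k (v, w) = 0 := fun k hk => by
      rw [hA]
      simp only [v, w, Pi.single_eq_of_ne hk, Prod.mk_zero_zero]
    have hAk' : ∀ k, k ≠ i → A k (ε • v, w) = 0 := fun k hk => by
      show (ε • v k, w k) = 0
      simp only [v, w, Pi.single_eq_of_ne hk, smul_zero, Prod.mk_zero_zero]
    have h9 := h5.2 v w
    have h10 : fderiv ℝ R (ζ ε).1 (ε • v, w) = 0 := by
      funext k
      rw [hRd _ h7]
      by_cases hk : k = i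
      · subst hk
        rw [hAi']
        exact hδ
      · rw [hAk' k hk, map_zero]
        rfl
    rw [h10, map_zero, add_zero, h6, neg_eq_zero, Finset.sum_eq_single i
      (fun k _ hk => by rw [hAk k hk, map_zero, map_zero]) (fun h => absurd (Finset.mem_univ i) h),
      hAi] at h9
    rw [h8]
    exact h9

end Multipliers

end ThinBilliard

namespace ThinBilliard

/-! ### Reflection from thin tubes -/

set_option synthInstance.maxHeartbeats 400000
set_option maxHeartbeats 1000000
set_option linter.unusedSectionVars false

section Reflect

variable {E : Type*} [NormedAddCommGroup E] [NormedSpace ℝ E] [FiniteDimensional ℝ E]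
  {M : Type*} [TopologicalSpace M] [ChartedSpace E M] [IsManifold 𝓘(ℝ, E) ∞ M] [T2Space M]
  {H : M → (E →L[ℝ] ℝ) → ℝ} {N K : Set M} {x : M} {s : SliceChart (E := E) N x} {g : Metric E M}
  {B : M → Set E} {J : E →L[ℝ] ℝ} {η₀ : conormal s.F} {r : SliceSpace s → ℝ} {μ : ℝ}
  {ζ : ℝ → SliceSpace s}

theorem tendsto_scaled (hζ : ContinuousAt ζ 0) (hζ0 : ζ 0 = (0, η₀)) :
    Tendsto (fun ε : ℝ => (((ζ ε).1, ε • (ζ ε).2) : SliceSpace s)) (𝓝 0) (𝓝 0) := by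
  have h2 : ContinuousAt (fun ε : ℝ => (((ζ ε).1, ε • (ζ ε).2) : SliceSpace s)) 0 :=
    hζ.fst.prodMk (continuousAt_id.smul hζ.snd)
  have h3 := h2.tendsto
  simp only [hζ0, zero_smul, Prod.mk_zero_zero] at h3
  exact h3

theorem tendsto_tubeMap_scaled (hζ : ContinuousAt ζ 0) (hζ0 : ζ 0 = (0, η₀)) :
    Tendsto (fun ε : ℝ => tubeMap s g ((ζ ε).1, ε • (ζ ε).2)) (𝓝 0) (𝓝 (chartAt E x x)) := by
  have h : Tendsto (tubeMap s g) (𝓝 0) (𝓝 (tubeMap s g 0)) := (contDiffAt_tubeMap s g).continuousAt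
  rw [tubeMap_zero] at h
  exact h.comp (tendsto_scaled hζ hζ0)

theorem chartAt_symm_self (x : M) : (chartAt E x).symm (chartAt E x x) = x :=
  (chartAt E x).left_inv (mem_chart_source E x)

theorem Reflection.eventually_mem_tubeBoundary (hx : x ∈ N)
    (hKx : K ∈ 𝓝[N] x) (hr : Reflection s g B J η₀ r μ) (hζ : ContinuousAt ζ 0)
    (hζ0 : ζ 0 = (0, η₀)) (hζr : ∀ᶠ ε in 𝓝 0, r (ζ ε) = 0) :
    ∀ᶠ ε in 𝓝 0, (chartAt E x).symm (tubeMap s g ((ζ ε).1, ε • (ζ ε).2))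
      ∈ tubeBoundary g N B K ε := by
  have hζt : Tendsto ζ (𝓝 0) (𝓝 (0, η₀)) := hζ0 ▸ hζ
  have hz₀ : chartAt E x x ∈ (chartAt E x).target := (chartAt E x).map_source (mem_chart_source E x)
  obtain ⟨e, he⟩ := hr.regular
  have h1 := hζt.eventually (eventually_boundary_iff (B := fun ξ : s.F => sliceBody s g B ξ)
    hr.contDiffAt he hr.mem_iff)
  have h2 : Tendsto (fun ε => slicePt s (ζ ε).1) (𝓝 0) (𝓝 x) := by
    have h3 : Tendsto (slicePt s) (𝓝 0) (𝓝 (slicePt s 0)) := (sliceDom_zero s).continuousAt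
    rw [slicePt_zero] at h3
    exact h3.comp ((tendsto_coe_fst s η₀).comp hζt)
  filter_upwards [h1, hζr, (tendsto_scaled hζ hζ0).eventually (eventually_isExp_slice_iff s g),
    h2.eventually (eventually_nhdsWithin_iff.1 hKx),
    (tendsto_tubeMap_scaled (g := g) hζ hζ0).eventually ((chartAt E x).open_target.mem_nhds hz₀)]
    with ε h3 h4 h5 h6 h7
  obtain ⟨hd, h8⟩ := h5
  refine ⟨slicePt s (ζ ε).1, h6 (hd.mem hx), sliceVec s g (ζ ε).1 (ζ ε).2,
    (mem_sphereOf_iff hx hd _).2 (h3.2 h4), ?_⟩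
  rw [← map_smul]
  exact (h8 _).2 ⟨(chartAt E x).map_target h7, (chartAt E x).right_inv h7⟩

/-- The tangent vectors to the boundary of a thin tube, in the coordinates `(ξ, η)`. -/
theorem Reflection.eventually_tangentTo (hN : IsScatterer (E := E) N)
    (hB : IsConvexFamily g N B) (hK : IsCompact K) (hKN : K ⊆ N) (hx : x ∈ N)
    (hr : Reflection s g B J η₀ r μ) (hζ : ContinuousAt ζ 0) (hζ0 : ζ 0 = (0, η₀)) :
    ∀ᶠ ε in 𝓝 0, 0 < ε → ∀ q, q = (chartAt E x).symm (tubeMap s g ((ζ ε).1, ε • (ζ ε).2)) →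
      ∀ v ∈ tangentTo (E := E) (tubeBoundary g N B K ε) q, ∃ δ : SliceSpace s,
        tr (chartAt E q) (chartAt E x) q v
          = fderiv ℝ (tubeMap s g) ((ζ ε).1, ε • (ζ ε).2) δ ∧
        fderiv ℝ r (ζ ε) (ε • δ.1, δ.2) = 0 := by
  obtain ⟨Θ, hΘ, hΘ0, hΘ1, hΘ2⟩ := exists_tubeInv s g
  have hζt : Tendsto ζ (𝓝 0) (𝓝 (0, η₀)) := hζ0 ▸ hζ
  have hz₀ : chartAt E x x ∈ (chartAt E x).target := (chartAt E x).map_source (mem_chart_source E x)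
  obtain ⟨e, he⟩ := hr.regular
  have hbd := (eventually_boundary_iff (B := fun ξ : s.F => sliceBody s g B ξ)
    hr.contDiffAt he hr.mem_iff).eventually_nhds
  have hcoord := (eventually_tube_coord hN hB hK hKN hx (B' := sphereOf g N B)
    (fun _ _ _ h => h.1) hΘ2).eventually_nhds
  have ht := tendsto_tubeMap_scaled (g := g) hζ hζ0
  have hq : Tendsto (fun ε : ℝ => (ε, (chartAt E x).symm
      (tubeMap s g ((ζ ε).1, ε • (ζ ε).2)))) (𝓝 0) (𝓝 (0, x)) := by
    refine tendsto_id.prodMk_nhds ?_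
    have h := ((chartAt E x).symm.continuousAt hz₀).tendsto.comp ht
    rwa [chartAt_symm_self] at h
  filter_upwards [hζt.eventually hbd, hζt.eventually (hr.contDiffAt.eventually (by simp)),
    hq.eventually hcoord, ht.eventually ((chartAt E x).open_target.mem_nhds hz₀),
    ht.eventually (hΘ.eventually (by simp)), ht.eventually hΘ1.eventually_nhds,
    (tendsto_scaled hζ hζ0).eventually hΘ2,
    (tendsto_scaled hζ hζ0).eventually ((contDiffAt_tubeMap s g).eventually (by simp))]
    with ε h1 h2 h3 h4 h5 h6 h7 h8 hε q hqε v hv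
  rw [← hqε] at h3
  set y := tubeMap s g ((ζ ε).1, ε • (ζ ε).2) with hy
  have hqs : q ∈ (chartAt E x).source := by rw [hqε]; exact (chartAt E x).map_target h4
  have hqy : chartAt E x q = y := by rw [hqε]; exact (chartAt E x).right_inv h4
  obtain ⟨c, hc0, hcA, hcc, hcd⟩ := hv
  have hct : Tendsto c (𝓝 0) (𝓝 q) := hc0 ▸ hcc
  rw [hc0] at hcd
  set u := tr (chartAt E q) (chartAt E x) q v with hu
  have hcx : HasDerivAt (fun τ => chartAt E x (c τ)) u 0 := by
    have e1 : HasFDerivAt (chartAt E x ∘ (chartAt E q).symm) (tr (chartAt E q) (chartAt E x) q)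
        (chartAt E q (c 0)) := by
      rw [hc0]
      exact ((contDiffAt_trans (chart_mem q) (chart_mem x)
        ((chartAt E q).map_source (mem_chart_source E q))
        (by rw [chartAt_symm_self]; exact hqs)).differentiableAt (by simp)).hasFDerivAt
    have e2 : HasDerivAt (fun τ => (chartAt E x ∘ (chartAt E q).symm) (chartAt E q (c τ))) u 0 :=
      HasFDerivAt.comp_hasDerivAt (l := chartAt E x ∘ (chartAt E q).symm)
        (f := fun τ => chartAt E q (c τ)) 0 e1 hcd
    refine e2.congr_of_eventuallyEq ?_
    filter_upwards [hct.eventually ((chartAt E q).open_source.mem_nhds (mem_chart_source E q))]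
      with τ hτ
    rw [Function.comp, (chartAt E q).left_inv hτ]
  have hcx0 : chartAt E x (c 0) = y := by rw [hc0, hqy]
  set δ := fderiv ℝ Θ y u with hδ
  have hΘc : HasDerivAt (fun τ => Θ (chartAt E x (c τ))) δ 0 := by
    refine HasFDerivAt.comp_hasDerivAt (l := Θ) (f := fun τ => chartAt E x (c τ)) 0 ?_ hcx
    rw [hcx0]
    exact (h5.differentiableAt two_ne_zero).hasFDerivAt
  refine ⟨δ, ?_, ?_⟩
  · have e1 : HasFDerivAt (fun y => tubeMap s g (Θ y))
        (fderiv ℝ (tubeMap s g) ((ζ ε).1, ε • (ζ ε).2) ∘L fderiv ℝ Θ y) y := by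
      refine HasFDerivAt.comp (g := tubeMap s g) (f := Θ) _ ?_
        (h5.differentiableAt two_ne_zero).hasFDerivAt
      rw [h7]
      exact (h8.differentiableAt two_ne_zero).hasFDerivAt
    have e2 : HasFDerivAt (fun y => tubeMap s g (Θ y)) (ContinuousLinearMap.id ℝ E) y :=
      (hasFDerivAt_id _).congr_of_eventuallyEq h6
    exact (DFunLike.congr_fun (e1.unique e2) u).symm
  · -- undoing the scaling gives a curve on which `r` vanishes
    let Z : ℝ → SliceSpace s := fun τ =>
      ((Θ (chartAt E x (c τ))).1, ε⁻¹ • (Θ (chartAt E x (c τ))).2)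
    have hZ0 : Z 0 = ζ ε := by
      show ((Θ (chartAt E x (c 0))).1, ε⁻¹ • (Θ (chartAt E x (c 0))).2) = ζ ε
      rw [hcx0, h7]
      refine Prod.ext rfl ?_
      show ε⁻¹ • ε • (ζ ε).2 = _
      rw [inv_smul_smul₀ hε.ne']
    have e1 : HasDerivAt (fun τ => (Θ (chartAt E x (c τ))).1) δ.1 0 := hΘc.fst
    have e2 : HasDerivAt (fun τ => (Θ (chartAt E x (c τ))).2) δ.2 0 := hΘc.snd
    have hZ : HasDerivAt Z (δ.1, ε⁻¹ • δ.2) 0 := e1.prodMk (e2.const_smul ε⁻¹)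
    have hZt : Tendsto Z (𝓝 0) (𝓝 (ζ ε)) := by
      have := hZ.continuousAt.tendsto
      rwa [hZ0] at this
    have hpair : Tendsto (fun τ => (ε, c τ)) (𝓝 0) (𝓝 (ε, q)) := tendsto_const_nhds.prodMk_nhds hct
    have e3 : ∀ᶠ τ in 𝓝 (0 : ℝ), r (Z τ) = 0 := by
      filter_upwards [hpair.eventually h3, hZt.eventually h1, hcA] with τ f1 f2 f3
      obtain ⟨ξ', η', hd, f4, f5⟩ := f1 f3
      have f6 : Z τ = (ξ', η') := by
        show ((Θ (chartAt E x (c τ))).1, ε⁻¹ • (Θ (chartAt E x (c τ))).2) = _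
        rw [f5]
        refine Prod.ext rfl ?_
        show ε⁻¹ • ε • η' = η'
        rw [inv_smul_smul₀ hε.ne']
      rw [f6] at f2 ⊢
      exact f2.1 ((mem_sphereOf_iff hx hd _).1 f4)
    have e4 : HasDerivAt (fun τ => r (Z τ)) (fderiv ℝ r (ζ ε) (δ.1, ε⁻¹ • δ.2)) 0 := by
      refine HasFDerivAt.comp_hasDerivAt (l := r) (f := Z) 0 ?_ hZ
      rw [hZ0]
      exact (h2.differentiableAt two_ne_zero).hasFDerivAt
    have e5 : fderiv ℝ r (ζ ε) (δ.1, ε⁻¹ • δ.2) = 0 :=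
      e4.unique ((hasDerivAt_const (0 : ℝ) (0 : ℝ)).congr_of_eventuallyEq e3)
    have e6 : ((ε • δ.1, δ.2) : SliceSpace s) = ε • (δ.1, ε⁻¹ • δ.2) := by
      refine Prod.ext rfl ?_
      show δ.2 = ε • ε⁻¹ • δ.2
      rw [smul_inv_smul₀ hε.ne']
    rw [e6, map_smul, e5, smul_zero]

/-- An orbit through a point of the boundary of a thin tube is outside the tube for small positive
times if its velocity points outwards, and for small negative times if it points inwards. -/
theorem Reflection.eventually_free (hH : IsC3 H) (hN : IsScatterer (E := E) N)
    (hB : IsConvexFamily g N B) (hK : IsCompact K) (hKN : K ⊆ N) (hx : x ∈ N)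
    (hr : Reflection s g B J η₀ r μ) (hζ : ContinuousAt ζ 0) (hζ0 : ζ 0 = (0, η₀))
    (hζr : ∀ᶠ ε in 𝓝 0, r (ζ ε) = 0) {y : E →L[ℝ] ℝ} (hy : J (vel H (x, y)) ≠ 0)
    {z : ℝ → E × (E →L[ℝ] ℝ)} (hz : ContinuousAt z 0) (hz0 : z 0 = (chartAt E x x, y))
    (hzζ : ∀ᶠ ε in 𝓝 0, (z ε).1 = tubeMap s g ((ζ ε).1, ε • (ζ ε).2)) :
    ∀ᶠ w : ℝ × ℝ in 𝓝 (0, 0), 0 < w.1 → 0 < w.2 * J (vel H (x, y)) →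
      (flow H (phasePt x (z w.1)) w.2).1 ∉ tube g B K w.1 := by
  obtain ⟨Θ, hΘ, hΘ0, hΘ1, hΘ2⟩ := exists_tubeInv s g
  have hfst : Tendsto Prod.fst (𝓝 ((0 : ℝ), (0 : ℝ))) (𝓝 0) := continuousAt_fst
  have hsnd : Tendsto Prod.snd (𝓝 ((0 : ℝ), (0 : ℝ))) (𝓝 0) := continuousAt_snd
  have hζt : Tendsto ζ (𝓝 0) (𝓝 (0, η₀)) := hζ0 ▸ hζ
  have hzt : Tendsto z (𝓝 0) (𝓝 (chartAt E x x, y)) := hz0 ▸ hz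
  have ht := (hfst.prodMk_nhds (hζt.comp hfst)).prodMk_nhds ((hzt.comp hfst).prodMk_nhds hsnd)
  filter_upwards [ht.eventually
      (hr.eventually_not_mem_tube hH hN hB hK hKN hx hΘ hΘ0 hΘ1 hΘ2 hy),
    hfst.eventually hζr, hfst.eventually hzζ,
    hfst.eventually ((tendsto_scaled hζ hζ0).eventually hΘ2)] with w h1 h2 h3 h4 hε hw
  exact h1 hε h2 (by show Θ (z w.1).1 = _; rw [h3]; exact h4) hw

end Reflect

/-! ### Orbits near a given orbit -/

section Segment

variable {E : Type*} [NormedAddCommGroup E] [NormedSpace ℝ E] [FiniteDimensional ℝ E]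
  {M : Type*} [TopologicalSpace M] [ChartedSpace E M] [IsManifold 𝓘(ℝ, E) ∞ M] [T2Space M]
  {H : M → (E →L[ℝ] ℝ) → ℝ} {N K : Set M} {g : Metric E M} {B : M → Set E} {e : ℝ} {γ : ℝ → M}
  {p : ℝ → E →L[ℝ] ℝ} {t₀ t₁ : ℝ} {z : ℝ → E × (E →L[ℝ] ℝ)} {T : ℝ → ℝ}

/-- The group property of the flow: orbits can be parametrized from their end points. -/
theorem SmoothFlow.eventually_flow_sub (hH : IsC3 H) {q₀ x : M} {z₀ : E × (E →L[ℝ] ℝ)} {T₀ : ℝ}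
    (h : SmoothFlow H q₀ x z₀ T₀) :
    ∀ᶠ w : (E × (E →L[ℝ] ℝ)) × (ℝ × ℝ) in 𝓝 (z₀, (T₀, T₀)),
      flow H (phasePt q₀ w.1) w.2.1
        = flow H (phasePt x (flowC H q₀ x (w.1, w.2.2))) (w.2.1 - w.2.2) := by
  have hC : (flowC H q₀ x (z₀, T₀)).1 ∈ (chartAt E x).target :=
    (chartAt E x).map_source h.mem_source.self_of_nhds
  obtain ⟨U, hU, δ, hδ, hflow⟩ := exists_smoothFlow hH hC
  have hS := (hflow _ (mem_of_mem_nhds hU) 0 ⟨by linarith, hδ⟩).good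
  have t1 : Tendsto (fun w : (E × (E →L[ℝ] ℝ)) × (ℝ × ℝ) => (w.1, w.2.2)) (𝓝 (z₀, (T₀, T₀)))
      (𝓝 (z₀, T₀)) :=
    (by fun_prop : Continuous fun w : (E × (E →L[ℝ] ℝ)) × (ℝ × ℝ) => (w.1, w.2.2)).tendsto _
  have t2 : Tendsto (fun w : (E × (E →L[ℝ] ℝ)) × (ℝ × ℝ) => w.2.1 - w.2.2) (𝓝 (z₀, (T₀, T₀)))
      (𝓝 0) := by
    have h1 : ContinuousAt (fun w : (E × (E →L[ℝ] ℝ)) × (ℝ × ℝ) => w.2.1 - w.2.2)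
      (z₀, (T₀, T₀)) := by fun_prop
    have h2 := h1.tendsto
    simp only [sub_self] at h2
    exact h2
  have t3 : Tendsto (fun w : (E × (E →L[ℝ] ℝ)) × (ℝ × ℝ) => flowC H q₀ x (w.1, w.2.2))
      (𝓝 (z₀, (T₀, T₀))) (𝓝 (flowC H q₀ x (z₀, T₀))) := h.contDiffAt.continuousAt.tendsto.comp t1
  filter_upwards [t1.eventually h.good, t1.eventually h.mem_source,
    (t3.prodMk_nhds t2).eventually hS] with w h1 h2 h3
  have h4 : phasePt x (flowC H q₀ x (w.1, w.2.2)) = flow H (phasePt q₀ w.1) w.2.2 :=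
    phasePt_phaseCoord h2
  rw [h4] at h3 ⊢
  have h5 := (h1.add hH h3).2
  rwa [add_sub_cancel] at h5

theorem IsOrbit.continuousAt_flow_fst (hH : IsHamiltonian H) (h : IsOrbit H e γ p t₀ t₁)
    (hz : ContinuousAt z 0) (hz0 : z 0 = (chartAt E (γ t₀) (γ t₀), p t₀)) {r : ℝ}
    (hr : r ∈ Icc 0 (t₁ - t₀)) :
    Tendsto (fun w : ℝ × ℝ => (flow H (phasePt (γ t₀) (z w.1)) w.2).1) (𝓝 (0, r))
      (𝓝 (γ (r + t₀))) := by
  obtain ⟨h1, h2⟩ := h.smoothFlow hH.isC3 hr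
  have h3 := (h2 _ (mem_chart_source E _)).continuousAt_base.tendsto
  simp only [phasePt_self, h1] at h3
  have hfst : Tendsto Prod.fst (𝓝 ((0 : ℝ), r)) (𝓝 0) := continuousAt_fst
  have hsnd : Tendsto Prod.snd (𝓝 ((0 : ℝ), r)) (𝓝 r) := continuousAt_snd
  have hzt : Tendsto z (𝓝 0) (𝓝 (chartAt E (γ t₀) (γ t₀), p t₀)) := hz0 ▸ hz
  exact h3.comp ((hzt.comp hfst).prodMk_nhds hsnd)

theorem IsOrbit.eventually_not_mem_tube (hH : IsHamiltonian H) (h : IsOrbit H e γ p t₀ t₁)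
    (hN : IsScatterer (E := E) N) (hB : IsConvexFamily g N B) (hK : IsCompact K) (hKN : K ⊆ N)
    (hz : ContinuousAt z 0) (hz0 : z 0 = (chartAt E (γ t₀) (γ t₀), p t₀)) {r : ℝ}
    (hr : r ∈ Icc 0 (t₁ - t₀)) (hrK : γ (r + t₀) ∉ K) :
    ∀ᶠ w : ℝ × ℝ in 𝓝 (0, r), (flow H (phasePt (γ t₀) (z w.1)) w.2).1 ∉ tube g B K w.1 := by
  have hfst : Tendsto Prod.fst (𝓝 ((0 : ℝ), r)) (𝓝 0) := continuousAt_fst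
  exact (hfst.prodMk_nhds (h.continuousAt_flow_fst hH hz hz0 hr)).eventually
    (ThinBilliard.eventually_not_mem_tube hN hB hK hKN hrK)

/-- If an orbit does not meet `K` at interior times, then the nearby orbits do not meet the thin
tubes, provided that this holds for times close to the two end points. The propositions `a` and `b`
tell whether the initial and the final time are excluded. -/
theorem IsOrbit.eventually_free (hH : IsHamiltonian H) (h : IsOrbit H e γ p t₀ t₁) (ht : t₀ < t₁)
    (hN : IsScatterer (E := E) N) (hB : IsConvexFamily g N B) (hK : IsCompact K) (hKN : K ⊆ N)
    (hfree : ∀ τ ∈ Ioo t₀ t₁, γ τ ∉ K) (hz : ContinuousAt z 0)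
    (hz0 : z 0 = (chartAt E (γ t₀) (γ t₀), p t₀)) (hT : ContinuousAt T 0) (hT0 : T 0 = t₁ - t₀)
    {a b : Prop}
    (hstart : ∀ᶠ w : ℝ × ℝ in 𝓝 (0, 0), 0 < w.1 → (a → 0 < w.2) →
      (flow H (phasePt (γ t₀) (z w.1)) w.2).1 ∉ tube g B K w.1)
    (hend : ∀ᶠ w : ℝ × ℝ in 𝓝 (0, t₁ - t₀), 0 < w.1 → (b → w.2 < T w.1) →
      (flow H (phasePt (γ t₀) (z w.1)) w.2).1 ∉ tube g B K w.1) :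
    ∀ᶠ ε in 𝓝 0, 0 < ε → ∀ σ ∈ Icc 0 (T ε), (a → 0 < σ) → (b → σ < T ε) →
      (flow H (phasePt (γ t₀) (z ε)) σ).1 ∉ tube g B K ε := by
  have hTt : Tendsto (fun ε => (ε, T ε)) (𝓝 0) (𝓝 (0, t₁ - t₀)) :=
    tendsto_id.prodMk_nhds (hT0 ▸ hT)
  have key := eventually_forall_Icc (sub_nonneg.2 ht.le) (w₀ := (0 : ℝ))
    (Q := fun w : ℝ × ℝ => 0 < w.1 → (a → 0 < w.2) → (b → w.2 < T w.1) →
      (flow H (phasePt (γ t₀) (z w.1)) w.2).1 ∉ tube g B K w.1) fun r hr => by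
    rcases hr.1.eq_or_lt with rfl | hr0
    · exact hstart.mono fun w hw h1 h2 _ => hw h1 h2
    rcases hr.2.eq_or_lt with rfl | hr1
    · exact hend.mono fun w hw h1 _ h2 => hw h1 h2
    · exact (h.eventually_not_mem_tube hH hN hB hK hKN hz hz0 hr
        (hfree _ ⟨by linarith, by linarith⟩)).mono fun w hw _ _ _ => hw
  filter_upwards [hTt.eventually key] with ε h1 hε σ hσ ha hb
  exact h1 σ hσ hε ha hb

/-- The estimate of `IsOrbit.exists_riemDist_le` for times close to a given one. -/
theorem IsOrbit.eventually_riemDist_le (hH : IsHamiltonian H) (h : IsOrbit H e γ p t₀ t₁)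
    (ht : t₀ < t₁) (g : Metric E M) (hz : DifferentiableAt ℝ z 0)
    (hz0 : z 0 = (chartAt E (γ t₀) (γ t₀), p t₀)) (hT : DifferentiableAt ℝ T 0)
    (hT0 : T 0 = t₁ - t₀) {s₀ : ℝ} (hs₀ : s₀ ∈ Icc (0 : ℝ) 1) :
    ∃ C, 0 ≤ C ∧ ∀ᶠ w : ℝ × ℝ in 𝓝 (0, s₀), w.2 ∈ Icc (0 : ℝ) 1 →
      riemDist g (flow H (phasePt (γ t₀) (z w.1)) (w.2 * T w.1)).1 (γ (t₀ + w.2 * (t₁ - t₀)))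
        ≤ ENNReal.ofReal (C * |w.1|) := by
  have hlen : ∀ {s : ℝ}, s ∈ Icc (0 : ℝ) 1 → s * (t₁ - t₀) ∈ Icc 0 (t₁ - t₀) := fun hs =>
    ⟨mul_nonneg hs.1 (sub_pos.2 ht).le, mul_le_of_le_one_left (sub_pos.2 ht).le hs.2⟩
  have hfl : ∀ {s : ℝ}, s ∈ Icc (0 : ℝ) 1 →
      (flow H (phasePt (γ t₀) (z 0)) (s * T 0)).1 = γ (t₀ + s * (t₁ - t₀)) := fun hs => by
    rw [hz0, hT0, phasePt_self, (h.smoothFlow hH.isC3 (hlen hs)).1, add_comm]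
  set x := γ (s₀ * (t₁ - t₀) + t₀) with hx
  have hS := (h.smoothFlow hH.isC3 (hlen hs₀)).2 x (mem_chart_source E _)
  obtain ⟨C₁, hC₁, hdist⟩ := exists_riemDist_le g x
  obtain ⟨L, U, hU, hL⟩ := (hS.contDiffAt.of_le one_le_two).exists_lipschitzOnWith
  -- the point at the time `s * T 0` on the given orbit and at the time `s * T ε` on the other one
  have hfst : Tendsto Prod.fst (𝓝 ((0 : ℝ), s₀)) (𝓝 0) := continuousAt_fst
  have hsnd : Tendsto Prod.snd (𝓝 ((0 : ℝ), s₀)) (𝓝 s₀) := continuousAt_snd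
  have hT' : Tendsto T (𝓝 0) (𝓝 (t₁ - t₀)) := hT0 ▸ hT.continuousAt
  have hz' : Tendsto z (𝓝 0) (𝓝 (chartAt E (γ t₀) (γ t₀), p t₀)) := hz0 ▸ hz.continuousAt
  have k1 : Tendsto (fun w : ℝ × ℝ => (z w.1, w.2 * T w.1)) (𝓝 (0, s₀))
      (𝓝 ((chartAt E (γ t₀) (γ t₀), p t₀), s₀ * (t₁ - t₀))) :=
    (hz'.comp hfst).prodMk_nhds (hsnd.mul (hT'.comp hfst))
  have k2 : Tendsto (fun w : ℝ × ℝ => (z 0, w.2 * T 0)) (𝓝 (0, s₀))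
      (𝓝 ((chartAt E (γ t₀) (γ t₀), p t₀), s₀ * (t₁ - t₀))) := by
    rw [hz0, hT0]
    exact tendsto_const_nhds.prodMk_nhds (hsnd.mul tendsto_const_nhds)
  have hbase := hS.continuousAt_base.tendsto
  simp only [phasePt_self, (h.smoothFlow hH.isC3 (hlen hs₀)).1] at hbase
  obtain ⟨C₂, hC₂⟩ := hz.hasFDerivAt.isBigO_sub.bound
  obtain ⟨C₃, hC₃⟩ := hT.hasFDerivAt.isBigO_sub.bound
  simp only [sub_zero, Real.norm_eq_abs] at hC₂ hC₃
  refine ⟨C₁ * (L * max |C₂| |C₃|), by positivity, ?_⟩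
  filter_upwards [((hbase.comp k1).prodMk_nhds (hbase.comp k2)).eventually hdist,
    k1.eventually hU, k2.eventually hU, hfst.eventually hC₂, hfst.eventually hC₃]
    with w h1 h2 h3 h4 h5 hw
  simp only [Function.comp] at h1
  rw [hfl hw] at h1
  refine h1.trans (ENNReal.ofReal_le_ofReal ?_)
  rw [mul_assoc C₁]
  refine mul_le_mul_of_nonneg_left ?_ hC₁
  have h6 : ‖flowC H (γ t₀) x (z 0, w.2 * T 0) - flowC H (γ t₀) x (z w.1, w.2 * T w.1)‖
      ≤ L * ‖((z 0, w.2 * T 0) : (E × (E →L[ℝ] ℝ)) × ℝ) - (z w.1, w.2 * T w.1)‖ :=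
    hL.norm_sub_le h3 h2
  have h7 : ‖((z 0, w.2 * T 0) : (E × (E →L[ℝ] ℝ)) × ℝ) - (z w.1, w.2 * T w.1)‖
      ≤ max |C₂| |C₃| * |w.1| := by
    rw [Prod.mk_sub_mk, Prod.norm_def]
    refine max_le ?_ ?_
    · rw [norm_sub_rev]
      exact h4.trans (mul_le_mul_of_nonneg_right ((le_abs_self _).trans (le_max_left _ _))
        (abs_nonneg _))
    · rw [norm_sub_rev, ← mul_sub, norm_mul, Real.norm_eq_abs, Real.norm_eq_abs,
        abs_of_nonneg hw.1]
      refine (mul_le_of_le_one_left (abs_nonneg _) hw.2).trans (h5.trans ?_)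
      exact mul_le_mul_of_nonneg_right ((le_abs_self _).trans (le_max_right _ _))
        (abs_nonneg _)
  have h8 : ‖chartAt E x (γ (t₀ + w.2 * (t₁ - t₀)))
        - chartAt E x (flow H (phasePt (γ t₀) (z w.1)) (w.2 * T w.1)).1‖
      ≤ ‖flowC H (γ t₀) x (z 0, w.2 * T 0) - flowC H (γ t₀) x (z w.1, w.2 * T w.1)‖ := by
    rw [← hfl hw]
    exact norm_fst_le (flowC H (γ t₀) x (z 0, w.2 * T 0) - flowC H (γ t₀) x (z w.1, w.2 * T w.1))
  rw [mul_assoc]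
  exact h8.trans (h6.trans (mul_le_mul_of_nonneg_left h7 L.coe_nonneg))

/-- A family of orbits depending differentiably on `ε` stays `O(ε)`-close to the orbit with
`ε = 0`, after a linear change of time. -/
theorem IsOrbit.exists_riemDist_le (hH : IsHamiltonian H) (h : IsOrbit H e γ p t₀ t₁)
    (ht : t₀ < t₁) (g : Metric E M) (hz : DifferentiableAt ℝ z 0)
    (hz0 : z 0 = (chartAt E (γ t₀) (γ t₀), p t₀)) (hT : DifferentiableAt ℝ T 0)
    (hT0 : T 0 = t₁ - t₀) :
    ∃ C, 0 ≤ C ∧ ∀ᶠ ε in 𝓝 0, ∀ s ∈ Icc (0 : ℝ) 1,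
      riemDist g (flow H (phasePt (γ t₀) (z ε)) (s * T ε)).1 (γ (t₀ + s * (t₁ - t₀)))
        ≤ ENNReal.ofReal (C * |ε|) := by
  refine isCompact_Icc.induction_on (p := fun A => ∃ C, 0 ≤ C ∧ ∀ᶠ ε in 𝓝 0, ∀ s ∈ A,
      riemDist g (flow H (phasePt (γ t₀) (z ε)) (s * T ε)).1 (γ (t₀ + s * (t₁ - t₀)))
        ≤ ENNReal.ofReal (C * |ε|)) ?_ ?_ ?_ ?_
  · exact ⟨0, le_rfl, Eventually.of_forall fun _ _ h => h.elim⟩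
  · rintro A A' hA ⟨C, hC, h1⟩
    exact ⟨C, hC, h1.mono fun ε h2 s hs => h2 s (hA hs)⟩
  · rintro A A' ⟨C, hC, h1⟩ ⟨C', hC', h1'⟩
    refine ⟨max C C', hC.trans (le_max_left _ _), ?_⟩
    filter_upwards [h1, h1'] with ε h2 h2' s hs
    rcases hs with hs | hs
    · exact (h2 s hs).trans (ENNReal.ofReal_le_ofReal
        (mul_le_mul_of_nonneg_right (le_max_left _ _) (abs_nonneg _)))
    · exact (h2' s hs).trans (ENNReal.ofReal_le_ofReal
        (mul_le_mul_of_nonneg_right (le_max_right _ _) (abs_nonneg _)))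
  · intro s₀ hs₀
    obtain ⟨C, hC, h1⟩ := h.eventually_riemDist_le hH ht g hz hz0 hT hT0 hs₀
    rw [nhds_prod_eq, eventually_prod_iff] at h1
    obtain ⟨pa, hpa, pb, hpb, h2⟩ := h1
    refine ⟨Icc 0 1 ∩ {s | pb s}, inter_mem_nhdsWithin _ hpb, C, hC, ?_⟩
    filter_upwards [hpa] with ε hε s hs
    exact h2 hε hs.2 hs.1

end Segment

end ThinBilliard

namespace ThinBilliard

/-! ### Billiard orbits composed of segments of the flow -/

set_option synthInstance.maxHeartbeats 400000
set_option maxHeartbeats 1000000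
set_option linter.unusedSectionVars false

section Glue

/-- Curves on consecutive intervals which agree at the common end points are the restrictions of one
curve. -/
theorem exists_eqOn_Icc {X : Type*} {n : ℕ} {t : Fin (n + 2) → ℝ} (ht : Monotone t)
    (f : Fin (n + 1) → ℝ → X)
    (hf : ∀ i : Fin n, f i.castSucc (t i.succ.castSucc) = f i.succ (t i.succ.castSucc)) :
    ∃ γ : ℝ → X, ∀ j, EqOn γ (f j) (Icc (t j.castSucc) (t j.succ)) := by
  induction n with
  | zero => exact ⟨f 0, fun j => by rw [Fin.fin_one_eq_zero j]; exact fun _ _ => rfl⟩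
  | succ n ih =>
    obtain ⟨γ, hγ⟩ := ih (t := fun j => t j.castSucc)
      (ht.comp (Fin.strictMono_castSucc).monotone) (fun j => f j.castSucc) fun i => hf i.castSucc
    let b := t (Fin.last (n + 1)).castSucc
    refine ⟨fun s => if s ≤ b then γ s else f (Fin.last (n + 1)) s, fun j => ?_⟩
    induction j using Fin.lastCases with
    | last =>
      intro s hs
      rcases hs.1.eq_or_lt with h | h
      · have hs' : s = b := h.symm
        have h1 := hγ (Fin.last n) (x := b)
          ⟨ht (Fin.castSucc_le_castSucc_iff.2 (Fin.castSucc_lt_succ).le), le_rfl⟩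
        have h2 := hf (Fin.last n)
        show (if s ≤ b then γ s else _) = _
        rw [hs', if_pos le_rfl]
        exact h1.trans h2
      · exact if_neg (not_le.2 h)
    | cast j =>
      intro s hs
      have h1 : s ≤ b := hs.2.trans (ht (Fin.castSucc_le_castSucc_iff.2 (Fin.le_last j.succ)))
      show (if s ≤ b then γ s else _) = _
      rw [if_pos h1]
      exact hγ j hs

theorem exists_mem_Icc {n : ℕ} {t : Fin (n + 2) → ℝ} (ht : Monotone t) {τ : ℝ}
    (hτ : τ ∈ Icc (t 0) (t (Fin.last (n + 1)))) :
    ∃ j : Fin (n + 1), τ ∈ Icc (t j.castSucc) (t j.succ) := by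
  suffices h : ∀ k : Fin (n + 2), τ ≤ t k → ∃ j : Fin (n + 1), τ ∈ Icc (t j.castSucc) (t j.succ) from
    h _ hτ.2
  intro k
  induction k using Fin.induction with
  | zero => exact fun h => ⟨0, hτ.1, h.trans (ht (Fin.zero_le _))⟩
  | succ k ih =>
    intro h
    rcases le_total τ (t k.castSucc) with h1 | h1
    · exact ih h1
    · exact ⟨k, h1, h⟩

theorem abs_sub_le_of_abs_increment_sub_le {n : ℕ} {t t' : Fin (n + 2) → ℝ} {c : ℝ}
    (h0 : t' 0 = t 0)
    (h : ∀ j : Fin (n + 1), |(t' j.succ - t' j.castSucc) - (t j.succ - t j.castSucc)| ≤ c)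
    (j : Fin (n + 2)) : |t' j - t j| ≤ (n + 1) * c := by
  have hc : 0 ≤ c := (abs_nonneg _).trans (h 0)
  suffices h1 : |t' j - t j| ≤ (j : ℕ) * c by
    refine h1.trans (mul_le_mul_of_nonneg_right ?_ hc)
    exact_mod_cast Nat.lt_succ_iff.1 j.2
  induction j using Fin.induction with
  | zero => simp [h0]
  | succ j ih =>
    have h2 : t' j.succ - t j.succ = (t' j.castSucc - t j.castSucc)
      + ((t' j.succ - t' j.castSucc) - (t j.succ - t j.castSucc)) := by ring
    rw [h2, Fin.val_succ, Nat.cast_add, Nat.cast_one, add_mul, one_mul]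
    exact (abs_add_le _ _).trans (add_le_add ih (h j))

end Glue

section Orbit

variable {E : Type*} [NormedAddCommGroup E] [NormedSpace ℝ E] [FiniteDimensional ℝ E]
  {M : Type*} [TopologicalSpace M] [ChartedSpace E M] [IsManifold 𝓘(ℝ, E) ∞ M] [T2Space M]
  {H : M → (E →L[ℝ] ℝ) → ℝ} {e : ℝ}

theorem IsOrbit.congr {γ γ' : ℝ → M} {p : ℝ → E →L[ℝ] ℝ} {a b : ℝ} (h : IsOrbit H e γ p a b)
    (hγ : EqOn γ' γ (Icc a b)) : IsOrbit H e γ' p a b := by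
  refine ⟨?_, fun s hs => by rw [hγ hs]; exact h.energy s hs,
    fun s hs => by rw [hγ hs]; exact h.motion s hs⟩
  exact Traj.congr (c := fun s => (γ s, p s)) (c' := fun s => (γ' s, p s)) h.trajectory
    fun s hs => Prod.ext (hγ hs) rfl

/-- Segments of the flow with the initial values `m j` and the lengths `T j`, joining `y j` and
`y (j + 1)`, form a billiard orbit if the jumps of momentum obey the law of reflection. -/
theorem exists_billiardOrbit (hH : IsC3 H) {A O : Set M} {n : ℕ}
    {m : Fin (n + 1) → M × (E →L[ℝ] ℝ)} {T : Fin (n + 1) → ℝ} {y : Fin (n + 2) → M} (t₀ : ℝ)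
    (hT : ∀ j, 0 < T j) (he : ∀ j, H (m j).1 (m j).2 = e)
    (hflow : ∀ j, ∀ r ∈ Icc 0 (T j), Good H (m j) r ∧ (flow H (m j) r).1 ∈ possibleMotion H e)
    (hstart : ∀ j, (m j).1 = y j.castSucc) (hend : ∀ j, (flow H (m j) (T j)).1 = y j.succ)
    (hA : ∀ i : Fin n, y i.succ.castSucc ∈ A)
    (helastic : ∀ i : Fin n, ∀ v ∈ tangentTo (E := E) A (y i.succ.castSucc),
      ((m i.succ).2 - (flow H (m i.castSucc) (T i.castSucc)).2) v = 0)
    (hjump : ∀ i : Fin n, (m i.succ).2 ≠ (flow H (m i.castSucc) (T i.castSucc)).2)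
    (hfree : ∀ j, ∀ σ ∈ Icc 0 (T j), (j ≠ 0 → 0 < σ) → (j ≠ Fin.last n → σ < T j) →
      (flow H (m j) σ).1 ∉ O) :
    ∃ (t : Fin (n + 2) → ℝ) (γ : ℝ → M) (p : Fin (n + 1) → ℝ → E →L[ℝ] ℝ),
      IsBilliardOrbit H e A O n t γ p ∧ γ (t 0) = y 0 ∧
      γ (t (Fin.last (n + 1))) = y (Fin.last (n + 1)) ∧ t 0 = t₀ ∧
      (∀ j, t j.succ - t j.castSucc = T j) ∧
      ∀ j, ∀ s ∈ Icc (0 : ℝ) 1,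
        γ (t j.castSucc + s * (t j.succ - t j.castSucc)) = (flow H (m j) (s * T j)).1 := by
  let t : Fin (n + 2) → ℝ := fun j => t₀ + Fin.partialSum T j
  have ht0 : t 0 = t₀ := by simp [t]
  have htT : ∀ j : Fin (n + 1), t j.succ = t j.castSucc + T j := fun j => by
    simp only [t, Fin.partialSum_succ, add_assoc]
  have hmono : StrictMono t := Fin.strictMono_iff_lt_succ.2 fun j => by
    rw [htT]; linarith [hT j]
  have hC : ∀ i : Fin n, t i.succ.castSucc - t i.castSucc.castSucc = T i.castSucc := fun i => by
    have := htT i.castSucc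
    rw [Fin.succ_castSucc] at this
    linarith
  obtain ⟨γ, hγ⟩ := exists_eqOn_Icc hmono.monotone
    (fun j s => (flow H (m j) (s - t j.castSucc)).1) fun i => by
      show (flow H (m i.castSucc) (t i.succ.castSucc - t i.castSucc.castSucc)).1
        = (flow H (m i.succ) (t i.succ.castSucc - t i.succ.castSucc)).1
      rw [hC, sub_self, hend, flow_zero, hstart, Fin.succ_castSucc]
  have hle : ∀ j : Fin (n + 1), t j.castSucc ≤ t j.succ := fun j =>
    hmono.monotone (Fin.castSucc_lt_succ).le
  have hγs : ∀ j : Fin (n + 1), γ (t j.castSucc) = y j.castSucc := fun j => by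
    rw [hγ j ⟨le_rfl, hle j⟩]
    show (flow H (m j) (t j.castSucc - t j.castSucc)).1 = _
    rw [sub_self, flow_zero, hstart]
  have hγe : ∀ j : Fin (n + 1), γ (t j.succ) = y j.succ := fun j => by
    rw [hγ j ⟨hle j, le_rfl⟩]
    show (flow H (m j) (t j.succ - t j.castSucc)).1 = _
    rw [htT, add_sub_cancel_left, hend]
  refine ⟨t, γ, fun j s => (flow H (m j) (s - t j.castSucc)).2, ?_, hγs 0,
    hγe (Fin.last n), ht0, fun j => by rw [htT, add_sub_cancel_left], fun j s hs => ?_⟩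
  · refine ⟨hmono, fun j => ?_, fun i => ?_, fun i v hv => ?_, fun i => ?_, fun τ hτ hne => ?_⟩
    · rw [htT]
      refine (isOrbit_flow hH (t j.castSucc) (hT j).le (he j) (hflow j)).congr ?_
      rw [← htT]
      exact hγ j
    · rw [hγs]; exact hA i
    · rw [hγs] at hv
      show ((flow H (m i.succ) (t i.succ.castSucc - t i.succ.castSucc)).2
        - (flow H (m i.castSucc) (t i.succ.castSucc - t i.castSucc.castSucc)).2) v = 0
      rw [hC, sub_self, flow_zero]
      exact helastic i v hv
    · show (flow H (m i.succ) (t i.succ.castSucc - t i.succ.castSucc)).2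
        ≠ (flow H (m i.castSucc) (t i.succ.castSucc - t i.castSucc.castSucc)).2
      rw [hC, sub_self, flow_zero]
      exact hjump i
    · obtain ⟨j, hj⟩ := exists_mem_Icc hmono.monotone hτ
      rw [hγ j hj]
      refine hfree j _ ⟨by linarith [hj.1], by linarith [hj.2, htT j]⟩ (fun h => ?_) fun h => ?_
      · obtain ⟨i, rfl⟩ := Fin.exists_succ_eq.2 h
        exact sub_pos.2 (lt_of_le_of_ne hj.1 (hne i).symm)
      · obtain ⟨i, rfl⟩ := Fin.exists_castSucc_eq.2 h
        have h1 : τ < t i.castSucc.succ := lt_of_le_of_ne hj.2 (hne i)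
        linarith [htT i.castSucc]
  · have h1 : t j.succ - t j.castSucc = T j := by rw [htT, add_sub_cancel_left]
    have h2 := mul_nonneg hs.1 (hT j).le
    have h3 := mul_le_of_le_one_left (hT j).le hs.2
    rw [h1, hγ j ⟨by linarith, by linarith [htT j]⟩]
    show (flow H (m j) (t j.castSucc + s * T j - t j.castSucc)).1 = _
    rw [add_sub_cancel_left]

end Orbit

end ThinBilliard

namespace ThinBilliard

/-! ### Shadowing of a nondegenerate collision chain -/

set_option synthInstance.maxHeartbeats 400000
set_option maxHeartbeats 1000000
set_option linter.unusedSectionVars false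

section Hessian

variable {E : Type*} [NormedAddCommGroup E] [NormedSpace ℝ E] [FiniteDimensional ℝ E]
  {M : Type*} [TopologicalSpace M] [ChartedSpace E M] [IsManifold 𝓘(ℝ, E) ∞ M] [T2Space M]
  {N : Set M} {g : Metric E M}

/-- On the zero section of the normal bundle the discrete action in the coordinates of the tubes is
the discrete action on `Nⁿ` in slice charts. -/
theorem eventually_discreteAction_tubeMap_eq {n : ℕ} {q : Fin (n + 2) → M}
    (s : ∀ i : Fin n, SliceChart (E := E) N (q i.succ.castSucc))
    {L : Fin (n + 1) → M × M → ℝ} {S : Fin (n + 1) → E × E → ℝ}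
    (hLS : ∀ j : Fin (n + 1), ∀ᶠ w in 𝓝 (q j.castSucc, q j.succ),
      L j w = S j (chartAt E (q j.castSucc) w.1, chartAt E (q j.succ) w.2)) :
    (fun u : ∀ i, (s i).F => discreteAction S (chartAt E (q 0) (q 0))
        (chartAt E (q (Fin.last (n + 1))) (q (Fin.last (n + 1))))
        fun i => tubeMap (s i) g (u i, 0)) =ᶠ[𝓝 0]
      inSlices s (discreteAction L (q 0) (q (Fin.last (n + 1)))) := by
  let Y : (∀ i, (s i).F) → Fin (n + 2) → M := fun u =>
    nodes (q 0) (q (Fin.last (n + 1))) fun i => slicePt (s i) (u i)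
  have hu : ∀ i, Tendsto (fun u : ∀ i, (s i).F => (u i : E)) (𝓝 0) (𝓝 0) := fun i => by
    have h : ContinuousAt (fun u : ∀ i, (s i).F => (u i : E)) 0 :=
      (continuous_subtype_val.comp (continuous_apply i)).continuousAt
    exact h.tendsto
  have hY : ∀ j, Tendsto (fun u => Y u j) (𝓝 0) (𝓝 (q j)) := by
    refine fun j => forall_nodes (P := fun j => Tendsto (fun u => Y u j) (𝓝 0) (𝓝 (q j)))
      tendsto_const_nhds ?_ (fun i => ?_) j
    · simp only [Y, nodes_last]
      exact tendsto_const_nhds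
    · simp only [Y, nodes_succ_castSucc]
      have h3 : Tendsto (slicePt (s i)) (𝓝 0) (𝓝 (slicePt (s i) 0)) :=
        (sliceDom_zero (s i)).continuousAt
      rw [slicePt_zero] at h3
      exact h3.comp (hu i)
  have hdom : ∀ᶠ u : ∀ i, (s i).F in 𝓝 0, ∀ i, SliceDom (s i) (u i) :=
    eventually_all.2 fun i => (hu i).eventually (eventually_sliceDom (s i))
  have hL : ∀ᶠ u in 𝓝 0, ∀ j : Fin (n + 1), L j (Y u j.castSucc, Y u j.succ)
      = S j (chartAt E (q j.castSucc) (Y u j.castSucc), chartAt E (q j.succ) (Y u j.succ)) :=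
    eventually_all.2 fun j => ((hY j.castSucc).prodMk_nhds (hY j.succ)).eventually (hLS j)
  filter_upwards [hdom, hL] with u h1 h2
  have h3 : ∀ j, nodes (chartAt E (q 0) (q 0))
      (chartAt E (q (Fin.last (n + 1))) (q (Fin.last (n + 1))))
      (fun i => tubeMap (s i) g (u i, 0)) j = chartAt E (q j) (Y u j) := by
    refine fun j => forall_nodes (P := fun j => nodes (chartAt E (q 0) (q 0))
      (chartAt E (q (Fin.last (n + 1))) (q (Fin.last (n + 1))))
      (fun i => tubeMap (s i) g (u i, 0)) j = chartAt E (q j) (Y u j)) rfl ?_ (fun i => ?_) j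
    · simp only [Y, nodes_last]
    · simp only [Y, nodes_succ_castSucc]
      exact tubeMap_zero_right (s i) g (h1 i)
  show discreteAction S _ _ _ = discreteAction L _ _ fun i => slicePt (s i) (u i)
  rw [discreteAction_eq, discreteAction_eq]
  exact Finset.sum_congr rfl fun j _ => by rw [h3, h3]; exact (h2 j).symm

end Hessian

section Segment

variable {E : Type*} [NormedAddCommGroup E] [NormedSpace ℝ E] [FiniteDimensional ℝ E]
  {M : Type*} [TopologicalSpace M] [ChartedSpace E M] [IsManifold 𝓘(ℝ, E) ∞ M] [T2Space M]
  {H : M → (E →L[ℝ] ℝ) → ℝ} {N K : Set M} {g : Metric E M} {B : M → Set E} {e : ℝ} {γ : ℝ → M}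
  {p : ℝ → E →L[ℝ] ℝ} {t₀ t₁ : ℝ} {Y : E × E → (E →L[ℝ] ℝ) × ℝ} {X₁ X₂ : ℝ → E}

theorem IsOrbit.flowC_eq (hH : IsHamiltonian H) (h : IsOrbit H e γ p t₀ t₁) (ht : t₀ < t₁) :
    flowC H (γ t₀) (γ t₁) ((chartAt E (γ t₀) (γ t₀), p t₀), t₁ - t₀)
      = (chartAt E (γ t₁) (γ t₁), p t₁) := by
  have h1 := (h.smoothFlow hH.isC3 (s := t₁ - t₀) ⟨by linarith, le_rfl⟩).1
  rw [flowC, phasePt_self, h1, sub_add_cancel]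
  exact phaseCoord_self (γ t₁, p t₁)

theorem differentiableAt_segInit (hY : SegmentFamily H e (γ t₀) (γ t₁) Y)
    (hX₁ : DifferentiableAt ℝ X₁ 0) (hX₂ : DifferentiableAt ℝ X₂ 0)
    (hX₁0 : X₁ 0 = chartAt E (γ t₀) (γ t₀)) (hX₂0 : X₂ 0 = chartAt E (γ t₁) (γ t₁)) :
    DifferentiableAt ℝ (fun ε => segInit Y (X₁ ε, X₂ ε)) 0 := by
  refine DifferentiableAt.comp (g := segInit Y) (f := fun ε => (X₁ ε, X₂ ε)) 0 ?_
    (hX₁.prodMk hX₂)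
  rw [hX₁0, hX₂0]
  exact hY.contDiffAt_segInit.differentiableAt two_ne_zero

theorem segInit_eq (hY0 : Y (chartAt E (γ t₀) (γ t₀), chartAt E (γ t₁) (γ t₁)) = (p t₀, t₁ - t₀))
    (hX₁0 : X₁ 0 = chartAt E (γ t₀) (γ t₀)) (hX₂0 : X₂ 0 = chartAt E (γ t₁) (γ t₁)) :
    segInit Y (X₁ 0, X₂ 0) = ((chartAt E (γ t₀) (γ t₀), p t₀), t₁ - t₀) := by
  rw [segInit, hX₁0, hX₂0, hY0]

theorem IsOrbit.continuousAt_flowC_segInit (hH : IsHamiltonian H) (h : IsOrbit H e γ p t₀ t₁)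
    (ht : t₀ < t₁) (hY : SegmentFamily H e (γ t₀) (γ t₁) Y)
    (hY0 : Y (chartAt E (γ t₀) (γ t₀), chartAt E (γ t₁) (γ t₁)) = (p t₀, t₁ - t₀))
    (hX₁ : DifferentiableAt ℝ X₁ 0) (hX₂ : DifferentiableAt ℝ X₂ 0)
    (hX₁0 : X₁ 0 = chartAt E (γ t₀) (γ t₀)) (hX₂0 : X₂ 0 = chartAt E (γ t₁) (γ t₁)) :
    Tendsto (fun ε => flowC H (γ t₀) (γ t₁) (segInit Y (X₁ ε, X₂ ε))) (𝓝 0)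
      (𝓝 (chartAt E (γ t₁) (γ t₁), p t₁)) := by
  have h1 := (differentiableAt_segInit hY hX₁ hX₂ hX₁0 hX₂0).continuousAt.tendsto
  rw [segInit_eq hY0 hX₁0 hX₂0] at h1
  have h2 := ((h.smoothFlow hH.isC3 (s := t₁ - t₀) ⟨by linarith, le_rfl⟩).2 (γ t₁)
    (by rw [sub_add_cancel]; exact mem_chart_source E _)).contDiffAt.continuousAt.tendsto
  rw [h.flowC_eq hH ht] at h2
  exact h2.comp h1

/-- The segments with end points close to those of the given orbit are orbits. -/
theorem IsOrbit.eventually_segment (hH : IsHamiltonian H) (h : IsOrbit H e γ p t₀ t₁)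
    (ht : t₀ < t₁) (hY : SegmentFamily H e (γ t₀) (γ t₁) Y)
    (hY0 : Y (chartAt E (γ t₀) (γ t₀), chartAt E (γ t₁) (γ t₁)) = (p t₀, t₁ - t₀))
    (hX₁ : DifferentiableAt ℝ X₁ 0) (hX₂ : DifferentiableAt ℝ X₂ 0)
    (hX₁0 : X₁ 0 = chartAt E (γ t₀) (γ t₀)) (hX₂0 : X₂ 0 = chartAt E (γ t₁) (γ t₁)) :
    ∀ᶠ ε in 𝓝 0, ∀ (m : M × (E →L[ℝ] ℝ)) (T : ℝ),
      m = phasePt (γ t₀) (segInit Y (X₁ ε, X₂ ε)).1 → T = (segInit Y (X₁ ε, X₂ ε)).2 →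
      0 < T ∧ H m.1 m.2 = e ∧
      (∀ r ∈ Icc 0 T, Good H m r ∧ (flow H m r).1 ∈ possibleMotion H e) ∧
      (flowC H (γ t₀) (γ t₁) (segInit Y (X₁ ε, X₂ ε))).1 = X₂ ε ∧
      flow H m T = phasePt (γ t₁) (flowC H (γ t₀) (γ t₁) (segInit Y (X₁ ε, X₂ ε))) := by
  have h1 := (differentiableAt_segInit hY hX₁ hX₂ hX₁0 hX₂0).continuousAt.tendsto
  rw [segInit_eq hY0 hX₁0 hX₂0] at h1
  have h2 : Tendsto (fun ε => (X₁ ε, X₂ ε)) (𝓝 0)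
      (𝓝 (chartAt E (γ t₀) (γ t₀), chartAt E (γ t₁) (γ t₁))) := by
    have := (hX₁.continuousAt.prodMk hX₂.continuousAt).tendsto
    rwa [hX₁0, hX₂0] at this
  have h3 : Tendsto (fun ε => (segInit Y (X₁ ε, X₂ ε)).2) (𝓝 0) (𝓝 (t₁ - t₀)) :=
    (continuous_snd.tendsto _).comp h1
  have h4 := ((h.smoothFlow hH.isC3 (s := t₁ - t₀) ⟨by linarith, le_rfl⟩).2 (γ t₁)
    (by rw [sub_add_cancel]; exact mem_chart_source E _)).mem_source
  filter_upwards [h1.eventually (h.eventually_flow hH ht.le), h2.eventually hY.solves,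
    h3.eventually (lt_mem_nhds (sub_pos.2 ht)), h1.eventually h4] with ε f1 f2 f3 f4 m T hm hT
  subst hm hT
  exact ⟨f3, f2.2, f1, f2.1, (phasePt_phaseCoord f4).symm⟩

/-- Before its collision with a thin tube, an orbit close to a given one does not meet the tubes. -/
theorem IsOrbit.eventually_free_end (hH : IsHamiltonian H) (h : IsOrbit H e γ p t₀ t₁)
    (ht : t₀ < t₁) (hN : IsScatterer (E := E) N) (hB : IsConvexFamily g N B) (hK : IsCompact K)
    (hKN : K ⊆ N) (hx : γ t₁ ∈ N) {s : SliceChart (E := E) N (γ t₁)} {J : E →L[ℝ] ℝ}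
    {η₀ : conormal s.F} {r : SliceSpace s → ℝ} {μ : ℝ} {ζ : ℝ → SliceSpace s}
    (hr : Reflection s g B J η₀ r μ) (hζ : ContinuousAt ζ 0) (hζ0 : ζ 0 = (0, η₀))
    (hζr : ∀ᶠ ε in 𝓝 0, r (ζ ε) = 0) (hJ : J (vel H (γ t₁, p t₁)) < 0)
    (hY : SegmentFamily H e (γ t₀) (γ t₁) Y)
    (hY0 : Y (chartAt E (γ t₀) (γ t₀), chartAt E (γ t₁) (γ t₁)) = (p t₀, t₁ - t₀))
    (hX₁ : DifferentiableAt ℝ X₁ 0) (hX₂ : DifferentiableAt ℝ X₂ 0)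
    (hX₁0 : X₁ 0 = chartAt E (γ t₀) (γ t₀)) (hX₂0 : X₂ 0 = chartAt E (γ t₁) (γ t₁))
    (hXζ : ∀ ε, X₂ ε = tubeMap s g ((ζ ε).1, ε • (ζ ε).2)) :
    ∀ᶠ w : ℝ × ℝ in 𝓝 (0, t₁ - t₀), 0 < w.1 → w.2 < (segInit Y (X₁ w.1, X₂ w.1)).2 →
      (flow H (phasePt (γ t₀) (segInit Y (X₁ w.1, X₂ w.1)).1) w.2).1 ∉ tube g B K w.1 := by
  have h1 := (differentiableAt_segInit hY hX₁ hX₂ hX₁0 hX₂0).continuousAt.tendsto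
  rw [segInit_eq hY0 hX₁0 hX₂0] at h1
  have hS := (h.smoothFlow hH.isC3 (s := t₁ - t₀) ⟨by linarith, le_rfl⟩).2 (γ t₁)
    (by rw [sub_add_cancel]; exact mem_chart_source E _)
  have hC := h.continuousAt_flowC_segInit hH ht hY hY0 hX₁ hX₂ hX₁0 hX₂0
  have hC0 : flowC H (γ t₀) (γ t₁) (segInit Y (X₁ 0, X₂ 0)) = (chartAt E (γ t₁) (γ t₁), p t₁) := by
    rw [segInit_eq hY0 hX₁0 hX₂0, h.flowC_eq hH ht]
  have hfree := hr.eventually_free hH.isC3 hN hB hK hKN hx hζ hζ0 hζr (y := p t₁) hJ.ne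
    (z := fun ε => flowC H (γ t₀) (γ t₁) (segInit Y (X₁ ε, X₂ ε)))
    (by rw [ContinuousAt, hC0]; exact hC) hC0 ?_
  · have hfst : Tendsto Prod.fst (𝓝 ((0 : ℝ), t₁ - t₀)) (𝓝 0) := continuousAt_fst
    have hsnd : Tendsto Prod.snd (𝓝 ((0 : ℝ), t₁ - t₀)) (𝓝 (t₁ - t₀)) := continuousAt_snd
    have k1 := h1.comp hfst
    have k2 : Tendsto (fun w : ℝ × ℝ => ((segInit Y (X₁ w.1, X₂ w.1)).1,
        (w.2, (segInit Y (X₁ w.1, X₂ w.1)).2))) (𝓝 (0, t₁ - t₀))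
        (𝓝 ((chartAt E (γ t₀) (γ t₀), p t₀), (t₁ - t₀, t₁ - t₀))) :=
      ((continuous_fst.tendsto _).comp k1).prodMk_nhds
        (hsnd.prodMk_nhds ((continuous_snd.tendsto _).comp k1))
    have k3 : Tendsto (fun w : ℝ × ℝ => (w.1, w.2 - (segInit Y (X₁ w.1, X₂ w.1)).2))
        (𝓝 (0, t₁ - t₀)) (𝓝 (0, 0)) := by
      have := hsnd.sub ((continuous_snd.tendsto _).comp k1)
      rw [sub_self] at this
      exact hfst.prodMk_nhds this
    filter_upwards [k2.eventually (hS.eventually_flow_sub hH.isC3), k3.eventually hfree]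
      with w f1 f2 hw hlt
    rw [f1]
    exact f2 hw (mul_pos_of_neg_of_neg (sub_neg.2 hlt) hJ)
  · have h2 : Tendsto (fun ε => (X₁ ε, X₂ ε)) (𝓝 0)
        (𝓝 (chartAt E (γ t₀) (γ t₀), chartAt E (γ t₁) (γ t₁))) := by
      have := (hX₁.continuousAt.prodMk hX₂.continuousAt).tendsto
      rwa [hX₁0, hX₂0] at this
    filter_upwards [h2.eventually hY.solves] with ε f1
    rw [f1.1, ← hXζ]

end Segment

section Collision

variable {E : Type*} [NormedAddCommGroup E] [NormedSpace ℝ E] [FiniteDimensional ℝ E]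
  {M : Type*} [TopologicalSpace M] [ChartedSpace E M] [IsManifold 𝓘(ℝ, E) ∞ M] [T2Space M]
  {N K : Set M} {x : M} {s : SliceChart (E := E) N x} {g : Metric E M}
  {B : M → Set E} {J : E →L[ℝ] ℝ} {η₀ : conormal s.F} {r : SliceSpace s → ℝ} {μ : ℝ}
  {ζ : ℝ → SliceSpace s}

/-- The multiplier equations for the constraints are the law of elastic reflection from the boundary
of the thin tube. -/
theorem Reflection.eventually_elastic (hN : IsScatterer (E := E) N)
    (hB : IsConvexFamily g N B) (hK : IsCompact K) (hKN : K ⊆ N) (hx : x ∈ N)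
    (hr : Reflection s g B J η₀ r μ) (hζ : ContinuousAt ζ 0) (hζ0 : ζ 0 = (0, η₀))
    {X : ℝ → E} (hX : ∀ ε, X ε = tubeMap s g ((ζ ε).1, ε • (ζ ε).2)) {P Q : ℝ → E →L[ℝ] ℝ}
    {p₁ p₂ : E →L[ℝ] ℝ} (hP : Tendsto P (𝓝 0) (𝓝 p₁)) (hQ : Tendsto Q (𝓝 0) (𝓝 p₂))
    (hp : p₁ ≠ p₂) (hPQ : ∀ᶠ ε in 𝓝 0, ∀ δ : SliceSpace s, fderiv ℝ r (ζ ε) (ε • δ.1, δ.2) = 0 →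
      (P ε - Q ε) (fderiv ℝ (tubeMap s g) ((ζ ε).1, ε • (ζ ε).2) δ) = 0) :
    ∀ᶠ ε in 𝓝 0, 0 < ε → (∀ v ∈ tangentTo (E := E) (tubeBoundary g N B K ε)
        ((chartAt E x).symm (X ε)),
        ((phasePt x (X ε, P ε)).2 - (phasePt x (X ε, Q ε)).2) v = 0) ∧
      (phasePt x (X ε, P ε)).2 ≠ (phasePt x (X ε, Q ε)).2 := by
  have hz₀ : chartAt E x x ∈ (chartAt E x).target := (chartAt E x).map_source (mem_chart_source E x)
  filter_upwards [hr.eventually_tangentTo hN hB hK hKN hx hζ hζ0, hPQ,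
    (hP.prodMk_nhds hQ).eventually ((isClosed_diagonal (X := E →L[ℝ] ℝ)).isOpen_compl.mem_nhds hp),
    (tendsto_tubeMap_scaled (g := g) hζ hζ0).eventually ((chartAt E x).open_target.mem_nhds hz₀)]
    with ε h1 h2 h3 h4 hε
  rw [← hX] at h4
  refine ⟨fun v hv => ?_, fun h => h3 ?_⟩
  · obtain ⟨δ, h5, h6⟩ := h1 hε _ (by rw [← hX]) v hv
    have h7 := h2 δ h6
    rw [← h5] at h7
    exact h7
  · have h5 : phasePt x (X ε, P ε) = phasePt x (X ε, Q ε) := Prod.ext rfl h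
    have h6 := congrArg (phaseCoord x) h5
    rw [phaseCoord_phasePt (z := (X ε, P ε)) h4, phaseCoord_phasePt (z := (X ε, Q ε)) h4] at h6
    exact congrArg Prod.snd h6

end Collision

end ThinBilliard

namespace ThinBilliard

set_option synthInstance.maxHeartbeats 400000
set_option maxHeartbeats 1000000
set_option linter.unusedSectionVars false

section Chain

variable {E : Type*} [NormedAddCommGroup E] [NormedSpace ℝ E] [FiniteDimensional ℝ E]
  {M : Type*} [TopologicalSpace M] [ChartedSpace E M] [IsManifold 𝓘(ℝ, E) ∞ M] [T2Space M]
  {H : M → (E →L[ℝ] ℝ) → ℝ} {N K : Set M} {g : Metric E M} {B : M → Set E} {e : ℝ}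
  {n : ℕ} {t : Fin (n + 2) → ℝ} {γ : ℝ → M} {p : Fin (n + 1) → ℝ → E →L[ℝ] ℝ}

theorem differentiableAt_tubeNodes {x : Fin n → M} {s : ∀ i, SliceChart (E := E) N (x i)} {a b : E}
    {ζ : ∀ i, ℝ → SliceSpace (s i)} {η₀ : ∀ i, conormal (s i).F}
    (hζ : ∀ i, ContDiffAt ℝ 1 (ζ i) 0 ∧ ζ i 0 = (0, η₀ i)) (j : Fin (n + 2)) :
    DifferentiableAt ℝ (fun ε => tubeNodes s g a b (fun i => ζ i ε) ε j) 0 := by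
  refine forall_nodes (P := fun j =>
    DifferentiableAt ℝ (fun ε => tubeNodes s g a b (fun i => ζ i ε) ε j) 0)
    (differentiableAt_const a) ?_ (fun i => ?_) j
  · simp only [tubeNodes, nodes_last]
    exact differentiableAt_const b
  · simp only [tubeNodes, nodes_succ_castSucc]
    have h1 := (hζ i).1.differentiableAt one_ne_zero
    have h2 : DifferentiableAt ℝ
        (fun ε : ℝ => (((ζ i ε).1, ε • (ζ i ε).2) : SliceSpace (s i))) 0 :=
      h1.fst.prodMk (differentiableAt_id.smul h1.snd)
    refine DifferentiableAt.comp (g := tubeMap (s i) g)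
      (f := fun ε : ℝ => (((ζ i ε).1, ε • (ζ i ε).2) : SliceSpace (s i))) 0 ?_ h2
    have h3 : (((ζ i 0).1, (0 : ℝ) • (ζ i 0).2) : SliceSpace (s i)) = 0 := by
      rw [(hζ i).2, zero_smul]; rfl
    rw [h3]
    exact (contDiffAt_tubeMap (s i) g).differentiableAt two_ne_zero

/-- The jump of momentum at a collision is an outer normal covector: the orbit comes from the side
where it is negative and leaves to the side where it is positive. -/
theorem IsBilliardOrbit.jump_vel (hH : IsHamiltonian H) {A O : Set M}
    (h : IsBilliardOrbit H e A O n t γ p) (i : Fin n) :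
    0 < (p i.succ (t i.succ.castSucc) - p i.castSucc (t i.succ.castSucc))
        (vel H (γ (t i.succ.castSucc), p i.succ (t i.succ.castSucc))) ∧
      (p i.succ (t i.succ.castSucc) - p i.castSucc (t i.succ.castSucc))
        (vel H (γ (t i.succ.castSucc), p i.castSucc (t i.succ.castSucc))) < 0 := by
  have h1 := (h.orbit i.succ).energy (t i.succ.castSucc)
    ⟨le_rfl, h.strictMono.monotone (Fin.castSucc_lt_succ).le⟩
  have h2 := (h.orbit i.castSucc).energy (t i.succ.castSucc)
    ⟨h.strictMono.monotone (Fin.castSucc_lt_succ).le, le_rfl⟩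
  have h3 := hH.add_lt (q := γ (t i.succ.castSucc)) (h.jump i)
  have h4 := hH.add_lt (q := γ (t i.succ.castSucc)) (h.jump i).symm
  rw [h1, h2] at h3
  rw [h1, h2] at h4
  refine ⟨?_, by linarith⟩
  rw [← neg_sub, neg_apply]
  linarith

/-- The shadowing orbits have the nodes given by `exists_reflected_nodes`; the constant `C` collects
the derivatives with respect to `ε` of their segments and of the travel times. -/
theorem exists_shadowing_orbits (hH : IsHamiltonian H) (hN : IsScatterer (E := E) N)
    (hK : IsCompact K) (hKN : K ⊆ N) (hB : IsConvexFamily g N B)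
    (hγ : IsCollisionChain H e N K n t γ p) (hnd : IsNondegenerateChain H e N n t γ p) :
    ∃ C > (0 : ℝ), ∀ᶠ ε in 𝓝 (0 : ℝ), 0 < ε →
      ∃ (t' : Fin (n + 2) → ℝ) (γ' : ℝ → M) (p' : Fin (n + 1) → ℝ → E →L[ℝ] ℝ),
        IsBilliardOrbit H e (tubeBoundary g N B K ε) (tube g B K ε) n t' γ' p' ∧
        γ' (t' 0) = γ (t 0) ∧ γ' (t' (Fin.last (n + 1))) = γ (t (Fin.last (n + 1))) ∧
        (∀ i, |t' i - t i| ≤ C * ε) ∧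
        ∀ (j : Fin (n + 1)), ∀ s ∈ Icc (0 : ℝ) 1,
          riemDist g (γ' (t' j.castSucc + s * (t' j.succ - t' j.castSucc)))
            (γ (t j.castSucc + s * (t j.succ - t j.castSucc))) ≤ ENNReal.ofReal (C * ε) := by
  have hmono := hγ.billiard.strictMono
  have hlt : ∀ j : Fin (n + 1), t j.castSucc < t j.succ := fun j => hmono Fin.castSucc_lt_succ
  have horb := hγ.billiard.orbit
  obtain ⟨L, hL, s, -, hcrit⟩ := hnd.critical
  choose Y hY hY0 hYu using fun j =>
    (hnd.nonConjugate j).exists_segmentFamily hH (horb j) (hlt j)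
  let q : Fin (n + 2) → M := fun j => γ (t j)
  let X₀ : Fin (n + 2) → E := fun j => chartAt E (q j) (q j)
  let S : Fin (n + 1) → E × E → ℝ := fun j => segAction H (q j.castSucc) (Y j)
  let P : Fin (n + 1) → E × E → E →L[ℝ] ℝ := fun j w => (Y j w).1
  let Q : Fin (n + 1) → E × E → E →L[ℝ] ℝ := fun j w =>
    (flowC H (q j.castSucc) (q j.succ) (segInit (Y j) w)).2
  have hX₀ : X₀ = nodes (X₀ 0) (X₀ (Fin.last (n + 1)))
      fun i : Fin n => chartAt E (q i.succ.castSucc) (q i.succ.castSucc) := by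
    funext j
    refine forall_nodes (P := fun j => X₀ j = nodes (X₀ 0) (X₀ (Fin.last (n + 1)))
      (fun i : Fin n => chartAt E (q i.succ.castSucc) (q i.succ.castSucc)) j) rfl ?_ (fun i => ?_) j
    · rw [nodes_last]
    · rw [nodes_succ_castSucc]
  have hP0 : ∀ j, P j (X₀ j.castSucc, X₀ j.succ) = p j (t j.castSucc) := fun j =>
    congrArg Prod.fst (hY0 j)
  have hQ0 : ∀ j, Q j (X₀ j.castSucc, X₀ j.succ) = p j (t j.succ) := fun j => by
    have h1 := segInit_eq (X₁ := fun _ => X₀ j.castSucc) (X₂ := fun _ => X₀ j.succ) (hY0 j) rfl rfl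
    show (flowC H (q j.castSucc) (q j.succ) (segInit (Y j) _)).2 = _
    rw [h1]
    exact congrArg Prod.snd ((horb j).flowC_eq hH (hlt j))
  have hcol : ∀ i : Fin n, γ (t i.succ.castSucc) ∈ N := hγ.billiard.collision
  -- the outer normals of the bodies at the points of reflection are the jumps of momentum
  have hrefl : ∀ i : Fin n, ∃ η₀ r μ, Reflection (s i) g B
      (P i.succ (X₀ i.succ.castSucc, X₀ i.succ.succ)
        - Q i.castSucc (X₀ i.castSucc.castSucc, X₀ i.castSucc.succ)) η₀ r μ := fun i => by
    rw [hP0, hQ0]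
    exact exists_reflection hB (hcol i) (sub_ne_zero.2 (hγ.billiard.jump i))
      (hγ.billiard.elastic i)
  choose η₀ r μ hr using hrefl
  have hhess := eventually_discreteAction_tubeMap_eq (g := g) (q := q) s (L := L) (S := S)
    fun j => (hL j).eventually_eq hH (hYu j)
  obtain ⟨ζ, hζ, hmain⟩ := exists_reflected_nodes (g := g) (B := B) s (S := S) (P := P) (Q := Q) hX₀
    (fun j => (hY j).contDiffAt_segAction) (fun j => (hY j).fderiv_segAction hH.isC3) hr (by
      intro u hu
      refine hcrit u fun w => ?_
      rw [← hhess.fderiv.fderiv_eq]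
      exact hu w)
  -- the nodes of the shadowing orbit, and its segments
  let X : ℝ → Fin (n + 2) → E := fun ε =>
    tubeNodes s g (X₀ 0) (X₀ (Fin.last (n + 1))) (fun i => ζ i ε) ε
  have hXd : ∀ j, DifferentiableAt ℝ (fun ε => X ε j) 0 := differentiableAt_tubeNodes hζ
  have hXi : ∀ (i : Fin n) ε, X ε i.succ.castSucc
      = tubeMap (s i) g ((ζ i ε).1, ε • (ζ i ε).2) := fun i ε =>
    nodes_succ_castSucc _ _ _ i
  have hXl : ∀ ε, X ε (Fin.last (n + 1)) = X₀ (Fin.last (n + 1)) := fun ε => nodes_last _ _ _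
  have hX0 : ∀ j, X 0 j = X₀ j := by
    refine forall_nodes (P := fun j => X 0 j = X₀ j) rfl (hXl 0) fun i => ?_
    rw [hXi, (hζ i).2, zero_smul]
    exact tubeMap_zero (s i) g
  let z : Fin (n + 1) → ℝ → E × (E →L[ℝ] ℝ) := fun j ε =>
    (segInit (Y j) (X ε j.castSucc, X ε j.succ)).1
  let T : Fin (n + 1) → ℝ → ℝ := fun j ε => (segInit (Y j) (X ε j.castSucc, X ε j.succ)).2
  have hsd : ∀ j, DifferentiableAt ℝ (fun ε => segInit (Y j) (X ε j.castSucc, X ε j.succ)) 0 :=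
    fun j => differentiableAt_segInit (hY j) (hXd _) (hXd _) (hX0 _) (hX0 _)
  have hs0 : ∀ j, segInit (Y j) (X 0 j.castSucc, X 0 j.succ)
      = ((X₀ j.castSucc, p j (t j.castSucc)), t j.succ - t j.castSucc) := fun j =>
    segInit_eq (X₁ := fun ε => X ε j.castSucc) (X₂ := fun ε => X ε j.succ) (hY0 j) (hX0 _) (hX0 _)
  have hzd : ∀ j, DifferentiableAt ℝ (z j) 0 := fun j => (hsd j).fst
  have hTd : ∀ j, DifferentiableAt ℝ (T j) 0 := fun j => (hsd j).snd
  have hz0 : ∀ j, z j 0 = (X₀ j.castSucc, p j (t j.castSucc)) := fun j =>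
    congrArg Prod.fst (hs0 j)
  have hT0 : ∀ j, T j 0 = t j.succ - t j.castSucc := fun j => congrArg Prod.snd (hs0 j)
  have hseg := eventually_all.2 fun j => (horb j).eventually_segment hH (hlt j) (hY j) (hY0 j)
    (hXd _) (hXd _) (hX0 _) (hX0 _)
  choose C₁ hC₁ hdist using fun j => (horb j).exists_riemDist_le hH (hlt j) g (hzd j) (hz0 j)
    (hTd j) (hT0 j)
  choose C₂ hC₂ using fun j => (hTd j).hasFDerivAt.isBigO_sub.bound
  have hζc : ∀ i, ContinuousAt (ζ i) 0 := fun i => (hζ i).1.continuousAt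
  have hζr : ∀ i, ∀ᶠ ε in 𝓝 0, r i (ζ i ε) = 0 := fun i => hmain.mono fun ε h => (h i).1
  have hbdry := eventually_all.2 fun i => (hr i).eventually_mem_tubeBoundary (hcol i)
    (hγ.interior i) (hζc i) (hζ i).2 (hζr i)
  have helas := eventually_all.2 fun i : Fin n => (hr i).eventually_elastic hN hB hK hKN (hcol i)
    (hζc i) (hζ i).2 (X := fun ε => X ε i.succ.castSucc) (hXi i)
    (P := fun ε => P i.succ (X ε i.succ.castSucc, X ε i.succ.succ))
    (Q := fun ε => Q i.castSucc (X ε i.castSucc.castSucc, X ε i.castSucc.succ))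
    (p₁ := p i.succ (t i.succ.castSucc)) (p₂ := p i.castSucc (t i.succ.castSucc))
    (by
      have h1 := (hzd i.succ).continuousAt.snd.tendsto
      rw [hz0] at h1
      exact h1)
    ((continuous_snd.tendsto _).comp ((horb i.castSucc).continuousAt_flowC_segInit hH
      (hlt i.castSucc) (hY i.castSucc) (hY0 i.castSucc) (hXd _) (hXd _) (hX0 _) (hX0 _)))
    (hγ.billiard.jump i) (hmain.mono fun ε h => (h i).2 (X ε) rfl)
  -- the given orbit meets `K` at the collisions only
  have hK0 : γ (t 0) ∉ K := hγ.billiard.free _ ⟨le_rfl, hmono.monotone (Fin.zero_le _)⟩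
    fun i => (hmono (Fin.lt_def.2 (by simp))).ne
  have hKl : γ (t (Fin.last (n + 1))) ∉ K :=
    hγ.billiard.free _ ⟨hmono.monotone (Fin.zero_le _), le_rfl⟩
      fun i => (hmono (Fin.castSucc_lt_last _)).ne'
  have hKj : ∀ j : Fin (n + 1), ∀ τ ∈ Ioo (t j.castSucc) (t j.succ), γ τ ∉ K := fun j τ hτ => by
    refine hγ.billiard.free _ ⟨(hmono.monotone (Fin.zero_le _)).trans hτ.1.le,
      hτ.2.le.trans (hmono.monotone (Fin.le_last _))⟩ fun i h => ?_
    rw [h] at hτ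
    have h1 := Fin.lt_def.1 (hmono.lt_iff_lt.1 hτ.1)
    have h2 := Fin.lt_def.1 (hmono.lt_iff_lt.1 hτ.2)
    simp only [Fin.val_castSucc, Fin.val_succ] at h1 h2
    omega
  have hstart : ∀ j, ∀ᶠ w : ℝ × ℝ in 𝓝 (0, 0), 0 < w.1 → (j ≠ 0 → 0 < w.2) →
      (flow H (phasePt (q j.castSucc) (z j w.1)) w.2).1 ∉ tube g B K w.1 := fun j => by
    refine Fin.cases ?_ (fun i => ?_) j
    · refine ((horb 0).eventually_not_mem_tube hH hN hB hK hKN (hzd 0).continuousAt (hz0 0)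
        (r := 0) ⟨le_rfl, (sub_pos.2 (hlt 0)).le⟩ ?_).mono fun w hw _ _ => hw
      rw [zero_add]
      exact hK0
    · have hJ := (hγ.billiard.jump_vel hH i).1
      have hr' := hr i
      rw [hP0, hQ0] at hr'
      refine (hr'.eventually_free hH.isC3 hN hB hK hKN (hcol i) (hζc i) (hζ i).2 (hζr i) hJ.ne'
        (hzd i.succ).continuousAt (hz0 i.succ) (Eventually.of_forall (hXi i))).mono
        fun w hw h1 h2 => hw h1 (mul_pos (h2 (Fin.succ_ne_zero i)) hJ)
  have hend : ∀ j, ∀ᶠ w : ℝ × ℝ in 𝓝 (0, t j.succ - t j.castSucc), 0 < w.1 →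
      (j ≠ Fin.last n → w.2 < T j w.1) →
      (flow H (phasePt (q j.castSucc) (z j w.1)) w.2).1 ∉ tube g B K w.1 := fun j => by
    refine Fin.lastCases ?_ (fun i => ?_) j
    · refine ((horb (Fin.last n)).eventually_not_mem_tube hH hN hB hK hKN
        (hzd (Fin.last n)).continuousAt (hz0 (Fin.last n))
        (r := t (Fin.last n).succ - t (Fin.last n).castSucc)
        ⟨(sub_pos.2 (hlt (Fin.last n))).le, le_rfl⟩ ?_).mono fun w hw _ _ => hw
      rw [sub_add_cancel]
      exact hKl
    · have hJ := (hγ.billiard.jump_vel hH i).2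
      have hr' := hr i
      rw [hP0, hQ0] at hr'
      exact ((horb i.castSucc).eventually_free_end hH (hlt i.castSucc) hN hB hK hKN (hcol i) hr'
        (hζc i) (hζ i).2 (hζr i) hJ (hY i.castSucc) (hY0 i.castSucc) (hXd _) (hXd _) (hX0 _)
        (hX0 _) (hXi i)).mono fun w hw h1 h2 => hw h1 (h2 (Fin.castSucc_lt_last i).ne)
  have hfree := eventually_all.2 fun j => (horb j).eventually_free hH (hlt j) hN hB hK hKN (hKj j)
    (hzd j).continuousAt (hz0 j) (hTd j).continuousAt (hT0 j) (hstart j) (hend j)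
  have hsum₁ : ∀ j, C₁ j ≤ ∑ j, C₁ j := fun j =>
    Finset.single_le_sum (fun j _ => hC₁ j) (Finset.mem_univ j)
  have hsum₂ : ∀ j, |C₂ j| ≤ ∑ j, |C₂ j| := fun j =>
    Finset.single_le_sum (f := fun j => |C₂ j|) (fun j _ => abs_nonneg _) (Finset.mem_univ j)
  have hsum₁0 : 0 ≤ ∑ j, C₁ j := Finset.sum_nonneg fun j _ => hC₁ j
  have hsum₂0 : 0 ≤ (n + 1) * ∑ j, |C₂ j| := by positivity
  refine ⟨∑ j, C₁ j + (n + 1) * ∑ j, |C₂ j| + 1, by positivity, ?_⟩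
  filter_upwards [hseg, eventually_all.2 hdist, eventually_all.2 hC₂, hbdry, helas, hfree]
    with ε h1 h2 h3 h4 h5 h6 hε
  have hseg' := fun j => h1 j _ _ rfl rfl
  have hflowT : ∀ j : Fin (n + 1), flow H (phasePt (q j.castSucc) (z j ε)) (T j ε)
      = phasePt (q j.succ) (X ε j.succ, Q j (X ε j.castSucc, X ε j.succ)) := fun j => by
    obtain ⟨-, -, -, f1, f2⟩ := hseg' j
    exact f2.trans (congrArg (phasePt (q j.succ)) (Prod.ext f1 rfl))
  obtain ⟨t', γ', p', g1, g2, g3, g4, g5, g6⟩ := exists_billiardOrbit hH.isC3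
    (e := e) (A := tubeBoundary g N B K ε) (O := tube g B K ε)
    (m := fun j => phasePt (q j.castSucc) (z j ε)) (T := fun j => T j ε)
    (y := fun j => (chartAt E (q j)).symm (X ε j)) (t 0) (fun j => (hseg' j).1)
    (fun j => (hseg' j).2.1) (fun j => (hseg' j).2.2.1) (fun j => rfl)
    (fun j => by rw [hflowT]; rfl)
    (fun i => by rw [hXi]; exact h4 i)
    (fun i v hv => by
      rw [hflowT]
      exact (h5 i hε).1 v hv)
    (fun i => by
      rw [hflowT]
      exact (h5 i hε).2)
    (fun j => h6 j hε)
  refine ⟨t', γ', p', g1, ?_, ?_, fun i => ?_, fun j σ hσ => ?_⟩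
  · rw [g2]
    exact chartAt_symm_self _
  · rw [g3, hXl]
    exact chartAt_symm_self _
  · refine (abs_sub_le_of_abs_increment_sub_le (c := (∑ j, |C₂ j|) * ε) g4 (fun j => ?_) i).trans ?_
    · have f1 := h3 j
      rw [hT0, sub_zero, Real.norm_eq_abs, Real.norm_eq_abs, abs_of_pos hε] at f1
      rw [g5]
      exact f1.trans (mul_le_mul_of_nonneg_right ((le_abs_self _).trans (hsum₂ j)) hε.le)
    · rw [← mul_assoc]
      exact mul_le_mul_of_nonneg_right (by linarith) hε.le
  · rw [g6 j σ hσ]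
    refine (h2 j σ hσ).trans (ENNReal.ofReal_le_ofReal ?_)
    rw [abs_of_pos hε]
    exact mul_le_mul_of_nonneg_right (by linarith [hsum₁ j]) hε.le

end Chain

end ThinBilliard

theorem mainTheorem4
    {E : Type*} [NormedAddCommGroup E] [NormedSpace ℝ E] [FiniteDimensional ℝ E]
    {M : Type*} [TopologicalSpace M] [T2Space M] [ChartedSpace E M] [IsManifold 𝓘(ℝ, E) ∞ M]
    (H : M → (E →L[ℝ] ℝ) → ℝ) (hH : ThinBilliard.IsHamiltonian H) (e : ℝ)
    (N : Set M) (hN : ThinBilliard.IsScatterer (E := E) N)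
    (K : Set M) (hK : IsCompact K) (hKN : K ⊆ N)
    (g : ThinBilliard.Metric E M) (B : M → Set E) (hB : ThinBilliard.IsConvexFamily g N B)
    (a b : M) (n : ℕ) (t : Fin (n + 2) → ℝ) (γ : ℝ → M) (p : Fin (n + 1) → ℝ → E →L[ℝ] ℝ)
    (hγ : ThinBilliard.IsCollisionChain H e N K n t γ p)
    (ha : γ (t 0) = a) (hb : γ (t (Fin.last (n + 1))) = b)
    (hnd : ThinBilliard.IsNondegenerateChain H e N n t γ p) :
    ∃ C > (0 : ℝ), ∃ ε₀ > (0 : ℝ), ∀ ε ∈ Ioo 0 ε₀,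
      ∃ (t' : Fin (n + 2) → ℝ) (γ' : ℝ → M) (p' : Fin (n + 1) → ℝ → E →L[ℝ] ℝ),
        ThinBilliard.IsBilliardOrbit H e (ThinBilliard.tubeBoundary g N B K ε)
          (ThinBilliard.tube g B K ε) n t' γ' p' ∧
        γ' (t' 0) = a ∧ γ' (t' (Fin.last (n + 1))) = b ∧
        (∀ i, |t' i - t i| ≤ C * ε) ∧
        ∀ (j : Fin (n + 1)), ∀ s ∈ Icc (0 : ℝ) 1,
          ThinBilliard.riemDist g
            (γ' (t' j.castSucc + s * (t' j.succ - t' j.castSucc)))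
            (γ (t j.castSucc + s * (t j.succ - t j.castSucc))) ≤ ENNReal.ofReal (C * ε) := by
  subst ha hb
  obtain ⟨C, hC, h⟩ := ThinBilliard.exists_shadowing_orbits (g := g) hH hN hK hKN hB hγ hnd
  obtain ⟨ε₀, hε₀, h'⟩ := Metric.eventually_nhds_iff.1 h
  refine ⟨C, hC, ε₀, hε₀, fun ε hε => h' ?_ hε.1⟩
  rw [Real.dist_eq, sub_zero, abs_of_pos hε.1]
  exact hε.2
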